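/- Let $n>1$, $K=\mathbb C[[\log q,\eta]]$, $\mathfrak m=(\log q,\eta)$, and $(\alpha_i,\alpha_i)=2$, $(\alpha_i,\alpha_{i\pm1})=-1$, $(\alpha_i,\alpha_j)=0$ otherwise, $\theta=\alpha_1+\dots+\alpha_n$. All algebras are unital associative $K$-algebras, complete and separated in the $\mathfrak m$-adic topology; generators and relations are meant topologically, and $\hat\otimes$ is the completed tensor product. In such an algebra $q^{x}=\exp(x\log q)$, $[x]=(q^x-q^{-x})/(q-q^{-1})$ (read as a power series in $\log q$), and $[a,b]_q=ab-q^{(\beta,\gamma)}ba$ for $a,b$ of weights $\beta,\gamma$. $U_q(sl(n+1))$ is generated by $h_{\alpha_i}$, $e_{i,i+1}=e_{\alpha_i}$, $e_{i+1,i}=e_{-\alpha_i}$ $(1\le i\le n)$ with $[h_{\alpha_i},h_{\alpha_j}]=0$, $[h_{\alpha_i},e_{\pm\alpha_j}]=\pm(\alpha_i,\alpha_j)e_{\pm\alpha_j}$, $[e_{\alpha_i},e_{-\alpha_j}]=\delta_{ij}[h_{\alpha_i}]$, $[e_{\pm\alpha_i},e_{\pm\alpha_j}]=0$ for $|i-j|\ge2$,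 and $[[e_{\pm\alpha_i},e_{\pm\alpha_j}]_q,e_{\pm\alpha_j}]_q=0$ for $|i-j|=1$. Put $e_{ii}=\frac1{n+1}\sum_{k=1}^n(n+1-k)h_{\alpha_k}-\sum_{k<i}h_{\alpha_k}$ and $e_{j+1,i}=[e_{j+1,j},e_{j,i}]_q$ for $j>i$, and choose $$\tilde e_{-\theta}=q^{e_{11}+e_{n+1,n+1}}e_{n+1,1}.$$ Let $D'=D'_{q\eta}(sl(n+1))$ be generated by the generators of $U_q(sl(n+1))$, $\xi=\xi_{\delta-\theta}$ and $h_\delta$ with the relations of $U_q(sl(n+1))$ and 1. $h_\delta$ is central; $[e_{11},\xi]=-\xi$, $[e_{ii},\xi]=0$ for $2\le i\le n$, $[e_{n+1,n+1},\xi]=\xi$; 2. $[\xi,e_{i+1,i}]=0$ for $1\le i\le n$, and $[e_{i,i+1},\xi]=0$ for $2\le i\le n-1$; 3. $[e_{12},[e_{12},\xi]_q]_q=0$ and $[[\xi,e_{n,n+1}]_q,e_{n,n+1}]_q=0$; 4. $[[e_{12},\xi]_q,\xi]_q=\eta\,q^{e_{11}+e_{n+1,n+1}}\bigl(q^{-2}[e_{12},e_{n+1,1}]\xi-e_{n+1,1}[e_{12},\xi]_q\bigr)$;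 5. $[\xi,[\xi,e_{n,n+1}]_q]_q=\eta\,q^{e_{11}+e_{n+1,n+1}+1}\bigl(q[e_{n+1,1},e_{n,n+1}]\xi-e_{n+1,1}[\xi,e_{n,n+1}]_q\bigr)$. The *exponential form* of these relations replaces the relations of $U_q(sl(n+1))$ that contain $h_{\alpha_i}$ on the left, and those in 1., by $q^{h_{\alpha_i}}q^{-h_{\alpha_i}}=q^{-h_{\alpha_i}}q^{h_{\alpha_i}}=1$, $q^{h_{\alpha_i}}q^{h_{\alpha_j}}=q^{h_{\alpha_j}}q^{h_{\alpha_i}}$, $q^{h_{\alpha_i}}e_{\pm\alpha_j}q^{-h_{\alpha_i}}=q^{\pm(\alpha_i,\alpha_j)}e_{\pm\alpha_j}$, $q^{\pm h_\delta}$ commutes with $q^{h_{\alpha_i}},e_{\pm\alpha_i},q^{h_\delta},\xi$, $q^{e_{11}}\xi=q^{-1}\xi q^{e_{11}}$, $q^{e_{ii}}\xi=\xi q^{e_{ii}}$ $(2\le i\le n)$, $q^{e_{n+1,n+1}}\xi=q\,\xi q^{e_{n+1,n+1}}$. The *general Drinfeldian relations attached to* $\tilde e_{-\theta}$ are the relations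 of $U_q(sl(n+1))$ in exponential form, the commutation of $q^{\pm h_\delta}$ with the generators as above, $q^{\pm h_{\alpha_i}}\xi=q^{\mp(\alpha_i,\theta)}\xi q^{\pm h_{\alpha_i}}$, and, for $e_{\delta-\theta}:=\xi-\frac{\eta}{q-q^{-1}}\tilde e_{-\theta}$, the relations $[e_{\delta-\theta},e_{-\alpha_i}]=0$ for all $i$, $[e_{\alpha_i},e_{\delta-\theta}]=0$ if $(\alpha_i,\theta)=0$, and $[e_{\alpha_i},[e_{\alpha_i},e_{\delta-\theta}]_q]_q=0=[[e_{\alpha_i},e_{\delta-\theta}]_q,e_{\delta-\theta}]_q$ if $(\alpha_i,\theta)\ne0$ (each multiplied by the power of $q-q^{-1}$ that clears denominators). Then: (a) $D'$ is complete and separated. Its generators satisfy the relations in exponential form and the general Drinfeldian relations attached to $\tilde e_{-\theta}$, and $q^{\pm h_\delta}$ commutes with everything. There is exactly one injective homomorphism $U_q(sl(n+1))\to D'$ that sends generators to the generators of the same name. (b) Let $B$ be a complete separated $K$-algebra without $(q-q^{-1})$-torsion. For a family of elements of $B$ indexed by the generators of $D'$ the following are equivalent: it satisfies the general Drinfeldian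 relations attached to $\tilde e_{-\theta}$; it satisfies the explicit relations in exponential form; it is the image of the generators under a unique homomorphism $D'\to B$. (c) $D'$ has exactly one topological Hopf algebra structure ($\Delta\colon D'\to D'\hat\otimes D'$ and $\varepsilon\colon D'\to K$ homomorphisms, $S$ an anti-homomorphism) such that, for $1\le i\le n$ and $h\in\{h_{\alpha_i},h_\delta\}$, $\Delta(h)=h\otimes1+1\otimes h$, $\Delta(q^{\pm h})=q^{\pm h}\otimes q^{\pm h}$, $S(h)=-h$, $S(q^{\pm h})=q^{\mp h}$, $\varepsilon(h)=\varepsilon(e_{\pm\alpha_i})=\varepsilon(\xi)=0$ (and $\varepsilon(q^{\pm h_{\alpha_i}})=1$), $\Delta(e_{\alpha_i})=e_{\alpha_i}\otimes1+q^{-h_{\alpha_i}}\otimes e_{\alpha_i}$, $\Delta(e_{-\alpha_i})=e_{-\alpha_i}\otimes q^{h_{\alpha_i}}+1\otimes e_{-\alpha_i}$, $S(e_{\alpha_i})=-q^{h_{\alpha_i}}e_{\alpha_i}$, $S(e_{-\alpha_i})=-e_{-\alpha_i}q^{-h_{\alpha_i}}$, $$\begin{aligned}\Delta(\xi)={}&\xi\otimes1+q^{e_{11}-e_{n+1,n+1}-h_\delta}\otimes\xi+\eta\Bigl(e_{n+1,1}q^{e_{n+1,n+1}}\otimes[e_{11}]\\&+\bigl[\tfrac{h_\delta}2+e_{n+1,n+1}\bigr]q^{-h_\delta/2}\otimes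 e_{n+1,1}q^{e_{n+1,n+1}}+\sum_{i=2}^n e_{n+1,i}q^{e_{n+1,n+1}}\otimes e_{i1}q^{e_{ii}}\Bigr)\bigl(q^{e_{11}}\otimes q^{e_{11}}\bigr),\end{aligned}$$ $$\begin{aligned}S(\xi)={}&-q^{h_\delta-e_{11}+e_{n+1,n+1}}\xi+\eta\bigl[\tfrac{h_\delta}2+e_{11}+e_{n+1,n+1}+1\bigr]q^{\frac{h_\delta}2-e_{11}+e_{n+1,n+1}-1}e_{n+1,1}\\&+\eta\sum_{k=1}^nq^{-k}(q^{-1}-q)^{k-1}\sum_{n\ge i_k>\dots>i_1\ge2}e_{n+1,i_k}e_{i_k,i_{k-1}}\cdots e_{i_1,1}\,q^{-2e_{11}},\end{aligned}$$ and, with $\zeta=(q-q^{-1})\xi-\eta\,\tilde e_{-\theta}$ and $h_{\delta-\theta}=h_\delta-\sum_ih_{\alpha_i}$, $\Delta(\zeta)=\zeta\otimes1+q^{-h_{\delta-\theta}}\otimes\zeta$ and $S(\zeta)=-q^{h_{\delta-\theta}}\zeta$. -/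

import Mathlib

open scoped TensorProduct

noncomputable section

/-! ## Adic completions of algebras and topological Hopf algebras -/

section Completion

variable {R : Type*} [CommRing R] (I : Ideal R)

/-- `A / I ^ N A`, as an `R`-algebra. -/
abbrev AdicLevel (N : ℕ) (A : Type*) [Ring A] [Algebra R A] : Type _ := (R ⧸ I ^ N) ⊗[R] A

/-- The projection `A / I ^ (N + 1) A → A / I ^ N A`. -/
def adicTrans (N : ℕ) (A : Type*) [Ring A] [Algebra R A] :
    AdicLevel I (N + 1) A →ₐ[R] AdicLevel I N A :=
  Algebra.TensorProduct.map
    (Ideal.Quotient.factorₐ R (Ideal.pow_le_pow_right (Nat.le_succ N))) (AlgHom.id R A)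

/-- The compatible sequences in `∏ A / I ^ N A`. -/
def complSubalgebra (A : Type*) [Ring A] [Algebra R A] :
    Subalgebra R (∀ N, AdicLevel I N A) :=
  ⨅ N, AlgHom.equalizer ((adicTrans I N A).comp (Pi.evalAlgHom R (fun N => AdicLevel I N A) (N + 1)))
    (Pi.evalAlgHom R (fun N => AdicLevel I N A) N)

/-- The `I`-adic completion `lim A / I ^ N A` of a (not necessarily commutative) `R`-algebra. -/
abbrev AdicCompl (A : Type*) [Ring A] [Algebra R A] : Type _ := complSubalgebra I A

variable {A C : Type*} [Ring A] [Algebra R A] [Ring C] [Algebra R C]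

theorem mem_complSubalgebra {x : ∀ N, AdicLevel I N A} :
    x ∈ complSubalgebra I A ↔ ∀ N, adicTrans I N A (x (N + 1)) = x N := by
  simp [complSubalgebra, Algebra.mem_iInf, AlgHom.mem_equalizer]

/-- The canonical map `A → lim A / I ^ N A`. -/
def toCompl (A : Type*) [Ring A] [Algebra R A] : A →ₐ[R] AdicCompl I A :=
  AlgHom.codRestrict
    (AlgHom.pi
      (fun N => (Algebra.TensorProduct.includeRight : A →ₐ[R] AdicLevel I N A)))
    (complSubalgebra I A) (fun a => by
      rw [mem_complSubalgebra]
      intro N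
      simp [adicTrans])

/-- The `N`-th component of an element of the completion. -/
def complEval (N : ℕ) : AdicCompl I A →ₐ[R] AdicLevel I N A :=
  (Pi.evalAlgHom R (fun N => AdicLevel I N A) N).comp (complSubalgebra I A).val

/-- The `N`-th component of the extension of `f : A → AdicCompl C` to `AdicCompl A → AdicCompl C`. -/
def extendLevel (f : A →ₗ[R] AdicCompl I C) (N : ℕ) :
    AdicLevel I N A →ₗ[R] AdicLevel I N C :=
  (LinearMap.liftBaseChange (R ⧸ I ^ N) ((complEval I N).toLinearMap ∘ₗ f)).restrictScalars R

theorem adicTrans_smul (N : ℕ) (r : R) (z : AdicLevel I (N + 1) C) :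
    adicTrans I N C ((Ideal.Quotient.mk (I ^ (N + 1)) r) • z) =
      (Ideal.Quotient.mk (I ^ N) r) • adicTrans I N C z := by
  have h1 : (Ideal.Quotient.mk (I ^ (N + 1)) r) • z = r • z := algebraMap_smul _ r z
  have h2 : (Ideal.Quotient.mk (I ^ N) r) • adicTrans I N C z = r • adicTrans I N C z :=
    algebraMap_smul _ r _
  rw [h1, h2, map_smul]

theorem extendLevel_compat (f : A →ₗ[R] AdicCompl I C) (N : ℕ) (y : AdicLevel I (N + 1) A) :
    adicTrans I N C (extendLevel I f (N + 1) y) = extendLevel I f N (adicTrans I N A y) := by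
  induction y using TensorProduct.induction_on with
  | zero => simp
  | add x y hx hy => simp only [map_add, hx, hy]
  | tmul r a =>
    obtain ⟨r, rfl⟩ := Ideal.Quotient.mk_surjective r
    have h := (mem_complSubalgebra I).1 (f a).2 N
    simp only [extendLevel, LinearMap.coe_restrictScalars, LinearMap.liftBaseChange_tmul]
    rw [adicTrans_smul]
    simp only [adicTrans, Algebra.TensorProduct.map_tmul, AlgHom.id_apply]
    change _ = LinearMap.liftBaseChange (R ⧸ I ^ N) _ ((Ideal.Quotient.mk (I ^ N) r) ⊗ₜ[R] a)
    rw [LinearMap.liftBaseChange_tmul]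
    exact congrArg _ h

/-- The extension of an `R`-linear map `A → AdicCompl C` to the completion of `A` (every `R`-linear
map is continuous in the `I`-adic topology). -/
def complExtend (f : A →ₗ[R] AdicCompl I C) : AdicCompl I A →ₗ[R] AdicCompl I C where
  toFun x := ⟨fun N => extendLevel I f N (x.1 N), by
    rw [mem_complSubalgebra]
    intro N
    rw [extendLevel_compat, (mem_complSubalgebra I).1 x.2 N]⟩
  map_add' x y := by
    apply Subtype.ext; funext N; simp
  map_smul' r x := by
    apply Subtype.ext; funext N; simp

/-- Functoriality of the completion on `R`-linear maps. -/
def complMap (f : A →ₗ[R] C) : AdicCompl I A →ₗ[R] AdicCompl I C :=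
  complExtend I ((toCompl I C).toLinearMap ∘ₗ f)

/-- `Δ ⊗ id : A ⊗ A → A ⊗̂ A ⊗̂ A`. -/
def coassocLeft (Δ : A →ₐ[R] AdicCompl I (A ⊗[R] A)) : A ⊗[R] A →ₗ[R] AdicCompl I (A ⊗[R] (A ⊗[R] A)) :=
  LinearMap.mul' R _ ∘ₗ TensorProduct.map
    (complMap I (Algebra.TensorProduct.map (AlgHom.id R A)
      (Algebra.TensorProduct.includeLeft : A →ₐ[R] A ⊗[R] A)).toLinearMap ∘ₗ Δ.toLinearMap)
    ((toCompl I (A ⊗[R] (A ⊗[R] A))).toLinearMap ∘ₗ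
      (Algebra.TensorProduct.includeRight : A ⊗[R] A →ₐ[R] A ⊗[R] (A ⊗[R] A)).toLinearMap ∘ₗ
      (Algebra.TensorProduct.includeRight : A →ₐ[R] A ⊗[R] A).toLinearMap)

/-- `id ⊗ Δ : A ⊗ A → A ⊗̂ A ⊗̂ A`. -/
def coassocRight (Δ : A →ₐ[R] AdicCompl I (A ⊗[R] A)) : A ⊗[R] A →ₗ[R] AdicCompl I (A ⊗[R] (A ⊗[R] A)) :=
  LinearMap.mul' R _ ∘ₗ TensorProduct.map
    ((toCompl I (A ⊗[R] (A ⊗[R] A))).toLinearMap ∘ₗ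
      (Algebra.TensorProduct.includeLeft : A →ₐ[R] A ⊗[R] (A ⊗[R] A)).toLinearMap)
    (complMap I (Algebra.TensorProduct.includeRight :
      A ⊗[R] A →ₐ[R] A ⊗[R] (A ⊗[R] A)).toLinearMap ∘ₗ Δ.toLinearMap)

/-- A topological Hopf algebra structure on a complete `R`-algebra `A`: the coproduct takes values
in the completed tensor product `A ⊗̂ A = lim (A ⊗ A) / I ^ N`, and the antipode is an
anti-homomorphism. The counit and antipode axioms are written in `AdicCompl A`, which is `A` itself
when `A` is complete. -/
structure TopHopf (A : Type*) [Ring A] [Algebra R A] where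
  comul : A →ₐ[R] AdicCompl I (A ⊗[R] A)
  counit : A →ₐ[R] R
  antipode : A →ₐ[R] Aᵐᵒᵖ
  coassoc : ∀ a, complExtend I (coassocLeft I comul) (comul a) =
    complExtend I (coassocRight I comul) (comul a)
  counit_left : ∀ a, complMap I ((TensorProduct.lid R A).toLinearMap ∘ₗ
    TensorProduct.map counit.toLinearMap LinearMap.id) (comul a) = toCompl I A a
  counit_right : ∀ a, complMap I ((TensorProduct.rid R A).toLinearMap ∘ₗ
    TensorProduct.map LinearMap.id counit.toLinearMap) (comul a) = toCompl I A a
  antipode_left : ∀ a, complMap I (LinearMap.mul' R A ∘ₗ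
    TensorProduct.map ((MulOpposite.opLinearEquiv R).symm.toLinearMap ∘ₗ antipode.toLinearMap)
      LinearMap.id) (comul a) = toCompl I A (algebraMap R A (counit a))
  antipode_right : ∀ a, complMap I (LinearMap.mul' R A ∘ₗ
    TensorProduct.map LinearMap.id
      ((MulOpposite.opLinearEquiv R).symm.toLinearMap ∘ₗ antipode.toLinearMap)) (comul a) =
        toCompl I A (algebraMap R A (counit a))

/-- The pure tensor `a ⊗ b` in `A ⊗̂ A`. -/
def pureT (a b : A) : AdicCompl I (A ⊗[R] A) := toCompl I (A ⊗[R] A) (a ⊗ₜ[R] b)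

end Completion

/-! ## The base ring and functions of `log q` -/

/-- The ring `ℂ[[log q, η]]`. -/
abbrev BaseRing : Type := MvPowerSeries (Fin 2) ℂ

/-- `log q`. -/
def logq : BaseRing := MvPowerSeries.X 0

/-- `η`. -/
def eta : BaseRing := MvPowerSeries.X 1

/-- The ideal `(log q, η)`, which defines the topology. -/
def adicIdeal : Ideal BaseRing := Ideal.span {logq, eta}

/-- Complex scalars in `ℂ[[log q, η]]`. -/
def scal (z : ℂ) : BaseRing := MvPowerSeries.C z

section Functions

variable {B : Type*} [Ring B] [Algebra BaseRing B]

/-- `s` is the sum of the convergent series `∑ (log q) ^ k u k`. -/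
def IsLogSum (u : ℕ → B) (s : B) : Prop :=
  ∀ N : ℕ, s - ∑ k ∈ Finset.range N, logq ^ k • u k ∈
    (adicIdeal ^ N • ⊤ : Submodule BaseRing B)

open Classical in
/-- The sum of the series `∑ (log q) ^ k u k`; it exists and is unique when `B` is complete. -/
def logSum (u : ℕ → B) : B := if h : ∃ s, IsLogSum u s then h.choose else 0

/-- `q ^ x = exp (x log q)`. -/
def qPow (x : B) : B := logSum (fun k => scal (1 / (k.factorial : ℂ)) • x ^ k)

/-- `(q ^ x - q ^ (-x)) / (2 log q)`, that is `∑ (log q) ^ (2 j) x ^ (2 j + 1) / (2 j + 1)!`. -/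
def qSinh (x : B) : B :=
  logSum (fun k => if Even k then scal (1 / ((k + 1).factorial : ℂ)) • x ^ (k + 1) else 0)

/-- The `q`-number `[x] = (q ^ x - q ^ (-x)) / (q - q⁻¹)`. Numerator and denominator are divided by
`2 log q`, after which the denominator is invertible. -/
def qNum (x : B) : B := (qSinh (1 : BaseRing))⁻¹ • qSinh x

/-- The scalar `q ^ r` for an integer `r`. -/
def qInt (r : ℤ) : BaseRing := qPow (r : BaseRing)

/-- `q - q⁻¹`. -/
def qDiff : BaseRing := qInt 1 - qInt (-1)

/-- `a b - q ^ r b a`. For `a`, `b` of weights `β`, `γ` with `r = (β, γ)` this is `[a, b]_q`. -/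
def qComm (r : ℤ) (a b : B) : B := a * b - qInt r • (b * a)

end Functions

/-! ## Generators and derived elements -/

/-- Names of the generators of `U_q(sl(n+1))`. -/
inductive UIdx (n : ℕ) : Type
  | h (i : Fin n) : UIdx n
  | e (i : Fin n) : UIdx n
  | f (i : Fin n) : UIdx n

/-- Names of the generators of the Drinfeldian: those of `U_q(sl(n+1))`, `ξ_{δ-θ}` and `h_δ`. -/
inductive DIdx (n : ℕ) : Type
  | u (a : UIdx n) : DIdx n
  | xi : DIdx n
  | hd : DIdx n

section Elements

variable {n : ℕ} {B : Type*} [Ring B] [Algebra BaseRing B] (x : UIdx n → B)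

/-- One-based access to a family indexed by `Fin n` (zero outside `1, …, n`). -/
def at1 (g : Fin n → B) (k : ℕ) : B :=
  if hk : 1 ≤ k ∧ k ≤ n then g ⟨k - 1, by omega⟩ else 0

/-- `h_{α_i}`, `1 ≤ i ≤ n`. -/
def hEl (i : ℕ) : B := at1 (fun j => x (UIdx.h j)) i

/-- `e_{α_i} = e_{i,i+1}`, `1 ≤ i ≤ n`. -/
def eEl (i : ℕ) : B := at1 (fun j => x (UIdx.e j)) i

/-- `e_{-α_i} = e_{i+1,i}`, `1 ≤ i ≤ n`. -/
def fEl (i : ℕ) : B := at1 (fun j => x (UIdx.f j)) i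

/-- The Cartan element `e_{ii}`, `1 ≤ i ≤ n + 1`. -/
def eDiag (i : ℕ) : B :=
  scal (1 / ((n : ℂ) + 1)) •
      (∑ k ∈ Finset.Icc 1 n, scal ((n : ℂ) + 1 - k) • hEl x k) -
    ∑ k ∈ Finset.Ico 1 i, hEl x k

/-- The root vector `e_{i+d+1,i}`, built by `e_{j+1,i} = [e_{j+1,j}, e_{j,i}]_q`. -/
def lowerAux (i : ℕ) : ℕ → B
  | 0 => fEl x i
  | d + 1 => qComm (-1) (fEl x (i + d + 1)) (lowerAux i d)

/-- The root vector `e_{j,i}` for `1 ≤ i < j ≤ n + 1`. -/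
def lowerEl (j i : ℕ) : B := lowerAux x i (j - i - 1)

/-- `ẽ_{-θ} = q ^ (e_{11} + e_{n+1,n+1}) e_{n+1,1}`. -/
def eTilde : B := qPow (eDiag x 1 + eDiag x (n + 1)) * lowerEl x (n + 1) 1

/-- The product `e_{j_0,j_1} e_{j_1,j_2} ⋯` along a decreasing list of indices. -/
def chainProd : List ℕ → B
  | a :: b :: l => lowerEl x a b * chainProd (b :: l)
  | _ => 1

end Elements

/-! ## Defining relations -/

/-- The scalar product `(α_i, α_j)`. -/
def rootForm (i j : ℕ) : ℤ :=
  if i = j then 2 else if i + 1 = j ∨ j + 1 = i then -1 else 0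

/-- The scalar product `(α_i, θ)`, where `θ = α_1 + ⋯ + α_n`. -/
def thetaForm (n i : ℕ) : ℤ := ∑ k ∈ Finset.Icc 1 n, rootForm i k

section Relations

variable {n : ℕ} {B : Type*} [Ring B] [Algebra BaseRing B]

/-- Cartan relations of `U_q(sl(n+1))` in terms of the `h_{α_i}`. -/
inductive UCartanLog (x : UIdx n → B) : B → B → Prop
  | hh (i j : ℕ) (hi : i ∈ Finset.Icc 1 n) (hj : j ∈ Finset.Icc 1 n) :
      UCartanLog x (hEl x i * hEl x j) (hEl x j * hEl x i)
  | he (i j : ℕ) (hi : i ∈ Finset.Icc 1 n) (hj : j ∈ Finset.Icc 1 n) :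
      UCartanLog x (hEl x i * eEl x j - eEl x j * hEl x i) (rootForm i j • eEl x j)
  | hf (i j : ℕ) (hi : i ∈ Finset.Icc 1 n) (hj : j ∈ Finset.Icc 1 n) :
      UCartanLog x (hEl x i * fEl x j - fEl x j * hEl x i) (-rootForm i j • fEl x j)

/-- Cartan relations of `U_q(sl(n+1))` in terms of the `q ^ (± h_{α_i})`. -/
inductive UCartanExp (x : UIdx n → B) : B → B → Prop
  | inv_right (i : ℕ) (hi : i ∈ Finset.Icc 1 n) :
      UCartanExp x (qPow (hEl x i) * qPow (-hEl x i)) 1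
  | inv_left (i : ℕ) (hi : i ∈ Finset.Icc 1 n) :
      UCartanExp x (qPow (-hEl x i) * qPow (hEl x i)) 1
  | hh (i j : ℕ) (hi : i ∈ Finset.Icc 1 n) (hj : j ∈ Finset.Icc 1 n) :
      UCartanExp x (qPow (hEl x i) * qPow (hEl x j)) (qPow (hEl x j) * qPow (hEl x i))
  | he (i j : ℕ) (hi : i ∈ Finset.Icc 1 n) (hj : j ∈ Finset.Icc 1 n) :
      UCartanExp x (qPow (hEl x i) * eEl x j * qPow (-hEl x i)) (qInt (rootForm i j) • eEl x j)
  | hf (i j : ℕ) (hi : i ∈ Finset.Icc 1 n) (hj : j ∈ Finset.Icc 1 n) :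
      UCartanExp x (qPow (hEl x i) * fEl x j * qPow (-hEl x i)) (qInt (-rootForm i j) • fEl x j)

/-- The relations of `U_q(sl(n+1))` between the `e_{±α_i}`. -/
inductive URoot (x : UIdx n → B) : B → B → Prop
  | ef_same (i : ℕ) (hi : i ∈ Finset.Icc 1 n) :
      URoot x (eEl x i * fEl x i - fEl x i * eEl x i) (qNum (hEl x i))
  | ef_ne (i j : ℕ) (hi : i ∈ Finset.Icc 1 n) (hj : j ∈ Finset.Icc 1 n) (hij : i ≠ j) :
      URoot x (eEl x i * fEl x j - fEl x j * eEl x i) 0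
  | ee_far (i j : ℕ) (hi : i ∈ Finset.Icc 1 n) (hj : j ∈ Finset.Icc 1 n) (hij : i + 2 ≤ j) :
      URoot x (eEl x i * eEl x j) (eEl x j * eEl x i)
  | ff_far (i j : ℕ) (hi : i ∈ Finset.Icc 1 n) (hj : j ∈ Finset.Icc 1 n) (hij : i + 2 ≤ j) :
      URoot x (fEl x i * fEl x j) (fEl x j * fEl x i)
  | e_serre (i j : ℕ) (hi : i ∈ Finset.Icc 1 n) (hj : j ∈ Finset.Icc 1 n)
      (hij : i + 1 = j ∨ j + 1 = i) :
      URoot x (qComm 1 (qComm (-1) (eEl x i) (eEl x j)) (eEl x j)) 0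
  | f_serre (i j : ℕ) (hi : i ∈ Finset.Icc 1 n) (hj : j ∈ Finset.Icc 1 n)
      (hij : i + 1 = j ∨ j + 1 = i) :
      URoot x (qComm 1 (qComm (-1) (fEl x i) (fEl x j)) (fEl x j)) 0

/-- The `U_q(sl(n+1))` part of a family of Drinfeldian generators. -/
def uPart (x : DIdx n → B) : UIdx n → B := fun a => x (DIdx.u a)

/-- Centrality of `h_δ` and the weight of `ξ_{δ-θ}`, in terms of `h_δ` and the `e_{ii}`. -/
inductive DCartanLog (x : DIdx n → B) : B → B → Prop
  | central (a : DIdx n) : DCartanLog x (x .hd * x a) (x a * x .hd)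
  | first : DCartanLog x (eDiag (uPart x) 1 * x .xi - x .xi * eDiag (uPart x) 1) (-x .xi)
  | middle (i : ℕ) (hi : i ∈ Finset.Icc 2 n) :
      DCartanLog x (eDiag (uPart x) i * x .xi) (x .xi * eDiag (uPart x) i)
  | last : DCartanLog x
      (eDiag (uPart x) (n + 1) * x .xi - x .xi * eDiag (uPart x) (n + 1)) (x .xi)

/-- The generators in exponential form: `q ^ h_{α_i}` and `q ^ h_δ` instead of `h_{α_i}`, `h_δ`. -/
def expGen (x : DIdx n → B) : DIdx n → B
  | .u (.h i) => qPow (x (.u (.h i)))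
  | .u (.e i) => x (.u (.e i))
  | .u (.f i) => x (.u (.f i))
  | .xi => x .xi
  | .hd => qPow (x .hd)

/-- Centrality of `q ^ (± h_δ)` and the weight of `ξ_{δ-θ}`, in terms of `q ^ (± h_δ)` and the
`q ^ e_{ii}`. -/
inductive DCartanExp (x : DIdx n → B) : B → B → Prop
  | central (a : DIdx n) : DCartanExp x (qPow (x .hd) * expGen x a) (expGen x a * qPow (x .hd))
  | central_neg (a : DIdx n) :
      DCartanExp x (qPow (-x .hd) * expGen x a) (expGen x a * qPow (-x .hd))
  | first : DCartanExp x (qPow (eDiag (uPart x) 1) * x .xi)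
      (qInt (-1) • (x .xi * qPow (eDiag (uPart x) 1)))
  | middle (i : ℕ) (hi : i ∈ Finset.Icc 2 n) :
      DCartanExp x (qPow (eDiag (uPart x) i) * x .xi) (x .xi * qPow (eDiag (uPart x) i))
  | last : DCartanExp x (qPow (eDiag (uPart x) (n + 1)) * x .xi)
      (qInt 1 • (x .xi * qPow (eDiag (uPart x) (n + 1))))

/-- The relations between `ξ_{δ-θ}` and the root vectors, with the two `η`-deformed Serre
relations. -/
inductive DRoot (x : DIdx n → B) : B → B → Prop
  | xi_f (i : ℕ) (hi : i ∈ Finset.Icc 1 n) :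
      DRoot x (x .xi * fEl (uPart x) i - fEl (uPart x) i * x .xi) 0
  | e_xi (i : ℕ) (hi : i ∈ Finset.Icc 2 (n - 1)) :
      DRoot x (eEl (uPart x) i * x .xi - x .xi * eEl (uPart x) i) 0
  | serre_first :
      DRoot x (qComm 1 (eEl (uPart x) 1) (qComm (-1) (eEl (uPart x) 1) (x .xi))) 0
  | serre_last :
      DRoot x (qComm 1 (qComm (-1) (x .xi) (eEl (uPart x) n)) (eEl (uPart x) n)) 0
  | eta_serre_first :
      DRoot x (qComm 1 (qComm (-1) (eEl (uPart x) 1) (x .xi)) (x .xi))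
        (eta • (qPow (eDiag (uPart x) 1 + eDiag (uPart x) (n + 1)) *
          (qInt (-2) • ((eEl (uPart x) 1 * lowerEl (uPart x) (n + 1) 1 -
              lowerEl (uPart x) (n + 1) 1 * eEl (uPart x) 1) * x .xi) -
            lowerEl (uPart x) (n + 1) 1 * qComm (-1) (eEl (uPart x) 1) (x .xi))))
  | eta_serre_last :
      DRoot x (qComm 1 (x .xi) (qComm (-1) (x .xi) (eEl (uPart x) n)))
        (eta • (qPow (eDiag (uPart x) 1 + eDiag (uPart x) (n + 1) + 1) *
          (qInt 1 • ((lowerEl (uPart x) (n + 1) 1 * eEl (uPart x) n -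
              eEl (uPart x) n * lowerEl (uPart x) (n + 1) 1) * x .xi) -
            lowerEl (uPart x) (n + 1) 1 * qComm (-1) (x .xi) (eEl (uPart x) n))))

/-- The explicit relations, with the Cartan part written in the exponentials `q ^ (± h)`. -/
def ExplicitRelations (x : DIdx n → B) : Prop :=
  (∀ a b, UCartanExp (uPart x) a b → a = b) ∧ (∀ a b, URoot (uPart x) a b → a = b) ∧
    (∀ a b, DCartanExp x a b → a = b) ∧ (∀ a b, DRoot x a b → a = b)

/-- `(q - q⁻¹) e_{δ-θ}`, where `e_{δ-θ} = ξ_{δ-θ} - η (q - q⁻¹)⁻¹ ẽ` is the affine root vector. -/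
def zetaEl (x : DIdx n → B) (etl : B) : B := qDiff • x .xi - eta • etl

/-- The general defining relations of the Drinfeldian of `sl(n+1)`, `n > 1`, attached to an element
`etl` of weight `-θ`: the singular shift `e_{δ-θ} = ξ_{δ-θ} - η (q - q⁻¹)⁻¹ etl` satisfies the
relations of the affine root vector of `U_q(sl(n+1)[u])`. They are homogeneous in `e_{δ-θ}`,
so the denominators are cleared by passing to `(q - q⁻¹) e_{δ-θ}`. -/
inductive DGeneral (etl : B) (x : DIdx n → B) : B → B → Prop
  | central (a : DIdx n) : DGeneral etl x (qPow (x .hd) * expGen x a) (expGen x a * qPow (x .hd))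
  | central_neg (a : DIdx n) :
      DGeneral etl x (qPow (-x .hd) * expGen x a) (expGen x a * qPow (-x .hd))
  | weight_xi (i : ℕ) (hi : i ∈ Finset.Icc 1 n) :
      DGeneral etl x (qPow (hEl (uPart x) i) * x .xi)
        (qInt (-thetaForm n i) • (x .xi * qPow (hEl (uPart x) i)))
  | weight_xi_neg (i : ℕ) (hi : i ∈ Finset.Icc 1 n) :
      DGeneral etl x (qPow (-hEl (uPart x) i) * x .xi)
        (qInt (thetaForm n i) • (x .xi * qPow (-hEl (uPart x) i)))
  | z_f (i : ℕ) (hi : i ∈ Finset.Icc 1 n) :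
      DGeneral etl x (zetaEl x etl * fEl (uPart x) i) (fEl (uPart x) i * zetaEl x etl)
  | e_z_zero (i : ℕ) (hi : i ∈ Finset.Icc 1 n) (h0 : thetaForm n i = 0) :
      DGeneral etl x (eEl (uPart x) i * zetaEl x etl) (zetaEl x etl * eEl (uPart x) i)
  | e_e_z (i : ℕ) (hi : i ∈ Finset.Icc 1 n) (h0 : thetaForm n i ≠ 0) :
      DGeneral etl x (qComm 1 (eEl (uPart x) i) (qComm (-1) (eEl (uPart x) i) (zetaEl x etl))) 0
  | e_z_z (i : ℕ) (hi : i ∈ Finset.Icc 1 n) (h0 : thetaForm n i ≠ 0) :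
      DGeneral etl x (qComm 1 (qComm (-1) (eEl (uPart x) i) (zetaEl x etl)) (zetaEl x etl)) 0

/-- The general defining relations of the Drinfeldian attached to `etl`, together with those of
`U_q(sl(n+1))`. -/
def GeneralRelations (etl : B) (x : DIdx n → B) : Prop :=
  (∀ a b, UCartanExp (uPart x) a b → a = b) ∧ (∀ a b, URoot (uPart x) a b → a = b) ∧
    (∀ a b, DGeneral etl x a b → a = b)

end Relations

/-! ## The algebras -/

/-- The free complete `ℂ[[log q, η]]`-algebra on `X`. -/
abbrev FreeCompl (X : Type) : Type := AdicCompl adicIdeal (FreeAlgebra BaseRing X)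

/-- The free generators. -/
def freeGen (X : Type) : X → FreeCompl X :=
  fun a => toCompl adicIdeal (FreeAlgebra BaseRing X) (FreeAlgebra.ι BaseRing a)

/-- The closed two-sided ideal generated by the differences `a - b` with `r a b`: the intersection
over `N` of the two-sided ideals generated by these differences and `(log q, η) ^ N`. -/
def closedIdeal {X : Type} (r : FreeCompl X → FreeCompl X → Prop) : TwoSidedIdeal (FreeCompl X) :=
  ⨅ N : ℕ, TwoSidedIdeal.span ({y | ∃ a b, r a b ∧ y = a - b} ∪
    (algebraMap BaseRing (FreeCompl X)) '' ((adicIdeal ^ N : Ideal BaseRing) : Set BaseRing))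

/-- The complete algebra with generators `X` and relations `a = b` for `r a b`. -/
abbrev PresAlg {X : Type} (r : FreeCompl X → FreeCompl X → Prop) : Type :=
  (closedIdeal r).ringCon.Quotient

/-- The image of a free generator. -/
def presGen {X : Type} (r : FreeCompl X → FreeCompl X → Prop) : X → PresAlg r :=
  fun a => ((freeGen X a : FreeCompl X) : (closedIdeal r).ringCon.Quotient)

/-- The relations of `U_q(sl(n+1))`. -/
def uqRel (n : ℕ) (a b : FreeCompl (UIdx n)) : Prop :=
  UCartanLog (freeGen (UIdx n)) a b ∨ URoot (freeGen (UIdx n)) a b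

/-- `U_q(sl(n+1))` over `ℂ[[log q, η]]`. -/
abbrev Uq (n : ℕ) : Type := PresAlg (uqRel n)

/-- The generators of `U_q(sl(n+1))`. -/
def uGen (n : ℕ) : UIdx n → Uq n := presGen (uqRel n)

/-- The explicit relations of the Drinfeldian. -/
def drinRel (n : ℕ) (a b : FreeCompl (DIdx n)) : Prop :=
  UCartanLog (uPart (freeGen (DIdx n))) a b ∨ URoot (uPart (freeGen (DIdx n))) a b ∨
    DCartanLog (freeGen (DIdx n)) a b ∨ DRoot (freeGen (DIdx n)) a b

/-- The algebra with the explicit presentation of `D'_{qη}(sl(n+1))`. -/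
abbrev Drin (n : ℕ) : Type := PresAlg (drinRel n)

/-- The generators of `D'_{qη}(sl(n+1))`. -/
def dGen (n : ℕ) : DIdx n → Drin n := presGen (drinRel n)

/-! ## The Hopf structure -/

section Hopf

variable (n : ℕ)

/-- The completed tensor square `D' ⊗̂ D'`. -/
abbrev DrinSq : Type := AdicCompl adicIdeal (Drin n ⊗[BaseRing] Drin n)

/-- `a ⊗ b` in `D' ⊗̂ D'`. -/
def dT (a b : Drin n) : DrinSq n := pureT adicIdeal a b

/-- `h_{α_i}` in `D'`. -/
def dh (i : ℕ) : Drin n := hEl (uPart (dGen n)) i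

/-- `e_{α_i}` in `D'`. -/
def de (i : ℕ) : Drin n := eEl (uPart (dGen n)) i

/-- `e_{-α_i}` in `D'`. -/
def df (i : ℕ) : Drin n := fEl (uPart (dGen n)) i

/-- `e_{ii}` in `D'`. -/
def dEps (i : ℕ) : Drin n := eDiag (uPart (dGen n)) i

/-- `e_{ji}`, `j > i`, in `D'`. -/
def dLow (j i : ℕ) : Drin n := lowerEl (uPart (dGen n)) j i

/-- `h_δ` in `D'`. -/
def dHd : Drin n := dGen n .hd

/-- `ξ_{δ-θ}` in `D'`. -/
def dXi : Drin n := dGen n .xi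

/-- `h_δ / 2`. -/
def dHd2 : Drin n := scal (1 / 2) • dHd n

/-- The stated value of the coproduct on `ξ_{δ-θ}`. -/
def comulXi : DrinSq n :=
  dT n (dXi n) 1 + dT n (qPow (dEps n 1 - dEps n (n + 1) - dHd n)) (dXi n) +
    eta • ((dT n (dLow n (n + 1) 1 * qPow (dEps n (n + 1))) (qNum (dEps n 1)) +
        dT n (qNum (dHd2 n + dEps n (n + 1)) * qPow (-dHd2 n))
          (dLow n (n + 1) 1 * qPow (dEps n (n + 1))) +
        ∑ i ∈ Finset.Icc 2 n, dT n (dLow n (n + 1) i * qPow (dEps n (n + 1)))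
          (dLow n i 1 * qPow (dEps n i))) *
      dT n (qPow (dEps n 1)) (qPow (dEps n 1)))

/-- The stated value of the antipode on `ξ_{δ-θ}`. The index sets `i_k > ⋯ > i_1` are the
`k`-element subsets of `{2, …, n}`. -/
def antipodeXi : Drin n :=
  -(qPow (dHd n - dEps n 1 + dEps n (n + 1)) * dXi n) +
    eta • (qNum (dHd2 n + dEps n 1 + dEps n (n + 1) + 1) *
      qPow (dHd2 n - dEps n 1 + dEps n (n + 1) - 1) * dLow n (n + 1) 1) +
    eta • ∑ k ∈ Finset.Icc 1 n, (qInt (-k) * (-qDiff) ^ (k - 1)) •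
      ∑ s ∈ (Finset.Icc 2 n).powersetCard k,
        chainProd (uPart (dGen n)) ((n + 1) :: (s.sort (· ≥ ·) ++ [1])) *
          qPow (scal (-2) • dEps n 1)

/-- The formulas for the Hopf structure of `U_q(sl(n+1)) ⊂ D'`. -/
structure HopfOnU (H : TopHopf adicIdeal (Drin n)) : Prop where
  comul_h : ∀ i ∈ Finset.Icc 1 n, H.comul (dh n i) = dT n (dh n i) 1 + dT n 1 (dh n i)
  comul_qh : ∀ i ∈ Finset.Icc 1 n,
    H.comul (qPow (dh n i)) = dT n (qPow (dh n i)) (qPow (dh n i)) ∧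
    H.comul (qPow (-dh n i)) = dT n (qPow (-dh n i)) (qPow (-dh n i))
  comul_e : ∀ i ∈ Finset.Icc 1 n,
    H.comul (de n i) = dT n (de n i) 1 + dT n (qPow (-dh n i)) (de n i)
  comul_f : ∀ i ∈ Finset.Icc 1 n,
    H.comul (df n i) = dT n (df n i) (qPow (dh n i)) + dT n 1 (df n i)
  antipode_h : ∀ i ∈ Finset.Icc 1 n, (H.antipode (dh n i)).unop = -dh n i
  antipode_qh : ∀ i ∈ Finset.Icc 1 n,
    (H.antipode (qPow (dh n i))).unop = qPow (-dh n i) ∧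
    (H.antipode (qPow (-dh n i))).unop = qPow (dh n i)
  antipode_e : ∀ i ∈ Finset.Icc 1 n, (H.antipode (de n i)).unop = -(qPow (dh n i) * de n i)
  antipode_f : ∀ i ∈ Finset.Icc 1 n, (H.antipode (df n i)).unop = -(df n i * qPow (-dh n i))
  counit_h : ∀ i ∈ Finset.Icc 1 n, H.counit (dh n i) = 0
  counit_qh : ∀ i ∈ Finset.Icc 1 n,
    H.counit (qPow (dh n i)) = 1 ∧ H.counit (qPow (-dh n i)) = 1
  counit_e : ∀ i ∈ Finset.Icc 1 n, H.counit (de n i) = 0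
  counit_f : ∀ i ∈ Finset.Icc 1 n, H.counit (df n i) = 0

/-- The formulas for the Hopf structure on `h_δ` and `ξ_{δ-θ}`. -/
structure HopfOnAffine (H : TopHopf adicIdeal (Drin n)) : Prop where
  comul_hd : H.comul (dHd n) = dT n (dHd n) 1 + dT n 1 (dHd n)
  comul_qhd : H.comul (qPow (dHd n)) = dT n (qPow (dHd n)) (qPow (dHd n)) ∧
    H.comul (qPow (-dHd n)) = dT n (qPow (-dHd n)) (qPow (-dHd n))
  antipode_hd : (H.antipode (dHd n)).unop = -dHd n
  antipode_qhd : (H.antipode (qPow (dHd n))).unop = qPow (-dHd n) ∧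
    (H.antipode (qPow (-dHd n))).unop = qPow (dHd n)
  counit_hd : H.counit (dHd n) = 0
  counit_xi : H.counit (dXi n) = 0
  comul_xi : H.comul (dXi n) = comulXi n
  antipode_xi : (H.antipode (dXi n)).unop = antipodeXi n

/-- The general Hopf structure of the Drinfeldian: `e_{δ-θ} = ξ_{δ-θ} - η (q - q⁻¹)⁻¹ ẽ_{-θ}` is
skew-primitive, `Δ(e_{δ-θ}) = e_{δ-θ} ⊗ 1 + q ^ (-h_{δ-θ}) ⊗ e_{δ-θ}` and
`S(e_{δ-θ}) = -q ^ h_{δ-θ} e_{δ-θ}` with `h_{δ-θ} = h_δ - ∑ h_{α_i}` (multiplied by `q - q⁻¹`). -/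
structure HopfGeneral (H : TopHopf adicIdeal (Drin n)) : Prop where
  comul_zeta : H.comul (zetaEl (dGen n) (eTilde (uPart (dGen n)))) =
    dT n (zetaEl (dGen n) (eTilde (uPart (dGen n)))) 1 +
      dT n (qPow (-(dHd n - ∑ i ∈ Finset.Icc 1 n, dh n i)))
        (zetaEl (dGen n) (eTilde (uPart (dGen n))))
  antipode_zeta : (H.antipode (zetaEl (dGen n) (eTilde (uPart (dGen n))))).unop =
    -(qPow (dHd n - ∑ i ∈ Finset.Icc 1 n, dh n i) *
      zetaEl (dGen n) (eTilde (uPart (dGen n))))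

end Hopf

end

/-!
The algebras `U_q(sl(n+1))` and `D'` are quotients of completed free algebras by closed ideals.
They are therefore complete, and homomorphisms to complete algebras are given by the values on the
generators (`presLift`, `pres_hom_ext`).

*Relations.* An element `a` with `u a = a (u + r)` is said to have weight `r`, and `qPow u` then
`q`-commutes with `a`. Conversely, without `(q - q⁻¹)`-torsion, `q`-commutation with `qPow u`
determines the weight, because `qPow` is injective up to torsion (`mul_eq_mul_of_qPow`). This
exchanges the relations between the Cartan elements and their exponential form
(`DRel.explicit`, `DRel.of_explicit`). The general relations are those of
`ζ = (q - q⁻¹) ξ - η ẽ_{-θ}`. In a Serre expression of `ζ` the part without `ξ` vanishes by the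
relations of `U_q(sl(n+1))`, and the mixed terms carry a factor `q - q⁻¹`, which leaves the right
hand sides of the `η`-deformed relations (`serre_first_shift`, `serre_last_shift`, `DRel.general`,
`DRel.of_general`). The inclusion of `U_q(sl(n+1))` in `D'` is split by the homomorphism that sends
`ξ` and `h_δ` to `0` (`existsUnique_inclusion`).

*Coproduct.* For families `X` and `Y` that satisfy the relations and commute with each other,
`coprod X Y` is the family given by the formulas for `Δ`, and `coprod_drel` shows that it satisfies
the relations. With the powers of `q` absorbed into matrix coefficients `col` and `row`, the
coefficient of `η` in `Δ(ξ)` becomes `∑ colEntry X i * rowEntry Y i`. The factors on which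
`e_{α_1}` and `e_{α_n}` act nontrivially are singled out and the sum over the remaining indices is
kept as one letter, so that the `η`-deformed Serre relations become identities between finitely
many letters with `q`-commutation rules, which hold by normal ordering (`first_relations`,
`last_relations`). The matrix coefficients have triangular coproducts (`colEntry_coprod`,
`rowEntry_coprod`), which makes `coprod` coassociative (`coprod_coassoc`).

*Antipode.* The left antipode axiom on the generators can be solved for `S`; this defines the family
`anti` in the opposite algebra. That `anti` satisfies the relations follows from the coproduct: for
the coproduct of `anti` and the generators, multiplication `S(a) ⊗ b ↦ S(a) b` annihilates each
relator, and a relator of the coproduct is the sum of those of the two factors, multiplied by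
invertible elements; the second factor satisfies the relations, hence so does the first
(`AntiPairing`). The right axiom needs one identity, that the two axioms give
the same coefficient of `η` in `S(ξ)` (`anti_etaPart`, from the triangular formulas for
`AntiCopairing`). The sum over chains in `S(ξ)` is the solution of the triangular recursion for
`S(e_{i1} q ^ (e_{11} + e_{ii}))` (`antiXi_formula`). A Hopf structure is determined by its values on
the generators because these generate a dense subalgebra (`HopfOnU.ext`).
-/

noncomputable section

set_option linter.unusedSectionVars false

open Finset (Icc Ico Ioc Ioo mem_Icc mem_Ico mem_Ioo mem_insert sum_mul mul_sum smul_sum sum_congr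
  sum_insert sum_empty sum_add_distrib)
open MulOpposite

/-- The generators of `U_q(sl(n+1))` in a family `x` indexed by the generators of `D'`. -/
local postfix:max "ᵘ" => uPart

/-- `q ^ (e_{11} + e_{mm})`. -/
local notation "κ[" y "," m "]" => qPow (eDiag yᵘ 1 + eDiag yᵘ m)

local instance (X : Type) : Ring (FreeCompl X) := inferInstance

local instance (X : Type) : Algebra BaseRing (FreeCompl X) := inferInstance

local instance {X : Type} (r : FreeCompl X → FreeCompl X → Prop) : Ring (PresAlg r) := inferInstance

local instance {X : Type} (r : FreeCompl X → FreeCompl X → Prop) : Algebra BaseRing (PresAlg r) :=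
  inferInstance

/-- Preferred over the `ℕ`-algebra structure of power series, with which `module` cannot work. -/
local instance (priority := 2000) instAlgebraNatBaseRing : Algebra ℕ BaseRing := Semiring.toNatAlgebra

/-- Preferred over the `ℤ`-algebra structure of power series, with which `module` cannot work. -/
local instance (priority := 2000) instAlgebraIntBaseRing : Algebra ℤ BaseRing := Ring.toIntAlgebra _

/-! ### Completeness of the completion and extension by continuity -/

section CompletionAPI

variable {R : Type*} [CommRing R] (I : Ideal R)
variable {A C : Type*} [Ring A] [Algebra R A] [Ring C] [Algebra R C]

lemma IsHausdorff.eq_of_sub_mem {M : Type*} [AddCommGroup M] [Module R M] [IsHausdorff I M]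
    {x y : M} (h : ∀ N : ℕ, x - y ∈ (I ^ N • ⊤ : Submodule R M)) : x = y :=
  (IsHausdorff.eq_iff_smodEq (I := I)).2 fun N => SModEq.sub_mem.2 (h N)

lemma LinearMap.map_mem_pow_smul_top {M N : Type*} [AddCommMonoid M] [Module R M]
    [AddCommMonoid N] [Module R N] (f : M →ₗ[R] N) (k : ℕ) {x : M}
    (hx : x ∈ (I ^ k • ⊤ : Submodule R M)) : f x ∈ (I ^ k • ⊤ : Submodule R N) := by
  have := Submodule.mem_map_of_mem (f := f) hx
  rw [Submodule.map_smul''] at this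
  exact Submodule.smul_mono le_rfl le_top this

/-- `(R / I ^ N) ⊗ A` is `A / I ^ N A`. -/
def levelEquiv (N : ℕ) (A : Type*) [Ring A] [Algebra R A] :
    AdicLevel I N A ≃ₗ[R] A ⧸ (I ^ N • (⊤ : Submodule R A)) :=
  TensorProduct.quotTensorEquivQuotSMul A (I ^ N)

lemma levelEquiv_tmul (N : ℕ) (r : R) (a : A) :
    levelEquiv I N A (Ideal.Quotient.mk (I ^ N) r ⊗ₜ[R] a) = Submodule.Quotient.mk (r • a) :=
  TensorProduct.quotTensorEquivQuotSMul_mk_tmul _ _ _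

lemma levelEquiv_trans (N : ℕ) (z : AdicLevel I (N + 1) A) : levelEquiv I N A (adicTrans I N A z) =
      AdicCompletion.transitionMap I A (Nat.le_succ N) (levelEquiv I (N + 1) A z) := by
  induction z using TensorProduct.induction_on with
  | zero => simp
  | add x y hx hy => simp only [map_add, hx, hy]
  | tmul r a =>
    obtain ⟨r, rfl⟩ := Ideal.Quotient.mk_surjective r
    rw [levelEquiv_tmul]
    have : adicTrans I N A ((Ideal.Quotient.mk (I ^ (N + 1))) r ⊗ₜ[R] a) =
        (Ideal.Quotient.mk (I ^ N)) r ⊗ₜ[R] a := by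
      simp [adicTrans]
    rw [this, levelEquiv_tmul]
    rfl

lemma levelEquiv_compat (x : AdicCompl I A) {m n : ℕ} (h : m ≤ n) :
    AdicCompletion.transitionMap I A h (levelEquiv I n A (x.1 n)) = levelEquiv I m A (x.1 m) := by
  induction n, h using Nat.le_induction with
  | base =>
    obtain ⟨y, hy⟩ := Submodule.Quotient.mk_surjective _ (levelEquiv I m A (x.1 m))
    rw [← hy]
    rfl
  | succ n hmn ih =>
    rw [← ih, ← (mem_complSubalgebra I).1 x.2 n, levelEquiv_trans]
    exact (Submodule.factor_comp_apply _ _ _).symm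

/-- The algebra `AdicCompl I A` is, as a module, Mathlib's `AdicCompletion I A`. -/
def complEquiv (A : Type*) [Ring A] [Algebra R A] : AdicCompl I A ≃ₗ[R] AdicCompletion I A where
  toFun x := ⟨fun N => levelEquiv I N A (x.1 N), fun h => levelEquiv_compat I x h⟩
  map_add' x y := by
    apply AdicCompletion.ext; intro N
    exact map_add (levelEquiv I N A) _ _
  map_smul' r x := by
    apply AdicCompletion.ext; intro N
    exact map_smul (levelEquiv I N A) _ _
  invFun y := ⟨fun N => (levelEquiv I N A).symm (y.1 N), by
    rw [mem_complSubalgebra]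
    intro N
    apply (levelEquiv I N A).injective
    rw [levelEquiv_trans, LinearEquiv.apply_symm_apply, LinearEquiv.apply_symm_apply]
    exact y.2 (Nat.le_succ N)⟩
  left_inv x := by
    apply Subtype.ext; funext N
    exact (levelEquiv I N A).symm_apply_apply _
  right_inv y := by
    apply AdicCompletion.ext; intro N
    exact (levelEquiv I N A).apply_symm_apply _

lemma IsAdicComplete.of_linearEquiv {M N : Type*} [AddCommGroup M] [Module R M]
    [AddCommGroup N] [Module R N] (e : M ≃ₗ[R] N) [IsAdicComplete I M] : IsAdicComplete I N where
  haus' x hx := by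
    have : e.symm x = 0 := IsHausdorff.haus' (I := I) _ fun n => by
      have := hx n
      rw [SModEq.zero] at this ⊢
      exact e.symm.toLinearMap.map_mem_pow_smul_top I n this
    simpa using this
  prec' f hf := by
    obtain ⟨L, hL⟩ := IsPrecomplete.prec' (I := I) (M := M) (fun n => e.symm (f n)) (by
      intro m n hmn
      have := hf hmn
      rw [SModEq.sub_mem] at this ⊢
      rw [← map_sub]
      exact e.symm.toLinearMap.map_mem_pow_smul_top I m this)
    refine ⟨e L, fun n => ?_⟩
    have := hL n
    rw [SModEq.sub_mem] at this ⊢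
    have := e.toLinearMap.map_mem_pow_smul_top I n this
    simpa using this

lemma isAdicComplete_adicCompl (hI : I.FG) : IsAdicComplete I (AdicCompl I A) := by
  have : IsAdicComplete I (AdicCompletion I A) := AdicCompletion.isAdicComplete hI
  exact IsAdicComplete.of_linearEquiv I (complEquiv I A).symm

lemma mem_pow_smul_of_complEval (hI : I.FG) {N : ℕ} {x : AdicCompl I A} (hx : x.1 N = 0) :
    x ∈ (I ^ N • ⊤ : Submodule R (AdicCompl I A)) := by
  have h : complEquiv I A x ∈ (AdicCompletion.eval I A N).ker := by
    rw [LinearMap.mem_ker]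
    change levelEquiv I N A (x.1 N) = 0
    rw [hx, map_zero]
  rw [← AdicCompletion.pow_smul_top_eq_ker_eval hI] at h
  have := (complEquiv I A).symm.toLinearMap.map_mem_pow_smul_top I N h
  simpa using this

lemma exists_toCompl_sub_mem (hI : I.FG) (x : AdicCompl I A) (N : ℕ) :
    ∃ a : A, x - toCompl I A a ∈ (I ^ N • ⊤ : Submodule R (AdicCompl I A)) := by
  obtain ⟨a, ha⟩ := Submodule.Quotient.mk_surjective _ (levelEquiv I N A (x.1 N))
  refine ⟨a, mem_pow_smul_of_complEval I hI ?_⟩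
  apply (levelEquiv I N A).injective
  change levelEquiv I N A (x.1 N - 1 ⊗ₜ a) = _
  rw [map_sub, ← ha, map_zero]
  have := levelEquiv_tmul I N 1 a
  rw [map_one, one_smul] at this
  rw [this, sub_self]

/-- Linear maps out of the completion into a separated module are determined on `A`. -/
lemma complLinear_ext (hI : I.FG) {M : Type*} [AddCommGroup M] [Module R M] [IsHausdorff I M]
    {f g : AdicCompl I A →ₗ[R] M} (h : ∀ a, f (toCompl I A a) = g (toCompl I A a)) : f = g := by
  ext x
  refine IsHausdorff.eq_of_sub_mem I fun N => ?_
  obtain ⟨a, ha⟩ := exists_toCompl_sub_mem I hI x N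
  have hx : x = toCompl I A a + (x - toCompl I A a) := by
    have := add_sub_cancel (toCompl I A a) x
    exact this.symm
  generalize x - toCompl I A a = d at hx ha
  rw [hx, map_add, map_add, h a, add_sub_add_left_eq_sub]
  exact sub_mem (f.map_mem_pow_smul_top I N ha) (g.map_mem_pow_smul_top I N ha)

lemma complExtend_toCompl (f : A →ₗ[R] AdicCompl I C) (a : A) :
    complExtend I f (toCompl I A a) = f a := by
  apply Subtype.ext; funext N
  change LinearMap.liftBaseChange (R ⧸ I ^ N) _ ((1 : R ⧸ I ^ N) ⊗ₜ[R] a) = _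
  rw [LinearMap.liftBaseChange_tmul, one_smul]
  rfl

lemma complMap_toCompl (f : A →ₗ[R] C) (a : A) : complMap I f (toCompl I A a) = toCompl I C (f a) :=
  complExtend_toCompl I _ a

/-- The extension of a multiplicative map to the completion is multiplicative. -/
lemma complExtend_mul (hI : I.FG) (f : A →ₐ[R] AdicCompl I C) (x y : AdicCompl I A) :
    complExtend I f.toLinearMap (x * y) =
      complExtend I f.toLinearMap x * complExtend I f.toLinearMap y := by
  have := isAdicComplete_adicCompl (A := C) I hI
  set F := complExtend I f.toLinearMap
  have h1 : ∀ a : A, F ∘ₗ LinearMap.mulLeft R (toCompl I A a) =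
      LinearMap.mulLeft R (f a) ∘ₗ F := fun a => by
    refine complLinear_ext I hI (M := AdicCompl I C) fun b => ?_
    simp only [LinearMap.comp_apply, LinearMap.mulLeft_apply, F, ← map_mul, complExtend_toCompl]
    exact map_mul f a b
  have h2 : F ∘ₗ LinearMap.mulRight R y = LinearMap.mulRight R (F y) ∘ₗ F := by
    refine complLinear_ext I hI (M := AdicCompl I C) fun a => ?_
    simpa [F, complExtend_toCompl] using LinearMap.congr_fun (h1 a) y
  simpa using LinearMap.congr_fun h2 x

/-- The extension of an algebra homomorphism `A → AdicCompl C` to the completion. -/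
def complExtendAlg (hI : I.FG) (f : A →ₐ[R] AdicCompl I C) : AdicCompl I A →ₐ[R] AdicCompl I C :=
  AlgHom.ofLinearMap (complExtend I f.toLinearMap)
    (by rw [← map_one (toCompl I A), complExtend_toCompl]; exact map_one f) (complExtend_mul I hI f)

lemma toCompl_bijective (A : Type*) [Ring A] [Algebra R A] [IsAdicComplete I A] :
    Function.Bijective (toCompl I A) := by
  have h : ⇑(toCompl I A) = (complEquiv I A).symm ∘ AdicCompletion.of I A := by
    funext a
    apply (complEquiv I A).injective
    simp only [Function.comp_apply, LinearEquiv.apply_symm_apply]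
    apply AdicCompletion.ext; intro N
    have := levelEquiv_tmul I N 1 a
    rw [map_one, one_smul] at this
    exact this
  rw [h]
  exact (complEquiv I A).symm.bijective.comp (AdicCompletion.of_bijective I A)

/-- A complete algebra is its own completion. -/
def complSelf (A : Type*) [Ring A] [Algebra R A] [IsAdicComplete I A] : A ≃ₐ[R] AdicCompl I A :=
  AlgEquiv.ofBijective (toCompl I A) (toCompl_bijective I A)

/-- The extension of a homomorphism into a complete algebra to the completion. -/
def complLift (hI : I.FG) [IsAdicComplete I C] (f : A →ₐ[R] C) : AdicCompl I A →ₐ[R] C :=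
  (complSelf I C).symm.toAlgHom.comp (complExtendAlg I hI ((toCompl I C).comp f))

lemma complLift_toCompl (hI : I.FG) [IsAdicComplete I C] (f : A →ₐ[R] C) (a : A) :
    complLift I hI f (toCompl I A a) = f a := by
  change (complSelf I C).symm (complExtend I _ (toCompl I A a)) = _
  rw [complExtend_toCompl, AlgEquiv.symm_apply_eq]
  rfl

/-- The linear extension to the completion of a linear map into a complete algebra. -/
def complLinLift [IsAdicComplete I C] (f : A →ₗ[R] C) : AdicCompl I A →ₗ[R] C :=
  (complSelf I C).symm.toLinearMap ∘ₗ complMap I f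

lemma complLinLift_toCompl [IsAdicComplete I C] (f : A →ₗ[R] C) (a : A) :
    complLinLift I f (toCompl I A a) = f a := by
  change (complSelf I C).symm (complMap I f (toCompl I A a)) = _
  rw [complMap_toCompl, AlgEquiv.symm_apply_eq]
  rfl

lemma complMap_eq [IsAdicComplete I C] (f : A →ₗ[R] C) (x : AdicCompl I A) :
    complMap I f x = toCompl I C (complLinLift I f x) :=
  ((complSelf I C).apply_symm_apply _).symm

end CompletionAPI

section BaseRingCompleteness

lemma adicIdeal_eq : adicIdeal = Ideal.span (Set.range (MvPowerSeries.X : Fin 2 → BaseRing)) := by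
  rw [adicIdeal]
  congr 1
  ext z
  simp [Fin.exists_fin_two, logq, eta, eq_comm]

lemma adicIdeal_fg : adicIdeal.FG := by
  classical
  exact ⟨({logq, eta} : Finset BaseRing), by simp [adicIdeal]⟩

instance : IsAdicComplete adicIdeal BaseRing := by
  rw [adicIdeal_eq]
  infer_instance

instance instIsAdicCompleteCompl (A : Type*) [Ring A] [Algebra BaseRing A] :
    IsAdicComplete adicIdeal (AdicCompl adicIdeal A) :=
  isAdicComplete_adicCompl adicIdeal adicIdeal_fg

instance instIsAdicCompleteOp (A : Type*) [Ring A] [Algebra BaseRing A]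
    [IsAdicComplete adicIdeal A] : IsAdicComplete adicIdeal Aᵐᵒᵖ :=
  IsAdicComplete.of_linearEquiv adicIdeal (MulOpposite.opLinearEquiv BaseRing)

lemma logq_mem : logq ∈ adicIdeal := Ideal.subset_span (by simp)

lemma logq_pow_smul_mem {M : Type*} [AddCommGroup M] [Module BaseRing M] (N : ℕ) (x : M) :
    logq ^ N • x ∈ (adicIdeal ^ N • ⊤ : Submodule BaseRing M) :=
  Submodule.smul_mem_smul (Ideal.pow_mem_pow logq_mem N) trivial

end BaseRingCompleteness

/-! ### Power series in `log q` -/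

section LogSeries

variable {B : Type*} [Ring B] [Algebra BaseRing B]

lemma mul_mem_adic_left {N : ℕ} (b : B) {x : B}
    (hx : x ∈ (adicIdeal ^ N • ⊤ : Submodule BaseRing B)) :
    b * x ∈ (adicIdeal ^ N • ⊤ : Submodule BaseRing B) :=
  (LinearMap.mulLeft BaseRing b).map_mem_pow_smul_top adicIdeal N hx

lemma mul_mem_adic_right {N : ℕ} (b : B) {x : B}
    (hx : x ∈ (adicIdeal ^ N • ⊤ : Submodule BaseRing B)) :
    x * b ∈ (adicIdeal ^ N • ⊤ : Submodule BaseRing B) :=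
  (LinearMap.mulRight BaseRing b).map_mem_pow_smul_top adicIdeal N hx

lemma logq_smul_mem {N : ℕ} {x : B} (hx : x ∈ (adicIdeal ^ N • ⊤ : Submodule BaseRing B)) :
    logq • x ∈ (adicIdeal ^ (N + 1) • ⊤ : Submodule BaseRing B) := by
  rw [pow_succ', ← smul_eq_mul, smul_assoc]
  exact Submodule.smul_mem_smul logq_mem hx

lemma scal_mul (a b : ℂ) : scal a * scal b = scal (a * b) := (map_mul MvPowerSeries.C a b).symm

lemma scal_add (a b : ℂ) : scal a + scal b = scal (a + b) := (map_add MvPowerSeries.C a b).symm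

lemma scal_one : scal 1 = 1 := map_one _

lemma scal_natCast (m : ℕ) : scal (m : ℂ) = (m : BaseRing) := map_natCast MvPowerSeries.C m

lemma scal_smul_natCast {M : Type*} [AddCommGroup M] [Module BaseRing M] (m : ℕ) (b : M) :
    scal (m : ℂ) • b = m • b := by
  rw [scal_natCast, Nat.cast_smul_eq_nsmul]

/-- The series `∑ x ^ k X ^ k / k!`. -/
def expSeries (x : B) : PowerSeries B :=
  PowerSeries.mk fun k => scal (1 / (k.factorial : ℂ)) • x ^ k

/-- The series `∑ x ^ (2 j + 1) X ^ (2 j) / (2 j + 1)!`. -/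
def sinhSeries (x : B) : PowerSeries B := PowerSeries.mk fun k =>
    if Even k then scal (1 / ((k + 1).factorial : ℂ)) • x ^ (k + 1) else 0

lemma expSeries_add {x y : B} (h : Commute x y) :
    expSeries (x + y) = expSeries x * expSeries y := by
  ext k
  rw [PowerSeries.coeff_mul]
  simp only [expSeries, PowerSeries.coeff_mk, h.add_pow', smul_sum]
  refine sum_congr rfl fun p hp => ?_
  rw [smul_mul_smul_comm, scal_mul, ← scal_smul_natCast, smul_smul, scal_mul]
  congr 2
  have hk := Finset.HasAntidiagonal.mem_antidiagonal.1 hp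
  rw [← hk, Nat.choose_symm_add, Nat.add_choose]
  have := Nat.factorial_mul_factorial_dvd_factorial_add p.1 p.2
  rw [Nat.cast_div this (by simp [Nat.factorial_ne_zero])]
  have h1 : ((p.1.factorial : ℕ) : ℂ) ≠ 0 := by simp [Nat.factorial_ne_zero]
  have h2 : ((p.2.factorial : ℕ) : ℂ) ≠ 0 := by simp [Nat.factorial_ne_zero]
  have h3 : (((p.1 + p.2).factorial : ℕ) : ℂ) ≠ 0 := by simp [Nat.factorial_ne_zero]
  push_cast
  field_simp

lemma expSeries_zero : expSeries (0 : B) = 1 := by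
  ext k
  rcases k with _ | k
  · simp [expSeries, scal_one]
  · simp [expSeries, PowerSeries.coeff_one]

lemma X_mul_sinhSeries (x : B) :
    PowerSeries.X * (sinhSeries x + sinhSeries x) = expSeries x - expSeries (-x) := by
  ext k
  rcases k with _ | k
  · simp [expSeries]
  · rw [PowerSeries.coeff_succ_X_mul]
    simp only [sinhSeries, expSeries, map_add, map_sub, PowerSeries.coeff_mk]
    split_ifs with h
    · rw [h.add_one.neg_pow]; simp
    · rw [(Nat.not_even_iff_odd.1 h).add_one.neg_pow]; simp

lemma sinhSeries_add {x y : B} (h : Commute x y) :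
    sinhSeries (x + y) = sinhSeries x * expSeries y + expSeries (-x) * sinhSeries y := by
  have half : ∀ f g : PowerSeries B, PowerSeries.X * (f + f) = PowerSeries.X * (g + g) → f = g := by
    intro f g hfg
    ext k
    have := congrArg (PowerSeries.coeff (k + 1)) hfg
    simp only [PowerSeries.coeff_succ_X_mul, ← two_nsmul, ← scal_smul_natCast] at this
    have := congrArg (fun z => scal (1 / 2) • z) this
    simpa [smul_smul, scal_mul, scal_one] using this
  apply half
  rw [X_mul_sinhSeries, add_add_add_comm, ← add_mul, ← mul_add, mul_add, ← mul_assoc,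
    ← mul_assoc PowerSeries.X, X_mul_sinhSeries, PowerSeries.X_mul, mul_assoc, X_mul_sinhSeries y,
    neg_add,
    expSeries_add h, expSeries_add h.neg_left.neg_right, sub_mul, mul_sub]
  abel

/-- The value at `X = log q` of a power series with coefficients in a complete algebra. -/
def evLog (f : PowerSeries B) : B := logSum fun k => PowerSeries.coeff k f

lemma qPow_eq (x : B) : qPow x = evLog (expSeries x) := by
  simp [qPow, evLog, expSeries]

lemma qSinh_eq (x : B) : qSinh x = evLog (sinhSeries x) := by
  simp [qSinh, evLog, sinhSeries]

variable [IsAdicComplete adicIdeal B]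

lemma eq_zero_of_forall_mem {x : B}
    (h : ∀ N : ℕ, x ∈ (adicIdeal ^ N • ⊤ : Submodule BaseRing B)) : x = 0 :=
  IsHausdorff.eq_of_sub_mem adicIdeal (by simpa using h)

lemma exists_isLogSum (u : ℕ → B) : ∃ s, IsLogSum u s := by
  obtain ⟨L, hL⟩ := IsPrecomplete.prec' (I := adicIdeal) (M := B)
    (fun N => ∑ k ∈ Finset.range N, logq ^ k • u k) (by
      intro m n hmn
      rw [SModEq.comm, SModEq.sub_mem, ← Finset.sum_range_add_sum_Ico _ hmn, add_sub_cancel_left]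
      refine Submodule.sum_mem _ fun k hk => ?_
      exact Submodule.pow_smul_top_le adicIdeal B (mem_Ico.1 hk).1 (logq_pow_smul_mem k _))
  exact ⟨L, fun N => SModEq.sub_mem.1 (hL N).symm⟩

lemma isLogSum_logSum (u : ℕ → B) : IsLogSum u (logSum u) := by
  rw [logSum, dif_pos (exists_isLogSum u)]
  exact (exists_isLogSum u).choose_spec

lemma IsLogSum.unique {u : ℕ → B} {s t : B} (hs : IsLogSum u s) (ht : IsLogSum u t) : s = t :=
  IsHausdorff.eq_of_sub_mem adicIdeal fun N => by
    have := sub_mem (hs N) (ht N)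
    rwa [sub_sub_sub_cancel_right] at this

lemma IsLogSum.logSum_eq {u : ℕ → B} {s : B} (hs : IsLogSum u s) : logSum u = s :=
  (isLogSum_logSum u).unique hs

lemma evLog_add (f g : PowerSeries B) : evLog (f + g) = evLog f + evLog g := by
  refine IsLogSum.logSum_eq fun N => ?_
  have := add_mem (isLogSum_logSum (fun k => PowerSeries.coeff k f) N)
    (isLogSum_logSum (fun k => PowerSeries.coeff k g) N)
  simpa [evLog, smul_add, sum_add_distrib, add_sub_add_comm] using this

lemma evLog_zero : evLog (0 : PowerSeries B) = 0 := IsLogSum.logSum_eq fun N => by simp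

lemma evLog_C_mul (b : B) (f : PowerSeries B) : evLog (PowerSeries.C b * f) = b * evLog f := by
  refine IsLogSum.logSum_eq fun N => ?_
  have := mul_mem_adic_left b (isLogSum_logSum (fun k => PowerSeries.coeff k f) N)
  simpa [evLog, mul_sub, mul_sum] using this

lemma evLog_mul_C (b : B) (f : PowerSeries B) : evLog (f * PowerSeries.C b) = evLog f * b := by
  refine IsLogSum.logSum_eq fun N => ?_
  have := mul_mem_adic_right b (isLogSum_logSum (fun k => PowerSeries.coeff k f) N)
  simpa [evLog, sub_mul, sum_mul] using this

lemma evLog_C (b : B) : evLog (PowerSeries.C b) = b := by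
  refine IsLogSum.logSum_eq fun N => ?_
  rcases N with _ | N
  · simp
  · rw [Finset.sum_range_succ']
    simp [PowerSeries.coeff_C]

lemma evLog_X_mul (f : PowerSeries B) : evLog (PowerSeries.X * f) = logq • evLog f := by
  refine IsLogSum.logSum_eq fun N => ?_
  rcases N with _ | N
  · simp
  · rw [Finset.sum_range_succ']
    have := logq_smul_mem (isLogSum_logSum (fun k => PowerSeries.coeff k f) N)
    simpa [evLog, smul_sub, smul_sum, smul_smul, pow_succ', PowerSeries.coeff_succ_X_mul] using this

lemma evLog_neg (f : PowerSeries B) : evLog (-f) = -evLog f := by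
  have := evLog_add f (-f)
  rw [add_neg_cancel, evLog_zero] at this
  exact (neg_eq_of_add_eq_zero_right this.symm).symm

lemma evLog_sub (f g : PowerSeries B) : evLog (f - g) = evLog f - evLog g := by
  rw [sub_eq_add_neg, evLog_add, evLog_neg, sub_eq_add_neg]

lemma evLog_mul (f g : PowerSeries B) : evLog (f * g) = evLog f * evLog g := by
  suffices h : ∀ (N : ℕ) (f : PowerSeries B),
      evLog (f * g) - evLog f * evLog g ∈ (adicIdeal ^ N • ⊤ : Submodule BaseRing B) from
    IsHausdorff.eq_of_sub_mem adicIdeal fun N => h N f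
  intro N
  induction N with
  | zero => intro f; simp
  | succ N ih =>
    intro f
    have := logq_smul_mem (ih (PowerSeries.mk fun p => PowerSeries.coeff (p + 1) f))
    rw [PowerSeries.eq_X_mul_shift_add_const f, add_mul, mul_assoc, evLog_add, evLog_add,
      evLog_X_mul, evLog_C_mul, evLog_X_mul, evLog_C, add_mul, add_sub_add_right_eq_sub,
      smul_mul_assoc, ← smul_sub]
    exact this

lemma evLog_mem {N : ℕ} {f : PowerSeries B}
    (h : ∀ k, PowerSeries.coeff k f ∈ (adicIdeal ^ N • ⊤ : Submodule BaseRing B)) :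
    evLog f ∈ (adicIdeal ^ N • ⊤ : Submodule BaseRing B) := by
  have h1 := isLogSum_logSum (fun k => PowerSeries.coeff k f) N
  have h2 : ∑ k ∈ Finset.range N, logq ^ k • PowerSeries.coeff k f ∈
      (adicIdeal ^ N • ⊤ : Submodule BaseRing B) :=
    Submodule.sum_mem _ fun k _ => Submodule.smul_mem _ _ (h k)
  simpa [evLog] using add_mem h1 h2

lemma AlgHom.map_logSum {C : Type*} [Ring C] [Algebra BaseRing C] [IsAdicComplete adicIdeal C]
    (φ : B →ₐ[BaseRing] C) (u : ℕ → B) : φ (logSum u) = logSum fun k => φ (u k) := by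
  refine (IsLogSum.logSum_eq fun N => ?_).symm
  have := φ.toLinearMap.map_mem_pow_smul_top adicIdeal N (isLogSum_logSum u N)
  simpa using this

/-! ### `q`-powers and `q`-numbers -/

lemma qPow_add {x y : B} (h : Commute x y) : qPow (x + y) = qPow x * qPow y := by
  rw [qPow_eq, qPow_eq, qPow_eq, expSeries_add h, evLog_mul]

lemma qPow_zero : qPow (0 : B) = 1 := by
  rw [qPow_eq, expSeries_zero, ← map_one PowerSeries.C, evLog_C]

lemma qSinh_add {x y : B} (h : Commute x y) :
    qSinh (x + y) = qSinh x * qPow y + qPow (-x) * qSinh y := by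
  simp only [qPow_eq, qSinh_eq, sinhSeries_add h, evLog_add, evLog_mul]

lemma logq_smul_qSinh (x : B) : logq • (qSinh x + qSinh x) = qPow x - qPow (-x) := by
  simp only [qPow_eq, qSinh_eq, ← evLog_add, ← evLog_sub, ← evLog_X_mul, X_mul_sinhSeries]

lemma qPow_mul_neg (x : B) : qPow x * qPow (-x) = 1 := by
  rw [← qPow_add (Commute.refl x).neg_right, add_neg_cancel, qPow_zero]

lemma qPow_neg_mul (x : B) : qPow (-x) * qPow x = 1 := by
  simpa using qPow_mul_neg (-x)

lemma qNum_add {x y : B} (h : Commute x y) :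
    qNum (x + y) = qNum x * qPow y + qPow (-x) * qNum y := by
  simp only [qNum, qSinh_add h, smul_add, smul_mul_assoc, mul_smul_comm]

/-- If `a x = y a` then `a f(x) = f(y) a` for the series used here. -/
lemma mul_qPow_of_mul_eq {a x y : B} (h : a * x = y * a) : a * qPow x = qPow y * a := by
  rw [qPow_eq, qPow_eq, ← evLog_C_mul, ← evLog_mul_C]
  congr 1
  ext k
  have hk : a * x ^ k = y ^ k * a := (show SemiconjBy a x y from h).pow_right k
  simp [expSeries, hk]

lemma mul_qNum_of_mul_eq {a x y : B} (h : a * x = y * a) : a * qNum x = qNum y * a := by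
  rw [qNum, qNum, mul_smul_comm, smul_mul_assoc]
  congr 1
  rw [qSinh_eq, qSinh_eq, ← evLog_C_mul, ← evLog_mul_C]
  congr 1
  ext k
  have hk : a * x ^ (k + 1) = y ^ (k + 1) * a := (show SemiconjBy a x y from h).pow_right (k + 1)
  simp only [sinhSeries, PowerSeries.coeff_C_mul, PowerSeries.coeff_mul_C, PowerSeries.coeff_mk]
  split_ifs <;> simp [hk]

section Hom

variable {C : Type*} [Ring C] [Algebra BaseRing C] [IsAdicComplete adicIdeal C]

lemma AlgHom.map_qPow (φ : B →ₐ[BaseRing] C) (x : B) : φ (qPow x) = qPow (φ x) := by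
  simp only [qPow, φ.map_logSum, map_smul, map_pow]

lemma AlgHom.map_qNum (φ : B →ₐ[BaseRing] C) (x : B) : φ (qNum x) = qNum (φ x) := by
  simp only [qNum, qSinh, φ.map_logSum, map_smul, map_pow, apply_ite φ, map_zero]

end Hom

lemma qPow_algebraMap (r : BaseRing) : qPow (algebraMap BaseRing B r) = qPow r • (1 : B) := by
  rw [← Algebra.algebraMap_eq_smul_one]
  exact (AlgHom.map_qPow (Algebra.ofId BaseRing B) r).symm

lemma qPow_intCast (r : ℤ) : qPow (r : B) = qInt r • (1 : B) := by
  rw [← map_intCast (algebraMap BaseRing B), qPow_algebraMap, qInt]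

lemma qInt_zero : qInt 0 = 1 := by rw [qInt, Int.cast_zero, qPow_zero]

lemma qInt_add (r s : ℤ) : qInt (r + s) = qInt r * qInt s := by
  rw [qInt, Int.cast_add, qPow_add (Commute.all _ _), qInt, qInt]

lemma qDiff_eq : qDiff = logq * (qSinh (1 : BaseRing) + qSinh (1 : BaseRing)) := by
  have := logq_smul_qSinh (1 : BaseRing)
  rw [smul_eq_mul] at this
  rw [this, qDiff, qInt, qInt]
  simp

lemma constantCoeff_eq_zero_of_mem {x : BaseRing} (h : x ∈ adicIdeal) :
    MvPowerSeries.constantCoeff x = 0 := by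
  have : adicIdeal ≤ RingHom.ker (MvPowerSeries.constantCoeff (σ := Fin 2) (R := ℂ)) := by
    rw [adicIdeal, Ideal.span_le]
    rintro z (rfl | rfl) <;> simp [logq, eta]
  exact this h

lemma constantCoeff_qSinh_one : MvPowerSeries.constantCoeff (qSinh (1 : BaseRing)) = 1 := by
  have h := isLogSum_logSum (B := BaseRing)
    (fun k => if Even k then scal (1 / ((k + 1).factorial : ℂ)) • (1 : BaseRing) ^ (k + 1) else 0) 1
  have h' := constantCoeff_eq_zero_of_mem (x := qSinh (1 : BaseRing) - 1)
    (by simpa [qSinh, scal_one] using h)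
  simpa [sub_eq_zero] using h'

lemma qSinh_one_inv_mul : (qSinh (1 : BaseRing))⁻¹ * qSinh (1 : BaseRing) = 1 :=
  MvPowerSeries.inv_mul_cancel _ (by rw [constantCoeff_qSinh_one]; exact one_ne_zero)

/-- `(q - q⁻¹) [x] = q ^ x - q ^ (-x)`. -/
lemma qDiff_smul_qNum (x : B) : qDiff • qNum x = qPow x - qPow (-x) := by
  rw [← logq_smul_qSinh, qDiff_eq, qNum, smul_smul, mul_assoc, add_mul, mul_comm (qSinh 1),
    qSinh_one_inv_mul, ← two_smul BaseRing (qSinh x), smul_smul]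
  norm_num

lemma qNum_zero : qNum (0 : B) = 0 := by
  have : qSinh (0 : B) = 0 := by
    rw [qSinh_eq]
    convert evLog_zero (B := B)
    ext k
    simp [sinhSeries]
  rw [qNum, this, smul_zero]

lemma qNum_neg (x : B) : qNum (-x) = -qNum x := by
  have h : sinhSeries (-x) = -sinhSeries x := by
    ext k
    simp only [sinhSeries, map_neg, PowerSeries.coeff_mk]
    split_ifs with h
    · rw [h.add_one.neg_pow, smul_neg]
    · simp
  rw [qNum, qNum, qSinh_eq (-x), h, evLog_neg, smul_neg, ← qSinh_eq]

lemma qNum_one : qNum (1 : B) = 1 := by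
  have h := AlgHom.map_qNum (Algebra.ofId BaseRing B) (1 : BaseRing)
  rw [map_one] at h
  rw [← h, qNum, smul_eq_mul, qSinh_one_inv_mul, map_one]

/-! ### Logarithms in algebras without torsion -/

/-- Without torsion, an intertwining relation between `q`-powers descends to the exponents. -/
lemma mul_eq_mul_of_qPow (hB : ∀ b : B, qDiff • b = 0 → b = 0) {x y a : B}
    (h : qPow x * a = a * qPow y) : x * a = a * y := by
  rw [← sub_eq_zero]
  refine eq_zero_of_forall_mem fun N => ?_
  induction N with
  | zero => simp
  | succ N ih =>
    have hk : ∀ k : ℕ, x ^ k * a - a * y ^ k ∈ (adicIdeal ^ N • ⊤ : Submodule BaseRing B) := by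
      intro k
      induction k with
      | zero => simp
      | succ k ihk =>
        have : x ^ (k + 1) * a - a * y ^ (k + 1) =
            x * (x ^ k * a - a * y ^ k) + (x * a - a * y) * y ^ k := by
          rw [pow_succ', pow_succ']
          noncomm_ring
        rw [this]
        exact add_mem (mul_mem_adic_left _ ihk) (mul_mem_adic_right _ ih)
    set P2 : PowerSeries B := PowerSeries.mk fun k =>
      scal (1 / ((k + 2).factorial : ℂ)) • (x ^ (k + 2) * a - a * y ^ (k + 2)) with hP2
    have hP : expSeries x * PowerSeries.C a - PowerSeries.C a * expSeries y =
        PowerSeries.X * (PowerSeries.C (x * a - a * y) + PowerSeries.X * P2) := by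
      ext k
      rcases k with _ | _ | k
      · simp [expSeries, scal_one]
      · rw [PowerSeries.coeff_succ_X_mul]
        simp [expSeries, scal_one]
      · rw [PowerSeries.coeff_succ_X_mul]
        simp [expSeries, hP2, PowerSeries.coeff_succ_X_mul, smul_sub]
    have h0 : evLog (expSeries x * PowerSeries.C a - PowerSeries.C a * expSeries y) = 0 := by
      rw [evLog_sub, evLog_mul_C, evLog_C_mul, ← qPow_eq, ← qPow_eq, h, sub_self]
    rw [hP, evLog_X_mul, evLog_add, evLog_C, evLog_X_mul] at h0
    have h1 := hB _ (by rw [qDiff_eq, mul_comm, mul_smul, h0, smul_zero])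
    rw [eq_neg_of_add_eq_zero_left h1]
    exact neg_mem (logq_smul_mem (evLog_mem fun k => by
      rw [hP2, PowerSeries.coeff_mk]
      exact Submodule.smul_mem _ _ (hk _)))

end LogSeries

/-! ### Complete algebras given by generators and relations -/

section Presentation

lemma IsPrecomplete.of_surjective {R : Type*} [CommRing R] (I : Ideal R) {M N : Type*}
    [AddCommGroup M] [Module R M] [AddCommGroup N] [Module R N] (f : M →ₗ[R] N)
    (hf : Function.Surjective f) [IsPrecomplete I M] : IsPrecomplete I N where
  prec' u hu := by
    have hmap : ∀ k : ℕ, ∀ y ∈ (I ^ k • ⊤ : Submodule R N),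
        ∃ x ∈ (I ^ k • ⊤ : Submodule R M), f x = y := by
      intro k y hy
      have h2 : (I ^ k • ⊤ : Submodule R N) = Submodule.map f (I ^ k • ⊤ : Submodule R M) := by
        rw [Submodule.map_smul'', Submodule.map_top, LinearMap.range_eq_top.2 hf]
      rw [h2] at hy
      exact hy
    have hd : ∀ k : ℕ, ∃ x ∈ (I ^ k • ⊤ : Submodule R M), f x = u (k + 1) - u k := fun k =>
      hmap k _ (SModEq.sub_mem.1 (hu (Nat.le_succ k)).symm)
    choose d hdm hdf using hd
    obtain ⟨x0, hx0⟩ := hf (u 0)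
    have hfs : ∀ k, f (x0 + ∑ i ∈ Finset.range k, d i) = u k := by
      intro k
      rw [map_add, map_sum, hx0]
      simp only [hdf]
      rw [Finset.sum_range_sub, add_sub_cancel]
    obtain ⟨L, hL⟩ := IsPrecomplete.prec' (I := I) (M := M)
      (fun k => x0 + ∑ i ∈ Finset.range k, d i) (by
        intro m n hmn
        rw [SModEq.comm, SModEq.sub_mem, add_sub_add_left_eq_sub,
          ← Finset.sum_range_add_sum_Ico _ hmn, add_sub_cancel_left]
        refine Submodule.sum_mem _ fun k hk => ?_
        exact Submodule.pow_smul_top_le I M (mem_Ico.1 hk).1 (hdm k))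
    refine ⟨f L, fun n => ?_⟩
    have := f.map_mem_pow_smul_top I n (SModEq.sub_mem.1 (hL n))
    rwa [map_sub, hfs, ← SModEq.sub_mem] at this

lemma adicCompl_map_sub {A B : Type*} [Ring A] [Algebra BaseRing A] [Ring B]
    [Algebra BaseRing B] (f : AdicCompl adicIdeal A →ₐ[BaseRing] B)
    (a b : AdicCompl adicIdeal A) : f (a - b) = f a - f b := by
  have := map_sub f a b
  exact this

variable {X : Type}

variable (r : FreeCompl X → FreeCompl X → Prop)

/-- The projection of the free complete algebra to a presented algebra. -/
def presProj : FreeCompl X →ₐ[BaseRing] PresAlg r := RingCon.mkₐ BaseRing (closedIdeal r).ringCon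

lemma presProj_surjective : Function.Surjective (presProj r) := RingCon.mkₐ_surjective _

lemma presProj_eq_zero {y : FreeCompl X} : presProj r y = 0 ↔ y ∈ closedIdeal r := Quotient.eq''

lemma mem_span_of_mem_pow (S : Set (FreeCompl X)) {N : ℕ} {w : FreeCompl X}
    (hw : w ∈ (adicIdeal ^ N • ⊤ : Submodule BaseRing (FreeCompl X))) :
    w ∈ TwoSidedIdeal.span (S ∪
      algebraMap BaseRing (FreeCompl X) '' ((adicIdeal ^ N : Ideal BaseRing) : Set BaseRing)) := by
  refine Submodule.smul_induction_on hw (fun c hc z _ => ?_) fun _ _ hx hy => add_mem hx hy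
  rw [Algebra.smul_def]
  exact TwoSidedIdeal.mul_mem_right _ _ _ (TwoSidedIdeal.subset_span (Or.inr ⟨c, hc, rfl⟩))

lemma mem_closedIdeal_of_rel {a b : FreeCompl X} (h : r a b) : a - b ∈ closedIdeal r := by
  rw [closedIdeal, TwoSidedIdeal.mem_iInf]
  exact fun N => TwoSidedIdeal.subset_span (Or.inl ⟨a, b, h, rfl⟩)

lemma presProj_eq_of_rel {a b : FreeCompl X} (h : r a b) : presProj r a = presProj r b := by
  rw [← sub_eq_zero, ← adicCompl_map_sub, presProj_eq_zero]
  exact mem_closedIdeal_of_rel r h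

instance : IsAdicComplete adicIdeal (PresAlg r) where
  haus' x hx := by
    obtain ⟨y, rfl⟩ := presProj_surjective r x
    rw [presProj_eq_zero, closedIdeal, TwoSidedIdeal.mem_iInf]
    intro N
    have h1 := hx N
    rw [SModEq.zero] at h1
    have h2 : (adicIdeal ^ N • ⊤ : Submodule BaseRing (PresAlg r)) =
        Submodule.map (presProj r).toLinearMap
          (adicIdeal ^ N • ⊤ : Submodule BaseRing (FreeCompl X)) := by
      rw [Submodule.map_smul'', Submodule.map_top, LinearMap.range_eq_top.2 (presProj_surjective r)]
    rw [h2] at h1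
    obtain ⟨w, hw, hwy⟩ := h1
    have h3 : y - w ∈ closedIdeal r := by
      rw [← presProj_eq_zero, adicCompl_map_sub, sub_eq_zero]
      exact hwy.symm
    rw [closedIdeal, TwoSidedIdeal.mem_iInf] at h3
    have := add_mem (h3 N) (mem_span_of_mem_pow _ hw)
    have h4 := sub_add_cancel y w
    exact h4 ▸ this
  prec' := (IsPrecomplete.of_surjective adicIdeal (M := FreeCompl X) (N := PresAlg r)
    (presProj r).toLinearMap (presProj_surjective r)).prec'

variable {B : Type*} [Ring B] [Algebra BaseRing B]

section Complete

variable [IsAdicComplete adicIdeal B]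

/-- The homomorphism from the free complete algebra with given values on the generators. -/
def freeLift (x : X → B) : FreeCompl X →ₐ[BaseRing] B :=
  complLift adicIdeal adicIdeal_fg (FreeAlgebra.lift BaseRing x)

lemma freeLift_freeGen (x : X → B) (a : X) : freeLift x (freeGen X a) = x a := by
  rw [freeLift, freeGen, complLift_toCompl, FreeAlgebra.lift_ι_apply]

/-- A homomorphism that respects the relations vanishes on the closed ideal they generate. -/
lemma map_closedIdeal (f : FreeCompl X →ₐ[BaseRing] B) (hf : ∀ a b, r a b → f a = f b)
    {y : FreeCompl X} (hy : y ∈ closedIdeal r) : f y = 0 := by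
  refine eq_zero_of_forall_mem fun N => ?_
  rw [closedIdeal, TwoSidedIdeal.mem_iInf] at hy
  let J : TwoSidedIdeal (FreeCompl X) := TwoSidedIdeal.mk'
    {z | f z ∈ (adicIdeal ^ N • ⊤ : Submodule BaseRing B)}
    (by simp) (fun hx hy => by simpa using add_mem hx hy) (fun hx => by simpa using hx)
    (fun hy => by simpa using mul_mem_adic_left _ hy)
    (fun hx => by simpa using mul_mem_adic_right _ hx)
  have hJ : ∀ z, z ∈ J ↔ f z ∈ (adicIdeal ^ N • ⊤ : Submodule BaseRing B) :=
    fun z => TwoSidedIdeal.mem_mk' _ _ _ _ _ _ z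
  refine (hJ y).1 (TwoSidedIdeal.mem_span_iff.1 (hy N) J ?_)
  rintro z (⟨a, b, hab, rfl⟩ | ⟨c, hc, rfl⟩)
  · refine (hJ _).2 ?_
    rw [adicCompl_map_sub, hf a b hab, sub_self]
    exact zero_mem _
  · refine (hJ _).2 ?_
    rw [AlgHom.commutes, Algebra.algebraMap_eq_smul_one]
    exact Submodule.smul_mem_smul hc trivial

/-- The homomorphism from a presented algebra given by a solution of the relations. -/
def presLift (x : X → B) (hx : ∀ a b, r a b → freeLift x a = freeLift x b) :
    PresAlg r →ₐ[BaseRing] B :=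
  { RingCon.lift (closedIdeal r).ringCon (freeLift x).toRingHom (by
      intro a b hab
      have h1 := map_closedIdeal r (freeLift x) hx ((TwoSidedIdeal.rel_iff _ _ _).1 hab)
      rw [adicCompl_map_sub, sub_eq_zero] at h1
      exact h1) with
    commutes' := fun c => (freeLift x).commutes c }

lemma presLift_presGen (x : X → B) (hx : ∀ a b, r a b → freeLift x a = freeLift x b) (a : X) :
    presLift r x hx (presGen r a) = x a :=
  freeLift_freeGen x a

end Complete

lemma freeCompl_hom_ext [IsHausdorff adicIdeal B] {f g : FreeCompl X →ₐ[BaseRing] B}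
    (h : ∀ a, f (freeGen X a) = g (freeGen X a)) : f = g := by
  have h1 : f.comp (toCompl adicIdeal (FreeAlgebra BaseRing X)) =
      g.comp (toCompl adicIdeal (FreeAlgebra BaseRing X)) := FreeAlgebra.hom_ext (funext h)
  have h2 := complLinear_ext adicIdeal adicIdeal_fg (f := f.toLinearMap) (g := g.toLinearMap)
    (fun a => AlgHom.congr_fun h1 a)
  exact AlgHom.ext fun x => LinearMap.congr_fun h2 x

lemma pres_hom_ext [IsHausdorff adicIdeal B] {f g : PresAlg r →ₐ[BaseRing] B}
    (h : ∀ a, f (presGen r a) = g (presGen r a)) : f = g := by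
  have h1 : f.comp (presProj r) = g.comp (presProj r) := freeCompl_hom_ext h
  refine AlgHom.ext fun x => ?_
  obtain ⟨y, rfl⟩ := presProj_surjective r x
  exact AlgHom.congr_fun h1 y

/-- An element that commutes with the generators of a presented algebra is central. -/
lemma pres_central {z : PresAlg r} (h : ∀ a, z * presGen r a = presGen r a * z)
    (y : PresAlg r) : z * y = y * z := by
  let D : FreeCompl X →ₗ[BaseRing] PresAlg r :=
    (LinearMap.mulLeft BaseRing z - LinearMap.mulRight BaseRing z) ∘ₗ (presProj r).toLinearMap
  have hD : D = 0 := by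
    refine complLinear_ext adicIdeal adicIdeal_fg fun a => ?_
    change z * presProj r (toCompl _ _ a) - presProj r (toCompl _ _ a) * z = 0
    rw [sub_eq_zero]
    induction a using FreeAlgebra.induction with
    | grade0 c =>
      rw [AlgHom.commutes, AlgHom.commutes]
      exact (Algebra.commutes c z).symm
    | grade1 a => exact h a
    | mul a b ha hb => rw [map_mul, map_mul, ← mul_assoc, ha, mul_assoc, hb, mul_assoc]
    | add a b ha hb => rw [map_add, map_add, mul_add, add_mul, ha, hb]
  obtain ⟨w, rfl⟩ := presProj_surjective r y
  exact sub_eq_zero.1 (LinearMap.congr_fun hD w)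

end Presentation

/-! ### Naturality of the relations -/

section Naturality

variable {n : ℕ} {B C : Type*} [Ring B] [Algebra BaseRing B] [Ring C] [Algebra BaseRing C]
variable (φ : B →ₐ[BaseRing] C) (x : UIdx n → B) (y : DIdx n → B)

lemma map_at1 (g : Fin n → B) (k : ℕ) : φ (at1 g k) = at1 (fun i => φ (g i)) k := by
  unfold at1
  split_ifs <;> simp

lemma map_hEl (k : ℕ) : φ (hEl x k) = hEl (fun a => φ (x a)) k := map_at1 φ _ k

lemma map_eEl (k : ℕ) : φ (eEl x k) = eEl (fun a => φ (x a)) k := map_at1 φ _ k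

lemma map_fEl (k : ℕ) : φ (fEl x k) = fEl (fun a => φ (x a)) k := map_at1 φ _ k

lemma map_qComm (r : ℤ) (a b : B) : φ (qComm r a b) = qComm r (φ a) (φ b) := by
  simp [qComm]

lemma map_eDiag (k : ℕ) : φ (eDiag x k) = eDiag (fun a => φ (x a)) k := by
  simp [eDiag, map_hEl]

lemma map_lowerEl (j i : ℕ) : φ (lowerEl x j i) = lowerEl (fun a => φ (x a)) j i := by
  rw [lowerEl, lowerEl]
  induction j - i - 1 with
  | zero => exact map_fEl φ x i
  | succ d ih => rw [lowerAux, lowerAux, map_qComm, ih, map_fEl]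

lemma UCartanLog.map {a b : B} (h : UCartanLog x a b) :
    UCartanLog (fun a => φ (x a)) (φ a) (φ b) := by
  cases h <;> simp only [map_mul, map_sub, map_zsmul, map_hEl, map_eEl, map_fEl] <;>
    constructor <;> assumption

lemma uPart_map : uPart (fun a => φ (y a)) = fun a => φ (uPart y a) := rfl

lemma DCartanLog.map {a b : B} (h : DCartanLog y a b) :
    DCartanLog (fun a => φ (y a)) (φ a) (φ b) := by
  cases h <;> simp only [map_mul, map_sub, map_neg, map_eDiag, ← uPart_map] <;>
    constructor <;> assumption

lemma UCartanLog.exists_lift {a b : C} (h : UCartanLog (fun a => φ (x a)) a b) :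
    ∃ a' b', UCartanLog x a' b' ∧ φ a' = a ∧ φ b' = b := by
  cases h with
  | hh i j hi hj => exact ⟨_, _, .hh i j hi hj, by simp [map_hEl]⟩
  | he i j hi hj => exact ⟨_, _, .he i j hi hj, by simp [map_hEl, map_eEl]⟩
  | hf i j hi hj => exact ⟨_, _, .hf i j hi hj, by simp [map_hEl, map_fEl]⟩

lemma DCartanLog.exists_lift {a b : C} (h : DCartanLog (fun a => φ (y a)) a b) :
    ∃ a' b', DCartanLog y a' b' ∧ φ a' = a ∧ φ b' = b := by
  cases h with
  | central a => exact ⟨_, _, .central a, by simp⟩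
  | first => exact ⟨_, _, .first, by simp [map_eDiag, ← uPart_map]⟩
  | middle i hi => exact ⟨_, _, .middle i hi, by simp [map_eDiag, ← uPart_map]⟩
  | last => exact ⟨_, _, .last, by simp [map_eDiag, ← uPart_map]⟩

variable [IsAdicComplete adicIdeal B] [IsAdicComplete adicIdeal C]

lemma map_eTilde : φ (eTilde x) = eTilde (fun a => φ (x a)) := by
  rw [eTilde, eTilde, map_mul, φ.map_qPow, map_add, map_eDiag, map_eDiag, map_lowerEl]

lemma URoot.map {a b : B} (h : URoot x a b) : URoot (fun a => φ (x a)) (φ a) (φ b) := by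
  cases h <;> simp only [map_mul, map_sub, map_zero, map_qComm, map_hEl, map_eEl, map_fEl,
    φ.map_qNum] <;>
    constructor <;> assumption

lemma DRoot.map {a b : B} (h : DRoot y a b) : DRoot (fun a => φ (y a)) (φ a) (φ b) := by
  cases h <;> simp only [map_mul, map_sub, map_add, map_smul, map_one, map_zero, map_qComm, map_eEl,
    map_fEl, map_eDiag, map_lowerEl, φ.map_qPow, ← uPart_map] <;>
    constructor <;> assumption

/-- The relations of `U_q(sl(n+1))`. -/
def URel (x : UIdx n → B) : Prop := (∀ a b, UCartanLog x a b → a = b) ∧ ∀ a b, URoot x a b → a = b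

/-- The explicit relations of the Drinfeldian, with the Cartan part in logarithmic form. -/
def DRel (y : DIdx n → B) : Prop :=
  URel yᵘ ∧ (∀ a b, DCartanLog y a b → a = b) ∧ ∀ a b, DRoot y a b → a = b

lemma URoot.exists_lift {a b : C} (h : URoot (fun a => φ (x a)) a b) :
    ∃ a' b', URoot x a' b' ∧ φ a' = a ∧ φ b' = b := by
  cases h with
  | ef_same i hi => exact ⟨_, _, .ef_same i hi, by simp [map_hEl, map_eEl, map_fEl, φ.map_qNum]⟩
  | ef_ne i j hi hj hij => exact ⟨_, _, .ef_ne i j hi hj hij, by simp [map_eEl, map_fEl]⟩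
  | ee_far i j hi hj hij => exact ⟨_, _, .ee_far i j hi hj hij, by simp [map_eEl]⟩
  | ff_far i j hi hj hij => exact ⟨_, _, .ff_far i j hi hj hij, by simp [map_fEl]⟩
  | e_serre i j hi hj hij => exact ⟨_, _, .e_serre i j hi hj hij, by simp [map_qComm, map_eEl]⟩
  | f_serre i j hi hj hij => exact ⟨_, _, .f_serre i j hi hj hij, by simp [map_qComm, map_fEl]⟩

lemma DRoot.exists_lift {a b : C} (h : DRoot (fun a => φ (y a)) a b) :
    ∃ a' b', DRoot y a' b' ∧ φ a' = a ∧ φ b' = b := by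
  cases h with
  | xi_f i hi => exact ⟨_, _, .xi_f i hi, by simp [map_fEl, ← uPart_map]⟩
  | e_xi i hi => exact ⟨_, _, .e_xi i hi, by simp [map_eEl, ← uPart_map]⟩
  | serre_first => exact ⟨_, _, .serre_first, by simp [map_qComm, map_eEl, ← uPart_map]⟩
  | serre_last => exact ⟨_, _, .serre_last, by simp [map_qComm, map_eEl, ← uPart_map]⟩
  | eta_serre_first => exact ⟨_, _, .eta_serre_first, by simp [map_qComm, map_eEl, map_eDiag,
      map_lowerEl, φ.map_qPow, ← uPart_map]⟩
  | eta_serre_last => exact ⟨_, _, .eta_serre_last, by simp [map_qComm, map_eEl, map_eDiag,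
      map_lowerEl, φ.map_qPow, ← uPart_map]⟩

lemma URel.of_hom (h1 : ∀ a b, UCartanLog x a b → φ a = φ b)
    (h2 : ∀ a b, URoot x a b → φ a = φ b) : URel fun a => φ (x a) := by
  refine ⟨fun a b h => ?_, fun a b h => ?_⟩
  · obtain ⟨a', b', h', rfl, rfl⟩ := UCartanLog.exists_lift φ x h
    exact h1 _ _ h'
  · obtain ⟨a', b', h', rfl, rfl⟩ := URoot.exists_lift φ x h
    exact h2 _ _ h'

lemma DRel.of_hom (h1 : ∀ a b, UCartanLog yᵘ a b → φ a = φ b)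
    (h2 : ∀ a b, URoot yᵘ a b → φ a = φ b) (h3 : ∀ a b, DCartanLog y a b → φ a = φ b)
    (h4 : ∀ a b, DRoot y a b → φ a = φ b) : DRel fun a => φ (y a) := by
  refine ⟨URel.of_hom φ _ h1 h2, fun a b h => ?_, fun a b h => ?_⟩
  · obtain ⟨a', b', h', rfl, rfl⟩ := DCartanLog.exists_lift φ y h
    exact h3 _ _ h'
  · obtain ⟨a', b', h', rfl, rfl⟩ := DRoot.exists_lift φ y h
    exact h4 _ _ h'

lemma URel.hom_eq {x' : UIdx n → C} (hx : URel x') (hφ : ∀ a, φ (x a) = x' a) {a b : B}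
    (h : UCartanLog x a b ∨ URoot x a b) : φ a = φ b := by
  obtain rfl : (fun a => φ (x a)) = x' := funext hφ
  exact h.elim (fun h => hx.1 _ _ (h.map φ)) fun h => hx.2 _ _ (h.map φ)

lemma DRel.hom_eq {y' : DIdx n → C} (hy : DRel y') (hφ : ∀ a, φ (y a) = y' a) {a b : B}
    (h : UCartanLog yᵘ a b ∨ URoot yᵘ a b ∨ DCartanLog y a b ∨ DRoot y a b) : φ a = φ b := by
  obtain rfl : (fun a => φ (y a)) = y' := funext hφ
  rcases h with h | h | h | h
  · exact hy.1.1 _ _ (h.map φ)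
  · exact hy.1.2 _ _ (h.map φ)
  · exact hy.2.1 _ _ (h.map φ)
  · exact hy.2.2 _ _ (h.map φ)

/-- The relations are preserved by homomorphisms. -/
lemma URel.map (hx : URel x) : URel fun a => φ (x a) :=
  URel.of_hom φ x (fun a b h => by rw [hx.1 a b h]) fun a b h => by rw [hx.2 a b h]

lemma DRel.map (hy : DRel y) : DRel fun a => φ (y a) :=
  DRel.of_hom φ y (fun a b h => by rw [hy.1.1 a b h]) (fun a b h => by rw [hy.1.2 a b h])
    (fun a b h => by rw [hy.2.1 a b h]) fun a b h => by rw [hy.2.2 a b h]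

lemma uGen_rel (n : ℕ) : URel (uGen n) := URel.of_hom (presProj (uqRel n)) (freeGen (UIdx n))
    (fun _ _ h => presProj_eq_of_rel _ (Or.inl h)) fun _ _ h => presProj_eq_of_rel _ (Or.inr h)

lemma dGen_rel (n : ℕ) : DRel (dGen n) := DRel.of_hom (presProj (drinRel n)) (freeGen (DIdx n))
    (fun _ _ h => presProj_eq_of_rel _ (Or.inl h))
    (fun _ _ h => presProj_eq_of_rel _ (Or.inr (Or.inl h)))
    (fun _ _ h => presProj_eq_of_rel _ (Or.inr (Or.inr (Or.inl h))))
    fun _ _ h => presProj_eq_of_rel _ (Or.inr (Or.inr (Or.inr h)))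

/-- The homomorphism out of `U_q(sl(n+1))` given by a solution of its relations. -/
def uqLift (x : UIdx n → B) (hx : URel x) : Uq n →ₐ[BaseRing] B := presLift (uqRel n) x fun _ _ h =>
    hx.hom_eq (freeLift x) (freeGen (UIdx n)) (freeLift_freeGen x) h

lemma uqLift_uGen (x : UIdx n → B) (hx : URel x) (a : UIdx n) : uqLift x hx (uGen n a) = x a :=
  presLift_presGen _ x _ a

/-- The homomorphism out of the Drinfeldian given by a solution of its relations. -/
def drinLift (y : DIdx n → B) (hy : DRel y) : Drin n →ₐ[BaseRing] B :=
  presLift (drinRel n) y fun _ _ h =>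
    hy.hom_eq (freeLift y) (freeGen (DIdx n)) (freeLift_freeGen y) h

lemma drinLift_dGen (y : DIdx n → B) (hy : DRel y) (a : DIdx n) : drinLift y hy (dGen n a) = y a :=
  presLift_presGen _ y _ a

end Naturality

/-! ### `q`-commutation and weights -/

section QCommutation

variable {B : Type*} [Ring B] [Algebra BaseRing B]

lemma qInt_mul_neg (r : ℤ) : qInt r * qInt (-r) = 1 := by
  rw [← qInt_add, add_neg_cancel, qInt_zero]

lemma qInt_neg_mul (r : ℤ) : qInt (-r) * qInt r = 1 := by
  rw [← qInt_add, neg_add_cancel, qInt_zero]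

lemma qInt_one_mul : qInt 1 * qInt (-1) = 1 := qInt_mul_neg 1

lemma qInt_two : qInt 2 = qInt 1 * qInt 1 := by
  rw [← qInt_add]
  rfl

lemma qInt_neg_two : qInt (-2) = qInt (-1) * qInt (-1) := by
  rw [← qInt_add]
  rfl

lemma isUnit_of_constantCoeff {u : BaseRing} (h : MvPowerSeries.constantCoeff (R := ℂ) u ≠ 0) :
    IsUnit u := by
  rw [MvPowerSeries.isUnit_iff_constantCoeff]
  exact isUnit_iff_ne_zero.2 h

lemma constantCoeff_qInt (r : ℤ) : MvPowerSeries.constantCoeff (qInt r) = 1 := by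
  have h := isLogSum_logSum (B := BaseRing)
    (fun k => scal (1 / (k.factorial : ℂ)) • (r : BaseRing) ^ k) 1
  have h' := constantCoeff_eq_zero_of_mem (x := qInt r - 1)
    (by simpa [qInt, qPow, scal_one] using h)
  simpa [sub_eq_zero] using h'

lemma isUnit_qInt_add_neg : IsUnit (qInt 1 + qInt (-1)) := by
  apply isUnit_of_constantCoeff
  rw [map_add, constantCoeff_qInt, constantCoeff_qInt]
  norm_num

lemma smul_cancel_of_isUnit {u : BaseRing} (hu : IsUnit u) {a b : B} (h : u • a = u • b) :
    a = b := hu.smul_left_cancel.1 h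

/-- `a` and `b` commute up to the factor `q ^ r`: `a b = q ^ r b a`. -/
def QC (r : ℤ) (a b : B) : Prop := a * b = qInt r • (b * a)

variable {r s t : ℤ} {a b c : B}

lemma QC.eq (h : QC r a b) : a * b = qInt r • (b * a) := h

lemma qc_zero_iff : QC 0 a b ↔ a * b = b * a := by rw [QC, qInt_zero, one_smul]

lemma QC.comm (h : QC 0 a b) : a * b = b * a := qc_zero_iff.1 h

lemma QC.symm (h : QC r a b) : QC (-r) b a := by
  rw [QC, h.eq, smul_smul, qInt_neg_mul, one_smul]

lemma QC.mul_right (h : QC r a b) (h' : QC s a c) : QC (r + s) a (b * c) := by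
  rw [QC, ← mul_assoc, h.eq, smul_mul_assoc, mul_assoc, h'.eq, mul_smul_comm, smul_smul, qInt_add,
    mul_assoc]

lemma QC.mul_left (h : QC r a c) (h' : QC s b c) : QC (r + s) (a * b) c := by
  rw [QC, mul_assoc, h'.eq, mul_smul_comm, ← mul_assoc, h.eq, smul_mul_assoc, smul_smul, qInt_add,
    mul_assoc, mul_comm]

lemma QC.sub_right (h : QC r a b) (h' : QC r a c) : QC r a (b - c) := by
  rw [QC, mul_sub, sub_mul, h.eq, h'.eq, smul_sub]

lemma QC.smul_right (z : BaseRing) (h : QC r a b) : QC r a (z • b) := by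
  rw [QC, mul_smul_comm, h.eq, smul_mul_assoc, smul_comm]

lemma QC.sum_right {ι : Type*} (S : Finset ι) (f : ι → B) (h : ∀ i ∈ S, QC r a (f i)) :
    QC r a (∑ i ∈ S, f i) := by
  rw [QC, mul_sum, sum_mul, smul_sum]
  exact sum_congr rfl h

lemma QC.cast (h : QC r a b) (e : r = s) : QC s a b := e ▸ h

lemma QC.qComm_right (h : QC r a b) (h' : QC s a c) : QC (r + s) a (qComm t b c) :=
  (h.mul_right h').sub_right (((h'.mul_right h).cast (add_comm s r)).smul_right _)

lemma qComm_assoc (h : a * c = c * a) : qComm r a (qComm s b c) = qComm s (qComm r a b) c := by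
  have h1 : a * (c * b) = c * (a * b) := by rw [← mul_assoc, h, mul_assoc]
  have h2 : b * (a * c) = b * (c * a) := by rw [h]
  simp only [qComm, mul_sub, sub_mul, mul_smul_comm, smul_mul_assoc, smul_sub, mul_assoc, h1, h2]
  rw [smul_comm (qInt s) (qInt r)]
  abel

/-- `a` has weight `r` under the Cartan element `h`: `[h, a] = r a`. -/
def HasWt (h : B) (r : ℤ) (a : B) : Prop := h * a = a * h + r • a

variable {h h' : B}

lemma HasWt.mul (ha : HasWt h r a) (hb : HasWt h s b) : HasWt h (r + s) (a * b) := by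
  rw [HasWt] at *
  rw [← mul_assoc, ha, add_mul, mul_assoc, hb, mul_add, add_smul, smul_mul_assoc, mul_smul_comm,
    mul_assoc]
  abel

lemma HasWt.add_left (ha : HasWt h r a) (hb : HasWt h' s a) : HasWt (h + h') (r + s) a := by
  rw [HasWt] at *
  rw [add_mul, ha, hb, mul_add, add_smul]
  abel

lemma HasWt.neg_left (ha : HasWt h r a) : HasWt (-h) (-r) a := by
  rw [HasWt] at *
  rw [neg_mul, ha, mul_neg, neg_smul]
  abel

lemma HasWt.sub_left (ha : HasWt h r a) (hb : HasWt h' s a) : HasWt (h - h') (r - s) a := by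
  rw [sub_eq_add_neg, sub_eq_add_neg]
  exact ha.add_left hb.neg_left

lemma HasWt.sum_left {ι : Type*} (S : Finset ι) (u : ι → B) (w : ι → ℤ)
    (H : ∀ i ∈ S, HasWt (u i) (w i) a) : HasWt (∑ i ∈ S, u i) (∑ i ∈ S, w i) a := by
  rw [HasWt, sum_mul, mul_sum, Finset.sum_smul, ← sum_add_distrib]
  exact sum_congr rfl H

lemma hasWt_zero_iff : HasWt h 0 a ↔ h * a = a * h := by simp [HasWt]

lemma HasWt.add_right (ha : HasWt h r a) (hb : HasWt h r b) : HasWt h r (a + b) := by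
  rw [HasWt] at *
  rw [mul_add, ha, hb, add_mul, smul_add]
  abel

lemma HasWt.smul_right (z : BaseRing) (ha : HasWt h r a) : HasWt h r (z • a) := by
  rw [HasWt] at *
  rw [mul_smul_comm, ha, smul_add, smul_mul_assoc, smul_comm z r a]

lemma HasWt.neg_right (ha : HasWt h r a) : HasWt h r (-a) := by
  simpa using ha.smul_right (-1)

lemma HasWt.zero_right : HasWt h r 0 := by simp [HasWt]

lemma HasWt.qComm (ha : HasWt h r a) (hb : HasWt h s b) (t : ℤ) :
    HasWt h (r + s) (qComm t a b) := by
  rw [_root_.qComm, sub_eq_add_neg]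
  exact (ha.mul hb).add_right (((add_comm s r ▸ hb.mul ha).smul_right _).neg_right)

lemma HasWt.cast (ha : HasWt h r a) (e : r = s) : HasWt h s a := e ▸ ha

lemma HasWt.shift (ha : HasWt h r a) : a * (h + (r : B)) = h * a := by
  rw [HasWt] at ha
  rw [ha, mul_add, zsmul_eq_mul, Int.cast_comm]

variable [IsAdicComplete adicIdeal B]

lemma HasWt.qPow (ha : HasWt h r a) : QC r (qPow h) a := by
  have h1 := mul_qPow_of_mul_eq ha.shift
  rw [qPow_add ((Int.cast_commute r h).symm), qPow_intCast, mul_smul_comm, mul_one,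
    mul_smul_comm] at h1
  exact h1.symm

/-- The two expansions of `[u + r]` give two ways to move `[u] q ^ v` past an element of weight
`r` under `u` and `s` under `v`. -/
lemma HasWt.qNum_mul_qPow {u v : B} (hu : HasWt u r a) (hv : HasWt v s a) :
    qNum u * _root_.qPow v * a = qInt s • (a * (qNum (u + (r : B)) * _root_.qPow v)) := by
  rw [mul_assoc, hv.qPow.eq, mul_smul_comm, ← mul_assoc, ← mul_assoc, ← mul_qNum_of_mul_eq hu.shift]

lemma qNum_add_intCast (u : B) (r : ℤ) :
    qNum (u + (r : B)) = qInt r • qNum u + qNum (r : B) * qPow (-u) := by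
  have h := (Int.cast_commute r u).symm
  rw [qNum_add h, qPow_intCast, mul_smul_comm, mul_one]
  congr 1
  exact (mul_qNum_of_mul_eq (by rw [(Int.cast_commute r (qPow (-u))).symm.eq])).trans rfl

lemma qNum_add_intCast' (u : B) (r : ℤ) :
    qNum (u + (r : B)) = qInt (-r) • qNum u + qNum (r : B) * qPow u := by
  have h := (Int.cast_commute r u)
  rw [add_comm u, qNum_add h, ← Int.cast_neg, qPow_intCast, smul_mul_assoc, one_mul, add_comm]

end QCommutation

/-! ### Root vectors of `U_q(sl(n+1))` -/

section RootVectors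

variable {n : ℕ} {B : Type*} [Ring B] [Algebra BaseRing B] {x : UIdx n → B}

lemma hEl_of_notMem {k : ℕ} (hk : k ∉ Icc 1 n) : hEl x k = 0 := by
  rw [hEl, at1, dif_neg (by simpa using hk)]

lemma eEl_of_notMem {k : ℕ} (hk : k ∉ Icc 1 n) : eEl x k = 0 := by
  rw [eEl, at1, dif_neg (by simpa using hk)]

lemma fEl_of_notMem {k : ℕ} (hk : k ∉ Icc 1 n) : fEl x k = 0 := by
  rw [fEl, at1, dif_neg (by simpa using hk)]

lemma lowerEl_self (i : ℕ) : lowerEl x (i + 1) i = fEl x i := by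
  rw [lowerEl, show i + 1 - i - 1 = 0 by omega, lowerAux]

lemma lowerEl_succ {i j : ℕ} (h : i < j) :
    lowerEl x (j + 1) i = qComm (-1) (fEl x j) (lowerEl x j i) := by
  rw [lowerEl, lowerEl, show j + 1 - i - 1 = (j - i - 1) + 1 by omega, lowerAux,
    show i + (j - i - 1) + 1 = j by omega]

lemma rootForm_comm (i j : ℕ) : rootForm i j = rootForm j i := by
  unfold rootForm
  split_ifs <;> first | rfl | omega

lemma qc_lowerEl_right {u : B} {r : ℕ → ℤ} {i j : ℕ} (hij : i < j)
    (h : ∀ l, i ≤ l → l < j → QC (r l) u (fEl x l)) :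
    QC (∑ l ∈ Ico i j, r l) u (lowerEl x j i) := by
  induction j, hij using Nat.le_induction with
  | base =>
    rw [lowerEl_self, Finset.sum_Ico_succ_top le_rfl, Finset.Ico_self, sum_empty, zero_add]
    exact h i le_rfl (Nat.lt_succ_self i)
  | succ j hij ih =>
    have hij' : i < j := hij
    rw [lowerEl_succ hij', Finset.sum_Ico_succ_top hij'.le, add_comm]
    exact (h j hij'.le (Nat.lt_succ_self j)).qComm_right
      (ih fun l h1 h2 => h l h1 (h2.trans (Nat.lt_succ_self j)))

lemma qc_lowerEl_left {u : B} {r : ℕ → ℤ} {i j : ℕ} (hij : i < j)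
    (h : ∀ l, i ≤ l → l < j → QC (r l) (fEl x l) u) :
    QC (∑ l ∈ Ico i j, r l) (lowerEl x j i) u := by
  have := (qc_lowerEl_right (r := fun l => -r l) hij fun l h1 h2 => (h l h1 h2).symm).symm
  exact this.cast (by simp)

lemma lowerEl_comm {u : B} {i j : ℕ} (hij : i < j)
    (h : ∀ l, i ≤ l → l < j → u * fEl x l = fEl x l * u) : u * lowerEl x j i = lowerEl x j i * u :=
  ((qc_lowerEl_right (r := fun _ => 0) hij fun l h1 h2 => qc_zero_iff.2 (h l h1 h2)).cast
    (by simp)).comm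

lemma hasWt_lowerEl {u : B} {r : ℕ → ℤ} {i j : ℕ} (hij : i < j)
    (h : ∀ l, i ≤ l → l < j → HasWt u (r l) (fEl x l)) :
    HasWt u (∑ l ∈ Ico i j, r l) (lowerEl x j i) := by
  induction j, hij using Nat.le_induction with
  | base =>
    rw [lowerEl_self, Finset.sum_Ico_succ_top le_rfl, Finset.Ico_self, sum_empty, zero_add]
    exact h i le_rfl (Nat.lt_succ_self i)
  | succ j hij ih =>
    have hij' : i < j := hij
    rw [lowerEl_succ hij', Finset.sum_Ico_succ_top hij'.le, add_comm]
    exact (h j hij'.le (Nat.lt_succ_self j)).qComm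
      (ih fun l h1 h2 => h l h1 (h2.trans (Nat.lt_succ_self j))) _

lemma sum_mul_sub_succ (v : ℕ → ℤ) (n : ℕ) : ∑ k ∈ Icc 1 n, ((n : ℤ) + 1 - k) * (v k - v (k + 1)) =
      (n + 1) * v 1 - ∑ k ∈ Icc 1 (n + 1), v k := by
  induction n with
  | zero => simp
  | succ n ih =>
    have h1 : ∑ k ∈ Icc 1 n, ((↑(n + 1) : ℤ) + 1 - k) * (v k - v (k + 1)) =
        ∑ k ∈ Icc 1 n, ((n : ℤ) + 1 - k) * (v k - v (k + 1)) + (v 1 - v (n + 1)) := by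
      have h2 : ∑ k ∈ Icc 1 n, (v k - v (k + 1)) = v 1 - v (n + 1) := by
        rw [← Finset.Ico_add_one_right_eq_Icc, ← neg_inj, ← Finset.sum_neg_distrib]
        simp only [neg_sub]
        exact Finset.sum_Ico_sub v (by omega)
      rw [← h2, ← sum_add_distrib]
      refine sum_congr rfl fun k _ => ?_
      push_cast
      ring
    rw [Finset.sum_Icc_succ_top (by omega), h1, ih, Finset.sum_Icc_succ_top (by omega :
      1 ≤ n + 1 + 1)]
    push_cast
    ring

/-- The weight of an element under `e_{ii}`, from its weights under the `h_{α_k}`. -/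
lemma hasWt_eDiag {u : B} {v : ℕ → ℤ} (h : ∀ k ∈ Icc 1 n, HasWt (hEl x k) (v k - v (k + 1)) u)
    (hv : ∑ k ∈ Icc 1 (n + 1), v k = 0) {i : ℕ} (hi1 : 1 ≤ i) (hi : i ≤ n + 1) :
    HasWt (eDiag x i) (v i) u := by
  have h0 := sum_mul_sub_succ v n
  rw [hv, sub_zero] at h0
  have hw : ∑ k ∈ Icc 1 n, ((n : ℂ) + 1 - k) * ((v k - v (k + 1) : ℤ) : ℂ) =
      (n + 1) * (v 1 : ℂ) := by
    exact_mod_cast congrArg (Int.cast : ℤ → ℂ) h0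
  have hs : ∑ k ∈ Ico 1 i, (v k - v (k + 1)) = v 1 - v i := by
    rw [← neg_inj, ← Finset.sum_neg_distrib]
    simp only [neg_sub]
    exact Finset.sum_Ico_sub v hi1
  have h1 : HasWt (∑ k ∈ Ico 1 i, hEl x k) (v 1 - v i) u := by
    rw [← hs]
    refine HasWt.sum_left _ _ _ fun k hk => h k ?_
    simp only [mem_Ico, mem_Icc] at hk ⊢
    omega
  have h2 : (∑ k ∈ Icc 1 n, scal ((n : ℂ) + 1 - k) • hEl x k) * u =
      u * (∑ k ∈ Icc 1 n, scal ((n : ℂ) + 1 - k) • hEl x k) +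
        scal (∑ k ∈ Icc 1 n, ((n : ℂ) + 1 - k) * ((v k - v (k + 1) : ℤ) : ℂ)) • u := by
    have h3 : scal (∑ k ∈ Icc 1 n, ((n : ℂ) + 1 - k) * ((v k - v (k + 1) : ℤ) : ℂ)) =
        ∑ k ∈ Icc 1 n, scal ((n : ℂ) + 1 - k) * ((v k - v (k + 1) : ℤ) : BaseRing) := by
      simp [scal]
    rw [h3, sum_mul, mul_sum, Finset.sum_smul, ← sum_add_distrib]
    refine sum_congr rfl fun k hk => ?_
    rw [smul_mul_assoc, (h k hk : _ = _), smul_add, mul_smul_comm, mul_smul, Int.cast_smul_eq_zsmul]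
  have hn : (n : ℂ) + 1 ≠ 0 := by exact_mod_cast Nat.succ_ne_zero n
  rw [HasWt] at *
  rw [eDiag, sub_mul, smul_mul_assoc, h2, h1, smul_add, smul_smul, mul_sub, mul_smul_comm, hw,
    scal_mul, ← mul_assoc, one_div_mul_cancel hn, one_mul]
  have h4 : scal (v 1 : ℂ) = ((v 1 : ℤ) : BaseRing) := by simp [scal]
  rw [h4, Int.cast_smul_eq_zsmul, sub_smul]
  abel

lemma eDiag_sub_eDiag_succ {i : ℕ} (hi : 1 ≤ i) : eDiag x i - eDiag x (i + 1) = hEl x i := by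
  rw [eDiag, eDiag, Finset.sum_Ico_succ_top hi]
  abel

end RootVectors

section URelLemmas

variable {n : ℕ} {B : Type*} [Ring B] [Algebra BaseRing B] [IsAdicComplete adicIdeal B]
variable {x : UIdx n → B}

lemma URel.hh (hx : URel x) (i j : ℕ) : hEl x i * hEl x j = hEl x j * hEl x i := by
  by_cases hi : i ∈ Icc 1 n
  · by_cases hj : j ∈ Icc 1 n
    · exact hx.1 _ _ (.hh i j hi hj)
    · rw [hEl_of_notMem hj, mul_zero, zero_mul]
  · rw [hEl_of_notMem hi, mul_zero, zero_mul]

lemma URel.hasWt_e (hx : URel x) {i : ℕ} (hi : i ∈ Icc 1 n) (j : ℕ) :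
    HasWt (hEl x i) (rootForm i j) (eEl x j) := by
  by_cases hj : j ∈ Icc 1 n
  · exact sub_eq_iff_eq_add'.1 (hx.1 _ _ (.he i j hi hj))
  · rw [eEl_of_notMem hj]
    exact HasWt.zero_right

lemma URel.hasWt_f (hx : URel x) {i : ℕ} (hi : i ∈ Icc 1 n) (j : ℕ) :
    HasWt (hEl x i) (-rootForm i j) (fEl x j) := by
  by_cases hj : j ∈ Icc 1 n
  · exact sub_eq_iff_eq_add'.1 (hx.1 _ _ (.hf i j hi hj))
  · rw [fEl_of_notMem hj]
    exact HasWt.zero_right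

lemma URel.ef_same (hx : URel x) (i : ℕ) :
    eEl x i * fEl x i = fEl x i * eEl x i + qNum (hEl x i) := by
  by_cases hi : i ∈ Icc 1 n
  · exact sub_eq_iff_eq_add'.1 (hx.2 _ _ (.ef_same i hi))
  · rw [eEl_of_notMem hi, hEl_of_notMem hi, qNum_zero, zero_mul, mul_zero, add_zero]

lemma URel.ef_ne (hx : URel x) {i j : ℕ} (h : i ≠ j) : eEl x i * fEl x j = fEl x j * eEl x i := by
  by_cases hi : i ∈ Icc 1 n
  · by_cases hj : j ∈ Icc 1 n
    · exact sub_eq_zero.1 (hx.2 _ _ (.ef_ne i j hi hj h))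
    · rw [fEl_of_notMem hj, mul_zero, zero_mul]
  · rw [eEl_of_notMem hi, mul_zero, zero_mul]

lemma URel.ff_far (hx : URel x) {i j : ℕ} (h : i + 2 ≤ j ∨ j + 2 ≤ i) :
    fEl x i * fEl x j = fEl x j * fEl x i := by
  by_cases hi : i ∈ Icc 1 n
  · by_cases hj : j ∈ Icc 1 n
    · rcases h with h | h
      · exact hx.2 _ _ (.ff_far i j hi hj h)
      · exact (hx.2 _ _ (.ff_far j i hj hi h)).symm
    · rw [fEl_of_notMem hj, mul_zero, zero_mul]
  · rw [fEl_of_notMem hi, mul_zero, zero_mul]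

lemma qComm_serre_eq (a b : B) : qComm 1 (qComm (-1) a b) b =
    a * b * b - (qInt 1 + qInt (-1)) • (b * a * b) + b * b * a := by
  simp only [qComm, mul_sub, sub_mul, smul_mul_assoc, mul_smul_comm, smul_sub, smul_smul,
    qInt_one_mul, one_smul, add_smul, mul_assoc]
  abel

lemma URel.f_serre (hx : URel x) {i j : ℕ} (h : i + 1 = j ∨ j + 1 = i) :
    fEl x i * fEl x j * fEl x j - (qInt 1 + qInt (-1)) • (fEl x j * fEl x i * fEl x j) +
      fEl x j * fEl x j * fEl x i = 0 := by
  by_cases hi : i ∈ Icc 1 n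
  · by_cases hj : j ∈ Icc 1 n
    · rw [← qComm_serre_eq]
      exact hx.2 _ _ (.f_serre i j hi hj h)
    · simp [fEl_of_notMem hj]
  · simp [fEl_of_notMem hi]

/-- `e_{ji} = [e_{jk}, e_{ki}]_q` for every intermediate `k`. -/
lemma URel.lowerEl_split (hx : URel x) {i k j : ℕ} (hik : i < k) (hkj : k < j) :
    lowerEl x j i = qComm (-1) (lowerEl x j k) (lowerEl x k i) := by
  induction j, hkj using Nat.le_induction with
  | base => rw [lowerEl_succ hik, lowerEl_self]
  | succ j hkj ih =>
    have hkj' : k < j := hkj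
    rw [lowerEl_succ (hik.trans hkj'), ih, lowerEl_succ hkj', qComm_assoc]
    exact lowerEl_comm hik fun l _ h2 => hx.ff_far (Or.inr (by omega))

/-- An element that commutes with the outer simple root vectors of `e_{ji}` has the same
`q`-commutation with `e_{ji}` as with the inner root vector `e_{ba}`. -/
lemma URel.qc_extend (hx : URel x) {u : B} {r : ℤ} {i a b j : ℕ} (hia : i ≤ a) (hab : a < b)
    (hbj : b ≤ j) (h : QC r u (lowerEl x b a)) (h1 : ∀ l, i ≤ l → l < a → u * fEl x l = fEl x l * u)
    (h2 : ∀ l, b ≤ l → l < j → u * fEl x l = fEl x l * u) : QC r u (lowerEl x j i) := by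
  have h3 : QC r u (lowerEl x b i) := by
    rcases hia.eq_or_lt with rfl | hia
    · exact h
    · rw [hx.lowerEl_split hia hab]
      exact (h.qComm_right (qc_zero_iff.2 (lowerEl_comm hia h1))).cast (add_zero r)
  rcases hbj.eq_or_lt with rfl | hbj
  · exact h3
  · rw [hx.lowerEl_split (hia.trans_lt hab) hbj]
    exact ((qc_zero_iff.2 (lowerEl_comm hbj h2)).qComm_right h3).cast (zero_add r)

lemma URel.f_lowerEl_far (hx : URel x) {i j k : ℕ} (hij : i < j) (h : k + 1 < i ∨ j < k) :
    fEl x k * lowerEl x j i = lowerEl x j i * fEl x k :=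
  lowerEl_comm hij fun l h1 h2 => hx.ff_far (by omega)

lemma URel.f_lowerEl_top (hx : URel x) {i j : ℕ} (hij : i < j) :
    QC 1 (fEl x j) (lowerEl x (j + 1) i) := by
  obtain ⟨m, rfl⟩ : ∃ m, j = m + 1 := ⟨j - 1, by omega⟩
  refine hx.qc_extend (a := m) (by omega) (by omega) le_rfl ?_
    (fun l h1 h2 => hx.ff_far (by omega)) (fun l h1 h2 => by omega)
  rw [lowerEl_succ (Nat.lt_succ_self m), lowerEl_self, QC, ← sub_eq_zero,
    ← hx.f_serre (i := m) (j := m + 1) (Or.inl rfl)]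
  simp only [qComm, mul_sub, sub_mul, smul_mul_assoc, mul_smul_comm, smul_sub, smul_smul,
    qInt_one_mul, one_smul, add_smul, mul_assoc]
  abel

lemma URel.f_lowerEl_bot (hx : URel x) {i j : ℕ} (hij : i + 1 < j) :
    QC (-1) (fEl x i) (lowerEl x j i) := by
  refine hx.qc_extend (b := i + 2) le_rfl (by omega) (by omega) ?_ (fun l h1 h2 => by omega)
    (fun l h1 h2 => hx.ff_far (by omega))
  have h := hx.f_serre (i := i + 1) (j := i) (Or.inr rfl)
  rw [lowerEl_succ (Nat.lt_succ_self i), lowerEl_self, QC]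
  have h' := congrArg (fun t => -(qInt (-1) • t)) h
  rw [← sub_eq_zero]
  simp only [smul_zero, neg_zero] at h'
  rw [← h']
  have e : qInt (-1) * qInt 1 = 1 := qInt_neg_mul 1
  simp only [qComm, mul_sub, sub_mul, smul_mul_assoc, mul_smul_comm, smul_sub, smul_add, smul_smul,
    e, add_smul, one_smul, mul_assoc]
  abel

lemma URel.f_lowerEl_inner (hx : URel x) {i k j : ℕ} (hik : i < k) (hkj : k + 1 < j) :
    fEl x k * lowerEl x j i = lowerEl x j i * fEl x k := by
  obtain ⟨m, rfl⟩ : ∃ m, k = m + 1 := ⟨k - 1, by omega⟩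
  refine (hx.qc_extend (r := 0) (a := m) (b := m + 3) (by omega) (by omega) (by omega) ?_
    (fun l h1 h2 => hx.ff_far (by omega)) (fun l h1 h2 => hx.ff_far (by omega))).comm
  -- With `X = e_{m+2,m}`, `Y = f_{m+2}` and `Z = [Y, X]_q`, the two expansions of `Z` give
  -- `(q + q⁻¹) [f_{m+1}, Z] = 0`.
  have h1 : lowerEl x (m + 3) m = qComm (-1) (fEl x (m + 2)) (lowerEl x (m + 2) m) :=
    lowerEl_succ (by omega)
  have h2 : lowerEl x (m + 3) m = qComm (-1) (lowerEl x (m + 3) (m + 1)) (fEl x m) := by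
    rw [hx.lowerEl_split (k := m + 1) (by omega) (by omega), lowerEl_self]
  have h3 : QC (-1) (fEl x (m + 1)) (lowerEl x (m + 3) (m + 1)) := hx.f_lowerEl_bot (by omega)
  have h4 : QC 1 (fEl x (m + 1)) (lowerEl x (m + 2) m) := hx.f_lowerEl_top (by omega)
  have h5 : lowerEl x (m + 2) m = qComm (-1) (fEl x (m + 1)) (fEl x m) := by
    rw [lowerEl_succ (by omega), lowerEl_self]
  have h6 : lowerEl x (m + 3) (m + 1) = qComm (-1) (fEl x (m + 2)) (fEl x (m + 1)) := by
    rw [lowerEl_succ (by omega), lowerEl_self]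
  have e := qInt_one_mul
  generalize lowerEl x (m + 3) m = Z at *
  generalize lowerEl x (m + 2) m = X at *
  generalize lowerEl x (m + 3) (m + 1) = Y at *
  generalize fEl x (m + 1) = a at *
  generalize fEl x (m + 2) = b at *
  generalize fEl x m = d at *
  simp only [qComm, QC] at h1 h2 h3 h4 h5 h6
  have hu := isUnit_qInt_add_neg
  generalize qInt 1 = P at *
  generalize qInt (-1) = Q at *
  have E1 : a * Z = (P * P) • (Z * a) - P • (Y * X - X * Y) := by
    linear_combination (norm := skip) a * h1 - (P * P) • (h1 * a) + P • (h6 * X) - P • (X * h6) -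
      Q • (h4 * b) + P • (b * h4)
    simp only [mul_sub, sub_mul, smul_mul_assoc, mul_smul_comm, mul_assoc]
    match_scalars <;> grind
  have E2 : a * Z = (Q * Q) • (Z * a) + Q • (Y * X - X * Y) := by
    linear_combination (norm := skip) a * h2 - (Q * Q) • (h2 * a) - Q • (Y * h5) + Q • (h5 * Y) +
      h3 * d - (Q * Q) • (d * h3)
    simp only [mul_sub, sub_mul, smul_mul_assoc, mul_smul_comm, mul_assoc]
    match_scalars <;> grind
  rw [qc_zero_iff]
  refine smul_cancel_of_isUnit hu ?_
  linear_combination (norm := skip) Q • E1 + P • E2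
  match_scalars <;> grind

lemma sum_Ico_ite_succ_eq {k j : ℕ} (h : k < j) (r : ℤ) :
    ∑ l ∈ Ico k j, (if l + 1 = j then r else 0) = r := by
  rw [Finset.sum_eq_single (j - 1)]
  · rw [if_pos (by omega)]
  · intro b hb hne
    rw [if_neg (by omega)]
  · intro hb
    exact absurd (mem_Ico.2 ⟨by omega, by omega⟩) hb

lemma sum_Ico_ite_eq {k j : ℕ} (h : k < j) (r : ℤ) :
    ∑ l ∈ Ico k j, (if l = k then r else 0) = r := by
  rw [Finset.sum_eq_single k (fun b _ hne => if_neg hne)]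
  · rw [if_pos rfl]
  · intro hb
    exact absurd (mem_Ico.2 ⟨le_rfl, h⟩) hb

lemma URel.lowerEl_same_top (hx : URel x) {i k j : ℕ} (hik : i < k) (hkj : k < j) :
    QC 1 (lowerEl x j k) (lowerEl x j i) := by
  refine (qc_lowerEl_left (r := fun l => if l + 1 = j then 1 else 0) hkj
    fun l h1 h2 => ?_).cast (sum_Ico_ite_succ_eq hkj 1)
  split_ifs with h
  · subst h
    exact hx.f_lowerEl_top (by omega)
  · exact qc_zero_iff.2 (hx.f_lowerEl_inner (by omega) (by omega))

lemma URel.lowerEl_same_bot (hx : URel x) {i k j : ℕ} (hik : i < k) (hkj : k < j) :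
    QC (-1) (lowerEl x k i) (lowerEl x j i) := by
  refine (qc_lowerEl_left (r := fun l => if l = i then -1 else 0) hik
    fun l h1 h2 => ?_).cast (sum_Ico_ite_eq hik (-1))
  split_ifs with h
  · subst h
    exact hx.f_lowerEl_bot (by omega)
  · exact qc_zero_iff.2 (hx.f_lowerEl_inner (by omega) (by omega))

lemma URel.lowerEl_nested (hx : URel x) {i k l j : ℕ} (hik : i < k) (hkl : k < l) (hlj : l < j) :
    lowerEl x l k * lowerEl x j i = lowerEl x j i * lowerEl x l k :=
  (lowerEl_comm hkl fun m h1 h2 => (hx.f_lowerEl_inner (by omega) (by omega)).symm).symm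

lemma URel.lowerEl_far (hx : URel x) {i k l j : ℕ} (hik : i < k) (hkl : k < l) (hlj : l < j) :
    lowerEl x k i * lowerEl x j l = lowerEl x j l * lowerEl x k i :=
  lowerEl_comm hlj fun m h1 h2 => (hx.f_lowerEl_far hik (by omega)).symm

lemma URel.lowerEl_cross (hx : URel x) {i k l j : ℕ} (hik : i < k) (hkl : k < l) (hlj : l < j) :
    lowerEl x j k * lowerEl x l i =
      lowerEl x l i * lowerEl x j k + qDiff • (lowerEl x j i * lowerEl x l k) := by
  have h1 := hx.lowerEl_split hik (hkl.trans hlj)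
  have h2 := hx.lowerEl_split hik hkl
  have h3 := (hx.lowerEl_same_bot hkl hlj).symm
  have h4 := hx.lowerEl_nested hik hkl hlj
  have e := qInt_one_mul
  rw [qDiff]
  rw [neg_neg] at h3
  simp only [qComm, QC] at h1 h2 h3
  generalize lowerEl x j k = a at *
  generalize lowerEl x l k = b at *
  generalize lowerEl x k i = d at *
  generalize lowerEl x j i = D at *
  generalize lowerEl x l i = G at *
  generalize qInt 1 = P at *
  generalize qInt (-1) = Q at *
  linear_combination (norm := skip) a * h2 - h2 * a + h3 * d - (Q * Q) • (d * h3) - P • (b * h1) +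
      P • h4 + Q • (h1 * b)
  simp only [mul_sub, sub_mul, smul_mul_assoc, mul_smul_comm, mul_assoc]
  match_scalars <;> grind

lemma URel.hasWt_h_lowerEl (hx : URel x) {i j : ℕ} (hij : i < j) {k : ℕ} (hk : k ∈ Icc 1 n) :
    HasWt (hEl x k) (((if k = j then 1 else 0) - (if k = i then 1 else 0)) -
      ((if k + 1 = j then 1 else 0) - (if k + 1 = i then 1 else 0))) (lowerEl x j i) := by
  refine (hasWt_lowerEl hij fun l _ _ => hx.hasWt_f hk l).cast ?_
  induction j, hij using Nat.le_induction with
  | base =>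
    rw [Finset.sum_Ico_succ_top le_rfl, Finset.Ico_self, sum_empty, zero_add, rootForm]
    split_ifs <;> omega
  | succ j hij ih =>
    rw [Finset.sum_Ico_succ_top (by omega), ih, rootForm]
    split_ifs <;> omega

lemma sum_Icc_ite_sub {i j : ℕ} (hi : 1 ≤ i) (hi' : i ≤ n + 1) (hj : 1 ≤ j) (hj' : j ≤ n + 1) :
    ∑ k ∈ Icc 1 (n + 1), (((if k = j then 1 else 0) - (if k = i then 1 else 0) : ℤ)) = 0 := by
  simp [Finset.sum_sub_distrib, hi, hi', hj, hj']

/-- `e_{ji}` has weight `δ_{jk} - δ_{ik}` under `e_{kk}`. -/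
lemma URel.hasWt_lowerEl (hx : URel x) {i j : ℕ} (hi : 1 ≤ i) (hij : i < j) (hj : j ≤ n + 1)
    {k : ℕ} (hk1 : 1 ≤ k) (hk : k ≤ n + 1) :
    HasWt (eDiag x k) ((if k = j then 1 else 0) - (if k = i then 1 else 0)) (lowerEl x j i) :=
  hasWt_eDiag (v := fun k => (if k = j then 1 else 0) - (if k = i then 1 else 0))
    (fun _ hk => hx.hasWt_h_lowerEl hij hk) (sum_Icc_ite_sub hi (by omega) (by omega) hj) hk1 hk

lemma URel.hasWt_eDiag_f (hx : URel x) {j : ℕ} (hj : j ∈ Icc 1 n) {k : ℕ} (hk1 : 1 ≤ k)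
    (hk : k ≤ n + 1) :
    HasWt (eDiag x k) ((if k = j + 1 then 1 else 0) - (if k = j then 1 else 0)) (fEl x j) := by
  rw [mem_Icc] at hj
  rw [← lowerEl_self]
  exact hx.hasWt_lowerEl hj.1 (by omega) (by omega) hk1 hk

lemma URel.hasWt_eDiag_e (hx : URel x) {j : ℕ} (hj : j ∈ Icc 1 n) {k : ℕ} (hk1 : 1 ≤ k)
    (hk : k ≤ n + 1) :
    HasWt (eDiag x k) ((if k = j then 1 else 0) - (if k = j + 1 then 1 else 0)) (eEl x j) := by
  rw [mem_Icc] at hj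
  refine hasWt_eDiag (v := fun k => (if k = j then 1 else 0) - (if k = j + 1 then 1 else 0))
    (fun k hk => (hx.hasWt_e hk j).cast ?_)
    (sum_Icc_ite_sub (by omega) (by omega) hj.1 (by omega)) hk1 hk
  rw [rootForm]
  split_ifs <;> omega

lemma URel.commute_h_eDiag (hx : URel x) (i j : ℕ) : Commute (hEl x i) (eDiag x j) := by
  refine Commute.sub_right (Commute.smul_right (Commute.sum_right _ _ _ fun k _ => ?_) _)
    (Commute.sum_right _ _ _ fun k _ => hx.hh i k)
  exact Commute.smul_right (hx.hh i k) _

lemma URel.commute_eDiag (hx : URel x) (i j : ℕ) : Commute (eDiag x i) (eDiag x j) := by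
  refine Commute.sub_left (Commute.smul_left (Commute.sum_left _ _ _ fun k _ => ?_) _)
    (Commute.sum_left _ _ _ fun k _ => hx.commute_h_eDiag k j)
  exact Commute.smul_left (hx.commute_h_eDiag k j) _

lemma URel.e_lowerEl_far (hx : URel x) {i j k : ℕ} (hij : i < j) (h : k < i ∨ j ≤ k) :
    eEl x k * lowerEl x j i = lowerEl x j i * eEl x k :=
  lowerEl_comm hij fun l h1 h2 => hx.ef_ne (by omega)

lemma URel.e_lowerEl_top (hx : URel x) {i j : ℕ} (hi : 1 ≤ i) (hij : i < j) (hj : j ≤ n) :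
    eEl x j * lowerEl x (j + 1) i =
      lowerEl x (j + 1) i * eEl x j + lowerEl x j i * qPow (hEl x j) := by
  have h1 : hEl x j * lowerEl x j i = lowerEl x j i * (hEl x j + ((1 : ℤ) : B)) := by
    refine (((hx.hasWt_h_lowerEl hij (k := j) (mem_Icc.2 ⟨by omega, hj⟩)).cast ?_).shift).symm
    split_ifs <;> omega
  have h2 := mul_qNum_of_mul_eq h1.symm
  have h3 := qNum_add_intCast' (hEl x j) 1
  rw [Int.cast_one, qNum_one, one_mul] at h3
  rw [Int.cast_one, h3] at h2
  have h4 := hx.e_lowerEl_far hij (k := j) (Or.inr le_rfl)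
  have h5 := hx.ef_same j
  rw [lowerEl_succ hij]
  have e := qInt_one_mul
  generalize lowerEl x j i = X at *
  generalize qNum (hEl x j) = N at *
  generalize qPow (hEl x j) = K at *
  generalize eEl x j = E at *
  generalize fEl x j = f at *
  rw [qComm]
  linear_combination (norm := skip) h5 * X + f * h4 - qInt (-1) • (h4 * f) -
    qInt (-1) • (X * h5) - h2
  simp only [mul_add, add_mul, mul_sub, sub_mul, smul_mul_assoc, mul_smul_comm, mul_assoc]
  module

lemma URel.e_lowerEl_bot (hx : URel x) {i j : ℕ} (hi : 1 ≤ i) (hij : i + 1 < j) (hj : j ≤ n + 1) :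
    eEl x i * lowerEl x j i =
      lowerEl x j i * eEl x i - qInt (-1) • (lowerEl x j (i + 1) * qPow (-hEl x i)) := by
  have h1 : hEl x i * lowerEl x j (i + 1) = lowerEl x j (i + 1) * (hEl x i + ((1 : ℤ) : B)) := by
    refine (((hx.hasWt_h_lowerEl hij (k := i) (mem_Icc.2 ⟨hi, by omega⟩)).cast ?_).shift).symm
    split_ifs <;> omega
  have h2 := mul_qNum_of_mul_eq h1.symm
  have h3 := qNum_add_intCast (hEl x i) 1
  rw [Int.cast_one, qNum_one, one_mul] at h3
  rw [Int.cast_one, h3] at h2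
  have h4 := hx.e_lowerEl_far hij (k := i) (Or.inl (by omega))
  have h5 := hx.ef_same i
  rw [hx.lowerEl_split (k := i + 1) (by omega) hij, lowerEl_self]
  have e := qInt_one_mul
  generalize lowerEl x j (i + 1) = X at *
  generalize qNum (hEl x i) = N at *
  generalize qPow (-hEl x i) = K at *
  generalize eEl x i = E at *
  generalize fEl x i = f at *
  rw [qComm]
  linear_combination (norm := skip) h4 * f + X * h5 - qInt (-1) • (h5 * X) -
    qInt (-1) • (f * h4) + qInt (-1) • h2
  simp only [mul_add, add_mul, mul_sub, sub_mul, smul_mul_assoc, mul_smul_comm, mul_assoc]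
  match_scalars <;> grind

lemma URel.e_lowerEl_inner (hx : URel x) {i k j : ℕ} (hi : 1 ≤ i) (hik : i < k) (hkj : k + 1 < j)
    (hj : j ≤ n + 1) : eEl x k * lowerEl x j i = lowerEl x j i * eEl x k := by
  have h1 := hx.lowerEl_split hik (show k < j by omega)
  have h2 := hx.e_lowerEl_bot (by omega) hkj hj
  have h3 := hx.e_lowerEl_far hik (k := k) (Or.inr le_rfl)
  have h4 : QC (-1) (qPow (-hEl x k)) (lowerEl x k i) := by
    refine ((hx.hasWt_h_lowerEl hik (k := k)
      (mem_Icc.2 ⟨by omega, by omega⟩)).neg_left.qPow).cast ?_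
    split_ifs <;> omega
  have h5 := hx.lowerEl_far hik (Nat.lt_succ_self k) hkj
  rw [QC] at h4
  rw [h1, qComm]
  generalize lowerEl x j k = a at *
  generalize lowerEl x k i = b at *
  generalize lowerEl x j (k + 1) = d at *
  generalize qPow (-hEl x k) = K at *
  generalize eEl x k = E at *
  linear_combination (norm := skip) h2 * b + a * h3 - qInt (-1) • (h3 * a) - qInt (-1) • (b * h2) -
    qInt (-1) • (d * h4) + (qInt (-1) * qInt (-1)) • (h5 * K)
  simp only [mul_sub, sub_mul, smul_mul_assoc, mul_smul_comm, mul_assoc]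
  module

end URelLemmas

/-! ### The singular shift by `ẽ_{-θ}` -/

section Shift

variable {B : Type*} [Ring B] [Algebra BaseRing B]

lemma mul_rule {a b c : B} (h : a * b = c) (t : B) : a * (b * t) = c * t := by
  rw [← mul_assoc, h]

/-- The quadratic Serre expression of a shift `c ξ - η K E` with respect to the first simple root:
the cross terms combine into a multiple of `c = q - q⁻¹`. -/
lemma serre_first_shift {e E N K ξ : B} (hKe : e * K = qInt (-1) • (K * e)) (hKE : E * K = K * E)
    (hKξ : ξ * K = K * ξ) (hN : e * E = E * e + N) (hEξ : ξ * E = E * ξ)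
    (hNξ : ξ * N = qInt (-1) • (N * ξ)) (hNE : N * E = (qInt 1 * qInt 1) • (E * N))
    (c' : BaseRing) :
    qComm 1 (qComm (-1) e (qDiff • ξ - c' • (K * E))) (qDiff • ξ - c' • (K * E)) =
      (qDiff * qDiff) • (qComm 1 (qComm (-1) e ξ) ξ -
        c' • (K * (qInt (-2) • ((e * E - E * e) * ξ) - E * qComm (-1) e ξ))) := by
  have hKN : N * K = qInt (-1) • (K * N) := by
    have : N = e * E - E * e := by rw [hN]; abel
    rw [this]
    simp only [mul_sub, sub_mul, mul_assoc, hKE, mul_rule hKE, hKe, mul_rule hKe,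
      mul_smul_comm, smul_mul_assoc, smul_sub]
  rw [qInt_neg_two]
  simp only [qDiff, qComm]
  simp only [mul_add, add_mul, mul_sub, sub_mul, smul_mul_assoc, mul_smul_comm, mul_assoc, smul_sub,
    smul_add, hN, hEξ, hNξ, hNE, mul_rule hKe, mul_rule hKE,
    mul_rule hKξ, mul_rule hN, mul_rule hEξ, mul_rule hKN]
  match_scalars <;> grind [qInt_one_mul]

/-- The quadratic Serre expression of a shift `c ξ - η K E` with respect to the last simple root. -/
lemma serre_last_shift {e E N K ξ : B} (hKe : e * K = qInt 1 • (K * e)) (hKE : E * K = K * E)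
    (hKξ : ξ * K = K * ξ) (hN : e * E = E * e - N) (hEξ : ξ * E = E * ξ)
    (hNξ : ξ * N = qInt 1 • (N * ξ)) (hNE : N * E = (qInt (-1) * qInt (-1)) • (E * N))
    (c' : BaseRing) : qComm 1 (qComm (-1) e (qDiff • ξ - c' • (K * E))) (qDiff • ξ - c' • (K * E)) =
      (qDiff * qDiff) • (qComm 1 ξ (qComm (-1) ξ e) -
        c' • ((qInt 1 • K) * (qInt 1 • ((E * e - e * E) * ξ) - E * qComm (-1) ξ e))) := by
  have hKN : N * K = qInt 1 • (K * N) := by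
    have : N = E * e - e * E := by rw [hN]; abel
    rw [this]
    simp only [mul_sub, sub_mul, mul_assoc, hKE, mul_rule hKE, hKe, mul_rule hKe,
      mul_smul_comm, smul_mul_assoc, smul_sub]
  simp only [qDiff, qComm]
  simp only [mul_sub, sub_mul, smul_mul_assoc, mul_smul_comm, mul_assoc, smul_sub,
    hN, hEξ, hNξ, hNE, mul_rule hKe, mul_rule hKE, mul_rule hKξ, mul_rule hN, mul_rule hEξ,
    mul_rule hKN]
  match_scalars <;> grind [qInt_one_mul]

/-- The cubic Serre expression, written with the opposite nesting. -/
lemma qComm_serre_swap (a b : B) : qComm 1 (qComm (-1) a b) b = qComm 1 b (qComm (-1) b a) := by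
  simp only [qComm, mul_sub, sub_mul, smul_mul_assoc, mul_smul_comm, smul_sub, mul_assoc]
  match_scalars <;> grind [qInt_one_mul]

lemma serre_shift_linear {e E N K ξ : B} {r s : ℤ} (hKe : e * K = qInt r • (K * e))
    (hN : e * E = E * e + N) (heN : e * N = qInt s • (N * e))
    (hrs : (r = -1 ∧ s = 2) ∨ (r = 1 ∧ s = -2)) (c' : BaseRing) :
    qComm 1 e (qComm (-1) e (qDiff • ξ - c' • (K * E))) = qDiff • qComm 1 e (qComm (-1) e ξ) := by
  rcases hrs with ⟨rfl, rfl⟩ | ⟨rfl, rfl⟩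
  all_goals
    simp only [qDiff, qComm, qInt_two, qInt_neg_two] at *
    simp only [mul_add, add_mul, mul_sub, sub_mul, smul_mul_assoc, mul_smul_comm, mul_assoc,
      smul_sub, smul_add, hN, heN, mul_rule hKe, mul_rule hN]
    match_scalars <;> grind [qInt_one_mul]

end Shift

/-! ### The shifted relations of `ξ_{δ-θ}` -/

section ShiftRelations

variable {n : ℕ} {B : Type*} [Ring B] [Algebra BaseRing B] [IsAdicComplete adicIdeal B]
variable {x : UIdx n → B} {y : DIdx n → B}

lemma eDiag_weight_sub {u : B} {v : ℕ → ℤ}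
    (h : ∀ k, 1 ≤ k → k ≤ n + 1 → HasWt (eDiag x k) (v k) u) {k : ℕ} (hk : k ∈ Icc 1 n) :
    HasWt (hEl x k) (v k - v (k + 1)) u := by
  rw [mem_Icc] at hk
  rw [← eDiag_sub_eDiag_succ hk.1]
  exact (h k hk.1 (by omega)).sub_left (h (k + 1) (by omega) (by omega))

/-- The weight `ε_{n+1} - ε_1` of `ξ_{δ-θ}` and of `e_{n+1,1}`. -/
def thetaWt (n k : ℕ) : ℤ := (if k = n + 1 then 1 else 0) - (if k = 1 then 1 else 0)

lemma thetaForm_eq (hn : 1 < n) {k : ℕ} (hk : k ∈ Icc 1 n) :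
    -thetaForm n k = thetaWt n k - thetaWt n (k + 1) := by
  rw [mem_Icc] at hk
  have h1 : ∀ m : ℕ, ∑ j ∈ Icc 1 m, rootForm k j =
      (if k ≤ m then 2 else 0) - (if k + 1 ≤ m then 1 else 0) -
        (if 2 ≤ k ∧ k ≤ m + 1 then 1 else 0) := by
    intro m
    induction m with
    | zero => simp; omega
    | succ m ih =>
      rw [Finset.sum_Icc_succ_top (by omega), ih, rootForm]
      split_ifs <;> omega
  rw [thetaForm, h1, thetaWt, thetaWt]
  split_ifs <;> omega

lemma thetaForm_eq_zero_iff (hn : 1 < n) {k : ℕ} (hk : k ∈ Icc 1 n) :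
    thetaForm n k = 0 ↔ k ∈ Icc 2 (n - 1) := by
  have h := thetaForm_eq hn hk
  rw [mem_Icc] at hk ⊢
  rw [thetaWt, thetaWt] at h
  split_ifs at h <;> omega

lemma sum_thetaWt : ∑ k ∈ Icc 1 (n + 1), thetaWt n k = 0 :=
  sum_Icc_ite_sub le_rfl (by omega) (by omega) le_rfl

/-- The relations of Cartan type between the generators. -/
def DCartan (y : DIdx n → B) : Prop := ∀ a b, DCartanLog y a b → a = b

lemma DCartan.hd_comm (hy : DCartan y) (a : DIdx n) : y .hd * y a = y a * y .hd :=
  hy _ _ (.central a)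

lemma DCartan.hasWt_xi (hy : DCartan y) (hn : 1 < n) {k : ℕ} (hk1 : 1 ≤ k) (hk : k ≤ n + 1) :
    HasWt (eDiag yᵘ k) (thetaWt n k) (y .xi) := by
  rcases hk1.eq_or_lt with rfl | hk1
  · have := sub_eq_iff_eq_add'.1 (hy _ _ .first)
    rw [HasWt, this, thetaWt, if_neg (by omega), if_pos rfl]
    simp
  · rcases hk.eq_or_lt with rfl | hk
    · have := sub_eq_iff_eq_add'.1 (hy _ _ .last)
      rw [HasWt, this, thetaWt, if_pos rfl, if_neg (by omega)]
      simp
    · have := hy _ _ (.middle k (mem_Icc.2 ⟨hk1, by omega⟩))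
      rw [HasWt, this, thetaWt, if_neg (by omega), if_neg (by omega)]
      simp

/-- A family with the Cartan weights of the generators satisfies the Cartan relations. -/
lemma DCartan.of_hasWt (hc : ∀ a, y .hd * y a = y a * y .hd) (hn : 1 < n)
    (h : ∀ k, 1 ≤ k → k ≤ n + 1 → HasWt (eDiag yᵘ k) (thetaWt n k) (y .xi)) : DCartan y := by
  rintro a b (a | _ | ⟨i, hi⟩ | _)
  · exact hc a
  · have := h 1 le_rfl (by omega)
    rw [HasWt, thetaWt, if_neg (by omega), if_pos rfl] at this
    rw [this]
    simp
  · rw [mem_Icc] at hi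
    have := h i (by omega) (by omega)
    rw [HasWt, thetaWt, if_neg (by omega), if_neg (by omega)] at this
    rw [this]
    simp
  · have := h (n + 1) (by omega) le_rfl
    rw [HasWt, thetaWt, if_pos rfl, if_neg (by omega)] at this
    rw [this]
    simp

/-- `q ^ (e_{11} + e_{n+1,n+1})`. -/
def kTop (x : UIdx n → B) : B := qPow (eDiag x 1 + eDiag x (n + 1))

lemma qc_kTop {u : B} {v : ℕ → ℤ} (h : ∀ k, 1 ≤ k → k ≤ n + 1 → HasWt (eDiag x k) (v k) u) :
    QC (v 1 + v (n + 1)) (kTop x) u :=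
  ((h 1 le_rfl (by omega)).add_left (h (n + 1) (by omega) le_rfl)).qPow

lemma URel.hasWt_theta (hx : URel x) (hn : 1 < n) {k : ℕ} (hk1 : 1 ≤ k) (hk : k ≤ n + 1) :
    HasWt (eDiag x k) (thetaWt n k) (lowerEl x (n + 1) 1) :=
  hx.hasWt_lowerEl le_rfl (by omega) le_rfl hk1 hk

lemma kTop_theta (hn : 1 < n) {u : B}
    (h : ∀ k, 1 ≤ k → k ≤ n + 1 → HasWt (eDiag x k) (thetaWt n k) u) : u * kTop x = kTop x * u := by
  refine ((qc_kTop h).cast ?_).comm.symm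
  rw [thetaWt, thetaWt]
  split_ifs <;> omega

lemma URel.qc_kTop_f (hx : URel x) {k : ℕ} (hk : k ∈ Icc 1 n) :
    QC ((if k = 1 then -1 else 0) + (if k = n then 1 else 0)) (kTop x) (fEl x k) := by
  refine (qc_kTop fun l h1 h2 => hx.hasWt_eDiag_f hk h1 h2).cast ?_
  rw [mem_Icc] at hk
  split_ifs <;> omega

lemma URel.qc_kTop_e (hx : URel x) {k : ℕ} (hk : k ∈ Icc 1 n) :
    QC ((if k = 1 then 1 else 0) + (if k = n then -1 else 0)) (kTop x) (eEl x k) := by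
  refine (qc_kTop fun l h1 h2 => hx.hasWt_eDiag_e hk h1 h2).cast ?_
  rw [mem_Icc] at hk
  split_ifs <;> omega

lemma URel.qc_f_theta (hx : URel x) (hn : 1 < n) {k : ℕ} (hk : k ∈ Icc 1 n) :
    QC ((if k = 1 then -1 else 0) + (if k = n then 1 else 0)) (fEl x k) (lowerEl x (n + 1) 1) := by
  rw [mem_Icc] at hk
  by_cases h1 : k = 1
  · subst h1
    rw [if_pos rfl, if_neg (by omega)]
    exact hx.f_lowerEl_bot (by omega)
  by_cases h2 : k = n
  · subst h2
    rw [if_neg h1, if_pos rfl]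
    exact hx.f_lowerEl_top (by omega)
  · rw [if_neg h1, if_neg h2]
    exact qc_zero_iff.2 (hx.f_lowerEl_inner (by omega) (by omega))

lemma URel.eTilde_f (hx : URel x) (hn : 1 < n) {k : ℕ} (hk : k ∈ Icc 1 n) :
    eTilde x * fEl x k = fEl x k * eTilde x := by
  have h := ((hx.qc_kTop_f hk).mul_left (hx.qc_f_theta hn hk).symm).cast (add_neg_cancel _)
  exact h.comm

lemma URel.eTilde_e (hx : URel x) (hn : 1 < n) {k : ℕ} (hk : k ∈ Icc 2 (n - 1)) :
    eEl x k * eTilde x = eTilde x * eEl x k := by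
  rw [mem_Icc] at hk
  have hk' : k ∈ Icc 1 n := mem_Icc.2 ⟨by omega, by omega⟩
  have h1 := hx.qc_kTop_e hk'
  rw [if_neg (by omega), if_neg (by omega), add_zero] at h1
  have h2 := qc_zero_iff.2 (hx.e_lowerEl_inner le_rfl (by omega : 1 < k)
    (by omega : k + 1 < n + 1) le_rfl)
  exact ((h1.symm.mul_right h2).cast (by ring)).comm

/-- The ingredients of the Serre relations between `e_{α_1}`, `ξ` and `ẽ_{-θ}`. -/
lemma URel.first_data (hx : URel x) (hn : 1 < n) :
    ∃ N, N = -(qInt (-1) • (lowerEl x (n + 1) 2 * qPow (-hEl x 1))) ∧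
      eEl x 1 * kTop x = qInt (-1) • (kTop x * eEl x 1) ∧
      lowerEl x (n + 1) 1 * kTop x = kTop x * lowerEl x (n + 1) 1 ∧
      eEl x 1 * lowerEl x (n + 1) 1 = lowerEl x (n + 1) 1 * eEl x 1 + N ∧
      N * lowerEl x (n + 1) 1 = (qInt 1 * qInt 1) • (lowerEl x (n + 1) 1 * N) ∧
      eEl x 1 * N = qInt 2 • (N * eEl x 1) := by
  have hm : 1 ∈ Icc 1 n := mem_Icc.2 ⟨le_rfl, by omega⟩
  refine ⟨_, rfl, ?_, kTop_theta hn fun k => hx.hasWt_theta hn, ?_, ?_, ?_⟩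
  · have := (hx.qc_kTop_e hm).symm
    rw [if_pos rfl, if_neg (by omega)] at this
    exact this
  · rw [hx.e_lowerEl_bot le_rfl (by omega) le_rfl, ← sub_eq_add_neg]
  · have h1 : QC 1 (qPow (-hEl x 1)) (lowerEl x (n + 1) 1) := by
      refine ((hx.hasWt_h_lowerEl (by omega) hm).neg_left.qPow).cast ?_
      split_ifs <;> omega
    have h2 : QC 1 (lowerEl x (n + 1) 2) (lowerEl x (n + 1) 1) :=
      hx.lowerEl_same_top (by omega) (by omega)
    have h3 := (h2.mul_left h1).eq
    rw [neg_mul, mul_neg, smul_mul_assoc, h3, mul_smul_comm, ← qInt_add, smul_neg, smul_comm]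
  · have h1 := hx.e_lowerEl_far (show 2 < n + 1 by omega) (k := 1) (Or.inl (by omega))
    have h2 : QC (-2) (qPow (-hEl x 1)) (eEl x 1) :=
      ((hx.hasWt_e hm 1).neg_left.qPow).cast (by simp [rootForm])
    have h3 := ((qc_zero_iff.2 h1).mul_right h2.symm).eq
    rw [mul_neg, mul_smul_comm, h3, neg_mul, smul_neg, smul_mul_assoc, smul_comm]
    rfl

/-- The ingredients of the Serre relations between `e_{α_n}`, `ξ` and `ẽ_{-θ}`. -/
lemma URel.last_data (hx : URel x) (hn : 1 < n) : ∃ N, N = -(lowerEl x n 1 * qPow (hEl x n)) ∧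
      eEl x n * kTop x = qInt 1 • (kTop x * eEl x n) ∧
      lowerEl x (n + 1) 1 * kTop x = kTop x * lowerEl x (n + 1) 1 ∧
      eEl x n * lowerEl x (n + 1) 1 = lowerEl x (n + 1) 1 * eEl x n - N ∧
      N * lowerEl x (n + 1) 1 = (qInt (-1) * qInt (-1)) • (lowerEl x (n + 1) 1 * N) ∧
      eEl x n * N = qInt (-2) • (N * eEl x n) := by
  have hm : n ∈ Icc 1 n := mem_Icc.2 ⟨by omega, le_rfl⟩
  refine ⟨_, rfl, ?_, kTop_theta hn fun k => hx.hasWt_theta hn, ?_, ?_, ?_⟩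
  · have := (hx.qc_kTop_e hm).symm
    rw [if_neg (by omega), if_pos rfl] at this
    exact this
  · rw [hx.e_lowerEl_top le_rfl (by omega) le_rfl, sub_neg_eq_add]
  · have h1 : QC (-1) (qPow (hEl x n)) (lowerEl x (n + 1) 1) := by
      refine ((hx.hasWt_h_lowerEl (by omega) hm).qPow).cast ?_
      split_ifs <;> omega
    have h2 : QC (-1) (lowerEl x n 1) (lowerEl x (n + 1) 1) :=
      hx.lowerEl_same_bot (by omega) (by omega)
    have h3 := (h2.mul_left h1).eq
    rw [neg_mul, mul_neg, h3, ← qInt_add, smul_neg]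
  · have h1 := hx.e_lowerEl_far (show 1 < n by omega) (k := n) (Or.inr (by omega))
    have h2 : QC 2 (qPow (hEl x n)) (eEl x n) := ((hx.hasWt_e hm n).qPow).cast (by simp [rootForm])
    have h3 := ((qc_zero_iff.2 h1).mul_right h2.symm).eq
    rw [mul_neg, h3, neg_mul, smul_neg]
    rfl

lemma zeta_f (hx : URel yᵘ) (hn : 1 < n) {k : ℕ} (hk : k ∈ Icc 1 n) :
    zetaEl y (eTilde yᵘ) * fEl yᵘ k - fEl yᵘ k * zetaEl y (eTilde yᵘ) =
      qDiff • (y .xi * fEl yᵘ k - fEl yᵘ k * y .xi) := by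
  rw [zetaEl, sub_mul, mul_sub, smul_mul_assoc, smul_mul_assoc, mul_smul_comm, mul_smul_comm,
    hx.eTilde_f hn hk, smul_sub]
  abel

lemma zeta_e (hx : URel yᵘ) (hn : 1 < n) {k : ℕ} (hk : k ∈ Icc 2 (n - 1)) :
    eEl yᵘ k * zetaEl y (eTilde yᵘ) - zetaEl y (eTilde yᵘ) * eEl yᵘ k =
      qDiff • (eEl yᵘ k * y .xi - y .xi * eEl yᵘ k) := by
  rw [zetaEl, sub_mul, mul_sub, smul_mul_assoc, smul_mul_assoc, mul_smul_comm, mul_smul_comm,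
    hx.eTilde_e hn hk, smul_sub]
  abel

lemma zeta_first (hx : URel yᵘ) (hn : 1 < n) :
    qComm 1 (eEl yᵘ 1) (qComm (-1) (eEl yᵘ 1) (zetaEl y (eTilde yᵘ))) =
      qDiff • qComm 1 (eEl yᵘ 1) (qComm (-1) (eEl yᵘ 1) (y .xi)) := by
  obtain ⟨N, -, h1, -, h3, -, h5⟩ := hx.first_data hn
  exact serre_shift_linear h1 h3 h5 (Or.inl ⟨rfl, rfl⟩) eta

lemma zeta_last (hx : URel yᵘ) (hn : 1 < n) :
    qComm 1 (eEl yᵘ n) (qComm (-1) (eEl yᵘ n) (zetaEl y (eTilde yᵘ))) =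
      qDiff • qComm 1 (qComm (-1) (y .xi) (eEl yᵘ n)) (eEl yᵘ n) := by
  obtain ⟨N, -, h1, -, h3, -, h5⟩ := hx.last_data hn
  rw [qComm_serre_swap (y .xi)]
  refine serre_shift_linear (N := -N) h1 ?_ ?_ (Or.inr ⟨rfl, rfl⟩) eta
  · rw [h3, sub_eq_add_neg]
  · rw [mul_neg, h5, neg_mul, smul_neg]

lemma xi_lowerEl (h : ∀ k ∈ Icc 1 n, y .xi * fEl yᵘ k = fEl yᵘ k * y .xi)
    {i j : ℕ} (hi : 1 ≤ i) (hij : i < j) (hj : j ≤ n + 1) :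
    y .xi * lowerEl yᵘ j i = lowerEl yᵘ j i * y .xi :=
  lowerEl_comm hij fun l h1 h2 => h l (mem_Icc.2 ⟨by omega, by omega⟩)

lemma zeta_eta_first (hx : URel yᵘ) (hy : DCartan y) (hn : 1 < n)
    (h : ∀ k ∈ Icc 1 n, y .xi * fEl yᵘ k = fEl yᵘ k * y .xi) :
    qComm 1 (qComm (-1) (eEl yᵘ 1) (zetaEl y (eTilde yᵘ))) (zetaEl y (eTilde yᵘ)) =
      (qDiff * qDiff) • (qComm 1 (qComm (-1) (eEl yᵘ 1) (y .xi)) (y .xi) - eta • (κ[y,n + 1] *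
          (qInt (-2) • ((eEl yᵘ 1 * lowerEl yᵘ (n + 1) 1 -
              lowerEl yᵘ (n + 1) 1 * eEl yᵘ 1) * y .xi) -
            lowerEl yᵘ (n + 1) 1 * qComm (-1) (eEl yᵘ 1) (y .xi)))) := by
  obtain ⟨N, hN, h1, h2, h3, h4, -⟩ := hx.first_data hn
  refine serre_first_shift h1 h2 (kTop_theta hn fun k => hy.hasWt_xi hn) h3
    (xi_lowerEl h le_rfl (by omega) le_rfl) ?_ h4 eta
  have h5 : QC 1 (qPow (-hEl yᵘ 1)) (y .xi) := by
    refine ((eDiag_weight_sub (fun k => hy.hasWt_xi hn) (mem_Icc.2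
      ⟨le_rfl, by omega⟩)).neg_left.qPow).cast ?_
    rw [thetaWt, thetaWt]
    split_ifs <;> omega
  have h6 := ((qc_zero_iff.2 (xi_lowerEl h (i := 2) (j := n + 1) (by omega) (by omega)
    le_rfl)).mul_right h5.symm).eq
  rw [hN, mul_neg, mul_smul_comm, h6, neg_mul, smul_neg, smul_mul_assoc, smul_comm]
  rfl

lemma zeta_eta_last (hx : URel yᵘ) (hy : DCartan y) (hn : 1 < n)
    (h : ∀ k ∈ Icc 1 n, y .xi * fEl yᵘ k = fEl yᵘ k * y .xi) :
    qComm 1 (qComm (-1) (eEl yᵘ n) (zetaEl y (eTilde yᵘ))) (zetaEl y (eTilde yᵘ)) =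
      (qDiff * qDiff) • (qComm 1 (y .xi) (qComm (-1) (y .xi) (eEl yᵘ n)) -
        eta • (qPow (eDiag yᵘ 1 + eDiag yᵘ (n + 1) + 1) *
          (qInt 1 • ((lowerEl yᵘ (n + 1) 1 * eEl yᵘ n - eEl yᵘ n * lowerEl yᵘ (n + 1) 1) * y .xi) -
            lowerEl yᵘ (n + 1) 1 * qComm (-1) (y .xi) (eEl yᵘ n)))) := by
  obtain ⟨N, hN, h1, h2, h3, h4, -⟩ := hx.last_data hn
  have hK : qPow (eDiag yᵘ 1 + eDiag yᵘ (n + 1) + 1) = qInt 1 • kTop yᵘ := by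
    rw [qPow_add (Commute.one_right _), ← Int.cast_one (R := B), qPow_intCast, mul_smul_comm,
      mul_one]
    rfl
  rw [hK]
  refine serre_last_shift h1 h2 (kTop_theta hn fun k => hy.hasWt_xi hn) h3
    (xi_lowerEl h le_rfl (by omega) le_rfl) ?_ h4 eta
  have h5 : QC (-1) (qPow (hEl yᵘ n)) (y .xi) := by
    refine ((eDiag_weight_sub (fun k => hy.hasWt_xi hn) (mem_Icc.2
      ⟨by omega, le_rfl⟩)).qPow).cast ?_
    rw [thetaWt, thetaWt]
    split_ifs <;> omega
  have h6 := ((qc_zero_iff.2 (xi_lowerEl h (i := 1) (j := n) (by omega) (by omega)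
    (by omega))).mul_right h5.symm).eq
  rw [hN, mul_neg, h6, neg_mul, smul_neg]
  rfl

end ShiftRelations

/-! ### The explicit and the general relations -/

section Equivalence

variable {n : ℕ} {B : Type*} [Ring B] [Algebra BaseRing B] [IsAdicComplete adicIdeal B]
variable {x : UIdx n → B} {y : DIdx n → B}

lemma qPow_comm {u a : B} (h : u * a = a * u) : qPow u * a = a * qPow u :=
  (mul_qPow_of_mul_eq h.symm).symm

lemma hasWt_of_qc (hB : ∀ b : B, qDiff • b = 0 → b = 0) {u a : B} {r : ℤ}
    (h : QC r (qPow u) a) : HasWt u r a := by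
  have h1 : qPow u * a = a * qPow (u + (r : B)) := by
    rw [h.eq, qPow_add (Int.cast_commute r u).symm, qPow_intCast, mul_smul_comm, mul_one,
      mul_smul_comm]
  rw [HasWt, mul_eq_mul_of_qPow hB h1, mul_add, zsmul_eq_mul, Int.cast_comm]

lemma mul_comm_of_qPow (hB : ∀ b : B, qDiff • b = 0 → b = 0) {u v : B}
    (h : qPow u * qPow v = qPow v * qPow u) : u * v = v * u :=
  (mul_eq_mul_of_qPow hB (mul_eq_mul_of_qPow hB h).symm).symm

lemma QC.mul_qPow_neg {u a : B} {r : ℤ} (h : QC r (qPow u) a) :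
    qPow u * a * qPow (-u) = qInt r • a := by
  rw [h.eq, smul_mul_assoc, mul_assoc, qPow_mul_neg, mul_one]

lemma qc_of_mul_qPow_neg {u a : B} {r : ℤ} (h : qPow u * a * qPow (-u) = qInt r • a) :
    QC r (qPow u) a := by
  rw [QC, ← smul_mul_assoc, ← h, mul_assoc, qPow_neg_mul, mul_one]

lemma URel.cartanExp (hx : URel x) (a b : B) (h : UCartanExp x a b) : a = b := by
  cases h with
  | inv_right i hi => exact qPow_mul_neg _
  | inv_left i hi => exact qPow_neg_mul _
  | hh i j hi hj => exact qPow_comm (qPow_comm (hx.hh j i)).symm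
  | he i j hi hj => exact (hx.hasWt_e hi j).qPow.mul_qPow_neg
  | hf i j hi hj => exact (hx.hasWt_f hi j).qPow.mul_qPow_neg

lemma cartanLog_of_exp (hB : ∀ b : B, qDiff • b = 0 → b = 0)
    (hx : ∀ a b, UCartanExp x a b → a = b) (a b : B) (h : UCartanLog x a b) : a = b := by
  cases h with
  | hh i j hi hj => exact mul_comm_of_qPow hB (hx _ _ (.hh i j hi hj))
  | he i j hi hj =>
    exact sub_eq_iff_eq_add'.2 (hasWt_of_qc hB (qc_of_mul_qPow_neg (hx _ _ (.he i j hi hj))))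
  | hf i j hi hj =>
    exact sub_eq_iff_eq_add'.2 (hasWt_of_qc hB (qc_of_mul_qPow_neg (hx _ _ (.hf i j hi hj))))

lemma DCartan.expGen_comm (hy : DCartan y) (a : DIdx n) :
    qPow (y .hd) * expGen y a = expGen y a * qPow (y .hd) := by
  rcases a with (i | i | i) | _ | _
  · exact qPow_comm (qPow_comm (hy.hd_comm _).symm).symm
  · exact qPow_comm (hy.hd_comm _)
  · exact qPow_comm (hy.hd_comm _)
  · exact qPow_comm (hy.hd_comm _)
  · rfl

lemma DCartan.expGen_comm_neg (hy : DCartan y) (a : DIdx n) :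
    qPow (-y .hd) * expGen y a = expGen y a * qPow (-y .hd) := by
  have h := hy.expGen_comm a
  calc qPow (-y .hd) * expGen y a
      = qPow (-y .hd) * (expGen y a * qPow (y .hd)) * qPow (-y .hd) := by
        rw [← mul_assoc, mul_assoc, qPow_mul_neg, mul_one]
    _ = expGen y a * qPow (-y .hd) := by rw [← h, ← mul_assoc, qPow_neg_mul, one_mul]

lemma hd_comm_of_expGen (hB : ∀ b : B, qDiff • b = 0 → b = 0)
    (h : ∀ a, qPow (y .hd) * expGen y a = expGen y a * qPow (y .hd)) (a : DIdx n) :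
    y .hd * y a = y a * y .hd := by
  have h := h a
  rcases a with (i | i | i) | _ | _
  · exact mul_comm_of_qPow hB h
  · exact mul_eq_mul_of_qPow hB h
  · exact mul_eq_mul_of_qPow hB h
  · exact mul_eq_mul_of_qPow hB h
  · rfl

lemma DRel.explicit (hn : 1 < n) (hy : DRel y) : ExplicitRelations y := by
  have hy2 : DCartan y := hy.2.1
  refine ⟨hy.1.cartanExp, hy.1.2, ?_, hy.2.2⟩
  intro a b h
  cases h with
  | central a => exact hy2.expGen_comm a
  | central_neg a => exact hy2.expGen_comm_neg a
  | first =>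
    refine ((hy2.hasWt_xi hn le_rfl (by omega)).qPow.cast ?_).eq
    rw [thetaWt, if_neg (by omega), if_pos rfl, zero_sub]
  | middle i hi =>
    rw [mem_Icc] at hi
    refine ((hy2.hasWt_xi hn (by omega : 1 ≤ i) (by omega)).qPow.cast ?_).comm
    rw [thetaWt, if_neg (by omega), if_neg (by omega), sub_zero]
  | last =>
    refine ((hy2.hasWt_xi hn (by omega : 1 ≤ n + 1) le_rfl).qPow.cast ?_).eq
    rw [thetaWt, if_neg (by omega : ¬n + 1 = 1), if_pos rfl, sub_zero]

lemma DRel.of_explicit (hB : ∀ b : B, qDiff • b = 0 → b = 0) (hn : 1 < n)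
    (hy : ExplicitRelations y) : DRel y := by
  refine ⟨⟨cartanLog_of_exp hB hy.1, hy.2.1⟩, ?_, hy.2.2.2⟩
  refine DCartan.of_hasWt (hd_comm_of_expGen hB fun a => hy.2.2.1 _ _ (.central a)) hn
    fun k hk1 hk => hasWt_of_qc hB ?_
  rw [thetaWt]
  rcases hk1.eq_or_lt with rfl | hk1
  · rw [if_neg (by omega), if_pos rfl, zero_sub]
    exact hy.2.2.1 _ _ .first
  · rcases hk.eq_or_lt with rfl | hk
    · rw [if_pos rfl, if_neg (by omega), sub_zero]
      exact hy.2.2.1 _ _ .last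
    · rw [if_neg (by omega), if_neg (by omega), sub_zero, qc_zero_iff]
      exact hy.2.2.1 _ _ (.middle k (mem_Icc.2 ⟨hk1, by omega⟩))

lemma DRel.xi_f (hy : DRel y) (k : ℕ) : y .xi * fEl yᵘ k = fEl yᵘ k * y .xi := by
  by_cases hk : k ∈ Icc 1 n
  · exact sub_eq_zero.1 (hy.2.2 _ _ (.xi_f k hk))
  · rw [fEl_of_notMem hk, mul_zero, zero_mul]

lemma DRel.general (hn : 1 < n) (hy : DRel y) : GeneralRelations (eTilde yᵘ) y := by
  have hx := hy.1
  have hy2 : DCartan y := hy.2.1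
  have hxi := fun k (_ : k ∈ Icc 1 n) => hy.xi_f k
  refine ⟨hx.cartanExp, hx.2, ?_⟩
  intro a b h
  cases h with
  | central a => exact hy2.expGen_comm a
  | central_neg a => exact hy2.expGen_comm_neg a
  | weight_xi i hi =>
    exact ((eDiag_weight_sub (fun k => hy2.hasWt_xi hn) hi).qPow.cast (thetaForm_eq hn hi).symm).eq
  | weight_xi_neg i hi =>
    refine ((eDiag_weight_sub (fun k => hy2.hasWt_xi hn) hi).neg_left.qPow.cast ?_).eq
    rw [← thetaForm_eq hn hi, neg_neg]
  | z_f i hi =>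
    rw [← sub_eq_zero, zeta_f hx hn hi, hy.xi_f, sub_self, smul_zero]
  | e_z_zero i hi h0 =>
    have hi' := (thetaForm_eq_zero_iff hn hi).1 h0
    rw [← sub_eq_zero, zeta_e hx hn hi', hy.2.2 _ _ (.e_xi i hi'), smul_zero]
  | e_e_z i hi h0 =>
    have hi' := mt (thetaForm_eq_zero_iff hn hi).2 h0
    rw [mem_Icc] at hi hi'
    rcases (show i = 1 ∨ i = n by omega) with rfl | rfl
    · rw [zeta_first hx hn, hy.2.2 _ _ .serre_first, smul_zero]
    · rw [zeta_last hx hn, hy.2.2 _ _ .serre_last, smul_zero]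
  | e_z_z i hi h0 =>
    have hi' := mt (thetaForm_eq_zero_iff hn hi).2 h0
    rw [mem_Icc] at hi hi'
    rcases (show i = 1 ∨ i = n by omega) with rfl | rfl
    · rw [zeta_eta_first hx hy2 hn hxi, hy.2.2 _ _ .eta_serre_first, sub_self, smul_zero]
    · rw [zeta_eta_last hx hy2 hn hxi, hy.2.2 _ _ .eta_serre_last, sub_self, smul_zero]

lemma DRel.of_general (hB : ∀ b : B, qDiff • b = 0 → b = 0) (hn : 1 < n)
    (hy : GeneralRelations (eTilde yᵘ) y) : DRel y := by
  have hx : URel yᵘ := ⟨cartanLog_of_exp hB hy.1, hy.2.1⟩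
  have hr := hy.2.2
  have hy2 : DCartan y := by
    refine DCartan.of_hasWt (hd_comm_of_expGen hB fun a => hr _ _ (.central a)) hn
      fun k => hasWt_eDiag (fun k hk => ?_) sum_thetaWt
    rw [← thetaForm_eq hn hk]
    exact hasWt_of_qc hB (hr _ _ (.weight_xi k hk))
  have hxi : ∀ k ∈ Icc 1 n, y .xi * fEl yᵘ k = fEl yᵘ k * y .xi := by
    intro k hk
    refine sub_eq_zero.1 (hB _ ?_)
    rw [← zeta_f hx hn hk, hr _ _ (.z_f k hk), sub_self]
  have hm1 : 1 ∈ Icc 1 n := mem_Icc.2 ⟨le_rfl, by omega⟩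
  have hmn : n ∈ Icc 1 n := mem_Icc.2 ⟨by omega, le_rfl⟩
  have h1 : thetaForm n 1 ≠ 0 := fun h => by
    have := (mem_Icc.1 ((thetaForm_eq_zero_iff hn hm1).1 h)).1
    omega
  have hnn : thetaForm n n ≠ 0 := fun h => by
    have := (mem_Icc.1 ((thetaForm_eq_zero_iff hn hmn).1 h)).2
    omega
  refine ⟨hx, hy2, ?_⟩
  intro a b h
  cases h with
  | xi_f i hi => exact sub_eq_zero.2 (hxi i hi)
  | e_xi i hi =>
    have hi' : i ∈ Icc 1 n := by
      rw [mem_Icc] at *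
      omega
    refine hB _ ?_
    rw [← zeta_e hx hn hi, hr _ _ (.e_z_zero i hi' ((thetaForm_eq_zero_iff hn hi').2 hi)), sub_self]
  | serre_first => exact hB _ (by rw [← zeta_first hx hn, hr _ _ (.e_e_z 1 hm1 h1)])
  | serre_last => exact hB _ (by rw [← zeta_last hx hn, hr _ _ (.e_e_z n hmn hnn)])
  | eta_serre_first =>
    refine sub_eq_zero.1 (hB _ (hB _ ?_))
    rw [smul_smul, ← zeta_eta_first hx hy2 hn hxi, hr _ _ (.e_z_z 1 hm1 h1)]
  | eta_serre_last =>
    refine sub_eq_zero.1 (hB _ (hB _ ?_))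
    rw [smul_smul, ← zeta_eta_last hx hy2 hn hxi, hr _ _ (.e_z_z n hmn hnn)]

/-- The family with `ξ_{δ-θ}` and `h_δ` sent to zero; it retracts the Drinfeldian onto
`U_q(sl(n+1))`. -/
def zeroExt (x : UIdx n → B) : DIdx n → B
  | .u a => x a
  | .xi => 0
  | .hd => 0

lemma zeroExt_rel (hx : URel x) : DRel (zeroExt x) := by
  have h1 : uPart (zeroExt x) = x := rfl
  refine ⟨hx, ?_, ?_⟩
  · intro a b h
    cases h <;> simp [zeroExt]
  · intro a b h
    cases h <;> simp [zeroExt, qComm]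

/-- Homomorphisms from the Drinfeldian without torsion in the target are solutions of the explicit
relations. -/
lemma explicit_iff_existsUnique (hB : ∀ b : B, qDiff • b = 0 → b = 0) (hn : 1 < n) :
    ExplicitRelations y ↔ ∃! φ : Drin n →ₐ[BaseRing] B, ∀ a, φ (dGen n a) = y a := by
  constructor
  · intro h
    refine ⟨drinLift y (DRel.of_explicit hB hn h), drinLift_dGen y _, fun φ hφ => ?_⟩
    exact pres_hom_ext _ fun a => (hφ a).trans (drinLift_dGen y _ a).symm
  · rintro ⟨φ, hφ, -⟩
    obtain rfl : (fun a => φ (dGen n a)) = y := funext hφ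
    exact ((dGen_rel n).map φ).explicit hn

lemma existsUnique_inclusion (n : ℕ) : ∃! j : Uq n →ₐ[BaseRing] Drin n,
    (∀ a, j (uGen n a) = dGen n (.u a)) ∧ Function.Injective j := by
  have hx : URel (dGen n)ᵘ := (dGen_rel n).1
  refine ⟨uqLift _ hx, ⟨uqLift_uGen _ hx, ?_⟩, fun j hj => ?_⟩
  · let ρ : Drin n →ₐ[BaseRing] Uq n := drinLift _ (zeroExt_rel (uGen_rel n))
    have h : ρ.comp (uqLift _ hx) = AlgHom.id BaseRing (Uq n) := by
      refine pres_hom_ext _ fun a => ?_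
      have h1 : uqLift _ hx (uGen n a) = dGen n (.u a) := uqLift_uGen _ hx a
      change ρ (uqLift _ hx (uGen n a)) = uGen n a
      rw [h1]
      exact drinLift_dGen _ _ _
    exact Function.LeftInverse.injective (g := ρ) fun a => AlgHom.congr_fun h a
  · refine pres_hom_ext _ fun a => ?_
    exact (hj.1 a).trans (uqLift_uGen _ hx a).symm

lemma dHd_qPow_central (n : ℕ) (b : Drin n) :
    qPow (dHd n) * b = b * qPow (dHd n) ∧ qPow (-dHd n) * b = b * qPow (-dHd n) := by
  have hy : DCartan (dGen n) := (dGen_rel n).2.1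
  have h1 : ∀ b, dHd n * b = b * dHd n := fun b => pres_central _ (fun a => hy.hd_comm a) b
  exact ⟨qPow_comm (h1 b), qPow_comm (by rw [neg_mul, h1, mul_neg])⟩

end Equivalence

/-! ### The `η`-deformed Serre relations for the coproduct of `ξ_{δ-θ}` -/

section SerreCoproduct

variable {B : Type*} [Ring B] [Algebra BaseRing B]

lemma eq_of_forall_mul_right {a b : B} (h : ∀ t, a * t = b * t) : a = b := by
  simpa using h 1

/-- Every element of the first list commutes with every element of the second, in the form of a
rewriting rule. -/
def ListComm (l l' : List B) : Prop := ∀ u ∈ l, ∀ v ∈ l', ∀ t, u * (v * t) = v * (u * t)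

/-- Relations of `E = e_{α_1}`, `κ = q ^ (-h_{α_1})` and the left tensor factors
`a₁`, `a₂`, `T` with indices `1`, `2`, `n + 1` of the coproduct of `ξ_{δ-θ}`. -/
structure ColFirst (E κ a₁ a₂ T g : B) : Prop where
  E_a₁ : E * a₁ = qInt (-1) • (a₁ * E) - qInt (-1) • (a₂ * κ)
  E_a₂ : E * a₂ = qInt (-1) • (a₂ * E)
  E_T : E * T = qInt (-1) • (T * E)
  E_g : E * g = qInt (-1) • (g * E)
  E_κ : E * κ = qInt 2 • (κ * E)
  κ_a₁ : κ * a₁ = qInt 1 • (a₁ * κ)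
  κ_a₂ : κ * a₂ = qInt (-1) • (a₂ * κ)
  κ_T : κ * T = T * κ
  κ_g : κ * g = g * κ
  a₂_a₁ : a₂ * a₁ = a₁ * a₂
  T_a₁ : T * a₁ = a₁ * T + qInt (-1) • (a₁ * g)
  T_a₂ : T * a₂ = qInt 1 • (a₂ * T) + a₂ * g
  g_a₁ : g * a₁ = qInt (-2) • (a₁ * g)
  g_a₂ : g * a₂ = qInt (-1) • (a₂ * g)
  g_T : g * T = T * g

/-- Relations of `E = e_{α_1}` and the right tensor factors `β₁`, `β₂`, `β₃` with indices
`1`, `2`, `n + 1` of the coproduct of `ξ_{δ-θ}`; `γ₂`, `γ₃` arise from them by the action of `E`. -/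
structure RowFirst (E β₁ β₂ β₃ γ₂ γ₃ : B) : Prop where
  E_β₁ : E * β₁ = qInt (-2) • (β₁ * E) - qInt (-1) • E
  E_β₂ : E * β₂ = β₂ * E + (β₁ - γ₂)
  E_β₃ : E * β₃ = qInt (-1) • (β₃ * E) - qInt (-1) • γ₃
  E_γ₂ : E * γ₂ = qInt 2 • (γ₂ * E) + qInt 1 • E
  E_γ₃ : E * γ₃ = qInt 1 • (γ₃ * E)
  γ₂_β₁ : γ₂ * β₁ = β₁ * γ₂
  γ₃_β₁ : γ₃ * β₁ = β₁ * γ₃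
  γ₂_β₂ : γ₂ * β₂ = qInt 2 • (β₂ * γ₂) + qInt 1 • β₂
  γ₃_β₂ : γ₃ * β₂ = qInt 1 • (β₂ * γ₃) + qInt 1 • (β₃ * (1 + qDiff • γ₂))
  γ₂_β₃ : γ₂ * β₃ = β₃ * γ₂
  γ₃_β₃ : γ₃ * β₃ = qInt 1 • (β₃ * γ₃)

/-- Relations of the sums `Sβ = ∑ a_i ⊗ β_i` and `Sγ = ∑ a_i ⊗ γ_i` over the inner indices
`3 ≤ i ≤ n` with the remaining factors. -/
structure SumFirst (E κ a₁ a₂ T g E' β₁ β₂ β₃ γ₂ γ₃ Sβ Sγ : B) : Prop where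
  E_Sβ : E * Sβ = qInt (-1) • (Sβ * E)
  E_Sγ : E * Sγ = qInt (-1) • (Sγ * E)
  κ_Sβ : κ * Sβ = Sβ * κ
  κ_Sγ : κ * Sγ = Sγ * κ
  Sβ_a₁ : Sβ * a₁ = a₁ * Sβ
  Sγ_a₁ : Sγ * a₁ = a₁ * Sγ
  Sβ_a₂ : Sβ * a₂ = qInt 1 • (a₂ * Sβ)
  Sγ_a₂ : Sγ * a₂ = qInt 1 • (a₂ * Sγ)
  T_Sβ : T * Sβ = qInt 1 • (Sβ * T) + Sβ * g
  T_Sγ : T * Sγ = qInt 1 • (Sγ * T) + Sγ * g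
  g_Sβ : g * Sβ = qInt (-1) • (Sβ * g)
  g_Sγ : g * Sγ = qInt (-1) • (Sγ * g)
  β₁_Sγ : β₁ * Sγ = Sγ * β₁
  β₂_Sγ : β₂ * Sγ = qInt (-1) • (Sγ * β₂) - Sβ * (1 + qDiff • γ₂)
  β₃_Sγ : β₃ * Sγ = Sγ * β₃
  γ₂_Sβ : γ₂ * Sβ = Sβ * γ₂
  γ₃_Sβ : γ₃ * Sβ = Sβ * γ₃ + qDiff • (Sγ * β₃)
  E'_Sβ : E' * Sβ = qInt (-1) • (Sβ * E') - qInt (-1) • Sγ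
  E'_Sγ : E' * Sγ = qInt 1 • (Sγ * E')
  Sγ_Sβ : Sγ * Sβ = qInt 1 • (Sβ * Sγ)

/-- Relations of `ξ ⊗ 1` and `1 ⊗ ξ` with the tensor factors of the coproduct of `ξ_{δ-θ}`. -/
structure XiFirst (κ a₁ a₂ T g β₁ β₂ β₃ γ₂ γ₃ Sβ Sγ ξ ξ' : B) : Prop where
  ξ_a₁ : ξ * a₁ = a₁ * ξ
  ξ_a₂ : ξ * a₂ = a₂ * ξ
  ξ_T : ξ * T = T * ξ - qInt 1 • (g * ξ)
  ξ_g : ξ * g = qInt 2 • (g * ξ)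
  ξ_κ : ξ * κ = qInt (-1) • (κ * ξ)
  ξ_Sβ : ξ * Sβ = Sβ * ξ
  ξ_Sγ : ξ * Sγ = Sγ * ξ
  ξ'_β₁ : ξ' * β₁ = qInt 2 • (β₁ * ξ') + qInt 1 • ξ'
  ξ'_β₂ : ξ' * β₂ = qInt 1 • (β₂ * ξ')
  ξ'_β₃ : ξ' * β₃ = β₃ * ξ'
  ξ'_γ₂ : ξ' * γ₂ = γ₂ * ξ'
  ξ'_γ₃ : ξ' * γ₃ = qInt (-1) • (γ₃ * ξ')
  ξ'_Sβ : ξ' * Sβ = qInt 1 • (Sβ * ξ')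
  ξ'_Sγ : ξ' * Sγ = Sγ * ξ'

/-- Relations of `E = e_{α_n}`, `κ = q ^ (-h_{α_n})` and the left tensor factors
`a₁`, `a₂`, `T` with indices `1`, `n`, `n + 1` of the coproduct of `ξ_{δ-θ}`; `α₁`, `α₂` arise from
them by the action of `E`. -/
structure ColLast (E κ a₁ a₂ T g α₁ α₂ : B) : Prop where
  E_a₁ : E * a₁ = qInt 1 • (a₁ * E) + α₁
  E_a₂ : E * a₂ = qInt 1 • (a₂ * E) + (α₂ - T * κ)
  E_T : E * T = qInt 1 • (T * E) + g * E
  E_g : E * g = qInt (-1) • (g * E)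
  E_κ : E * κ = qInt 2 • (κ * E)
  E_α₁ : E * α₁ = qInt (-1) • (α₁ * E)
  E_α₂ : E * α₂ = qInt (-1) • (α₂ * E) - g * κ * E
  κ_a₁ : κ * a₁ = qInt 1 • (a₁ * κ)
  κ_a₂ : κ * a₂ = qInt 2 • (a₂ * κ)
  κ_T : κ * T = T * κ
  κ_g : κ * g = g * κ
  κ_α₁ : κ * α₁ = qInt (-1) • (α₁ * κ)
  κ_α₂ : κ * α₂ = α₂ * κ
  α₁_a₁ : α₁ * a₁ = qInt (-1) • (a₁ * α₁)
  α₁_a₂ : α₁ * a₂ = qInt 1 • (a₂ * α₁) - a₁ * (qDiff • α₂ + g * κ)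
  α₂_a₁ : α₂ * a₁ = qInt (-1) • (a₁ * α₂)
  α₂_a₂ : α₂ * a₂ = qInt (-1) • (a₂ * α₂) - a₂ * (g * κ)
  T_α₁ : T * α₁ = qInt (-1) • (α₁ * T)
  T_α₂ : T * α₂ = α₂ * T
  g_a₁ : g * a₁ = qInt (-2) • (a₁ * g)
  g_a₂ : g * a₂ = qInt (-1) • (a₂ * g)
  g_α₁ : g * α₁ = qInt (-1) • (α₁ * g)
  g_α₂ : g * α₂ = α₂ * g
  g_T : g * T = T * g

/-- Relations of `E = e_{α_n}` and the right tensor factors `β₁`, `β₂`, `β₃` with indices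
`1`, `n`, `n + 1` of the coproduct of `ξ_{δ-θ}`. -/
structure RowLast (E β₁ β₂ β₃ : B) : Prop where
  E_β₁ : E * β₁ = β₁ * E
  E_β₂ : E * β₂ = qInt (-1) • (β₂ * E)
  E_β₃ : E * β₃ = qInt 1 • (β₃ * E) + β₂
  β₁_β₂ : β₁ * β₂ = qInt (-2) • (β₂ * β₁) - qInt (-1) • β₂
  β₁_β₃ : β₁ * β₃ = qInt (-2) • (β₃ * β₁) - qInt (-1) • β₃
  β₂_β₃ : β₂ * β₃ = qInt (-1) • (β₃ * β₂)

/-- Relations of the sums `Sβ = ∑ a_i ⊗ β_i` and `Sα = ∑ α_i ⊗ β_i` over the inner indices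
`2 ≤ i ≤ n - 1` with the remaining factors. -/
structure SumLast (E κ a₁ a₂ T g α₁ α₂ E' β₁ β₂ β₃ Sβ Sα : B) : Prop where
  E_Sβ : E * Sβ = qInt 1 • (Sβ * E) + Sα
  E_Sα : E * Sα = qInt (-1) • (Sα * E)
  κ_Sβ : κ * Sβ = qInt 1 • (Sβ * κ)
  κ_Sα : κ * Sα = qInt (-1) • (Sα * κ)
  α₁_Sβ : α₁ * Sβ = qInt 1 • (Sβ * α₁) - qDiff • (a₁ * Sα)
  α₂_Sβ : α₂ * Sβ = Sβ * α₂
  Sα_a₁ : Sα * a₁ = qInt (-1) • (a₁ * Sα)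
  Sα_a₂ : Sα * a₂ = a₂ * Sα - Sβ * (qDiff • α₂ + g * κ)
  T_Sα : T * Sα = Sα * T
  g_Sβ : g * Sβ = qInt (-1) • (Sβ * g)
  g_Sα : g * Sα = Sα * g
  β₁_Sα : β₁ * Sα = qInt (-2) • (Sα * β₁) - qInt (-1) • Sα
  β₂_Sα : β₂ * Sα = qInt 1 • (Sα * β₂)
  β₃_Sα : β₃ * Sα = qInt 1 • (Sα * β₃)
  β₁_Sβ : β₁ * Sβ = qInt (-2) • (Sβ * β₁) - qInt (-1) • Sβ
  β₂_Sβ : β₂ * Sβ = qInt 1 • (Sβ * β₂)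
  β₃_Sβ : β₃ * Sβ = qInt 1 • (Sβ * β₃)
  E'_Sβ : E' * Sβ = Sβ * E'
  E'_Sα : E' * Sα = Sα * E'
  Sα_Sβ : Sα * Sβ = qInt (-1) • (Sβ * Sα)

/-- Relations of `ξ ⊗ 1` and `1 ⊗ ξ` with the tensor factors of the coproduct of `ξ_{δ-θ}`. -/
structure XiLast (κ a₁ a₂ T g α₁ α₂ β₁ β₂ β₃ Sβ Sα ξ ξ' : B) : Prop where
  ξ_a₁ : ξ * a₁ = a₁ * ξ
  ξ_a₂ : ξ * a₂ = a₂ * ξ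
  ξ_T : ξ * T = T * ξ - qInt 1 • (g * ξ)
  ξ_g : ξ * g = qInt 2 • (g * ξ)
  ξ_κ : ξ * κ = qInt (-1) • (κ * ξ)
  ξ_α₁ : ξ * α₁ = qInt 1 • (α₁ * ξ)
  ξ_α₂ : ξ * α₂ = qInt 1 • (α₂ * ξ)
  ξ_Sβ : ξ * Sβ = Sβ * ξ
  ξ_Sα : ξ * Sα = qInt 1 • (Sα * ξ)
  ξ'_β₁ : ξ' * β₁ = qInt 2 • (β₁ * ξ') + qInt 1 • ξ'
  ξ'_β₂ : ξ' * β₂ = qInt 1 • (β₂ * ξ')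
  ξ'_β₃ : ξ' * β₃ = β₃ * ξ'
  ξ'_Sβ : ξ' * Sβ = qInt 1 • (Sβ * ξ')
  ξ'_Sα : ξ' * Sα = qInt 1 • (Sα * ξ')

variable {E κ a₁ a₂ T g α₁ α₂ E' β₁ β₂ β₃ γ₂ γ₃ Sα Sβ Sγ ξ ξ' : B}

section First

set_option maxHeartbeats 8000000 in
/-- The `q`-commutators in the `η`-deformed Serre relations, computed for the coproduct: the Serre
expressions of the coproduct are combinations of those of the tensor factors. All products are
brought into a normal order by the relations of the letters, and coefficients are compared. -/
lemma first_relations (hX : ColFirst E κ a₁ a₂ T g) (hY : RowFirst E' β₁ β₂ β₃ γ₂ γ₃)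
    (hS : SumFirst E κ a₁ a₂ T g E' β₁ β₂ β₃ γ₂ γ₃ Sβ Sγ)
    (hc : ListComm [E', β₁, β₂, β₃, γ₂, γ₃, ξ'] [E, κ, a₁, a₂, T, g, ξ])
    (hξ : XiFirst κ a₁ a₂ T g β₁ β₂ β₃ γ₂ γ₃ Sβ Sγ ξ ξ') (c : BaseRing) :
    (qComm (-1) (E + κ * E') (ξ + g * ξ' + c • (a₁ * β₁ + a₂ * β₂ + Sβ + T * β₃)) =
       (qComm (-1) E ξ + qDiff • (ξ * κ * E') + κ * g * qComm (-1) E' ξ' -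
         (c * qInt (-1)) • ((qInt 1 • (a₁ * E') + a₂ * γ₂ + Sγ + T * γ₃) * κ))) ∧
    (qComm (-1) (E + κ * E') (qDiff • (a₁ * β₁ + a₂ * β₂ + Sβ + T * β₃) + a₁ + g * β₃) =
       -(qInt (-1) • ((qDiff • (qInt 1 • (a₁ * E') + a₂ * γ₂ + Sγ + T * γ₃) + a₂ + g * γ₃ -
         (qDiff * qInt 1) • (a₁ * E')) * κ))) ∧
    (qComm 1 (E + κ * E') (qComm (-1) E ξ + qDiff • (ξ * κ * E') + κ * g * qComm (-1) E' ξ' -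
         (c * qInt (-1)) • ((qInt 1 • (a₁ * E') + a₂ * γ₂ + Sγ + T * γ₃) * κ)) =
       qComm 1 E (qComm (-1) E ξ) + κ * κ * g * qComm 1 E' (qComm (-1) E' ξ')) ∧
    (qComm 1 (qComm (-1) E ξ + qDiff • (ξ * κ * E') + κ * g * qComm (-1) E' ξ' -
         (c * qInt (-1)) • ((qInt 1 • (a₁ * E') + a₂ * γ₂ + Sγ + T * γ₃) * κ))
         (ξ + g * ξ' + c • (a₁ * β₁ + a₂ * β₂ + Sβ + T * β₃)) -
       c • (qInt (-1) • (-(qInt (-1) • ((qDiff • (qInt 1 • (a₁ * E') + a₂ * γ₂ + Sγ + T * γ₃) +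
         a₂ + g * γ₃ - (qDiff * qInt 1) • (a₁ * E')) * κ)) *
         (ξ + g * ξ' + c • (a₁ * β₁ + a₂ * β₂ + Sβ + T * β₃))) -
         (qDiff • (a₁ * β₁ + a₂ * β₂ + Sβ + T * β₃) + a₁ + g * β₃) *
         (qComm (-1) E ξ + qDiff • (ξ * κ * E') + κ * g * qComm (-1) E' ξ' -
         (c * qInt (-1)) • ((qInt 1 • (a₁ * E') + a₂ * γ₂ + Sγ + T * γ₃) * κ))) =
       qComm 1 (qComm (-1) E ξ) ξ -
           c • (qInt (-1) • (-(qInt (-1) • (a₂ * κ)) * ξ) - a₁ * qComm (-1) E ξ) +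
         κ * g * g * (qComm 1 (qComm (-1) E' ξ') ξ' -
           c • (qInt (-1) • (-(qInt (-1) • γ₃) * ξ') - β₃ * qComm (-1) E' ξ'))) := by
  simp [ListComm] at hc
  refine ⟨?_, ?_, ?_, ?_⟩ <;>
  · simp only [qComm]
    refine eq_of_forall_mul_right fun t => ?_
    simp only [mul_add, add_mul, mul_sub, sub_mul, smul_mul_assoc, mul_smul_comm, mul_assoc,
      smul_sub, smul_add, neg_mul, mul_neg, mul_one, qInt_two, qInt_neg_two, qDiff, hc,
      mul_rule hX.E_a₁, mul_rule hX.E_a₂, mul_rule hX.E_T, mul_rule hX.E_g,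
      mul_rule hX.E_κ, mul_rule hX.κ_a₁, mul_rule hX.κ_a₂, mul_rule hX.κ_T,
      mul_rule hX.κ_g, mul_rule hX.a₂_a₁, mul_rule hX.T_a₁, mul_rule hX.T_a₂,
      mul_rule hX.g_a₁, mul_rule hX.g_a₂, mul_rule hX.g_T, mul_rule hY.E_β₁,
      mul_rule hY.E_β₂, mul_rule hY.E_β₃, mul_rule hY.E_γ₂, mul_rule hY.E_γ₃,
      mul_rule hY.γ₂_β₁, mul_rule hY.γ₃_β₁, mul_rule hY.γ₂_β₂,
      mul_rule hY.γ₃_β₂, mul_rule hY.γ₂_β₃, mul_rule hY.γ₃_β₃,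
      mul_rule hS.E_Sβ, mul_rule hS.E_Sγ, mul_rule hS.κ_Sβ, mul_rule hS.κ_Sγ,
      mul_rule hS.Sβ_a₁, mul_rule hS.Sγ_a₁, mul_rule hS.Sβ_a₂,
      mul_rule hS.Sγ_a₂, mul_rule hS.T_Sβ, mul_rule hS.T_Sγ, mul_rule hS.g_Sβ,
      mul_rule hS.g_Sγ, mul_rule hS.β₁_Sγ, mul_rule hS.β₂_Sγ,
      mul_rule hS.β₃_Sγ, mul_rule hS.γ₂_Sβ, mul_rule hS.γ₃_Sβ,
      mul_rule hS.E'_Sβ, mul_rule hS.E'_Sγ, mul_rule hS.Sγ_Sβ,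
      mul_rule hξ.ξ_a₁, mul_rule hξ.ξ_a₂, mul_rule hξ.ξ_T, mul_rule hξ.ξ_g,
      mul_rule hξ.ξ_κ, mul_rule hξ.ξ_Sβ, mul_rule hξ.ξ_Sγ, mul_rule hξ.ξ'_β₁,
      mul_rule hξ.ξ'_β₂, mul_rule hξ.ξ'_β₃, mul_rule hξ.ξ'_γ₂,
      mul_rule hξ.ξ'_γ₃, mul_rule hξ.ξ'_Sβ, mul_rule hξ.ξ'_Sγ]
    clear hX hY hS hξ hc
    match_scalars <;> clear * - c <;> grind [qInt_one_mul]

end First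

section Last

set_option maxHeartbeats 8000000 in
/-- The `q`-commutators in the `η`-deformed Serre relations, computed for the coproduct: the Serre
expressions of the coproduct are combinations of those of the tensor factors. All products are
brought into a normal order by the relations of the letters, and coefficients are compared. -/
lemma last_relations (hX : ColLast E κ a₁ a₂ T g α₁ α₂) (hY : RowLast E' β₁ β₂ β₃)
    (hS : SumLast E κ a₁ a₂ T g α₁ α₂ E' β₁ β₂ β₃ Sβ Sα)
    (hc : ListComm [E', β₁, β₂, β₃, ξ'] [E, κ, a₁, a₂, T, g, α₁, α₂, ξ])
    (hξ : XiLast κ a₁ a₂ T g α₁ α₂ β₁ β₂ β₃ Sβ Sα ξ ξ') (c : BaseRing) :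
    (qComm (-1) (ξ + g * ξ' + c • (a₁ * β₁ + a₂ * β₂ + Sβ + T * β₃)) (E + κ * E') =
       (qComm (-1) ξ E + (qInt (-1) * qDiff) • (g * E * ξ') + g * κ * qComm (-1) ξ' E' -
         (c * qInt (-1)) • (α₁ * β₁ + α₂ * β₂ + Sα + g * E * β₃))) ∧
    (qComm (-1) (qDiff • (a₁ * β₁ + a₂ * β₂ + Sβ + T * β₃) + a₁ + g * β₃) (E + κ * E') =
       (-(qInt (-1) • (qDiff • (α₁ * β₁ + α₂ * β₂ + Sα + g * E * β₃) + α₁ - qDiff • (g * E * β₃) +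
       g * κ * β₂)))) ∧
    (qComm 1 (qComm (-1) ξ E + (qInt (-1) * qDiff) • (g * E * ξ') + g * κ * qComm (-1) ξ' E' -
         (c * qInt (-1)) • (α₁ * β₁ + α₂ * β₂ + Sα + g * E * β₃)) (E + κ * E') =
       qComm 1 (qComm (-1) ξ E) E + g * κ * κ * qComm 1 (qComm (-1) ξ' E') E') ∧
    (qComm 1 (ξ + g * ξ' + c • (a₁ * β₁ + a₂ * β₂ + Sβ + T * β₃))
         (qComm (-1) ξ E + (qInt (-1) * qDiff) • (g * E * ξ') + g * κ * qComm (-1) ξ' E' -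
         (c * qInt (-1)) • (α₁ * β₁ + α₂ * β₂ + Sα + g * E * β₃)) -
       c • (qInt 2 • ((-(qInt (-1) • (qDiff • (α₁ * β₁ + α₂ * β₂ + Sα + g * E * β₃) + α₁ - qDiff •
         (g * E * β₃) + g * κ * β₂))) *
         (ξ + g * ξ' + c • (a₁ * β₁ + a₂ * β₂ + Sβ + T * β₃))) -
         qInt 1 • ((qDiff • (a₁ * β₁ + a₂ * β₂ + Sβ + T * β₃) + a₁ + g * β₃) *
         (qComm (-1) ξ E + (qInt (-1) * qDiff) • (g * E * ξ') + g * κ * qComm (-1) ξ' E' -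
         (c * qInt (-1)) • (α₁ * β₁ + α₂ * β₂ + Sα + g * E * β₃)))) =
       qComm 1 ξ (qComm (-1) ξ E) -
           c • (qInt 2 • (-(qInt (-1) • α₁) * ξ) - qInt 1 • (a₁ * qComm (-1) ξ E)) +
         g * g * κ * (qComm 1 ξ' (qComm (-1) ξ' E') -
           c • (qInt 2 • (-(qInt (-1) • β₂) * ξ') - qInt 1 • (β₃ * qComm (-1) ξ' E')))) := by
  simp [ListComm] at hc
  refine ⟨?_, ?_, ?_, ?_⟩ <;>
  · simp only [qComm]
    refine eq_of_forall_mul_right fun t => ?_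
    simp only [mul_add, add_mul, mul_sub, sub_mul, smul_mul_assoc, mul_smul_comm, mul_assoc,
      smul_sub, smul_add, neg_mul, mul_neg, qInt_two, qInt_neg_two, qDiff, hc,
      mul_rule hX.E_a₁, mul_rule hX.E_a₂, mul_rule hX.E_T, mul_rule hX.E_g,
      mul_rule hX.E_κ, mul_rule hX.E_α₁, mul_rule hX.E_α₂, mul_rule hX.κ_a₁,
      mul_rule hX.κ_a₂, mul_rule hX.κ_T, mul_rule hX.κ_g, mul_rule hX.κ_α₁,
      mul_rule hX.κ_α₂, mul_rule hX.α₁_a₁, mul_rule hX.α₁_a₂,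
      mul_rule hX.α₂_a₁, mul_rule hX.α₂_a₂, mul_rule hX.T_α₁, mul_rule hX.T_α₂,
      mul_rule hX.g_a₁, mul_rule hX.g_a₂, mul_rule hX.g_α₁, mul_rule hX.g_α₂,
      mul_rule hX.g_T, mul_rule hY.E_β₁, mul_rule hY.E_β₂, mul_rule hY.E_β₃,
      mul_rule hY.β₁_β₂, mul_rule hY.β₁_β₃, mul_rule hY.β₂_β₃,
      mul_rule hS.E_Sβ, mul_rule hS.E_Sα, mul_rule hS.κ_Sβ, mul_rule hS.κ_Sα,
      mul_rule hS.α₁_Sβ, mul_rule hS.α₂_Sβ, mul_rule hS.Sα_a₁,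
      mul_rule hS.Sα_a₂, mul_rule hS.T_Sα, mul_rule hS.g_Sβ, mul_rule hS.g_Sα,
      mul_rule hS.β₁_Sα, mul_rule hS.β₂_Sα, mul_rule hS.β₃_Sα,
      mul_rule hS.β₁_Sβ, mul_rule hS.β₂_Sβ, mul_rule hS.β₃_Sβ,
      mul_rule hS.E'_Sβ, mul_rule hS.E'_Sα, mul_rule hS.Sα_Sβ,
      mul_rule hξ.ξ_a₁, mul_rule hξ.ξ_a₂, mul_rule hξ.ξ_T, mul_rule hξ.ξ_g,
      mul_rule hξ.ξ_κ, mul_rule hξ.ξ_α₁, mul_rule hξ.ξ_α₂, mul_rule hξ.ξ_Sβ,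
      mul_rule hξ.ξ_Sα, mul_rule hξ.ξ'_β₁, mul_rule hξ.ξ'_β₂,
      mul_rule hξ.ξ'_β₃, mul_rule hξ.ξ'_Sβ, mul_rule hξ.ξ'_Sα]
    clear hX hY hS hξ hc
    match_scalars <;> clear * - c <;> grind [qInt_one_mul]

end Last

end SerreCoproduct

/-! ### Matrix coefficients of the coproduct of `ξ_{δ-θ}` -/

section Letters

variable {n : ℕ} {B : Type*} [Ring B] [Algebra BaseRing B] [IsAdicComplete adicIdeal B]
variable {y : DIdx n → B}

/-- `h_δ / 2`. -/
def halfHd (y : DIdx n → B) : B := scal (1 / 2) • y .hd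

/-- `e_{mi} q ^ (e_{11} + e_{mm})`; for `m = n + 1` these are the left tensor factors of the
coproduct of `ξ_{δ-θ}`. -/
def col (y : DIdx n → B) (m i : ℕ) : B := lowerEl yᵘ m i * κ[y,m]

/-- `[h_δ / 2 + e_{mm}] q ^ (e_{11} - h_δ / 2)`, which plays the role of a diagonal entry
of `col`. -/
def colTop (y : DIdx n → B) (m : ℕ) : B :=
  qNum (halfHd y + eDiag yᵘ m) * qPow (eDiag yᵘ 1 - halfHd y)

/-- `e_{ir} q ^ (e_{rr} + e_{ii})`; for `r = 1` these are the right tensor factors of the coproduct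
of `ξ_{δ-θ}`. -/
def row (y : DIdx n → B) (r i : ℕ) : B := lowerEl yᵘ i r * qPow (eDiag yᵘ r + eDiag yᵘ i)

/-- `[e_{rr}] q ^ e_{rr}`, which plays the role of a diagonal entry of `row`. -/
def rowBot (y : DIdx n → B) (r : ℕ) : B := qNum (eDiag yᵘ r) * qPow (eDiag yᵘ r)

/-- `q ^ (e_{11} - e_{mm} - h_δ)`. -/
def grp (y : DIdx n → B) (m : ℕ) : B := qPow (eDiag yᵘ 1 - eDiag yᵘ m - y .hd)

/-- `a` has weight `w k` under `e_{kk}` and commutes with `h_δ`. -/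
structure FullWt (y : DIdx n → B) (w : ℕ → ℤ) (a : B) : Prop where
  eps : ∀ k, 1 ≤ k → k ≤ n + 1 → HasWt (eDiag yᵘ k) (w k) a
  hd : y .hd * a = a * y .hd

/-- The weight `ε_j - ε_i` of `e_{ji}`. -/
def wt (j i k : ℕ) : ℤ := (if k = j then 1 else 0) - (if k = i then 1 else 0)

variable {w w' : ℕ → ℤ} {a b : B}

lemma halfHd_add (y : DIdx n → B) : halfHd y + halfHd y = y .hd := by
  rw [halfHd, ← add_smul, scal_add]
  norm_num [scal_one]

lemma FullWt.mul (ha : FullWt y w a) (hb : FullWt y w' b) : FullWt y (w + w') (a * b) :=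
  ⟨fun k h1 h2 => (ha.eps k h1 h2).mul (hb.eps k h1 h2), by
    rw [← mul_assoc, ha.hd, mul_assoc, hb.hd, mul_assoc]⟩

lemma FullWt.half (ha : FullWt y w a) : HasWt (halfHd y) 0 a := by
  rw [hasWt_zero_iff, halfHd, smul_mul_assoc, ha.hd, mul_smul_comm]

lemma FullWt.h (ha : FullWt y w a) {k : ℕ} (hk : k ∈ Icc 1 n) :
    HasWt (hEl yᵘ k) (w k - w (k + 1)) a :=
  eDiag_weight_sub ha.eps hk

lemma FullWt.qc_h (ha : FullWt y w a) {k : ℕ} (hk : k ∈ Icc 1 n) {r : ℤ}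
    (hr : w k - w (k + 1) = r) : QC r (qPow (hEl yᵘ k)) a :=
  (ha.h hk).qPow.cast hr

lemma FullWt.qc_neg_h (ha : FullWt y w a) {k : ℕ} (hk : k ∈ Icc 1 n) {r : ℤ}
    (hr : w (k + 1) - w k = r) : QC r (qPow (-hEl yᵘ k)) a :=
  (ha.h hk).neg_left.qPow.cast (by rw [← hr, neg_sub])

lemma FullWt.qc_add (ha : FullWt y w a) {i j : ℕ} (hi : 1 ≤ i ∧ i ≤ n + 1)
    (hj : 1 ≤ j ∧ j ≤ n + 1) {r : ℤ} (hr : w i + w j = r) :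
    QC r (qPow (eDiag yᵘ i + eDiag yᵘ j)) a :=
  ((ha.eps i hi.1 hi.2).add_left (ha.eps j hj.1 hj.2)).qPow.cast hr

lemma FullWt.qc_sub (ha : FullWt y w a) {i j : ℕ} (hi : 1 ≤ i ∧ i ≤ n + 1)
    (hj : 1 ≤ j ∧ j ≤ n + 1) {r : ℤ} (hr : w i - w j = r) :
    QC r (qPow (eDiag yᵘ i - eDiag yᵘ j)) a :=
  ((ha.eps i hi.1 hi.2).sub_left (ha.eps j hj.1 hj.2)).qPow.cast hr

lemma FullWt.qc_grp (ha : FullWt y w a) {m : ℕ} (hm : 1 ≤ m ∧ m ≤ n + 1) {r : ℤ}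
    (hr : w 1 - w m = r) : QC r (grp y m) a :=
  (((ha.eps 1 le_rfl (by omega)).sub_left (ha.eps m hm.1 hm.2)).sub_left
    (hasWt_zero_iff.2 ha.hd)).qPow.cast (by rw [sub_zero, hr])

lemma URel.fullWt_eDiag (hx : URel yᵘ) (hy : DCartan y) (k : ℕ) : FullWt y 0 (eDiag yᵘ k) := by
  refine ⟨fun j _ _ => hasWt_zero_iff.2 (hx.commute_eDiag j k).eq, ?_⟩
  have h1 : ∀ i, Commute (y .hd) (hEl yᵘ i) := by
    intro i
    by_cases hi : 1 ≤ i ∧ i ≤ n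
    · rw [hEl, at1, dif_pos hi]
      exact hy.hd_comm _
    · rw [hEl, at1, dif_neg hi]
      exact Commute.zero_right _
  exact (Commute.sub_right (Commute.smul_right (Commute.sum_right _ _ _ fun k _ =>
    Commute.smul_right (h1 k) _) _) (Commute.sum_right _ _ _ fun k _ => h1 k)).eq

lemma URel.commute_hd_eDiag (hx : URel yᵘ) (hy : DCartan y) (k : ℕ) :
    Commute (y .hd) (eDiag yᵘ k) :=
  (hx.fullWt_eDiag hy k).hd

lemma URel.commute_half_eDiag (hx : URel yᵘ) (hy : DCartan y) (k : ℕ) :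
    Commute (halfHd y) (eDiag yᵘ k) :=
  (hx.commute_hd_eDiag hy k).smul_left _

lemma FullWt.qPow_of (hb : FullWt y 0 b) : FullWt y 0 (qPow b) := ⟨fun k h1 h2 => hasWt_zero_iff.2
    (qPow_comm (hasWt_zero_iff.1 (hb.eps k h1 h2)).symm).symm, (qPow_comm hb.hd.symm).symm⟩

lemma FullWt.add (ha : FullWt y w a) (hb : FullWt y w b) : FullWt y w (a + b) :=
  ⟨fun k h1 h2 => (ha.eps k h1 h2).add_right (hb.eps k h1 h2), by
    rw [mul_add, add_mul, ha.hd, hb.hd]⟩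

lemma FullWt.mul_qPow (ha : FullWt y w a) (hb : FullWt y 0 b) : FullWt y w (a * qPow b) := by
  simpa using ha.mul hb.qPow_of

lemma DCartan.hd_comm_at1 (hy : DCartan y) (f : Fin n → DIdx n) (k : ℕ) :
    y .hd * at1 (fun j => y (f j)) k = at1 (fun j => y (f j)) k * y .hd := by
  unfold at1
  split_ifs
  · exact hy.hd_comm _
  · rw [mul_zero, zero_mul]

lemma URel.fullWt_lowerEl (hx : URel yᵘ) (hy : DCartan y) {i j : ℕ} (hi : 1 ≤ i)
    (hij : i < j) (hj : j ≤ n + 1) : FullWt y (wt j i) (lowerEl yᵘ j i) :=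
  ⟨fun _ h1 h2 => hx.hasWt_lowerEl hi hij hj h1 h2,
    lowerEl_comm hij fun l _ _ => hy.hd_comm_at1 (fun j => .u (.f j)) l⟩

lemma URel.fullWt_f (hx : URel yᵘ) (hy : DCartan y) {k : ℕ} (hk : k ∈ Icc 1 n) :
    FullWt y (wt (k + 1) k) (fEl yᵘ k) := by
  rw [mem_Icc] at hk
  rw [← lowerEl_self]
  exact hx.fullWt_lowerEl hy hk.1 (by omega) (by omega)

lemma URel.fullWt_e (hx : URel yᵘ) (hy : DCartan y) {k : ℕ} (hk : k ∈ Icc 1 n) :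
    FullWt y (wt k (k + 1)) (eEl yᵘ k) :=
  ⟨fun _ h1 h2 => hx.hasWt_eDiag_e hk h1 h2, hy.hd_comm_at1 (fun j => .u (.e j)) k⟩

lemma DCartan.fullWt_xi (hy : DCartan y) (hn : 1 < n) : FullWt y (wt (n + 1) 1) (y .xi) :=
  ⟨fun _ h1 h2 => hy.hasWt_xi hn h1 h2, hy.hd_comm _⟩

lemma URel.fullWt_col (hx : URel yᵘ) (hy : DCartan y) {i m : ℕ} (hi : 1 ≤ i)
    (him : i < m) (hm : m ≤ n + 1) : FullWt y (wt m i) (col y m i) :=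
  (hx.fullWt_lowerEl hy hi him hm).mul_qPow ((hx.fullWt_eDiag hy 1).add (hx.fullWt_eDiag hy m))

lemma URel.fullWt_row (hx : URel yᵘ) (hy : DCartan y) {i r : ℕ} (hr : 1 ≤ r)
    (hri : r < i) (hi : i ≤ n + 1) : FullWt y (wt i r) (row y r i) :=
  (hx.fullWt_lowerEl hy hr hri hi).mul_qPow ((hx.fullWt_eDiag hy r).add (hx.fullWt_eDiag hy i))

/-- Products of weight vectors with Cartan exponentials `q`-commute if the vectors do. -/
lemma QC.mul_qPow {r s t e : ℤ} {k l : B} (h : QC r a b) (hk : QC s k b) (hl : QC t l a)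
    (hkl : k * l = l * k) (he : r + s - t = e) : QC e (a * k) (b * l) := by
  refine ((h.mul_right (hl.symm)).mul_left (hk.mul_right (qc_zero_iff.2 hkl))).cast ?_
  rw [← he]
  ring

lemma URel.qPow_comm_add (hx : URel yᵘ) (i j k l : ℕ) :
    qPow (eDiag yᵘ i + eDiag yᵘ j) * qPow (eDiag yᵘ k + eDiag yᵘ l) =
      qPow (eDiag yᵘ k + eDiag yᵘ l) * qPow (eDiag yᵘ i + eDiag yᵘ j) := by
  have h : Commute (eDiag yᵘ i + eDiag yᵘ j) (eDiag yᵘ k + eDiag yᵘ l) :=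
    ((hx.commute_eDiag i k).add_right (hx.commute_eDiag i l)).add_left
      ((hx.commute_eDiag j k).add_right (hx.commute_eDiag j l))
  exact qPow_comm (qPow_comm h.eq.symm).symm

/-- Moving `colTop` past a weight vector. -/
lemma FullWt.colTop_mul (ha : FullWt y w a) (hx : URel yᵘ) (hy : DCartan y) {m : ℕ}
    (hm : 1 ≤ m ∧ m ≤ n + 1) :
    colTop y m * a = qInt (w 1) • (a * (qInt (w m) • colTop y m + qNum ((w m : ℤ) : B) *
    grp y m)) := by
  have hu : HasWt (halfHd y + eDiag yᵘ m) (w m) a :=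
    (ha.half.add_left (ha.eps m hm.1 hm.2)).cast (zero_add _)
  have hv : HasWt (eDiag yᵘ 1 - halfHd y) (w 1) a :=
    ((ha.eps 1 le_rfl (by omega)).sub_left ha.half).cast (sub_zero _)
  have hc : Commute (-(halfHd y + eDiag yᵘ m)) (eDiag yᵘ 1 - halfHd y) := by
    refine Commute.neg_left (Commute.add_left ?_ ?_)
    · exact (hx.commute_half_eDiag hy 1).sub_right (Commute.refl _)
    · exact (hx.commute_eDiag m 1).sub_right (hx.commute_half_eDiag hy m).symm
  have hg : qPow (-(halfHd y + eDiag yᵘ m)) * qPow (eDiag yᵘ 1 - halfHd y) = grp y m := by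
    rw [← qPow_add hc, grp]
    congr 1
    rw [← halfHd_add y]
    abel
  rw [colTop, hu.qNum_mul_qPow hv, qNum_add_intCast, add_mul, smul_mul_assoc, mul_assoc (qNum _),
    hg]

lemma FullWt.rowBot_mul (ha : FullWt y w a) {r : ℕ} (hr : 1 ≤ r ∧ r ≤ n + 1) :
    rowBot y r * a = qInt (w r) • (a * (qInt (w r) • rowBot y r + qNum ((w r : ℤ) : B))) := by
  have hu := ha.eps r hr.1 hr.2
  rw [rowBot, hu.qNum_mul_qPow hu, qNum_add_intCast, add_mul, smul_mul_assoc, mul_assoc,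
    qPow_neg_mul, mul_one]

lemma qDiff_smul_rowBot (r : ℕ) : qDiff • rowBot y r = qPow (eDiag yᵘ r + eDiag yᵘ r) - 1 := by
  rw [rowBot, ← smul_mul_assoc, qDiff_smul_qNum, sub_mul, qPow_neg_mul, qPow_add (Commute.refl _)]

lemma URel.qDiff_smul_colTop (hx : URel yᵘ) (hy : DCartan y) (m : ℕ) :
    qDiff • colTop y m = κ[y,m] - grp y m := by
  have hc : Commute (halfHd y + eDiag yᵘ m) (eDiag yᵘ 1 - halfHd y) := by
    refine Commute.add_left ?_ ?_
    · exact (hx.commute_half_eDiag hy 1).sub_right (Commute.refl _)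
    · exact (hx.commute_eDiag m 1).sub_right (hx.commute_half_eDiag hy m).symm
  rw [colTop, ← smul_mul_assoc, qDiff_smul_qNum, sub_mul, ← qPow_add hc, ← qPow_add hc.neg_left,
    grp, ← halfHd_add y]
  congr 2 <;> abel

/-- `[h_{α_1}] q ^ (e_{11} + e_{22})` as a difference of diagonal entries. -/
lemma URel.qNum_h_row (hx : URel yᵘ) {k : ℕ} (hk : 1 ≤ k) :
    qNum (hEl yᵘ k) * qPow (eDiag yᵘ k + eDiag yᵘ (k + 1)) = rowBot y k - rowBot y (k + 1) := by
  have hc := hx.commute_eDiag k (k + 1)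
  rw [← eDiag_sub_eDiag_succ hk, sub_eq_add_neg, qNum_add hc.neg_right, qPow_add hc, add_mul,
    qNum_neg, rowBot, rowBot]
  have h1 : qPow (-eDiag yᵘ (k + 1)) * qPow (eDiag yᵘ k) =
      qPow (eDiag yᵘ k) * qPow (-eDiag yᵘ (k + 1)) :=
    qPow_comm (qPow_comm hc.neg_right.eq).symm
  have h2 : -qNum (eDiag yᵘ (k + 1)) * qPow (eDiag yᵘ k) =
      qPow (eDiag yᵘ k) * -qNum (eDiag yᵘ (k + 1)) := by
    rw [neg_mul, mul_neg, mul_qNum_of_mul_eq (qPow_comm hc.eq)]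
  rw [mul_assoc, ← mul_assoc (qPow (-_)), h1, mul_assoc (qPow _), qPow_neg_mul, mul_one,
    mul_assoc, ← mul_assoc (-qNum _), h2, mul_assoc, ← mul_assoc (qPow (-_)), qPow_neg_mul, one_mul,
    neg_mul, sub_eq_add_neg]

lemma URel.qNum_h_col (hx : URel yᵘ) (hy : DCartan y) {k : ℕ} (hk : 1 ≤ k) :
    qNum (hEl yᵘ k) * qPow (eDiag yᵘ 1 + eDiag yᵘ (k + 1)) =
      colTop y k - colTop y (k + 1) * qPow (-hEl yᵘ k) := by
  have hc := hx.commute_eDiag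
  have hd : ∀ i, Commute (halfHd y) (eDiag yᵘ i) := hx.commute_half_eDiag hy
  have hd' : ∀ i, Commute (eDiag yᵘ i) (halfHd y) := fun i => (hd i).symm
  have hu : ∀ i j, Commute (halfHd y + eDiag yᵘ i) (halfHd y + eDiag yᵘ j) :=
    fun i j => ((Commute.refl _).add_right (hd j)).add_left ((hd' i).add_right (hc i j))
  have hv : ∀ i j, Commute (halfHd y + eDiag yᵘ i) (eDiag yᵘ 1 + eDiag yᵘ j) :=
    fun i j => ((hd 1).add_right (hd j)).add_left ((hc i 1).add_right (hc i j))
  have h0 : hEl yᵘ k = (halfHd y + eDiag yᵘ k) + -(halfHd y + eDiag yᵘ (k + 1)) := by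
    rw [← eDiag_sub_eDiag_succ hk]
    abel
  have hk1 : hEl yᵘ k = eDiag yᵘ k - eDiag yᵘ (k + 1) := (eDiag_sub_eDiag_succ hk).symm
  have h1 : qPow (-(halfHd y + eDiag yᵘ (k + 1))) * qPow (eDiag yᵘ 1 + eDiag yᵘ (k + 1)) =
        qPow (eDiag yᵘ 1 - halfHd y) := by
    rw [← qPow_add (hv _ _).neg_left]
    congr 1
    abel
  have h2 : qPow (-(halfHd y + eDiag yᵘ k)) * qPow (eDiag yᵘ 1 + eDiag yᵘ (k + 1)) =
        qPow (eDiag yᵘ 1 - halfHd y) * qPow (-hEl yᵘ k) := by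
    rw [← qPow_add (hv _ _).neg_left, ← qPow_add]
    · congr 1
      rw [hk1]
      abel
    · rw [hk1]
      exact (((hc 1 k).sub_right (hc 1 (k + 1))).sub_left ((hd k).sub_right (hd (k + 1)))).neg_right
  have h3 : qNum (halfHd y + eDiag yᵘ (k + 1)) * qPow (-(halfHd y + eDiag yᵘ k)) =
      qPow (-(halfHd y + eDiag yᵘ k)) * qNum (halfHd y + eDiag yᵘ (k + 1)) :=
    (mul_qNum_of_mul_eq (qPow_comm (hu k (k + 1)).neg_left.eq)).symm
  rw [congrArg qNum h0, qNum_add (hu _ _).neg_right, add_mul, mul_assoc, h1, qNum_neg, mul_neg,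
    neg_mul, ← h3,
    mul_assoc, h2, ← mul_assoc, ← sub_eq_add_neg]
  rfl

lemma FullWt.cast {v : ℕ → ℤ} (ha : FullWt y w a) (e : w = v) : FullWt y v a := e ▸ ha

lemma FullWt.neg (ha : FullWt y w a) : FullWt y w (-a) :=
  ⟨fun k h1 h2 => (ha.eps k h1 h2).neg_right, by rw [mul_neg, neg_mul, ha.hd]⟩

lemma FullWt.sub (ha : FullWt y w a) (hb : FullWt y w b) : FullWt y w (a - b) := by
  rw [sub_eq_add_neg]
  exact ha.add hb.neg

lemma FullWt.smul (z : BaseRing) (ha : FullWt y w a) : FullWt y w (z • a) :=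
  ⟨fun k h1 h2 => (ha.eps k h1 h2).smul_right z, by rw [mul_smul_comm, smul_mul_assoc, ha.hd]⟩

lemma FullWt.qNum_of (hb : FullWt y 0 b) : FullWt y 0 (qNum b) :=
  ⟨fun k h1 h2 => hasWt_zero_iff.2 (mul_qNum_of_mul_eq (hasWt_zero_iff.1 (hb.eps k h1 h2))),
    mul_qNum_of_mul_eq hb.hd⟩

lemma URel.fullWt_hd (hx : URel yᵘ) (hy : DCartan y) : FullWt y 0 (y .hd) :=
  ⟨fun k _ _ => hasWt_zero_iff.2 (hx.commute_hd_eDiag hy k).symm.eq, rfl⟩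

lemma URel.fullWt_half (hx : URel yᵘ) (hy : DCartan y) : FullWt y 0 (halfHd y) :=
  (hx.fullWt_hd hy).smul _

lemma URel.fullWt_h (hx : URel yᵘ) (hy : DCartan y) {k : ℕ} (hk : 1 ≤ k) :
    FullWt y 0 (hEl yᵘ k) := by
  rw [← eDiag_sub_eDiag_succ hk]
  exact (hx.fullWt_eDiag hy k).sub (hx.fullWt_eDiag hy (k + 1))

lemma URel.fullWt_colTop (hx : URel yᵘ) (hy : DCartan y) (m : ℕ) : FullWt y 0 (colTop y m) := by
  have := (((hx.fullWt_half hy).add (hx.fullWt_eDiag hy m)).qNum_of).mul_qPow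
    ((hx.fullWt_eDiag hy 1).sub (hx.fullWt_half hy))
  exact this

lemma URel.fullWt_grp (hx : URel yᵘ) (hy : DCartan y) (m : ℕ) : FullWt y 0 (grp y m) :=
  (((hx.fullWt_eDiag hy 1).sub (hx.fullWt_eDiag hy m)).sub (hx.fullWt_hd hy)).qPow_of

lemma URel.fullWt_rowBot (hx : URel yᵘ) (hy : DCartan y) (r : ℕ) : FullWt y 0 (rowBot y r) :=
  ((hx.fullWt_eDiag hy r).qNum_of).mul_qPow (hx.fullWt_eDiag hy r)

lemma URel.fullWt_qPow_neg_h (hx : URel yᵘ) (hy : DCartan y) {k : ℕ} (hk : 1 ≤ k) :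
    FullWt y 0 (qPow (-hEl yᵘ k)) :=
  (hx.fullWt_h hy hk).neg.qPow_of

lemma FullWt.colTop_comm (ha : FullWt y w a) (hx : URel yᵘ) (hy : DCartan y) {m : ℕ}
    (hm : 1 ≤ m ∧ m ≤ n + 1) {r : ℤ} (h1 : w 1 = r) (h2 : w m = 0) :
    colTop y m * a = qInt r • (a * colTop y m) := by
  rw [ha.colTop_mul hx hy hm, h1, h2, Int.cast_zero, qNum_zero, zero_mul, add_zero, qInt_zero,
    one_smul]

lemma FullWt.colTop_pos (ha : FullWt y w a) (hx : URel yᵘ) (hy : DCartan y) {m : ℕ}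
    (hm : 1 ≤ m ∧ m ≤ n + 1) {r : ℤ} (h1 : w 1 = r) (h2 : w m = 1) :
    colTop y m * a = qInt (r + 1) • (a * colTop y m) + qInt r • (a * grp y m) := by
  rw [ha.colTop_mul hx hy hm, h1, h2, Int.cast_one, qNum_one, one_mul, mul_add, mul_smul_comm,
    smul_add, smul_smul, qInt_add]

lemma FullWt.colTop_neg (ha : FullWt y w a) (hx : URel yᵘ) (hy : DCartan y) {m : ℕ}
    (hm : 1 ≤ m ∧ m ≤ n + 1) {r : ℤ} (h1 : w 1 = r) (h2 : w m = -1) :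
    colTop y m * a = qInt (r - 1) • (a * colTop y m) - qInt r • (a * grp y m) := by
  rw [ha.colTop_mul hx hy hm, h1, h2, Int.cast_neg, Int.cast_one, qNum_neg, qNum_one, neg_mul,
    one_mul, ← sub_eq_add_neg, mul_sub, mul_smul_comm, smul_sub, smul_smul, ← qInt_add,
    ← sub_eq_add_neg]

lemma FullWt.rowBot_comm (ha : FullWt y w a) {r : ℕ} (hr : 1 ≤ r ∧ r ≤ n + 1) (h : w r = 0) :
    rowBot y r * a = a * rowBot y r := by
  rw [ha.rowBot_mul hr, h, Int.cast_zero, qNum_zero, add_zero, qInt_zero, one_smul, one_smul]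

lemma FullWt.rowBot_pos (ha : FullWt y w a) {r : ℕ} (hr : 1 ≤ r ∧ r ≤ n + 1) (h : w r = 1) :
    rowBot y r * a = qInt 2 • (a * rowBot y r) + qInt 1 • a := by
  rw [ha.rowBot_mul hr, h, Int.cast_one, qNum_one, mul_add, mul_smul_comm, smul_add, smul_smul,
    mul_one, qInt_two]

lemma FullWt.rowBot_neg (ha : FullWt y w a) {r : ℕ} (hr : 1 ≤ r ∧ r ≤ n + 1) (h : w r = -1) :
    rowBot y r * a = qInt (-2) • (a * rowBot y r) - qInt (-1) • a := by
  rw [ha.rowBot_mul hr, h, Int.cast_neg, Int.cast_one, qNum_neg, qNum_one, mul_add, mul_smul_comm,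
    smul_add, smul_smul, mul_neg, mul_one, qInt_neg_two, smul_neg, sub_eq_add_neg]

end Letters

/-! ### Relations of the matrix coefficients with `U_q(sl(n+1))` -/

section LetterRelations

variable {n : ℕ} {B : Type*} [Ring B] [Algebra BaseRing B] [IsAdicComplete adicIdeal B]
variable {y : DIdx n → B}

lemma URel.qc_col (hx : URel yᵘ) (hy : DCartan y) {i j : ℕ} (hi : 1 ≤ i) (hij : i < j)
    (hj : j ≤ n) {r : ℤ} (hr : (if i = 1 then 0 else 1) = r) :
    QC r (col y (n + 1) j) (col y (n + 1) i) := by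
  refine QC.mul_qPow (hx.lowerEl_same_top hij (by omega))
    ((hx.fullWt_lowerEl hy hi (by omega) le_rfl).qc_add (by omega) (by omega) rfl)
    ((hx.fullWt_lowerEl hy (by omega) (by omega) le_rfl).qc_add (by omega) (by omega) rfl)
    (hx.qPow_comm_add _ _ _ _) ?_
  grind [wt]

lemma URel.qc_row_row (hx : URel yᵘ) (hy : DCartan y) {i j : ℕ} (hi : 2 ≤ i)
    (hij : i < j) (hj : j ≤ n + 1) : QC (-1) (row y 1 i) (row y 1 j) := by
  refine QC.mul_qPow (hx.lowerEl_same_bot hi hij)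
    ((hx.fullWt_lowerEl hy le_rfl (by omega) hj).qc_add (by omega) (by omega) rfl)
    ((hx.fullWt_lowerEl hy le_rfl (by omega) (by omega)).qc_add (by omega) (by omega) rfl)
    (hx.qPow_comm_add _ _ _ _) ?_
  grind [wt]

lemma URel.e_col_ne (hx : URel yᵘ) (hy : DCartan y) {i m k : ℕ} (hi : 1 ≤ i)
    (him : i < m) (hm : m ≤ n + 1) (hk : k ∈ Icc 1 n)
    (h : k < i ∨ m ≤ k ∨ (i < k ∧ k + 1 < m)) {r : ℤ}
    (hr : -(wt k (k + 1) 1 + wt k (k + 1) m) = r) : QC r (eEl yᵘ k) (col y m i) := by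
  have h1 : QC 0 (eEl yᵘ k) (lowerEl yᵘ m i) := by
    rw [qc_zero_iff]
    rcases h with h | h | h
    · exact hx.e_lowerEl_far him (Or.inl h)
    · exact hx.e_lowerEl_far him (Or.inr h)
    · exact hx.e_lowerEl_inner hi h.1 h.2 hm
  exact (h1.mul_right ((hx.fullWt_e hy hk).qc_add (by omega) (by omega) rfl).symm).cast
    (by rw [← hr, zero_add])

lemma URel.e_row_ne (hx : URel yᵘ) (hy : DCartan y) {i r k : ℕ} (hr : 1 ≤ r)
    (hri : r < i) (hi : i ≤ n + 1) (hk : k ∈ Icc 1 n)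
    (h : k < r ∨ i ≤ k ∨ (r < k ∧ k + 1 < i)) {s : ℤ}
    (hs : -(wt k (k + 1) r + wt k (k + 1) i) = s) : QC s (eEl yᵘ k) (row y r i) := by
  have h1 : QC 0 (eEl yᵘ k) (lowerEl yᵘ i r) := by
    rw [qc_zero_iff]
    rcases h with h | h | h
    · exact hx.e_lowerEl_far hri (Or.inl h)
    · exact hx.e_lowerEl_far hri (Or.inr h)
    · exact hx.e_lowerEl_inner hr h.1 h.2 hi
  exact (h1.mul_right ((hx.fullWt_e hy hk).qc_add (by omega) (by omega) rfl).symm).cast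
    (by rw [← hs, zero_add])

lemma colFirst (hx : URel yᵘ) (hy : DCartan y) (hn : 1 < n) :
    ColFirst (eEl yᵘ 1) (qPow (-hEl yᵘ 1)) (col y (n + 1) 1) (col y (n + 1) 2)
      (colTop y (n + 1)) (grp y (n + 1)) := by
  have hm : 1 ∈ Icc 1 n := mem_Icc.2 ⟨le_rfl, by omega⟩
  have hE := hx.fullWt_e hy hm
  have h1 := hx.fullWt_col hy (i := 1) le_rfl (by omega) (le_refl (n + 1))
  have h2 := hx.fullWt_col hy (i := 2) (by omega) (by omega) (le_refl (n + 1))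
  refine ⟨?_, ?_, ?_, ?_, ?_, ?_, ?_, ?_, ?_, ?_, ?_, ?_, ?_, ?_, ?_⟩
  · have e1 := hx.e_lowerEl_bot (i := 1) (j := n + 1) le_rfl (by omega) le_rfl
    have e2 : QC (-1) (eEl yᵘ 1) κ[y,n + 1] :=
      (hE.qc_add (by omega) (by omega) (r := 1) (by grind [wt])).symm
    have e3 : qPow (-hEl yᵘ 1) * κ[y,n + 1] = κ[y,n + 1] * qPow (-hEl yᵘ 1) :=
      ((hx.fullWt_qPow_neg_h hy le_rfl).qc_add (i := 1) (j := n + 1) (r := 0) (by omega)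
        (by omega) rfl).comm.symm
    rw [QC] at e2
    simp only [col, sub_mul, smul_mul_assoc, mul_smul_comm, mul_assoc, mul_rule e1, e2, e3]
  · exact hx.e_col_ne hy (by omega) (by omega) le_rfl hm (by omega) (by grind [wt])
  · exact (show QC 1 _ _ from hE.colTop_comm hx hy (by omega) (by grind [wt]) (by grind [wt])).symm
  · exact (hE.qc_grp (r := 1) (by omega) (by grind [wt])).symm
  · exact (hE.qc_neg_h hm (r := -2) (by grind [wt])).symm.cast (neg_neg 2)
  · exact h1.qc_neg_h hm (by grind [wt])
  · exact h2.qc_neg_h hm (by grind [wt])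
  · exact ((hx.fullWt_colTop hy _).qc_neg_h hm (r := 0) rfl).comm
  · exact ((hx.fullWt_grp hy _).qc_neg_h hm (r := 0) rfl).comm
  · exact (hx.qc_col hy le_rfl (by omega) (by omega) rfl).comm
  · rw [h1.colTop_pos hx hy (by omega) (r := -1) (by grind [wt])
      (by grind [wt]), neg_add_cancel, qInt_zero, one_smul]
  · rw [h2.colTop_pos hx hy (by omega) (r := 0) (by grind [wt])
      (by grind [wt]), zero_add, qInt_zero, one_smul]
  · exact h1.qc_grp (by omega) (by grind [wt])
  · exact h2.qc_grp (by omega) (by grind [wt])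
  · exact ((hx.fullWt_colTop hy _).qc_grp (by omega) (r := 0) rfl).comm

/-- `γ_j β_2` in terms of `β_2 γ_j` and `β_j`. -/
lemma URel.row_two_mul (hx : URel yᵘ) (hy : DCartan y) {j : ℕ} (hj : 2 < j) (hj' : j ≤ n + 1) :
    row y 2 j * row y 1 2 =
      qInt 1 • (row y 1 2 * row y 2 j) + qInt 1 • (row y 1 j * (1 + qDiff • rowBot y 2)) := by
  have hc := hx.commute_eDiag
  have e1 : QC 1 (qPow (eDiag yᵘ 2 + eDiag yᵘ j)) (lowerEl yᵘ 2 1) :=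
    (hx.fullWt_lowerEl hy le_rfl (by omega) (by omega)).qc_add (by omega) (by omega) (by grind [wt])
  have e2 : QC (-1) κ[y,2] (lowerEl yᵘ j 2) :=
    (hx.fullWt_lowerEl hy (by omega) hj hj').qc_add (by omega) (by omega) (by grind [wt])
  have e3 := hx.lowerEl_split (i := 1) (k := 2) (j := j) (by omega) hj
  have e4 : κ[y,j] * qPow (eDiag yᵘ 2 + eDiag yᵘ 2) = qPow (eDiag yᵘ 2 + eDiag yᵘ j) * κ[y,2] := by
    rw [← qPow_add, ← qPow_add]
    · congr 1
      abel
    · exact ((hc 2 1).add_right (hc 2 2)).add_left ((hc j 1).add_right (hc j 2))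
    · exact ((hc 1 2).add_right (hc 1 2)).add_left ((hc j 2).add_right (hc j 2))
  have e5 := hx.qPow_comm_add 2 j 1 2
  rw [qDiff_smul_rowBot, add_sub_cancel, row, row, row, mul_assoc (lowerEl yᵘ j 1), e4]
  rw [QC] at e1 e2
  rw [qComm] at e3
  rw [e3]
  generalize qPow (eDiag yᵘ 2 + eDiag yᵘ j) = K at *
  generalize κ[y,2] = L at *
  simp only [sub_mul, smul_mul_assoc, mul_smul_comm, mul_assoc, mul_rule e1, mul_rule e2, e5]
  match_scalars <;> grind [qInt_one_mul]

lemma URel.qc_row_two_same (hx : URel yᵘ) (hy : DCartan y) {j : ℕ} (hj : 2 < j)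
    (hj' : j ≤ n + 1) : QC 1 (row y 2 j) (row y 1 j) := by
  refine QC.mul_qPow (hx.lowerEl_same_top (by omega) hj)
    ((hx.fullWt_lowerEl hy le_rfl (by omega) hj').qc_add (by omega) (by omega) rfl)
    ((hx.fullWt_lowerEl hy (by omega) (by omega) hj').qc_add (by omega) (by omega) rfl)
    (hx.qPow_comm_add _ _ _ _) ?_
  grind [wt]

lemma URel.row_two_nested (hx : URel yᵘ) (hy : DCartan y) {i j : ℕ} (hi : 2 < i)
    (hij : i < j) (hj : j ≤ n + 1) : row y 2 i * row y 1 j = row y 1 j * row y 2 i := by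
  refine (QC.mul_qPow (qc_zero_iff.2 (hx.lowerEl_nested (by omega) hi hij))
    ((hx.fullWt_lowerEl hy le_rfl (by omega) hj).qc_add (by omega) (by omega) rfl)
    ((hx.fullWt_lowerEl hy (by omega) (by omega) (by omega)).qc_add (by omega) (by omega) rfl)
    (hx.qPow_comm_add _ _ _ _) ?_).comm
  grind [wt]

lemma URel.row_two_cross (hx : URel yᵘ) (hy : DCartan y) {i j : ℕ} (hi : 2 < i)
    (hij : i < j) (hj : j ≤ n + 1) :
    row y 2 j * row y 1 i = row y 1 i * row y 2 j + qDiff • (row y 1 j * row y 2 i) := by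
  have hc := hx.commute_eDiag
  have e1 : QC 0 (qPow (eDiag yᵘ 2 + eDiag yᵘ j)) (lowerEl yᵘ i 1) :=
    (hx.fullWt_lowerEl hy le_rfl (by omega) (by omega)).qc_add (by omega) (by omega) (by grind [wt])
  have e2 : QC 0 κ[y,i] (lowerEl yᵘ j 2) :=
    (hx.fullWt_lowerEl hy (by omega) (by omega) hj).qc_add (by omega) (by omega) (by grind [wt])
  have e6 : QC 0 κ[y,j] (lowerEl yᵘ i 2) :=
    (hx.fullWt_lowerEl hy (by omega) (by omega) (by omega)).qc_add (by omega) (by omega)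
      (by grind [wt])
  have e3 := hx.lowerEl_cross (i := 1) (k := 2) (by omega) hi hij
  have e4 : κ[y,j] * qPow (eDiag yᵘ 2 + eDiag yᵘ i) = qPow (eDiag yᵘ 2 + eDiag yᵘ j) * κ[y,i] := by
    rw [← qPow_add, ← qPow_add]
    · congr 1
      abel
    · exact ((hc 2 1).add_right (hc 2 i)).add_left ((hc j 1).add_right (hc j i))
    · exact ((hc 1 2).add_right (hc 1 i)).add_left ((hc j 2).add_right (hc j i))
  have e5 := hx.qPow_comm_add 1 i 2 j
  simp only [row, mul_assoc, mul_rule e1.comm, mul_rule e2.comm, mul_rule e6.comm,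
    e4, e5, mul_rule e3, add_mul, smul_mul_assoc]

lemma URel.e_row_bot (hx : URel yᵘ) (hy : DCartan y) {j : ℕ} (hj : 2 < j) (hj' : j ≤ n + 1) :
    eEl yᵘ 1 * row y 1 j = qInt (-1) • (row y 1 j * eEl yᵘ 1) - qInt (-1) • row y 2 j := by
  have hc := hx.commute_eDiag
  have hE := hx.fullWt_e hy (mem_Icc.2 ⟨le_rfl, by omega⟩ : 1 ∈ Icc 1 n)
  have e1 := hx.e_lowerEl_bot (i := 1) le_rfl hj hj'
  have e2 : QC (-1) (eEl yᵘ 1) κ[y,j] :=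
    (hE.qc_add (by omega) (by omega) (r := 1) (by grind [wt])).symm
  have e3 : qPow (-hEl yᵘ 1) * κ[y,j] = qPow (eDiag yᵘ 2 + eDiag yᵘ j) := by
    rw [← eDiag_sub_eDiag_succ le_rfl, ← qPow_add]
    · congr 1
      abel
    · exact (((hc 1 1).add_right (hc 1 j)).sub_left ((hc 2 1).add_right (hc 2 j))).neg_left
  rw [QC] at e2
  simp only [row, sub_mul, smul_mul_assoc, mul_smul_comm, mul_assoc, mul_rule e1, e2, e3]

lemma rowFirst (hx : URel yᵘ) (hy : DCartan y) (hn : 1 < n) :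
    RowFirst (eEl yᵘ 1) (rowBot y 1) (row y 1 2) (row y 1 (n + 1)) (rowBot y 2)
      (row y 2 (n + 1)) := by
  have hm : 1 ∈ Icc 1 n := mem_Icc.2 ⟨le_rfl, by omega⟩
  have hE := hx.fullWt_e hy hm
  have h3 := hx.fullWt_row hy (r := 1) (i := n + 1) le_rfl (by omega) le_rfl
  have h2 := hx.fullWt_row hy (r := 1) (i := 2) le_rfl (by omega) (by omega)
  have g3 := hx.fullWt_row hy (r := 2) (i := n + 1) (by omega) (by omega) le_rfl
  refine ⟨?_, ?_, ?_, ?_, ?_, ?_, ?_, ?_, ?_, ?_, ?_⟩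
  · have := hE.rowBot_pos (r := 1) (by omega) (by grind [wt])
    rw [qInt_two] at this
    rw [this, qInt_neg_two]
    match_scalars <;> grind [qInt_one_mul]
  · have e1 := hx.ef_same 1
    have e2 : eEl yᵘ 1 * κ[y,2] = κ[y,2] * eEl yᵘ 1 := (hE.qc_add (by omega) (by omega) (r := 0)
        (by grind [wt])).comm.symm
    rw [← hx.qNum_h_row le_rfl, row, lowerEl_self, ← mul_assoc, e1, add_mul, mul_assoc, e2,
      mul_assoc]
  · exact hx.e_row_bot hy (by omega) le_rfl
  · have := hE.rowBot_neg (r := 2) (by omega) (by grind [wt])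
    rw [qInt_neg_two] at this
    rw [this, qInt_two]
    match_scalars <;> grind [qInt_one_mul]
  · exact hx.e_row_ne hy (by omega) (by omega) le_rfl hm (by omega) (by grind [wt])
  · exact ((hx.fullWt_rowBot hy 1).rowBot_comm (by omega) rfl)
  · exact (g3.rowBot_comm (by omega) (by grind [wt])).symm
  · exact h2.rowBot_pos (by omega) (by grind [wt])
  · exact hx.row_two_mul hy (by omega) le_rfl
  · exact h3.rowBot_comm (by omega) (by grind [wt])
  · exact hx.qc_row_two_same hy (by omega) le_rfl

end LetterRelations

section LetterRelationsLast

variable {n : ℕ} {B : Type*} [Ring B] [Algebra BaseRing B] [IsAdicComplete adicIdeal B]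
variable {y : DIdx n → B}

lemma URel.e_col_top (hx : URel yᵘ) (hy : DCartan y) {i m : ℕ} (hi : 1 ≤ i)
    (hi' : i < m) (hm : m ≤ n) : eEl yᵘ m * col y (m + 1) i =
      qInt 1 • (col y (m + 1) i * eEl yᵘ m) + col y m i := by
  have hc := hx.commute_eDiag
  have hE := hx.fullWt_e hy (mem_Icc.2 ⟨by omega, hm⟩ : m ∈ Icc 1 n)
  have e1 := hx.e_lowerEl_top hi hi' hm
  have e2 : QC 1 (eEl yᵘ m) (qPow (eDiag yᵘ 1 + eDiag yᵘ (m + 1))) :=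
    (hE.qc_add (by omega) (by omega) (r := -1) (by grind [wt])).symm.cast (neg_neg 1)
  have e3 : qPow (hEl yᵘ m) * qPow (eDiag yᵘ 1 + eDiag yᵘ (m + 1)) = κ[y,m] := by
    rw [← eDiag_sub_eDiag_succ (by omega : 1 ≤ m), ← qPow_add]
    · congr 1
      abel
    · exact ((hc m 1).add_right (hc m (m + 1))).sub_left ((hc _ 1).add_right (hc _ _))
  rw [QC] at e2
  simp only [col, add_mul, mul_smul_comm, mul_assoc, mul_rule e1, e2, e3]

lemma URel.e_row_top (hx : URel yᵘ) (hy : DCartan y) {m : ℕ} (hm : 1 < m) (hm' : m ≤ n) :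
    eEl yᵘ m * row y 1 (m + 1) = qInt 1 • (row y 1 (m + 1) * eEl yᵘ m) + row y 1 m := by
  have := hx.e_col_top hy le_rfl hm hm'
  simpa only [row, col] using this

lemma URel.qc_colN_col (hx : URel yᵘ) (hy : DCartan y) {i : ℕ} (hi : 1 ≤ i)
    (hi' : i < n) : QC (-1) (col y n i) (col y (n + 1) i) := by
  refine QC.mul_qPow (hx.lowerEl_same_bot hi' (by omega))
    ((hx.fullWt_lowerEl hy hi (by omega) le_rfl).qc_add (by omega) (by omega) rfl)
    ((hx.fullWt_lowerEl hy hi hi' (by omega)).qc_add (by omega) (by omega) rfl)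
    (hx.qPow_comm_add _ _ _ _) ?_
  grind [wt]

lemma URel.colN_nested (hx : URel yᵘ) (hy : DCartan y) {i j : ℕ} (hi : 1 ≤ i)
    (hij : i < j) (hj : j < n) {d : ℤ} (hd : (if i = 1 then -1 else 0) = d) :
    QC d (col y n j) (col y (n + 1) i) := by
  refine QC.mul_qPow (qc_zero_iff.2 (hx.lowerEl_nested hij hj (by omega)))
    ((hx.fullWt_lowerEl hy hi (by omega) le_rfl).qc_add (by omega) (by omega) rfl)
    ((hx.fullWt_lowerEl hy (by omega) hj (by omega)).qc_add (by omega) (by omega) rfl)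
    (hx.qPow_comm_add _ _ _ _) ?_
  grind [wt]

lemma URel.colN_cross (hx : URel yᵘ) (hy : DCartan y) {i j : ℕ} (hi : 1 ≤ i)
    (hij : i < j) (hj : j < n) {d : ℤ} (hd : (if i = 1 then 1 else 0) = d) :
    col y n i * col y (n + 1) j =
      qInt d • (col y (n + 1) j * col y n i) - qDiff • (col y (n + 1) i * col y n j) := by
  have e1 : QC d (lowerEl yᵘ n i) κ[y,n + 1] :=
    ((hx.fullWt_lowerEl hy hi (by omega) (by omega)).qc_add (r := -d) (by omega) (by omega)
      (by grind [wt])).symm.cast (neg_neg d)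
  have e2 : QC 0 κ[y,n] (lowerEl yᵘ (n + 1) j) :=
    (hx.fullWt_lowerEl hy (by omega) (by omega) le_rfl).qc_add (by omega) (by omega) (by grind [wt])
  have e6 : QC 0 κ[y,n + 1] (lowerEl yᵘ n j) :=
    (hx.fullWt_lowerEl hy (by omega) (by omega) (by omega)).qc_add (by omega) (by omega)
      (by grind [wt])
  have e3 := hx.lowerEl_cross hij hj (Nat.lt_succ_self n)
  have e5 := hx.qPow_comm_add 1 (n + 1) 1 n
  rw [QC] at e1
  have e7 : qInt (-d) * qInt d = 1 := qInt_neg_mul d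
  have e8 : κ[y,n + 1] * lowerEl yᵘ n i = qInt (-d) • (lowerEl yᵘ n i * κ[y,n + 1]) := by
    rw [e1, smul_smul, e7, one_smul]
  simp only [col, mul_assoc, mul_rule e2.comm, mul_rule e6.comm, mul_rule e8,
    smul_mul_assoc, mul_smul_comm, smul_smul, mul_rule e3, add_mul, smul_add, e5, qInt_mul_neg]
  have e9 := qInt_mul_neg d
  generalize qInt d = P at *
  generalize qInt (-d) = Q at *
  match_scalars <;> grind [qInt_one_mul]

lemma URel.grp_eq (hx : URel yᵘ) (hy : DCartan y) (hn : 1 ≤ n) :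
    grp y n = grp y (n + 1) * qPow (-hEl yᵘ n) := by
  have hc := hx.commute_eDiag
  have hd : ∀ i, Commute (y .hd) (eDiag yᵘ i) := hx.commute_hd_eDiag hy
  rw [grp, grp, ← eDiag_sub_eDiag_succ hn, ← qPow_add]
  · congr 1
    abel
  · exact Commute.neg_right ((((hc _ _).sub_left (hc _ _)).sub_left (hd _)).sub_right
      (((hc _ _).sub_left (hc _ _)).sub_left (hd _)))

lemma URel.colN_last (hx : URel yᵘ) (hy : DCartan y) {i : ℕ} (hi : 1 ≤ i)
    (hi' : i < n) {d : ℤ} (hd : (if i = 1 then 1 else 0) = d) : col y n i * col y (n + 1) n =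
      qInt d • (col y (n + 1) n * col y n i) -
        col y (n + 1) i * (qDiff • colTop y n + grp y (n + 1) * qPow (-hEl yᵘ n)) := by
  have e1 : QC d (lowerEl yᵘ n i) κ[y,n + 1] :=
    ((hx.fullWt_lowerEl hy hi (by omega) (by omega)).qc_add (r := -d) (by omega) (by omega)
      (by grind [wt])).symm.cast (neg_neg d)
  have e2 : QC (-1) κ[y,n] (lowerEl yᵘ (n + 1) n) :=
    (hx.fullWt_lowerEl hy (by omega) (by omega) le_rfl).qc_add (by omega) (by omega) (by grind [wt])
  have e3 := hx.lowerEl_split hi' (Nat.lt_succ_self n)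
  have e5 := hx.qPow_comm_add 1 n 1 (n + 1)
  rw [← hx.grp_eq hy (by omega), hx.qDiff_smul_colTop hy, sub_add_cancel]
  rw [QC] at e1 e2
  rw [qComm] at e3
  have e7 : qInt (-d) * qInt d = 1 := qInt_neg_mul d
  have e8 : κ[y,n + 1] * lowerEl yᵘ n i = qInt (-d) • (lowerEl yᵘ n i * κ[y,n + 1]) := by
    rw [e1, smul_smul, e7, one_smul]
  simp only [col, mul_assoc, mul_rule e2, mul_rule e8,
    smul_mul_assoc, mul_smul_comm, smul_smul, e3, sub_mul, e5, qInt_mul_neg]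
  module

lemma colLast (hx : URel yᵘ) (hy : DCartan y) (hn : 1 < n) :
    ColLast (eEl yᵘ n) (qPow (-hEl yᵘ n)) (col y (n + 1) 1) (col y (n + 1) n)
      (colTop y (n + 1)) (grp y (n + 1)) (col y n 1) (colTop y n) := by
  have hm : n ∈ Icc 1 n := mem_Icc.2 ⟨by omega, le_rfl⟩
  have hE := hx.fullWt_e hy hm
  have h1 := hx.fullWt_col hy (i := 1) le_rfl (by omega) (le_refl (n + 1))
  have h2 := hx.fullWt_col hy (i := n) (by omega) (by omega) (le_refl (n + 1))
  have k1 := hx.fullWt_col hy (i := 1) (m := n) le_rfl (by omega) (by omega)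
  have hEg : QC (-1) (eEl yᵘ n) (grp y (n + 1)) :=
    (hE.qc_grp (r := 1) (by omega) (by grind [wt])).symm
  have eg := hx.grp_eq hy (by omega : 1 ≤ n)
  refine ⟨?_, ?_, ?_, ?_, ?_, ?_, ?_, ?_, ?_, ?_, ?_, ?_, ?_, ?_, ?_, ?_, ?_, ?_, ?_, ?_, ?_, ?_,
    ?_, ?_⟩
  · exact hx.e_col_top hy le_rfl hn le_rfl
  · have e1 := hx.ef_same n
    have e2 : QC 1 (eEl yᵘ n) κ[y,n + 1] :=
      (hE.qc_add (by omega) (by omega) (r := -1) (by grind [wt])).symm.cast (neg_neg 1)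
    rw [QC] at e2
    rw [← hx.qNum_h_col hy (by omega), col, lowerEl_self, ← mul_assoc, e1, add_mul, mul_assoc, e2,
      mul_smul_comm, mul_assoc]
  · have e1 := hE.colTop_neg hx hy (m := n + 1) (r := 0) (by omega) (by grind [wt]) (by grind [wt])
    have e2 := qInt_one_mul
    rw [QC] at hEg
    rw [qInt_zero, zero_sub (1 : ℤ), one_smul, hEg] at e1
    rw [e1]
    match_scalars <;> grind [qInt_one_mul]
  · exact hEg
  · exact (hE.qc_neg_h hm (r := -2) (by grind [wt])).symm.cast (neg_neg 2)
  · exact hx.e_col_ne hy le_rfl (by omega) (by omega) hm (by omega) (by grind [wt])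
  · have e1 := hE.colTop_pos hx hy (m := n) (r := 0) (by omega) (by grind [wt]) (by grind [wt])
    have e3 : QC 1 (eEl yᵘ n) (grp y n) :=
      (hE.qc_grp (r := -1) (by omega) (by grind [wt])).symm.cast (neg_neg 1)
    have e2 := qInt_one_mul
    rw [QC] at e3
    rw [qInt_zero, zero_add (1 : ℤ), one_smul, e3] at e1
    rw [← eg, e1]
    match_scalars <;> grind [qInt_one_mul]
  · exact h1.qc_neg_h hm (by grind [wt])
  · exact h2.qc_neg_h hm (by grind [wt])
  · exact ((hx.fullWt_colTop hy _).qc_neg_h hm (r := 0) rfl).comm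
  · exact ((hx.fullWt_grp hy _).qc_neg_h hm (r := 0) rfl).comm
  · exact k1.qc_neg_h hm (by grind [wt])
  · exact ((hx.fullWt_colTop hy _).qc_neg_h hm (r := 0) rfl).comm
  · exact hx.qc_colN_col hy le_rfl hn
  · exact hx.colN_last hy le_rfl hn rfl
  · exact h1.colTop_comm hx hy (by omega) (by grind [wt]) (by grind [wt])
  · have e1 := h2.colTop_neg hx hy (m := n) (r := 0) (by omega) (by grind [wt]) (by grind [wt])
    rw [qInt_zero, zero_sub (1 : ℤ), one_smul] at e1
    rw [e1, eg]
  · exact k1.colTop_comm hx hy (by omega) (by grind [wt]) (by grind [wt])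
  · have e1 := (hx.fullWt_colTop hy n).colTop_comm hx hy (m := n + 1) (by omega) (r := 0) rfl rfl
    rwa [qInt_zero, one_smul] at e1
  · exact h1.qc_grp (by omega) (by grind [wt])
  · exact h2.qc_grp (by omega) (by grind [wt])
  · exact k1.qc_grp (by omega) (by grind [wt])
  · exact ((hx.fullWt_colTop hy _).qc_grp (by omega) (r := 0) rfl).comm
  · exact ((hx.fullWt_colTop hy _).qc_grp (by omega) (r := 0) rfl).comm

lemma rowLast (hx : URel yᵘ) (hy : DCartan y) (hn : 1 < n) :
    RowLast (eEl yᵘ n) (rowBot y 1) (row y 1 n) (row y 1 (n + 1)) := by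
  have hm : n ∈ Icc 1 n := mem_Icc.2 ⟨by omega, le_rfl⟩
  have hE := hx.fullWt_e hy hm
  have h3 := hx.fullWt_row hy (r := 1) (i := n + 1) le_rfl (by omega) le_rfl
  have h2 := hx.fullWt_row hy (r := 1) (i := n) le_rfl (by omega) (by omega)
  refine ⟨?_, ?_, ?_, ?_, ?_, ?_⟩
  · exact (hE.rowBot_comm (by omega) (by grind [wt])).symm
  · exact hx.e_row_ne hy le_rfl (by omega) (by omega) hm (by omega) (by grind [wt])
  · exact hx.e_row_top hy hn le_rfl
  · exact h2.rowBot_neg (by omega) (by grind [wt])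
  · exact h3.rowBot_neg (by omega) (by grind [wt])
  · exact hx.qc_row_row hy (by omega) (by omega) le_rfl

end LetterRelationsLast

/-! ### Relations of the matrix coefficients with `ξ_{δ-θ}` -/

section XiLetters

variable {n : ℕ} {B : Type*} [Ring B] [Algebra BaseRing B] [IsAdicComplete adicIdeal B]
variable {y : DIdx n → B}

/-- The Cartan relations, those of `U_q(sl(n+1))`, and the commutation of `ξ_{δ-θ}` with the
`e_{-α_k}`. -/
def XiRel (y : DIdx n → B) : Prop := URel yᵘ ∧ DCartan y ∧ ∀ k, y .xi * fEl yᵘ k = fEl yᵘ k * y .xi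

lemma DRel.xiRel (hy : DRel y) : XiRel y := ⟨hy.1, hy.2.1, hy.xi_f⟩

lemma XiRel.xi_lowerEl (hy : XiRel y) {i j : ℕ} (hij : i < j) :
    y .xi * lowerEl yᵘ j i = lowerEl yᵘ j i * y .xi :=
  lowerEl_comm hij fun l _ _ => hy.2.2 l

lemma XiRel.qc_xi_lowerEl_mul (hy : XiRel y) (hn : 1 < n) {i j k l : ℕ} (hij : i < j)
    (hk : 1 ≤ k ∧ k ≤ n + 1) (hl : 1 ≤ l ∧ l ≤ n + 1) {d : ℤ}
    (hd : -(wt (n + 1) 1 k + wt (n + 1) 1 l) = d) :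
    QC d (y .xi) (lowerEl yᵘ j i * qPow (eDiag yᵘ k + eDiag yᵘ l)) :=
  ((qc_zero_iff.2 (hy.xi_lowerEl hij)).mul_right
    ((DCartan.fullWt_xi hy.2.1 hn).qc_add hk hl rfl).symm).cast (by rw [zero_add, hd])

lemma XiRel.qc_xi_col (hy : XiRel y) (hn : 1 < n) {i m : ℕ} (him : i < m) (hm : 1 < m ∧ m ≤ n + 1)
    {d : ℤ} (hd : (if m = n + 1 then 0 else 1) = d) : QC d (y .xi) (col y m i) :=
  hy.qc_xi_lowerEl_mul hn him (by omega) (by omega)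
    (by grind [wt])

lemma XiRel.qc_xi_row_one (hy : XiRel y) (hn : 1 < n) {i : ℕ} (hi : 1 < i ∧ i ≤ n + 1)
    {d : ℤ} (hd : (if i = n + 1 then 0 else 1) = d) : QC d (y .xi) (row y 1 i) :=
  hy.qc_xi_lowerEl_mul hn hi.1 (by omega) (by omega)
    (by grind [wt])

lemma XiRel.qc_xi_row_two (hy : XiRel y) (hn : 1 < n) {i : ℕ} (hi : 2 < i ∧ i ≤ n + 1)
    {d : ℤ} (hd : (if i = n + 1 then -1 else 0) = d) : QC d (y .xi) (row y 2 i) :=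
  hy.qc_xi_lowerEl_mul hn hi.1 (by omega) (by omega)
    (by grind [wt])

lemma XiRel.qc_xi_grp (hy : XiRel y) (hn : 1 < n) : QC 2 (y .xi) (grp y (n + 1)) :=
  ((DCartan.fullWt_xi hy.2.1 hn).qc_grp (r := -2) (by omega) (by grind [wt])).symm.cast (neg_neg 2)

lemma XiRel.xi_colTop (hy : XiRel y) (hn : 1 < n) :
    y .xi * colTop y (n + 1) = colTop y (n + 1) * y .xi - qInt 1 • (grp y (n + 1) * y .xi) := by
  have h1 := (DCartan.fullWt_xi hy.2.1 hn).colTop_pos hy.1 hy.2.1 (m := n + 1) (r := -1) (by omega)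
    (by grind [wt]) (by grind [wt])
  have h2 := (hy.qc_xi_grp hn).eq
  rw [neg_add_cancel, qInt_zero, one_smul, h2, qInt_two] at h1
  rw [h1]
  match_scalars <;> grind [qInt_one_mul]

lemma XiRel.xi_rowBot_one (hy : XiRel y) (hn : 1 < n) :
    y .xi * rowBot y 1 = qInt 2 • (rowBot y 1 * y .xi) + qInt 1 • y .xi := by
  have h1 := (DCartan.fullWt_xi hy.2.1 hn).rowBot_neg (r := 1) (by omega) (by grind [wt])
  rw [qInt_neg_two] at h1
  rw [h1, qInt_two]
  match_scalars <;> grind [qInt_one_mul]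

lemma XiRel.xi_rowBot_two (hy : XiRel y) (hn : 1 < n) : y .xi * rowBot y 2 = rowBot y 2 * y .xi :=
  ((DCartan.fullWt_xi hy.2.1 hn).rowBot_comm (r := 2) (by omega) (by grind [wt])).symm

lemma XiRel.qc_xi_colTop (hy : XiRel y) (hn : 1 < n) : QC 1 (y .xi) (colTop y n) :=
  (show QC (-1) _ _ from (DCartan.fullWt_xi hy.2.1 hn).colTop_comm hy.1 hy.2.1 (m := n) (by omega)
    (by grind [wt]) (by grind [wt])).symm.cast (neg_neg 1)

lemma XiRel.qc_xi_qPow_h (hy : XiRel y) (hn : 1 < n) {k : ℕ} (hk : k = 1 ∨ k = n) :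
    QC (-1) (y .xi) (qPow (-hEl yᵘ k)) :=
  ((DCartan.fullWt_xi hy.2.1 hn).qc_neg_h (r := 1) (mem_Icc.2 (by omega)) (by grind [wt])).symm

end XiLetters

section PairSums

variable {B : Type*} [Ring B] [Algebra BaseRing B]
variable {ι : Type*} {S : Finset ι} {f f' g g' : ι → B} {u v : B} {r : ℤ} {z : BaseRing}

lemma mul_sum_pair_left (h : ∀ i ∈ S, u * f i = z • (f i * u) + f' i * v)
    (hu : ∀ i ∈ S, u * g i = g i * u) (hv : ∀ i ∈ S, v * g i = g i * v) :
    u * ∑ i ∈ S, f i * g i = z • ((∑ i ∈ S, f i * g i) * u) + (∑ i ∈ S, f' i * g i) * v := by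
  simp only [mul_sum, sum_mul, smul_sum, ← sum_add_distrib]
  refine sum_congr rfl fun i hi => ?_
  rw [← mul_assoc, h i hi, add_mul, smul_mul_assoc, mul_assoc, mul_assoc, hu i hi, hv i hi,
    ← mul_assoc, ← mul_assoc]

lemma mul_sum_pair_right (h : ∀ i ∈ S, u * g i = z • (g i * u) + g' i * v)
    (hu : ∀ i ∈ S, u * f i = f i * u) :
    u * ∑ i ∈ S, f i * g i = z • ((∑ i ∈ S, f i * g i) * u) + (∑ i ∈ S, f i * g' i) * v := by
  simp only [mul_sum, sum_mul, smul_sum, ← sum_add_distrib]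
  refine sum_congr rfl fun i hi => ?_
  rw [← mul_assoc, hu i hi, mul_assoc, h i hi, mul_add, mul_smul_comm, ← mul_assoc, ← mul_assoc]

lemma sum_pair_mul_left (h : ∀ i ∈ S, f i * u = z • (u * f i) + f' i * v)
    (hu : ∀ i ∈ S, u * g i = g i * u) (hv : ∀ i ∈ S, v * g i = g i * v) :
    (∑ i ∈ S, f i * g i) * u = z • (u * ∑ i ∈ S, f i * g i) + (∑ i ∈ S, f' i * g i) * v := by
  simp only [mul_sum, sum_mul, smul_sum, ← sum_add_distrib]
  refine sum_congr rfl fun i hi => ?_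
  rw [mul_assoc, ← hu i hi, ← mul_assoc, h i hi, add_mul, smul_mul_assoc, mul_assoc, mul_assoc,
    mul_assoc, hv i hi]

lemma QC.sum_pair_left (h : ∀ i ∈ S, QC r u (f i)) (hu : ∀ i ∈ S, u * g i = g i * u) :
    QC r u (∑ i ∈ S, f i * g i) :=
  QC.sum_right _ _ fun i hi => ((h i hi).mul_right (qc_zero_iff.2 (hu i hi))).cast (add_zero r)

lemma QC.sum_pair_right (h : ∀ i ∈ S, QC r u (g i)) (hu : ∀ i ∈ S, u * f i = f i * u) :
    QC r u (∑ i ∈ S, f i * g i) :=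
  QC.sum_right _ _ fun i hi => ((qc_zero_iff.2 (hu i hi)).mul_right (h i hi)).cast (zero_add r)

/-- Two sums `q`-commute if the symmetrizations of their products do. -/
lemma sum_mul_sum_of_pairs (S : Finset ℕ) (F G : ℕ → B) (hd : ∀ i ∈ S, F i * G i = z • (G i * F i))
    (ho : ∀ i ∈ S, ∀ j ∈ S, i < j → F i * G j + F j * G i = z • (G i * F j + G j * F i)) :
    (∑ i ∈ S, F i) * ∑ i ∈ S, G i = z • ((∑ i ∈ S, G i) * ∑ i ∈ S, F i) := by
  induction S using Finset.induction_on_max with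
  | empty => simp
  | insert a s ha ih =>
    have hn : a ∉ s := fun h => lt_irrefl a (ha a h)
    have h1 := ih (fun i hi => hd i (Finset.mem_insert_of_mem hi)) fun i hi j hj =>
      ho i (Finset.mem_insert_of_mem hi) j (Finset.mem_insert_of_mem hj)
    have h2 := hd a (Finset.mem_insert_self a s)
    have h3 : (∑ i ∈ s, F i) * G a + F a * ∑ i ∈ s, G i =
        z • ((∑ i ∈ s, G i) * F a + G a * ∑ i ∈ s, F i) := by
      simp only [mul_sum, sum_mul, ← sum_add_distrib, smul_sum]
      exact sum_congr rfl fun i hi =>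
        ho i (Finset.mem_insert_of_mem hi) a (Finset.mem_insert_self a s) (ha i hi)
    rw [sum_insert hn, sum_insert hn]
    calc (F a + ∑ i ∈ s, F i) * (G a + ∑ i ∈ s, G i)
        = F a * G a + ((∑ i ∈ s, F i) * G a + F a * ∑ i ∈ s, G i) +
            (∑ i ∈ s, F i) * ∑ i ∈ s, G i := by noncomm_ring
      _ = _ := by
        rw [h1, h2, h3, ← smul_add, ← smul_add]
        congr 1
        noncomm_ring

end PairSums

/-! ### Commuting families -/

section DoubleCommutant

variable {n : ℕ} {B : Type*} [Ring B] [Algebra BaseRing B] [IsAdicComplete adicIdeal B]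

/-- The double commutant of the family `x`: it contains everything built from `x`, power series in
`log q` included. -/
def bicomm (x : DIdx n → B) : Subalgebra BaseRing B :=
  Subalgebra.centralizer BaseRing (Set.centralizer (Set.range x))

/-- Every member of the family `x` commutes with every member of the family `y`. -/
def CommFam (x y : DIdx n → B) : Prop := ∀ a b, x a * y b = y b * x a

variable (x : DIdx n → B)

lemma bicomm_gen (a : DIdx n) : x a ∈ bicomm x := by
  rw [bicomm, Subalgebra.mem_centralizer_iff]
  intro b hb
  exact (hb (x a) ⟨a, rfl⟩).symm

variable {x}

lemma bicomm_qPow {a : B} (ha : a ∈ bicomm x) : qPow a ∈ bicomm x := by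
  rw [bicomm, Subalgebra.mem_centralizer_iff] at *
  intro b hb
  exact (qPow_comm (ha b hb).symm).symm

lemma bicomm_qNum {a : B} (ha : a ∈ bicomm x) : qNum a ∈ bicomm x := by
  rw [bicomm, Subalgebra.mem_centralizer_iff] at *
  intro b hb
  exact mul_qNum_of_mul_eq (ha b hb)

variable (x)

lemma bicomm_at1 (f : Fin n → DIdx n) (k : ℕ) : at1 (fun j => x (f j)) k ∈ bicomm x := by
  unfold at1
  split_ifs
  · exact bicomm_gen x _
  · exact zero_mem _

lemma bicomm_hEl (k : ℕ) : hEl xᵘ k ∈ bicomm x := bicomm_at1 x (fun j => .u (.h j)) k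

lemma bicomm_eEl (k : ℕ) : eEl xᵘ k ∈ bicomm x := bicomm_at1 x (fun j => .u (.e j)) k

lemma bicomm_fEl (k : ℕ) : fEl xᵘ k ∈ bicomm x := bicomm_at1 x (fun j => .u (.f j)) k

lemma bicomm_eDiag (k : ℕ) : eDiag xᵘ k ∈ bicomm x :=
  sub_mem (Subalgebra.smul_mem _ (sum_mem fun _ _ => Subalgebra.smul_mem _ (bicomm_hEl x _) _) _)
    (sum_mem fun _ _ => bicomm_hEl x _)

lemma bicomm_lowerEl (j i : ℕ) : lowerEl xᵘ j i ∈ bicomm x := by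
  unfold lowerEl
  induction j - i - 1 with
  | zero => exact bicomm_fEl x i
  | succ d ih =>
    exact sub_mem (mul_mem (bicomm_fEl x _) ih)
      (Subalgebra.smul_mem _ (mul_mem ih (bicomm_fEl x _)) _)

lemma bicomm_halfHd : halfHd x ∈ bicomm x := Subalgebra.smul_mem _ (bicomm_gen x _) _

lemma bicomm_qPow_h (k : ℕ) : qPow (hEl xᵘ k) ∈ bicomm x := bicomm_qPow (bicomm_hEl x k)

lemma bicomm_qPow_neg_h (k : ℕ) : qPow (-hEl xᵘ k) ∈ bicomm x :=
  bicomm_qPow (neg_mem (bicomm_hEl x k))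

lemma bicomm_col (m i : ℕ) : col x m i ∈ bicomm x :=
  mul_mem (bicomm_lowerEl x m i) (bicomm_qPow (add_mem (bicomm_eDiag x _) (bicomm_eDiag x _)))

lemma bicomm_row (r i : ℕ) : row x r i ∈ bicomm x :=
  mul_mem (bicomm_lowerEl x i r) (bicomm_qPow (add_mem (bicomm_eDiag x _) (bicomm_eDiag x _)))

lemma bicomm_colTop (m : ℕ) : colTop x m ∈ bicomm x :=
  mul_mem (bicomm_qNum (add_mem (bicomm_halfHd x) (bicomm_eDiag x _)))
    (bicomm_qPow (sub_mem (bicomm_eDiag x _) (bicomm_halfHd x)))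

lemma bicomm_rowBot (r : ℕ) : rowBot x r ∈ bicomm x :=
  mul_mem (bicomm_qNum (bicomm_eDiag x _)) (bicomm_qPow (bicomm_eDiag x _))

lemma bicomm_grp (m : ℕ) : grp x m ∈ bicomm x :=
  bicomm_qPow (sub_mem (sub_mem (bicomm_eDiag x _) (bicomm_eDiag x _)) (bicomm_gen x _))

variable {x}

/-- If two families commute with each other, then so do their double commutants. -/
lemma bicomm_comm {y : DIdx n → B} (hc : CommFam x y) {a b : B}
    (ha : a ∈ bicomm x) (hb : b ∈ bicomm y) : a * b = b * a := by
  rw [bicomm, Subalgebra.mem_centralizer_iff] at ha hb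
  refine hb a ?_
  rintro _ ⟨c, rfl⟩
  refine ha (y c) ?_
  rintro _ ⟨d, rfl⟩
  exact hc d c

lemma listComm_of_bicomm {y : DIdx n → B} (hc : CommFam x y) {l l' : List B}
    (hl : ∀ u ∈ l, u ∈ bicomm y) (hl' : ∀ v ∈ l', v ∈ bicomm x) : ListComm l l' := by
  intro u hu v hv t
  rw [← mul_assoc, ← bicomm_comm hc (hl' v hv) (hl u hu), mul_assoc]

end DoubleCommutant

/-! ### Two commuting copies of the Drinfeldian -/

section Copies

variable {n : ℕ} {B : Type*} [Ring B] [Algebra BaseRing B] [IsAdicComplete adicIdeal B]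
variable {X Y : DIdx n → B}

/-- `∑ e_{mi} q ^ (e_{11} + e_{mm}) ⊗ e_{ir} q ^ (e_{rr} + e_{ii})` over `i ∈ S`, for two commuting
copies `X`, `Y` of the generators in place of the tensor factors. -/
def pairSum (X Y : DIdx n → B) (m r : ℕ) (S : Finset ℕ) : B := ∑ i ∈ S, col X m i * row Y r i

lemma pairSum_left_comm (hc : CommFam X Y) {m r : ℕ} {S : Finset ℕ} {u : B}
    (hu : u ∈ bicomm X) {s : ℤ} (h : ∀ i ∈ S, QC s u (col X m i)) : QC s u (pairSum X Y m r S) :=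
  QC.sum_pair_left h fun i _ => bicomm_comm hc hu (bicomm_row Y r i)

lemma pairSum_right_comm (hc : CommFam X Y) {m r : ℕ} {S : Finset ℕ} {u : B}
    (hu : u ∈ bicomm Y) {s : ℤ} (h : ∀ i ∈ S, QC s u (row Y r i)) : QC s u (pairSum X Y m r S) :=
  QC.sum_pair_right h fun i _ => (bicomm_comm hc (bicomm_col X m i) hu).symm

lemma pairSum_left_mul (hc : CommFam X Y) {m m' r : ℕ} {S : Finset ℕ} {u v : B}
    (hu : u ∈ bicomm X) (hv : v ∈ bicomm X) {z : BaseRing}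
    (h : ∀ i ∈ S, u * col X m i = z • (col X m i * u) + col X m' i * v) :
    u * pairSum X Y m r S = z • (pairSum X Y m r S * u) + pairSum X Y m' r S * v :=
  mul_sum_pair_left h (fun i _ => bicomm_comm hc hu (bicomm_row Y r i))
    fun i _ => bicomm_comm hc hv (bicomm_row Y r i)

lemma pairSum_mul_left (hc : CommFam X Y) {m m' r : ℕ} {S : Finset ℕ} {u v : B}
    (hu : u ∈ bicomm X) (hv : v ∈ bicomm X) {z : BaseRing}
    (h : ∀ i ∈ S, col X m i * u = z • (u * col X m i) + col X m' i * v) :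
    pairSum X Y m r S * u = z • (u * pairSum X Y m r S) + pairSum X Y m' r S * v :=
  sum_pair_mul_left h (fun i _ => bicomm_comm hc hu (bicomm_row Y r i))
    fun i _ => bicomm_comm hc hv (bicomm_row Y r i)

lemma pairSum_right_mul (hc : CommFam X Y) {m r r' : ℕ} {S : Finset ℕ} {u v : B}
    (hu : u ∈ bicomm Y) {z : BaseRing}
    (h : ∀ i ∈ S, u * row Y r i = z • (row Y r i * u) + row Y r' i * v) :
    u * pairSum X Y m r S = z • (pairSum X Y m r S * u) + pairSum X Y m r' S * v :=
  mul_sum_pair_right h fun i _ => (bicomm_comm hc (bicomm_col X m i) hu).symm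

lemma pairSum_right_sub_smul (hc : CommFam X Y) {m r r' : ℕ} {S : Finset ℕ}
    {u : B} (hu : u ∈ bicomm Y) {z z' : BaseRing}
    (h : ∀ i ∈ S, u * row Y r i = z • (row Y r i * u) - z' • row Y r' i) :
    u * pairSum X Y m r S = z • (pairSum X Y m r S * u) - z' • pairSum X Y m r' S := by
  have h1 := pairSum_right_mul (m := m) hc hu (v := (-z') • 1) (r' := r') (z := z) fun i hi => by
    rw [h i hi, mul_smul_comm, mul_one, neg_smul, sub_eq_add_neg]
  rw [h1, mul_smul_comm, mul_one, neg_smul, sub_eq_add_neg]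

lemma sumFirst (hX : URel Xᵘ) (hX' : DCartan X) (hY : URel Yᵘ) (hY' : DCartan Y)
    (hc : CommFam X Y) (hn : 1 < n) :
    SumFirst (eEl Xᵘ 1) (qPow (-hEl Xᵘ 1)) (col X (n + 1) 1) (col X (n + 1) 2)
      (colTop X (n + 1)) (grp X (n + 1)) (eEl Yᵘ 1) (rowBot Y 1) (row Y 1 2)
      (row Y 1 (n + 1)) (rowBot Y 2) (row Y 2 (n + 1)) (pairSum X Y (n + 1) 1 (Icc 3 n))
      (pairSum X Y (n + 1) 2 (Icc 3 n)) := by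
  have hm : 1 ∈ Icc 1 n := mem_Icc.2 ⟨le_rfl, by omega⟩
  have hE := hX.fullWt_e hX' hm
  have bE := bicomm_eEl X 1
  have bκ := bicomm_qPow_neg_h X 1
  have ba := bicomm_col X (n + 1)
  have bT := bicomm_colTop X (n + 1)
  have bg := bicomm_grp X (n + 1)
  have bβ := bicomm_row Y 1
  have bγ := bicomm_row Y 2
  have hcol : ∀ i ∈ Icc 3 n, FullWt X (wt (n + 1) i) (col X (n + 1) i) := fun i hi => by
    rw [mem_Icc] at hi
    exact hX.fullWt_col hX' (by omega) (by omega) le_rfl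
  have hrow : ∀ r, r = 1 ∨ r = 2 → ∀ i ∈ Icc 3 n, FullWt Y (wt i r) (row Y r i) :=
    fun r hr i hi => by
      rw [mem_Icc] at hi
      exact hY.fullWt_row hY' (by omega) (by omega) (by omega)
  have hEa : ∀ i ∈ Icc 3 n, QC (-1) (eEl Xᵘ 1) (col X (n + 1) i) := fun i hi => by
    rw [mem_Icc] at hi
    exact hX.e_col_ne hX' (by omega) (by omega) le_rfl hm (by omega) (by grind [wt])
  have hκa : ∀ i ∈ Icc 3 n, QC 0 (qPow (-hEl Xᵘ 1)) (col X (n + 1) i) :=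
    fun i hi => (hcol i hi).qc_neg_h hm (by
      grind [wt])
  have haa1 : ∀ i ∈ Icc 3 n, QC 0 (col X (n + 1) 1) (col X (n + 1) i) := fun i hi => by
    rw [mem_Icc] at hi
    exact (hX.qc_col hX' le_rfl (by omega) (by omega) rfl).symm
  have haa2 : ∀ i ∈ Icc 3 n, QC (-1) (col X (n + 1) 2) (col X (n + 1) i) := fun i hi => by
    rw [mem_Icc] at hi
    exact (hX.qc_col hX' (by omega) (by omega) (by omega) (r := 1) rfl).symm
  have hTa : ∀ i ∈ Icc 3 n, colTop X (n + 1) * col X (n + 1) i =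
      qInt 1 • (col X (n + 1) i * colTop X (n + 1)) + col X (n + 1) i * grp X (n + 1) :=
    fun i hi => by
      have h1 := (hcol i hi).colTop_pos hX hX' (m := n + 1) (r := 0) (by omega) (by grind [wt])
        (by grind [wt])
      rwa [qInt_zero, zero_add (1 : ℤ), one_smul] at h1
  have hga : ∀ i ∈ Icc 3 n, QC (-1) (grp X (n + 1)) (col X (n + 1) i) := fun i hi =>
    (hcol i hi).qc_grp (by omega) (by
      grind [wt])
  have hEβ : ∀ i ∈ Icc 3 n, eEl Yᵘ 1 * row Y 1 i =
      qInt (-1) • (row Y 1 i * eEl Yᵘ 1) - qInt (-1) • row Y 2 i := fun i hi => by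
    rw [mem_Icc] at hi
    exact hY.e_row_bot hY' (by omega) (by omega)
  have hEγ : ∀ i ∈ Icc 3 n, QC 1 (eEl Yᵘ 1) (row Y 2 i) := fun i hi => by
    rw [mem_Icc] at hi
    exact hY.e_row_ne hY' (by omega) (by omega) (by omega) hm (by omega) (by grind [wt])
  refine ⟨?_, ?_, ?_, ?_, ?_, ?_, ?_, ?_, ?_, ?_, ?_, ?_, ?_, ?_, ?_, ?_, ?_, ?_, ?_, ?_⟩
  · exact pairSum_left_comm hc bE hEa
  · exact pairSum_left_comm hc bE hEa
  · exact (pairSum_left_comm hc bκ hκa).comm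
  · exact (pairSum_left_comm hc bκ hκa).comm
  · exact (pairSum_left_comm hc (ba 1) haa1).comm.symm
  · exact (pairSum_left_comm hc (ba 1) haa1).comm.symm
  · exact (pairSum_left_comm hc (ba 2) haa2).symm.cast (neg_neg 1)
  · exact (pairSum_left_comm hc (ba 2) haa2).symm.cast (neg_neg 1)
  · exact pairSum_left_mul hc bT bg hTa
  · exact pairSum_left_mul hc bT bg hTa
  · exact pairSum_left_comm hc bg hga
  · exact pairSum_left_comm hc bg hga
  · refine (pairSum_right_comm hc (bicomm_rowBot Y 1) (s := 0) fun i hi => ?_).comm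
    refine qc_zero_iff.2 ((hrow 2 (by omega) i hi).rowBot_comm (by omega) ?_)
    grind [wt]
  · have h1 := pairSum_right_mul (X := X) (m := n + 1) (r := 2) (r' := 1) (z := qInt (-1))
      (v := -(1 + qDiff • rowBot Y 2)) hc (bβ 2) (S := Icc 3 n) fun i hi => by
        rw [mem_Icc] at hi
        have h2 := hY.row_two_mul hY' (j := i) (by omega) (by omega)
        generalize (1 + qDiff • rowBot Y 2) = U at *
        rw [h2]
        simp only [mul_neg]
        match_scalars <;> grind [qInt_one_mul]
    rw [h1, mul_neg, sub_eq_add_neg]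
  · refine (pairSum_right_comm hc (bβ (n + 1)) (s := 0) fun i hi => ?_).comm
    rw [mem_Icc] at hi
    exact qc_zero_iff.2 (hY.row_two_nested hY' (by omega) (by omega) le_rfl).symm
  · refine (pairSum_right_comm hc (bicomm_rowBot Y 2) (s := 0) fun i hi => ?_).comm
    refine qc_zero_iff.2 ((hrow 1 (by omega) i hi).rowBot_comm (by omega) ?_)
    grind [wt]
  · have h1 := pairSum_right_mul (X := X) (m := n + 1) (r := 1) (r' := 2) (z := 1)
      (v := qDiff • row Y 1 (n + 1)) hc (bγ (n + 1)) (S := Icc 3 n) fun i hi => by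
        rw [mem_Icc] at hi
        rw [hY.row_two_cross hY' (i := i) (j := n + 1) (by omega) (by omega) le_rfl, one_smul,
          mul_smul_comm, hY.row_two_nested hY' (by omega) (by omega) le_rfl]
    rw [h1, one_smul, mul_smul_comm]
  · exact pairSum_right_sub_smul hc (bicomm_eEl Y 1) hEβ
  · exact pairSum_right_comm hc (bicomm_eEl Y 1) hEγ
  · have hcm : ∀ r i j, row Y r i * col X (n + 1) j = col X (n + 1) j * row Y r i := fun r i j =>
      (bicomm_comm hc (bicomm_col X (n + 1) j) (bicomm_row Y r i)).symm
    refine sum_mul_sum_of_pairs _ _ _ (fun i hi => ?_) fun i hi j hj hij => ?_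
    · rw [mem_Icc] at hi
      have h1 := (hY.qc_row_two_same hY' (j := i) (by omega) (by omega)).eq
      simp only [mul_assoc, mul_rule (hcm _ _ _), h1, mul_smul_comm]
    · rw [mem_Icc] at hi hj
      have h1 := (hX.qc_col hX' (i := i) (j := j) (by omega) hij (by omega) (r := 1)
        (by rw [if_neg (by omega)])).eq
      have h2 := hY.row_two_nested hY' (i := i) (j := j) (by omega) hij (by omega)
      have h3 := hY.row_two_cross hY' (i := i) (j := j) (by omega) hij (by omega)
      refine eq_of_forall_mul_right fun t => ?_
      simp only [add_mul, smul_add, mul_add, smul_mul_assoc, mul_smul_comm, mul_assoc,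
        mul_rule (hcm _ _ _), mul_rule h1, mul_rule h2, mul_rule h3, qDiff]
      match_scalars <;> grind [qInt_one_mul]

lemma sumLast (hX : URel Xᵘ) (hX' : DCartan X) (hY : URel Yᵘ) (hY' : DCartan Y)
    (hc : CommFam X Y) (hn : 1 < n) :
    SumLast (eEl Xᵘ n) (qPow (-hEl Xᵘ n)) (col X (n + 1) 1) (col X (n + 1) n)
      (colTop X (n + 1)) (grp X (n + 1)) (col X n 1) (colTop X n) (eEl Yᵘ n) (rowBot Y 1)
      (row Y 1 n) (row Y 1 (n + 1)) (pairSum X Y (n + 1) 1 (Icc 2 (n - 1)))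
      (pairSum X Y n 1 (Icc 2 (n - 1))) := by
  have hm : n ∈ Icc 1 n := mem_Icc.2 ⟨by omega, le_rfl⟩
  have hE := hX.fullWt_e hX' hm
  have bE := bicomm_eEl X n
  have bκ := bicomm_qPow_neg_h X n
  have ba := bicomm_col X
  have bT := bicomm_colTop X
  have bg := bicomm_grp X (n + 1)
  have bβ := bicomm_row Y 1
  have hcol : ∀ m, m = n ∨ m = n + 1 → ∀ i ∈ Icc 2 (n - 1),
      FullWt X (wt m i) (col X m i) := fun m hm i hi => by
    rw [mem_Icc] at hi
    exact hX.fullWt_col hX' (by omega) (by omega) (by omega)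
  have hrow : ∀ i ∈ Icc 2 (n - 1), FullWt Y (wt i 1) (row Y 1 i) := fun i hi => by
      rw [mem_Icc] at hi
      exact hY.fullWt_row hY' le_rfl (by omega) (by omega)
  have hββ1 : ∀ i ∈ Icc 2 (n - 1), rowBot Y 1 * row Y 1 i =
      qInt (-2) • (row Y 1 i * rowBot Y 1) - qInt (-1) • row Y 1 i := fun i hi =>
    (hrow i hi).rowBot_neg (by omega) (by grind [wt])
  have hββ2 : ∀ i ∈ Icc 2 (n - 1), QC 1 (row Y 1 n) (row Y 1 i) := fun i hi => by
    rw [mem_Icc] at hi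
    exact (hY.qc_row_row hY' (by omega) (by omega) (by omega)).symm.cast (neg_neg 1)
  have hββ3 : ∀ i ∈ Icc 2 (n - 1), QC 1 (row Y 1 (n + 1)) (row Y 1 i) := fun i hi => by
    rw [mem_Icc] at hi
    exact (hY.qc_row_row hY' (by omega) (by omega) le_rfl).symm.cast (neg_neg 1)
  have hEβ : ∀ i ∈ Icc 2 (n - 1), QC 0 (eEl Yᵘ n) (row Y 1 i) := fun i hi => by
    rw [mem_Icc] at hi
    exact hY.e_row_ne hY' le_rfl (by omega) (by omega) hm (by omega) (by grind [wt])
  have bW : qDiff • colTop X n + grp X (n + 1) * qPow (-hEl Xᵘ n) ∈ bicomm X :=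
    add_mem (Subalgebra.smul_mem _ (bT n) _) (mul_mem bg bκ)
  refine ⟨?_, ?_, ?_, ?_, ?_, ?_, ?_, ?_, ?_, ?_, ?_, ?_, ?_, ?_, ?_, ?_, ?_, ?_, ?_, ?_⟩
  · have h1 := pairSum_left_mul (Y := Y) (m := n + 1) (r := 1) (m' := n) (z := qInt 1) hc bE
      (one_mem _) (S := Icc 2 (n - 1)) fun i hi => by
        rw [mem_Icc] at hi
        rw [hX.e_col_top hX' (by omega) (by omega) le_rfl, mul_one]
    rw [h1, mul_one]
  · refine pairSum_left_comm hc bE fun i hi => ?_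
    rw [mem_Icc] at hi
    exact hX.e_col_ne hX' (by omega) (by omega) (by omega) hm (by omega) (by grind [wt])
  · refine pairSum_left_comm hc bκ fun i hi => (hcol _ (by omega) i hi).qc_neg_h hm ?_
    grind [wt]
  · refine pairSum_left_comm hc bκ fun i hi => (hcol _ (by omega) i hi).qc_neg_h hm ?_
    grind [wt]
  · simp only [pairSum, mul_sum, sum_mul, smul_sum, ← Finset.sum_sub_distrib]
    refine sum_congr rfl fun i hi => ?_
    rw [mem_Icc] at hi
    rw [← mul_assoc, hX.colN_cross hX' le_rfl (by omega) (by omega) (d := 1) rfl, sub_mul,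
      smul_mul_assoc, smul_mul_assoc, mul_assoc, mul_assoc, mul_assoc,
      bicomm_comm hc (ba n 1) (bβ i)]
  · refine (pairSum_left_comm hc (bT n) (s := 0) fun i hi => qc_zero_iff.2 ?_).comm
    have h1 := (hcol _ (Or.inr rfl) i hi).colTop_comm hX hX' (m := n) (r := 0) (by omega)
      (by grind [wt]) (by grind [wt])
    rwa [qInt_zero, one_smul] at h1
  · refine (pairSum_left_comm hc (ba (n + 1) 1) (s := 1) fun i hi => ?_).symm
    rw [mem_Icc] at hi
    exact (hX.colN_nested hX' le_rfl (by omega) (by omega) rfl).symm.cast (neg_neg 1)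
  · have h1 := pairSum_mul_left (Y := Y) (m := n) (r := 1) (m' := n + 1) (z := 1) hc
      (ba (n + 1) n) (neg_mem bW) (S := Icc 2 (n - 1)) fun i hi => by
        rw [mem_Icc] at hi
        rw [hX.colN_last hX' (by omega) (by omega) (d := 0) (by rw [if_neg (by omega)]), qInt_zero,
          mul_neg, sub_eq_add_neg]
    rw [h1, one_smul, mul_neg, ← sub_eq_add_neg]
  · refine (pairSum_left_comm hc (bT (n + 1)) (s := 0) fun i hi => qc_zero_iff.2 ?_).comm
    have h1 := (hcol _ (Or.inl rfl) i hi).colTop_comm hX hX' (m := n + 1) (r := 0) (by omega)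
      (by grind [wt]) (by grind [wt])
    rwa [qInt_zero, one_smul] at h1
  · refine pairSum_left_comm hc bg fun i hi => (hcol _ (by omega) i hi).qc_grp (by omega) ?_
    grind [wt]
  · refine (pairSum_left_comm hc bg (s := 0) fun i hi =>
      (hcol _ (by omega) i hi).qc_grp (by omega) ?_).comm
    grind [wt]
  · exact pairSum_right_sub_smul hc (bicomm_rowBot Y 1) hββ1
  · exact pairSum_right_comm hc (bβ n) hββ2
  · exact pairSum_right_comm hc (bβ (n + 1)) hββ3
  · exact pairSum_right_sub_smul hc (bicomm_rowBot Y 1) hββ1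
  · exact pairSum_right_comm hc (bβ n) hββ2
  · exact pairSum_right_comm hc (bβ (n + 1)) hββ3
  · exact (pairSum_right_comm hc (bicomm_eEl Y n) hEβ).comm
  · exact (pairSum_right_comm hc (bicomm_eEl Y n) hEβ).comm
  · have hcm : ∀ i m j, row Y 1 i * col X m j = col X m j * row Y 1 i := fun i m j =>
      (bicomm_comm hc (bicomm_col X m j) (bicomm_row Y 1 i)).symm
    refine sum_mul_sum_of_pairs _ _ _ (fun i hi => ?_) fun i hi j hj hij => ?_
    · rw [mem_Icc] at hi
      have h1 := (hX.qc_colN_col hX' (i := i) (by omega) (by omega)).eq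
      simp only [mul_assoc, mul_rule (hcm _ _ _), mul_rule h1, smul_mul_assoc]
    · rw [mem_Icc] at hi hj
      have h1 := (hY.qc_row_row hY' (i := i) (j := j) (by omega) hij (by omega)).eq
      have h2 := (hX.colN_nested hX' (i := i) (j := j) (by omega) hij (by omega) (d := 0)
        (by rw [if_neg (by omega)])).comm
      have h3 := hX.colN_cross hX' (i := i) (j := j) (by omega) hij (by omega) (d := 0)
        (by rw [if_neg (by omega)])
      rw [qInt_zero, one_smul] at h3
      refine eq_of_forall_mul_right fun t => ?_
      simp only [add_mul, sub_mul, smul_add, smul_mul_assoc,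
        mul_smul_comm, mul_assoc, mul_rule (hcm _ _ _), mul_rule h1, mul_rule h2,
        mul_rule h3, qDiff]
      match_scalars <;> grind [qInt_one_mul]

lemma xiFirst (hX : XiRel X) (hY : XiRel Y) (hc : CommFam X Y) (hn : 1 < n) :
    XiFirst (qPow (-hEl Xᵘ 1)) (col X (n + 1) 1) (col X (n + 1) 2)
      (colTop X (n + 1)) (grp X (n + 1)) (rowBot Y 1) (row Y 1 2)
      (row Y 1 (n + 1)) (rowBot Y 2) (row Y 2 (n + 1)) (pairSum X Y (n + 1) 1 (Icc 3 n))
      (pairSum X Y (n + 1) 2 (Icc 3 n)) (X .xi) (Y .xi) := by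
  have hcol : ∀ i ∈ Icc 3 n, QC 0 (X .xi) (col X (n + 1) i) := fun i hi => by
    rw [mem_Icc] at hi
    exact hX.qc_xi_col hn (by omega) (by omega) (if_pos rfl)
  refine ⟨?_, ?_, ?_, ?_, ?_, ?_, ?_, ?_, ?_, ?_, ?_, ?_, ?_, ?_⟩
  · exact (hX.qc_xi_col hn (by omega) (by omega) (if_pos rfl)).comm
  · exact (hX.qc_xi_col hn (by omega) (by omega) (if_pos rfl)).comm
  · exact hX.xi_colTop hn
  · exact hX.qc_xi_grp hn
  · exact hX.qc_xi_qPow_h hn (by omega)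
  · exact (pairSum_left_comm hc (bicomm_gen X _) hcol).comm
  · exact (pairSum_left_comm hc (bicomm_gen X _) hcol).comm
  · exact hY.xi_rowBot_one hn
  · exact hY.qc_xi_row_one hn (by omega) (if_neg (by omega))
  · exact (hY.qc_xi_row_one hn (by omega) (if_pos rfl)).comm
  · exact hY.xi_rowBot_two hn
  · exact hY.qc_xi_row_two hn (by omega) (if_pos rfl)
  · refine pairSum_right_comm hc (bicomm_gen Y _) fun i hi => ?_
    rw [mem_Icc] at hi
    exact hY.qc_xi_row_one hn (by omega) (if_neg (by omega))
  · refine (pairSum_right_comm hc (bicomm_gen Y _) (s := 0) fun i hi => ?_).comm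
    rw [mem_Icc] at hi
    exact hY.qc_xi_row_two hn (by omega) (if_neg (by omega))

lemma xiLast (hX : XiRel X) (hY : XiRel Y) (hc : CommFam X Y) (hn : 1 < n) :
    XiLast (qPow (-hEl Xᵘ n)) (col X (n + 1) 1) (col X (n + 1) n)
      (colTop X (n + 1)) (grp X (n + 1)) (col X n 1) (colTop X n) (rowBot Y 1)
      (row Y 1 n) (row Y 1 (n + 1)) (pairSum X Y (n + 1) 1 (Icc 2 (n - 1)))
      (pairSum X Y n 1 (Icc 2 (n - 1))) (X .xi) (Y .xi) := by
  have hrow : ∀ i ∈ Icc 2 (n - 1), QC 1 (Y .xi) (row Y 1 i) := fun i hi => by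
    rw [mem_Icc] at hi
    exact hY.qc_xi_row_one hn (by omega) (if_neg (by omega))
  refine ⟨?_, ?_, ?_, ?_, ?_, ?_, ?_, ?_, ?_, ?_, ?_, ?_, ?_, ?_⟩
  · exact (hX.qc_xi_col hn (by omega) (by omega) (if_pos rfl)).comm
  · exact (hX.qc_xi_col hn (by omega) (by omega) (if_pos rfl)).comm
  · exact hX.xi_colTop hn
  · exact hX.qc_xi_grp hn
  · exact hX.qc_xi_qPow_h hn (by omega)
  · exact hX.qc_xi_col hn (by omega) (by omega) (if_neg (by omega))
  · exact hX.qc_xi_colTop hn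
  · refine (pairSum_left_comm hc (bicomm_gen X _) (s := 0) fun i hi => ?_).comm
    rw [mem_Icc] at hi
    exact hX.qc_xi_col hn (by omega) (by omega) (if_pos rfl)
  · refine pairSum_left_comm hc (bicomm_gen X _) fun i hi => ?_
    rw [mem_Icc] at hi
    exact hX.qc_xi_col hn (by omega) (by omega) (if_neg (by omega))
  · exact hY.xi_rowBot_one hn
  · exact hY.qc_xi_row_one hn (by omega) (if_neg (by omega))
  · exact (hY.qc_xi_row_one hn (by omega) (if_pos rfl)).comm
  · exact pairSum_right_comm hc (bicomm_gen Y _) hrow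
  · exact pairSum_right_comm hc (bicomm_gen Y _) hrow

end Copies

/-! ### The coproduct on generators -/

section Coproduct

variable {n : ℕ} {B : Type*} [Ring B] [Algebra BaseRing B]

/-- The Cartan relations of `U_q(sl(n+1))`. -/
def UCartan (x : UIdx n → B) : Prop := ∀ a b, UCartanLog x a b → a = b

/-- `[e_{11}] q ^ e_{11}` and the `e_{i1} q ^ (e_{11} + e_{ii})`, the right tensor factors of the
coproduct of `ξ_{δ-θ}`. -/
def rowEntry (y : DIdx n → B) (i : ℕ) : B := if i = 1 then rowBot y 1 else row y 1 i

/-- The `e_{n+1,i} q ^ (e_{11} + e_{n+1,n+1})` and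
`[h_δ / 2 + e_{n+1,n+1}] q ^ (e_{11} - h_δ / 2)`, the left tensor factors of the coproduct of
`ξ_{δ-θ}`. -/
def colEntry (y : DIdx n → B) (i : ℕ) : B := if i = n + 1 then colTop y (n + 1) else col y (n + 1) i

/-- The coefficient of `η` in the coproduct of `ξ_{δ-θ}`, for two copies of the generators in place
of the tensor factors. -/
def etaPart (X Y : DIdx n → B) : B := ∑ i ∈ Icc 1 (n + 1), colEntry X i * rowEntry Y i

/-- The coproduct of the generators, for two copies of the generators in place of the tensor
factors. -/
def coprod (X Y : DIdx n → B) : DIdx n → B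
  | .u (.h i) => X (.u (.h i)) + Y (.u (.h i))
  | .u (.e i) => X (.u (.e i)) + qPow (-X (.u (.h i))) * Y (.u (.e i))
  | .u (.f i) => X (.u (.f i)) * qPow (Y (.u (.h i))) + Y (.u (.f i))
  | .xi => X .xi + grp X (n + 1) * Y .xi + eta • etaPart X Y
  | .hd => X .hd + Y .hd

variable (X Y : DIdx n → B)

lemma hEl_coprod (k : ℕ) : hEl (coprod X Y)ᵘ k = hEl Xᵘ k + hEl Yᵘ k := by
  unfold hEl at1
  split_ifs
  · rfl
  · rw [add_zero]

lemma eEl_coprod (k : ℕ) : eEl (coprod X Y)ᵘ k = eEl Xᵘ k + qPow (-hEl Xᵘ k) * eEl Yᵘ k := by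
  unfold hEl eEl at1
  split_ifs
  · rfl
  · rw [mul_zero, add_zero]

lemma fEl_coprod (k : ℕ) : fEl (coprod X Y)ᵘ k = fEl Xᵘ k * qPow (hEl Yᵘ k) + fEl Yᵘ k := by
  unfold hEl fEl at1
  split_ifs
  · rfl
  · rw [zero_mul, add_zero]

lemma eDiag_coprod (k : ℕ) : eDiag (coprod X Y)ᵘ k = eDiag Xᵘ k + eDiag Yᵘ k := by
  simp only [eDiag, hEl_coprod, smul_add, sum_add_distrib]
  abel

lemma halfHd_coprod : halfHd (coprod X Y) = halfHd X + halfHd Y := smul_add _ _ _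

end Coproduct

section CoproductURel

variable {n : ℕ} {B : Type*} [Ring B] [Algebra BaseRing B] [IsAdicComplete adicIdeal B]
variable {x : UIdx n → B} {X Y : DIdx n → B}

lemma UCartan.hh (hx : UCartan x) (i j : ℕ) : hEl x i * hEl x j = hEl x j * hEl x i := by
  by_cases hi : i ∈ Icc 1 n
  · by_cases hj : j ∈ Icc 1 n
    · exact hx _ _ (.hh i j hi hj)
    · rw [hEl_of_notMem hj, mul_zero, zero_mul]
  · rw [hEl_of_notMem hi, mul_zero, zero_mul]

lemma UCartan.hasWt_e (hx : UCartan x) {i j : ℕ} (hi : i ∈ Icc 1 n)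
    (hj : j ∈ Icc 1 n) : HasWt (hEl x i) (rootForm i j) (eEl x j) :=
  sub_eq_iff_eq_add'.1 (hx _ _ (.he i j hi hj))

lemma UCartan.hasWt_f (hx : UCartan x) {i j : ℕ} (hi : i ∈ Icc 1 n)
    (hj : j ∈ Icc 1 n) : HasWt (hEl x i) (-rootForm i j) (fEl x j) :=
  sub_eq_iff_eq_add'.1 (hx _ _ (.hf i j hi hj))

lemma UCartan.qc_neg_h_e (hx : UCartan x) {i j : ℕ} (hi : i ∈ Icc 1 n)
    (hj : j ∈ Icc 1 n) {r : ℤ} (hr : -rootForm i j = r) : QC r (qPow (-hEl x i)) (eEl x j) :=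
  (hx.hasWt_e hi hj).neg_left.qPow.cast hr

lemma UCartan.qc_h_f (hx : UCartan x) {i j : ℕ} (hi : i ∈ Icc 1 n)
    (hj : j ∈ Icc 1 n) {r : ℤ} (hr : -rootForm i j = r) : QC r (qPow (hEl x i)) (fEl x j) :=
  (hx.hasWt_f hi hj).qPow.cast hr

lemma coprod_ucartan (hX : UCartan Xᵘ) (hY : UCartan Yᵘ)
    (hc : CommFam X Y) : UCartan (coprod X Y)ᵘ := by
  have c1 : ∀ {a b : B}, a ∈ bicomm X → b ∈ bicomm Y → b * a = a * b := fun ha hb =>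
    (bicomm_comm hc ha hb).symm
  intro a b h
  cases h with
  | hh i j hi hj =>
    simp only [hEl_coprod, mul_add, add_mul, hX.hh i j, hY.hh i j,
      c1 (bicomm_hEl X _) (bicomm_hEl Y _)]
    abel
  | he i j hi hj =>
    have h1 : HasWt (hEl Xᵘ i + hEl Yᵘ i) (rootForm i j) (eEl Xᵘ j) :=
      ((hX.hasWt_e hi hj).add_left (hasWt_zero_iff.2
        (c1 (bicomm_eEl X _) (bicomm_hEl Y _)))).cast (add_zero _)
    have h2 : HasWt (hEl Xᵘ i + hEl Yᵘ i) (rootForm i j) (eEl Yᵘ j) :=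
      ((hasWt_zero_iff.2 (c1 (bicomm_hEl X _) (bicomm_eEl Y _)).symm).add_left
        (hY.hasWt_e hi hj)).cast (zero_add _)
    have h4 : hEl Xᵘ i * qPow (-hEl Xᵘ j) = qPow (-hEl Xᵘ j) * hEl Xᵘ i :=
      mul_qPow_of_mul_eq (by rw [mul_neg, neg_mul, hX.hh])
    have h3 : HasWt (hEl Xᵘ i + hEl Yᵘ i) 0 (qPow (-hEl Xᵘ j)) := by
      rw [hasWt_zero_iff, add_mul, mul_add, h4, c1 (bicomm_qPow_neg_h X _) (bicomm_hEl Y _)]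
    rw [hEl_coprod, eEl_coprod]
    exact sub_eq_iff_eq_add'.2 (h1.add_right ((h3.mul h2).cast (zero_add _)))
  | hf i j hi hj =>
    have h1 : HasWt (hEl Xᵘ i + hEl Yᵘ i) (-rootForm i j) (fEl Xᵘ j) :=
      ((hX.hasWt_f hi hj).add_left (hasWt_zero_iff.2
        (c1 (bicomm_fEl X _) (bicomm_hEl Y _)))).cast (add_zero _)
    have h2 : HasWt (hEl Xᵘ i + hEl Yᵘ i) (-rootForm i j) (fEl Yᵘ j) :=
      ((hasWt_zero_iff.2 (c1 (bicomm_hEl X _) (bicomm_fEl Y _)).symm).add_left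
        (hY.hasWt_f hi hj)).cast (zero_add _)
    have h4 : hEl Yᵘ i * qPow (hEl Yᵘ j) = qPow (hEl Yᵘ j) * hEl Yᵘ i :=
      mul_qPow_of_mul_eq (hY.hh i j)
    have h3 : HasWt (hEl Xᵘ i + hEl Yᵘ i) 0 (qPow (hEl Yᵘ j)) := by
      rw [hasWt_zero_iff, add_mul, mul_add, h4, c1 (bicomm_hEl X _) (bicomm_qPow_h Y _)]
    rw [hEl_coprod, fEl_coprod]
    exact sub_eq_iff_eq_add'.2 (((h1.mul h3).cast (add_zero _)).add_right h2)

lemma coprod_qNum_h (hc : CommFam X Y) (i : ℕ) :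
    qNum (hEl (coprod X Y)ᵘ i) = qNum (hEl Xᵘ i) * qPow (hEl Yᵘ i) +
      qPow (-hEl Xᵘ i) * qNum (hEl Yᵘ i) := by
  rw [hEl_coprod, qNum_add (bicomm_comm hc (bicomm_hEl X i) (bicomm_hEl Y i))]

lemma coprod_ef (hX : UCartan Xᵘ) (hY : UCartan Yᵘ)
    (hc : CommFam X Y) {i j : ℕ} (hi : i ∈ Icc 1 n) (hj : j ∈ Icc 1 n) :
    eEl (coprod X Y)ᵘ i * fEl (coprod X Y)ᵘ j -
        fEl (coprod X Y)ᵘ j * eEl (coprod X Y)ᵘ i =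
      (eEl Xᵘ i * fEl Xᵘ j - fEl Xᵘ j * eEl Xᵘ i) * qPow (hEl Yᵘ j) + qPow (-hEl Xᵘ i) *
          (eEl Yᵘ i * fEl Yᵘ j - fEl Yᵘ j * eEl Yᵘ i) := by
  have hl := listComm_of_bicomm hc (l := [eEl Yᵘ i, fEl Yᵘ j, qPow (hEl Yᵘ j)])
    (l' := [eEl Xᵘ i, fEl Xᵘ j, qPow (-hEl Xᵘ i)]) (by simp [bicomm_eEl, bicomm_fEl, bicomm_qPow_h])
    (by simp [bicomm_eEl, bicomm_fEl, bicomm_qPow_neg_h])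
  have h1 : QC (rootForm i j) (qPow (-hEl Xᵘ i)) (fEl Xᵘ j) :=
    (hX.hasWt_f hi hj).neg_left.qPow.cast (neg_neg _)
  have h2 : QC (-rootForm i j) (eEl Yᵘ i) (qPow (hEl Yᵘ j)) :=
    ((hY.hasWt_e hj hi).qPow.cast (rootForm_comm j i)).symm
  have e := qInt_mul_neg (rootForm i j)
  refine eq_of_forall_mul_right fun t => ?_
  simp [ListComm] at hl
  rw [eEl_coprod, fEl_coprod]
  simp only [mul_add, add_mul, mul_sub, sub_mul, smul_mul_assoc, mul_smul_comm, mul_assoc, hl,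
    mul_rule h1.eq, mul_rule h2.eq]
  generalize qInt (rootForm i j) = P at *
  generalize qInt (-rootForm i j) = Q at *
  match_scalars <;> grind [qInt_one_mul]

lemma coprod_ee (hX : UCartan Xᵘ) (hc : CommFam X Y) {i j : ℕ}
    (hi : i ∈ Icc 1 n) (hj : j ∈ Icc 1 n) (hij : i + 2 ≤ j) :
    eEl (coprod X Y)ᵘ i * eEl (coprod X Y)ᵘ j -
        eEl (coprod X Y)ᵘ j * eEl (coprod X Y)ᵘ i =
      (eEl Xᵘ i * eEl Xᵘ j - eEl Xᵘ j * eEl Xᵘ i) + qPow (-hEl Xᵘ i) * qPow (-hEl Xᵘ j) *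
          (eEl Yᵘ i * eEl Yᵘ j - eEl Yᵘ j * eEl Yᵘ i) := by
  have hl := listComm_of_bicomm hc (l := [eEl Yᵘ i, eEl Yᵘ j])
    (l' := [eEl Xᵘ i, eEl Xᵘ j, qPow (-hEl Xᵘ i), qPow (-hEl Xᵘ j)])
    (by simp [bicomm_eEl]) (by simp [bicomm_eEl, bicomm_qPow_neg_h])
  have hr : -rootForm i j = 0 := by rw [rootForm, if_neg (by omega), if_neg (by omega)]; rfl
  have h1 := (hX.qc_neg_h_e hi hj hr).comm
  have h2 := (hX.qc_neg_h_e hj hi (r := 0) (by rw [rootForm_comm]; exact hr)).comm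
  have h3 : qPow (-hEl Xᵘ j) * qPow (-hEl Xᵘ i) = qPow (-hEl Xᵘ i) * qPow (-hEl Xᵘ j) :=
    mul_qPow_of_mul_eq (qPow_comm (by simp only [neg_mul, mul_neg, hX.hh j i]))
  refine eq_of_forall_mul_right fun t => ?_
  simp [ListComm] at hl
  rw [eEl_coprod, eEl_coprod]
  simp only [mul_add, add_mul, mul_sub, sub_mul, mul_assoc, hl,
    mul_rule h1, mul_rule h2, mul_rule h3]
  abel

lemma coprod_ff (hY : UCartan Yᵘ) (hc : CommFam X Y) {i j : ℕ}
    (hi : i ∈ Icc 1 n) (hj : j ∈ Icc 1 n) (hij : i + 2 ≤ j) :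
    fEl (coprod X Y)ᵘ i * fEl (coprod X Y)ᵘ j -
        fEl (coprod X Y)ᵘ j * fEl (coprod X Y)ᵘ i =
      (fEl Xᵘ i * fEl Xᵘ j - fEl Xᵘ j * fEl Xᵘ i) * (qPow (hEl Yᵘ i) * qPow (hEl Yᵘ j)) +
        (fEl Yᵘ i * fEl Yᵘ j - fEl Yᵘ j * fEl Yᵘ i) := by
  have hl := listComm_of_bicomm hc (l := [fEl Yᵘ i, fEl Yᵘ j, qPow (hEl Yᵘ i), qPow (hEl Yᵘ j)])
    (l' := [fEl Xᵘ i, fEl Xᵘ j]) (by simp [bicomm_fEl, bicomm_qPow_h]) (by simp [bicomm_fEl])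
  have hr : -rootForm i j = 0 := by rw [rootForm, if_neg (by omega), if_neg (by omega)]; rfl
  have h1 := (hY.qc_h_f hi hj hr).comm
  have h2 := (hY.qc_h_f hj hi (r := 0) (by rw [rootForm_comm]; exact hr)).comm
  have h3 : qPow (hEl Yᵘ j) * qPow (hEl Yᵘ i) = qPow (hEl Yᵘ i) * qPow (hEl Yᵘ j) :=
    mul_qPow_of_mul_eq (qPow_comm (hY.hh j i))
  refine eq_of_forall_mul_right fun t => ?_
  simp [ListComm] at hl
  rw [fEl_coprod, fEl_coprod]
  simp only [mul_add, add_mul, sub_mul, mul_assoc, hl, mul_rule h1, mul_rule h2, mul_rule h3]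
  abel

lemma coprod_e_serre (hX : UCartan Xᵘ) (hc : CommFam X Y) {i j : ℕ}
    (hi : i ∈ Icc 1 n) (hj : j ∈ Icc 1 n) (hij : i + 1 = j ∨ j + 1 = i) :
    qComm 1 (qComm (-1) (eEl (coprod X Y)ᵘ i) (eEl (coprod X Y)ᵘ j))
        (eEl (coprod X Y)ᵘ j) =
      qComm 1 (qComm (-1) (eEl Xᵘ i) (eEl Xᵘ j)) (eEl Xᵘ j) +
        qPow (-hEl Xᵘ i) * qPow (-hEl Xᵘ j) * qPow (-hEl Xᵘ j) *
          qComm 1 (qComm (-1) (eEl Yᵘ i) (eEl Yᵘ j)) (eEl Yᵘ j) := by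
  have hl := listComm_of_bicomm hc (l := [eEl Yᵘ i, eEl Yᵘ j])
    (l' := [eEl Xᵘ i, eEl Xᵘ j, qPow (-hEl Xᵘ i), qPow (-hEl Xᵘ j)])
    (by simp [bicomm_eEl]) (by simp [bicomm_eEl, bicomm_qPow_neg_h])
  have hr : -rootForm i j = 1 := by rw [rootForm, if_neg (by omega), if_pos hij]; norm_num
  have h1 := (hX.qc_neg_h_e hi hj hr).eq
  have h2 := (hX.qc_neg_h_e hj hi (r := 1) (by rw [rootForm_comm]; exact hr)).eq
  have h4 := (hX.qc_neg_h_e hj hj (r := -2) (by rw [rootForm, if_pos rfl])).eq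
  have h3 : qPow (-hEl Xᵘ j) * qPow (-hEl Xᵘ i) = qPow (-hEl Xᵘ i) * qPow (-hEl Xᵘ j) :=
    mul_qPow_of_mul_eq (qPow_comm (by simp only [neg_mul, mul_neg, hX.hh j i]))
  rw [qInt_neg_two] at h4
  refine eq_of_forall_mul_right fun t => ?_
  simp [ListComm] at hl
  rw [eEl_coprod, eEl_coprod]
  simp only [qComm, mul_add, add_mul, mul_sub, sub_mul, smul_mul_assoc, mul_smul_comm, mul_assoc,
    hl,
    smul_add, smul_sub, mul_rule h1, mul_rule h2, mul_rule h3, mul_rule h4]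
  match_scalars <;> grind [qInt_one_mul]

lemma coprod_f_serre (hY : UCartan Yᵘ) (hc : CommFam X Y) {i j : ℕ}
    (hi : i ∈ Icc 1 n) (hj : j ∈ Icc 1 n) (hij : i + 1 = j ∨ j + 1 = i) :
    qComm 1 (qComm (-1) (fEl (coprod X Y)ᵘ i) (fEl (coprod X Y)ᵘ j))
        (fEl (coprod X Y)ᵘ j) =
      qComm 1 (qComm (-1) (fEl Xᵘ i) (fEl Xᵘ j)) (fEl Xᵘ j) *
          (qPow (hEl Yᵘ i) * qPow (hEl Yᵘ j) * qPow (hEl Yᵘ j)) +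
        qComm 1 (qComm (-1) (fEl Yᵘ i) (fEl Yᵘ j)) (fEl Yᵘ j) := by
  have hl := listComm_of_bicomm hc (l := [fEl Yᵘ i, fEl Yᵘ j, qPow (hEl Yᵘ i), qPow (hEl Yᵘ j)])
    (l' := [fEl Xᵘ i, fEl Xᵘ j]) (by simp [bicomm_fEl, bicomm_qPow_h]) (by simp [bicomm_fEl])
  have hr : -rootForm i j = 1 := by rw [rootForm, if_neg (by omega), if_pos hij]; norm_num
  have h1 := (hY.qc_h_f hi hj hr).eq
  have h2 := (hY.qc_h_f hj hi (r := 1) (by rw [rootForm_comm]; exact hr)).eq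
  have h4 := (hY.qc_h_f hj hj (r := -2) (by rw [rootForm, if_pos rfl])).eq
  have h3 : qPow (hEl Yᵘ j) * qPow (hEl Yᵘ i) = qPow (hEl Yᵘ i) * qPow (hEl Yᵘ j) :=
    mul_qPow_of_mul_eq (qPow_comm (hY.hh j i))
  rw [qInt_neg_two] at h4
  refine eq_of_forall_mul_right fun t => ?_
  simp [ListComm] at hl
  rw [fEl_coprod, fEl_coprod]
  simp only [qComm, mul_add, add_mul, mul_sub, sub_mul, smul_mul_assoc, mul_smul_comm, mul_assoc,
    hl,
    smul_add, smul_sub, mul_rule h1, mul_rule h2, mul_rule h3, mul_rule h4]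
  match_scalars <;> grind [qInt_one_mul]

end CoproductURel

/-! ### Cartan relations and lowering operators for the coproduct -/

section EntryRelations

variable {n : ℕ} {B : Type*} [Ring B] [Algebra BaseRing B] [IsAdicComplete adicIdeal B]
variable {y : DIdx n → B}

lemma URel.fullWt_colEntry (hx : URel yᵘ) (hy : DCartan y) {i : ℕ} (hi : 1 ≤ i)
    (hi' : i ≤ n + 1) : FullWt y (wt (n + 1) i) (colEntry y i) := by
  unfold colEntry
  split_ifs with h
  · exact (hx.fullWt_colTop hy _).cast (by funext k; rw [h, wt, sub_self]; rfl)
  · exact hx.fullWt_col hy hi (by omega) le_rfl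

lemma URel.fullWt_rowEntry (hx : URel yᵘ) (hy : DCartan y) {i : ℕ} (hi : 1 ≤ i)
    (hi' : i ≤ n + 1) : FullWt y (wt i 1) (rowEntry y i) := by
  unfold rowEntry
  split_ifs with h
  · exact (hx.fullWt_rowBot hy _).cast (by funext k; rw [h, wt, sub_self]; rfl)
  · exact hx.fullWt_row hy le_rfl (by omega) hi'

lemma URel.f_colEntry_ne (hx : URel yᵘ) (hy : DCartan y) {i k : ℕ} (hi : 1 ≤ i)
    (hi' : i ≤ n + 1) (hk : k ∈ Icc 1 n) (h : i ≠ k) (h' : i ≠ k + 1) {d : ℤ}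
    (hd : (if k = 1 then 1 else 0) = d) : QC d (fEl yᵘ k) (colEntry y i) := by
  have hf := hx.fullWt_f hy hk
  rw [mem_Icc] at hk
  unfold colEntry
  split_ifs with hiN
  · refine QC.symm (r := -d) ?_ |>.cast (neg_neg d)
    exact hf.colTop_comm hx hy (by omega) (by grind [wt])
      (by grind [wt])
  · have h1 : QC (if k = n then 1 else 0) (fEl yᵘ k) (lowerEl yᵘ (n + 1) i) := by
      split_ifs with hkn
      · rw [hkn]
        exact hx.f_lowerEl_top (by omega)
      · rw [qc_zero_iff]
        rcases lt_or_gt_of_ne h with h | h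
        · exact hx.f_lowerEl_inner h (by omega)
        · exact hx.f_lowerEl_far (by omega) (by omega)
    refine (h1.mul_right (hf.qc_add (by omega) (by omega) rfl).symm).cast ?_
    grind [wt]

lemma URel.f_colEntry_self (hx : URel yᵘ) (hy : DCartan y) (hn : 1 < n) {k : ℕ}
    (hk : k ∈ Icc 1 n) {d : ℤ} (hd : (if k = 1 then 0 else -1) = d) :
    QC d (fEl yᵘ k) (colEntry y k) := by
  have hf := hx.fullWt_f hy hk
  rw [mem_Icc] at hk
  unfold colEntry
  rw [if_neg (by omega)]
  have h1 : QC (if k = n then 0 else -1) (fEl yᵘ k) (lowerEl yᵘ (n + 1) k) := by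
    split_ifs with hkn
    · rw [hkn, qc_zero_iff, lowerEl_self]
    · exact hx.f_lowerEl_bot (by omega)
  refine (h1.mul_right (hf.qc_add (by omega) (by omega) rfl).symm).cast ?_
  grind [wt]

lemma URel.f_colEntry_succ (hx : URel yᵘ) (hy : DCartan y) (hn : 1 < n) {k : ℕ}
    (hk : k ∈ Icc 1 n) {d : ℤ} (hd : (if k = 1 then 1 else 0) = d) : fEl yᵘ k * colEntry y (k + 1) =
      (qInt 1 * qInt d) • (colEntry y (k + 1) * fEl yᵘ k) - qInt 1 • colEntry y k := by
  have hf := hx.fullWt_f hy hk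
  rw [mem_Icc] at hk
  unfold colEntry
  rw [if_neg (by omega : k ≠ n + 1)]
  split_ifs with hkn
  · obtain rfl : k = n := by omega
    have hd0 : d = 0 := by rw [← hd, if_neg (by omega)]
    have h1 := hf.colTop_pos hx hy (m := k + 1) (r := 0) (by omega) (by grind [wt]) (by grind [wt])
    rw [qInt_zero, zero_add (1 : ℤ), one_smul] at h1
    have h2 : col y (k + 1) k = fEl yᵘ k * (qDiff • colTop y (k + 1) + grp y (k + 1)) := by
      rw [hx.qDiff_smul_colTop hy, sub_add_cancel, col, lowerEl_self]
    rw [h1, h2, hd0, qInt_zero, mul_one, mul_add, mul_smul_comm, qDiff]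
    match_scalars <;> grind [qInt_one_mul]
  · have h1 := hx.lowerEl_split (i := k) (k := k + 1) (j := n + 1) (by omega) (by omega)
    rw [lowerEl_self, qComm] at h1
    have h2 : QC d (fEl yᵘ k) κ[y,n + 1] := (hf.qc_add (r := -d) (by omega) (by omega)
        (by grind [wt])).symm.cast (neg_neg d)
    simp only [col, h1, sub_mul, smul_mul_assoc, mul_assoc, h2.eq, mul_smul_comm]
    match_scalars <;> grind [qInt_one_mul]

lemma URel.qc_h_rowEntry (hx : URel yᵘ) (hy : DCartan y) {i k : ℕ} (hi : 1 ≤ i)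
    (hi' : i ≤ n + 1) (hk : k ∈ Icc 1 n) {d : ℤ}
    (hd : (if i = k then 1 else 0) - (if i = k + 1 then 1 else 0) - (if k = 1 then 1 else 0) = d) :
    QC d (qPow (hEl yᵘ k)) (rowEntry y i) :=
  (hx.fullWt_rowEntry hy hi hi').qc_h hk (by grind [wt])

lemma URel.f_rowEntry_ne (hx : URel yᵘ) (hy : DCartan y) {i k : ℕ} (hi : 1 ≤ i)
    (hi' : i ≤ n + 1) (hk : k ∈ Icc 1 n) (h : i ≠ k) :
    fEl yᵘ k * rowEntry y i = rowEntry y i * fEl yᵘ k := by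
  have hf := hx.fullWt_f hy hk
  rw [mem_Icc] at hk
  rw [← qc_zero_iff]
  unfold rowEntry
  split_ifs with hi1
  · exact qc_zero_iff.2 (hf.rowBot_comm (by omega) (by grind [wt])).symm
  · have h1 : QC (if i = k + 1 then (if k = 1 then 0 else 1) else if k = 1 then -1 else 0)
        (fEl yᵘ k) (lowerEl yᵘ i 1) := by
      split_ifs with h1 h2 h2
      · rw [h1, h2, lowerEl_self, qc_zero_iff]
      · rw [h1]
        exact hx.f_lowerEl_top (by omega)
      · rw [h2]
        exact hx.f_lowerEl_bot (by omega)
      · rw [qc_zero_iff]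
        rcases lt_or_gt_of_ne h with h | h
        · exact hx.f_lowerEl_far (by omega) (by omega)
        · exact hx.f_lowerEl_inner (by omega) (by omega)
    refine (h1.mul_right (hf.qc_add (by omega) (by omega) rfl).symm).cast ?_
    grind [wt]

lemma URel.f_rowEntry_self (hx : URel yᵘ) (hy : DCartan y) {k : ℕ}
    (hk : k ∈ Icc 1 n) {d : ℤ} (hd : (if k = 1 then -1 else 0) = d) :
    fEl yᵘ k * rowEntry y k = rowEntry y k * fEl yᵘ k +
      qInt d • (rowEntry y (k + 1) * qPow (hEl yᵘ k)) := by
  have hc := hx.commute_eDiag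
  have hf := hx.fullWt_f hy hk
  rw [mem_Icc] at hk
  have h3 : ∀ i, qPow (eDiag yᵘ i + eDiag yᵘ (k + 1)) * qPow (hEl yᵘ k) =
      qPow (eDiag yᵘ i + eDiag yᵘ k) := fun i => by
    rw [← eDiag_sub_eDiag_succ hk.1, ← qPow_add]
    · congr 1
      abel
    · exact ((hc i k).sub_right (hc i (k + 1))).add_left ((hc _ k).sub_right (hc _ _))
  unfold rowEntry
  rw [if_neg (by omega : k + 1 ≠ 1)]
  split_ifs at hd ⊢ with hk1
  · subst hk1
    have h1 := hf.rowBot_neg (r := 1) (by omega) (by grind [wt])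
    have h2 : row y 1 (1 + 1) * qPow (hEl yᵘ 1) = fEl yᵘ 1 * (qDiff • rowBot y 1 + 1) := by
      rw [qDiff_smul_rowBot, sub_add_cancel, row, lowerEl_self, mul_assoc, h3 1]
    rw [h1, h2, ← hd, mul_add, mul_smul_comm, mul_one, qDiff, qInt_neg_two]
    match_scalars <;> grind [qInt_one_mul]
  · have h1 := lowerEl_succ (x := uPart y) (i := 1) (j := k) (by omega)
    have h2 : QC 1 (fEl yᵘ k) κ[y,k] := (hf.qc_add (r := -1) (by omega) (by omega)
        (by grind [wt])).symm.cast (neg_neg 1)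
    rw [qComm] at h1
    rw [← hd, qInt_zero, one_smul, row, row, mul_assoc (lowerEl _ (k + 1) 1), h3 1, h1]
    simp only [sub_mul, smul_mul_assoc, mul_assoc, h2.eq, mul_smul_comm]
    match_scalars <;> grind [qInt_one_mul]

lemma URel.e_colEntry_ne (hx : URel yᵘ) (hy : DCartan y) {i k : ℕ} (hi : 1 ≤ i)
    (hi' : i ≤ n + 1) (hk : 1 < k ∧ k < n) (h : i ≠ k) :
    eEl yᵘ k * colEntry y i = colEntry y i * eEl yᵘ k := by
  have hkm : k ∈ Icc 1 n := mem_Icc.2 (by omega)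
  unfold colEntry
  split_ifs with hiN
  · have h1 := (hx.fullWt_e hy hkm).colTop_comm hx hy (m := n + 1) (r := 0) (by omega)
      (by grind [wt]) (by grind [wt])
    rw [h1, qInt_zero, one_smul]
  · exact (hx.e_col_ne hy hi (by omega) le_rfl hkm (by omega) (r := 0) (by grind [wt])).comm

lemma URel.e_colEntry_self (hx : URel yᵘ) (hy : DCartan y) {k : ℕ} (hk : 1 < k ∧ k < n) :
    eEl yᵘ k * colEntry y k = colEntry y k * eEl yᵘ k -
      qInt (-1) • (colEntry y (k + 1) * qPow (-hEl yᵘ k)) := by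
  have hE := hx.fullWt_e hy (mem_Icc.2 (by omega) : k ∈ Icc 1 n)
  have h1 := hx.e_lowerEl_bot (i := k) (j := n + 1) (by omega) (by omega) le_rfl
  have h2 : eEl yᵘ k * κ[y,n + 1] = κ[y,n + 1] * eEl yᵘ k :=
    (hE.qc_add (r := 0) (by omega) (by omega) (by grind [wt])).comm.symm
  have h3 : qPow (-hEl yᵘ k) * κ[y,n + 1] = κ[y,n + 1] * qPow (-hEl yᵘ k) :=
    ((hx.fullWt_qPow_neg_h hy (by omega : 1 ≤ k)).qc_add (i := 1) (j := n + 1) (r := 0) (by omega)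
      (by omega) rfl).comm.symm
  unfold colEntry
  rw [if_neg (by omega), if_neg (by omega)]
  simp only [col, sub_mul, smul_mul_assoc, mul_assoc, mul_rule h1, h2, h3]

lemma URel.qc_neg_h_colEntry (hx : URel yᵘ) (hy : DCartan y) {i k : ℕ} (hi : 1 ≤ i)
    (hi' : i ≤ n + 1) (hk : 1 < k ∧ k < n) {d : ℤ}
    (hd : (if i = k then 1 else 0) - (if i = k + 1 then 1 else 0) = d) :
    QC d (qPow (-hEl yᵘ k)) (colEntry y i) :=
  (hx.fullWt_colEntry hy hi hi').qc_neg_h (mem_Icc.2 (by omega)) (by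
    grind [wt])

lemma URel.qc_e_rowEntry (hx : URel yᵘ) (hy : DCartan y) {i k : ℕ} (hi : 1 ≤ i)
    (hi' : i ≤ n + 1) (hk : 1 < k ∧ k < n) (h : i ≠ k + 1) {d : ℤ}
    (hd : (if i = k then -1 else 0) = d) : QC d (eEl yᵘ k) (rowEntry y i) := by
  have hkm : k ∈ Icc 1 n := mem_Icc.2 (by omega)
  unfold rowEntry
  split_ifs with hi1
  · rw [← hd, if_neg (by omega), qc_zero_iff]
    exact ((hx.fullWt_e hy hkm).rowBot_comm (by omega) (by grind [wt])).symm
  · exact hx.e_row_ne hy le_rfl (by omega) hi' hkm (by omega)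
      (by grind [wt])

end EntryRelations

section CoproductXi

variable {n : ℕ} {B : Type*} [Ring B] [Algebra BaseRing B] [IsAdicComplete adicIdeal B]
variable {X Y : DIdx n → B}

lemma bicomm_colEntry (x : DIdx n → B) (i : ℕ) : colEntry x i ∈ bicomm x := by
  unfold colEntry
  split_ifs
  exacts [bicomm_colTop x _, bicomm_col x _ _]

lemma bicomm_rowEntry (x : DIdx n → B) (i : ℕ) : rowEntry x i ∈ bicomm x := by
  unfold rowEntry
  split_ifs
  exacts [bicomm_rowBot x _, bicomm_row x _ _]

/-- A sum of which only two adjacent terms fail to commute with `u`, while their sum does. -/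
lemma mul_sum_comm_of_pair {S : Finset ℕ} {T : ℕ → B} {u : B} {k : ℕ} (hk : k ∈ S)
    (hk' : k + 1 ∈ S) (h : ∀ i ∈ S, i ≠ k → i ≠ k + 1 → u * T i = T i * u)
    (hp : u * (T k + T (k + 1)) = (T k + T (k + 1)) * u) :
    u * ∑ i ∈ S, T i = (∑ i ∈ S, T i) * u := by
  have hk'' : k + 1 ∈ S.erase k := Finset.mem_erase.2 ⟨by omega, hk'⟩
  rw [← Finset.add_sum_erase S T hk, ← Finset.add_sum_erase _ T hk'', ← add_assoc, mul_add,
    add_mul, hp, mul_sum, sum_mul]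
  congr 1
  refine sum_congr rfl fun i hi => ?_
  simp only [Finset.mem_erase] at hi
  exact h i hi.2.2 hi.2.1 hi.1

lemma coprod_f_etaPart (hX : URel Xᵘ) (hX' : DCartan X) (hY : URel Yᵘ)
    (hY' : DCartan Y) (hc : CommFam X Y) (hn : 1 < n) {k : ℕ} (hk : k ∈ Icc 1 n) :
    fEl (coprod X Y)ᵘ k * etaPart X Y = etaPart X Y * fEl (coprod X Y)ᵘ k := by
  have hk0 := hk
  rw [mem_Icc] at hk
  have hl : ∀ i, ListComm [fEl Yᵘ k, qPow (hEl Yᵘ k), rowEntry Y i]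
      [fEl Xᵘ k, colEntry X k, colEntry X (k + 1), colEntry X i] := fun i =>
    listComm_of_bicomm hc (by simp [bicomm_fEl, bicomm_qPow_h, bicomm_rowEntry])
      (by simp [bicomm_fEl, bicomm_colEntry])
  simp [ListComm] at hl
  refine mul_sum_comm_of_pair (k := k) (mem_Icc.2 (by omega)) (mem_Icc.2 (by omega))
    (fun i hi h1 h2 => ?_) ?_
  · rw [mem_Icc] at hi
    have r1 := hX.f_colEntry_ne hX' hi.1 hi.2 hk0 h1 h2 rfl
    have r2 := hY.qc_h_rowEntry hY' hi.1 hi.2 hk0 (d := -(if k = 1 then 1 else 0))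
      (by rw [if_neg h1, if_neg h2]; ring)
    have r3 := hY.f_rowEntry_ne hY' hi.1 hi.2 hk0 h1
    have e2 := qInt_mul_neg (if k = 1 then 1 else 0)
    refine eq_of_forall_mul_right fun t => ?_
    rw [fEl_coprod]
    simp only [mul_add, add_mul, smul_mul_assoc, mul_smul_comm, mul_assoc, hl i,
      mul_rule r1.eq, mul_rule r2.eq, mul_rule r3]
    generalize qInt (if k = 1 then 1 else 0) = P at *
    generalize qInt (-(if k = 1 then 1 else 0)) = Q at *
    match_scalars <;> grind [qInt_one_mul]
  · have r1 := (hX.f_colEntry_self hX' hn hk0 rfl).eq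
    have r2 := hX.f_colEntry_succ hX' hn hk0 rfl
    have r3 := (hY.qc_h_rowEntry hY' (i := k) (by omega) (by omega) hk0 rfl).eq
    have r4 := (hY.qc_h_rowEntry hY' (i := k + 1) (by omega) (by omega) hk0 rfl).eq
    have r5 := hY.f_rowEntry_self hY' hk0 rfl
    have r6 := hY.f_rowEntry_ne hY' (i := k + 1) (by omega) (by omega) hk0 (by omega)
    have hl1 := hl k
    have hl2 := hl (k + 1)
    rw [if_pos rfl, if_neg (by omega)] at r3
    rw [if_neg (by omega), if_pos rfl] at r4
    refine eq_of_forall_mul_right fun t => ?_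
    rw [fEl_coprod]
    split_ifs at r1 r2 r3 r4 r5
    · rw [show (1 - 0 - 1 : ℤ) = 0 by norm_num] at r3
      rw [show (0 - 1 - 1 : ℤ) = -2 by norm_num] at r4
      rw [qInt_zero, one_smul] at r1 r3
      rw [qInt_neg_two] at r4
      simp only [mul_add, add_mul, sub_mul, smul_mul_assoc, mul_smul_comm, mul_assoc, hl1, hl2,
        mul_rule r1, mul_rule r2, mul_rule r3, mul_rule r4, mul_rule r5, mul_rule r6]
      match_scalars <;> grind [qInt_one_mul]
    · rw [show (1 - 0 - 0 : ℤ) = 1 by norm_num] at r3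
      rw [show (0 - 1 - 0 : ℤ) = -1 by norm_num] at r4
      rw [qInt_zero, one_smul] at r5
      rw [qInt_zero, mul_one] at r2
      simp only [mul_add, add_mul, sub_mul, smul_mul_assoc, mul_smul_comm, mul_assoc, hl1, hl2,
        mul_rule r1, mul_rule r2, mul_rule r3, mul_rule r4, mul_rule r5, mul_rule r6]
      match_scalars <;> grind [qInt_one_mul]

lemma coprod_e_etaPart (hX : URel Xᵘ) (hX' : DCartan X) (hY : URel Yᵘ)
    (hY' : DCartan Y) (hc : CommFam X Y) {k : ℕ} (hk : 1 < k ∧ k < n) :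
    eEl (coprod X Y)ᵘ k * etaPart X Y = etaPart X Y * eEl (coprod X Y)ᵘ k := by
  have hl : ∀ i, ListComm [eEl Yᵘ k, rowEntry Y i]
      [eEl Xᵘ k, qPow (-hEl Xᵘ k), colEntry X i, colEntry X k, colEntry X (k + 1)] :=
    fun i => listComm_of_bicomm hc (by simp [bicomm_eEl, bicomm_rowEntry])
      (by simp [bicomm_eEl, bicomm_qPow_neg_h, bicomm_colEntry])
  simp [ListComm] at hl
  refine mul_sum_comm_of_pair (k := k) (mem_Icc.2 (by omega)) (mem_Icc.2 (by omega))
    (fun i hi h1 h2 => ?_) ?_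
  · rw [mem_Icc] at hi
    have r1 := hX.e_colEntry_ne hX' hi.1 hi.2 hk h1
    have r2 := (hX.qc_neg_h_colEntry hX' hi.1 hi.2 hk (d := 0)
      (by rw [if_neg h1, if_neg h2]; rfl)).comm
    have r3 := (hY.qc_e_rowEntry hY' hi.1 hi.2 hk h2 (d := 0) (if_neg h1)).comm
    refine eq_of_forall_mul_right fun t => ?_
    rw [eEl_coprod]
    simp only [mul_add, add_mul, mul_assoc, hl i, mul_rule r1, mul_rule r2, mul_rule r3]
  · have r1 := hX.e_colEntry_self hX' hk
    have r2 := hX.e_colEntry_ne hX' (i := k + 1) (by omega) (by omega) hk (by omega)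
    have r3 := (hX.qc_neg_h_colEntry hX' (i := k) (by omega) (by omega) hk (d := 1)
      (by rw [if_pos rfl, if_neg (by omega)]; rfl)).eq
    have r4 := (hX.qc_neg_h_colEntry hX' (i := k + 1) (by omega) (by omega) hk (d := -1)
      (by rw [if_neg (by omega), if_pos rfl]; rfl)).eq
    have r5 := (hY.qc_e_rowEntry hY' (i := k) (by omega) (by omega) hk (by omega) (d := -1)
      (if_pos rfl)).eq
    have r6 : eEl Yᵘ k * rowEntry Y (k + 1) =
        qInt 1 • (rowEntry Y (k + 1) * eEl Yᵘ k) + rowEntry Y k := by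
      unfold rowEntry
      rw [if_neg (by omega), if_neg (by omega)]
      exact hY.e_row_top hY' hk.1 hk.2.le
    have hl1 := hl k
    have hl2 := hl (k + 1)
    refine eq_of_forall_mul_right fun t => ?_
    rw [eEl_coprod]
    simp only [mul_add, add_mul, sub_mul, smul_mul_assoc, mul_smul_comm, mul_assoc,
      hl1, hl2, smul_add, mul_rule r1, mul_rule r2, mul_rule r3, mul_rule r4, mul_rule r5,
      mul_rule r6]
    match_scalars <;> grind [qInt_one_mul]

lemma coprod_mem {S : Subalgebra BaseRing B} (hX : bicomm X ≤ S) (hY : bicomm Y ≤ S) (a : DIdx n) :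
    coprod X Y a ∈ S := by
  match a with
  | .u (.h i) =>
    exact add_mem (hX (bicomm_gen X _)) (hY (bicomm_gen Y _))
  | .u (.e i) =>
    exact add_mem (hX (bicomm_gen X _))
      (mul_mem (hX (bicomm_qPow (neg_mem (bicomm_gen X _)))) (hY (bicomm_gen Y _)))
  | .u (.f i) =>
    exact add_mem (mul_mem (hX (bicomm_gen X _)) (hY (bicomm_qPow (bicomm_gen Y _))))
      (hY (bicomm_gen Y _))
  | .xi =>
    exact add_mem (add_mem (hX (bicomm_gen X _))
      (mul_mem (hX (bicomm_grp X _)) (hY (bicomm_gen Y _)))) (Subalgebra.smul_mem _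
        (sum_mem fun i _ => mul_mem (hX (bicomm_colEntry X i)) (hY (bicomm_rowEntry Y i))) _)
  | .hd =>
    exact add_mem (hX (bicomm_gen X _)) (hY (bicomm_gen Y _))

lemma DCartan.hd_bicomm {x : DIdx n → B} (hx : DCartan x) {a : B} (ha : a ∈ bicomm x) :
    x .hd * a = a * x .hd := by
  rw [bicomm, Subalgebra.mem_centralizer_iff] at ha
  refine ha (x .hd) ?_
  rintro _ ⟨c, rfl⟩
  exact (hx.hd_comm c).symm

lemma coprod_hd_comm (hX' : DCartan X) (hY' : DCartan Y)
    (hc : CommFam X Y) (a : DIdx n) :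
    coprod X Y .hd * coprod X Y a = coprod X Y a * coprod X Y .hd := by
  have h := coprod_mem (S := Subalgebra.centralizer BaseRing {X .hd + Y .hd}) (X := X) (Y := Y)
    (fun b hb => by
      rw [Subalgebra.mem_centralizer_iff]
      rintro _ rfl
      rw [mul_add, add_mul, hX'.hd_bicomm hb, bicomm_comm hc hb (bicomm_gen Y .hd)])
    (fun b hb => by
      rw [Subalgebra.mem_centralizer_iff]
      rintro _ rfl
      rw [mul_add, add_mul, hY'.hd_bicomm hb, bicomm_comm hc (bicomm_gen X .hd) hb]) a
  rw [Subalgebra.mem_centralizer_iff] at h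
  exact h _ rfl

lemma coprod_dcartan (hX : URel Xᵘ) (hX' : DCartan X) (hY : URel Yᵘ)
    (hY' : DCartan Y) (hc : CommFam X Y) (hn : 1 < n) : DCartan (coprod X Y) := by
  refine DCartan.of_hasWt (coprod_hd_comm hX' hY' hc) hn fun k h1 h2 => ?_
  rw [eDiag_coprod]
  have hl : ∀ {a : B} {w : ℕ → ℤ}, FullWt X w a → a ∈ bicomm X →
      HasWt (eDiag Xᵘ k + eDiag Yᵘ k) (w k) a := fun ha hb =>
    ((ha.eps k h1 h2).add_left (hasWt_zero_iff.2
      (bicomm_comm hc hb (bicomm_eDiag Y k)).symm)).cast (add_zero _)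
  have hr : ∀ {a : B} {w : ℕ → ℤ}, FullWt Y w a → a ∈ bicomm Y →
      HasWt (eDiag Xᵘ k + eDiag Yᵘ k) (w k) a := fun ha hb =>
    ((hasWt_zero_iff.2 (bicomm_comm hc (bicomm_eDiag X k) hb)).add_left
      (ha.eps k h1 h2)).cast (zero_add _)
  refine HasWt.add_right (HasWt.add_right ?_ ?_) (HasWt.smul_right _ ?_)
  · exact hl (DCartan.fullWt_xi hX' hn) (bicomm_gen X _)
  · exact ((hl (hX.fullWt_grp hX' _) (bicomm_grp X _)).mul
      (hr (DCartan.fullWt_xi hY' hn) (bicomm_gen Y _))).cast (zero_add _)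
  · refine Finset.sum_induction _ (fun a => HasWt (eDiag Xᵘ k + eDiag Yᵘ k)
      (thetaWt n k) a) (fun a b => HasWt.add_right) HasWt.zero_right fun i hi => ?_
    rw [mem_Icc] at hi
    exact ((hl (hX.fullWt_colEntry hX' hi.1 hi.2) (bicomm_colEntry X i)).mul
      (hr (hY.fullWt_rowEntry hY' hi.1 hi.2) (bicomm_rowEntry Y i))).cast (by
        simp only [wt, thetaWt]
        ring)

lemma coprod_xi_f (hX : URel Xᵘ) (hX' : DCartan X) (hY : URel Yᵘ)
    (hY' : DCartan Y) (hc : CommFam X Y) (hn : 1 < n) {k : ℕ} (hk : k ∈ Icc 1 n) :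
    coprod X Y .xi * fEl (coprod X Y)ᵘ k - fEl (coprod X Y)ᵘ k * coprod X Y .xi =
      (X .xi * fEl Xᵘ k - fEl Xᵘ k * X .xi) * qPow (hEl Yᵘ k) +
        grp X (n + 1) * (Y .xi * fEl Yᵘ k - fEl Yᵘ k * Y .xi) := by
  have hl := listComm_of_bicomm hc (l := [Y .xi, fEl Yᵘ k, qPow (hEl Yᵘ k)])
    (l' := [X .xi, fEl Xᵘ k, grp X (n + 1)]) (by simp [bicomm_gen, bicomm_fEl, bicomm_qPow_h])
    (by simp [bicomm_gen, bicomm_fEl, bicomm_grp])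
  simp [ListComm] at hl
  have r1 := ((hX.fullWt_f hX' hk).qc_grp (m := n + 1) (by omega) rfl).eq
  have r2 := ((DCartan.fullWt_xi hY' hn).qc_h hk (r := wt (k + 1) k 1 - wt (k + 1) k (n + 1))
    (by grind [wt])).eq
  have h := coprod_f_etaPart hX hX' hY hY' hc hn hk
  have e : coprod X Y .xi = X .xi + grp X (n + 1) * Y .xi + eta • etaPart X Y := rfl
  rw [e, add_mul, mul_add, smul_mul_assoc, mul_smul_comm, h, add_sub_add_right_eq_sub, fEl_coprod]
  refine eq_of_forall_mul_right fun t => ?_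
  simp only [mul_add, add_mul, mul_sub, sub_mul, smul_mul_assoc, mul_smul_comm, mul_assoc, hl,
    mul_rule r1, mul_rule r2]
  abel

lemma coprod_e_xi (hX : URel Xᵘ) (hX' : DCartan X) (hY : URel Yᵘ)
    (hY' : DCartan Y) (hc : CommFam X Y) (hn : 1 < n) {k : ℕ}
    (hk : 1 < k ∧ k < n) :
    eEl (coprod X Y)ᵘ k * coprod X Y .xi - coprod X Y .xi * eEl (coprod X Y)ᵘ k =
      (eEl Xᵘ k * X .xi - X .xi * eEl Xᵘ k) + grp X (n + 1) * qPow (-hEl Xᵘ k) *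
          (eEl Yᵘ k * Y .xi - Y .xi * eEl Yᵘ k) := by
  have hkm : k ∈ Icc 1 n := mem_Icc.2 (by omega)
  have hl := listComm_of_bicomm hc (l := [Y .xi, eEl Yᵘ k])
    (l' := [X .xi, eEl Xᵘ k, grp X (n + 1), qPow (-hEl Xᵘ k)]) (by simp [bicomm_gen, bicomm_eEl])
    (by simp [bicomm_gen, bicomm_eEl, bicomm_grp, bicomm_qPow_neg_h])
  simp [ListComm] at hl
  have r1 := ((hX.fullWt_e hX' hkm).qc_grp (m := n + 1) (r := 0) (by omega)
    (by grind [wt])).comm.symm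
  have r2 := ((DCartan.fullWt_xi hX' hn).qc_neg_h hkm (r := 0) (by grind [wt])).comm
  have r3 := ((hX.fullWt_grp hX' (n + 1)).qc_neg_h hkm (r := 0) rfl).comm
  have h := coprod_e_etaPart hX hX' hY hY' hc hk
  have e : coprod X Y .xi = X .xi + grp X (n + 1) * Y .xi + eta • etaPart X Y := rfl
  rw [e, add_mul, mul_add, smul_mul_assoc, mul_smul_comm, h, add_sub_add_right_eq_sub, eEl_coprod]
  refine eq_of_forall_mul_right fun t => ?_
  simp only [mul_add, add_mul, mul_sub, sub_mul, mul_assoc, hl,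
    mul_rule r1, mul_rule r2, mul_rule r3]
  abel

end CoproductXi

/-! ### The coefficient of `η` in the coproduct -/

section EtaPart

variable {n : ℕ} {B : Type*} [Ring B] [Algebra BaseRing B] [IsAdicComplete adicIdeal B]
variable {X Y : DIdx n → B}

lemma etaPart_eq (hn : 1 < n) : etaPart X Y =
    col X (n + 1) 1 * rowBot Y 1 + pairSum X Y (n + 1) 1 (Icc 2 n) +
      colTop X (n + 1) * row Y 1 (n + 1) := by
  have h : Icc 1 (n + 1) = insert 1 (insert (n + 1) (Icc 2 n)) := by
    ext k
    simp only [mem_Icc, mem_insert]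
    omega
  rw [etaPart, h, sum_insert (by simp [mem_Icc]; omega), sum_insert (by simp [mem_Icc])]
  have h2 : ∑ i ∈ Icc 2 n, colEntry X i * rowEntry Y i = pairSum X Y (n + 1) 1 (Icc 2 n) :=
    sum_congr rfl fun i hi => by
      rw [mem_Icc] at hi
      rw [colEntry, rowEntry, if_neg (by omega), if_neg (by omega)]
  rw [h2, colEntry, rowEntry, colEntry, rowEntry, if_neg (by omega), if_pos rfl, if_pos rfl,
    if_neg (by omega)]
  abel

lemma etaPart_eq_first (hn : 1 < n) : etaPart X Y =
    col X (n + 1) 1 * rowBot Y 1 + col X (n + 1) 2 * row Y 1 2 +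
      pairSum X Y (n + 1) 1 (Icc 3 n) + colTop X (n + 1) * row Y 1 (n + 1) := by
  have h : Icc 2 n = insert 2 (Icc 3 n) := by
    ext k
    simp only [mem_Icc, mem_insert]
    omega
  rw [etaPart_eq hn, h, pairSum, sum_insert (by simp [mem_Icc]), pairSum, ← add_assoc]

lemma etaPart_eq_last (hn : 1 < n) : etaPart X Y =
    col X (n + 1) 1 * rowBot Y 1 + col X (n + 1) n * row Y 1 n +
      pairSum X Y (n + 1) 1 (Icc 2 (n - 1)) + colTop X (n + 1) * row Y 1 (n + 1) := by
  have h : Icc 2 n = insert n (Icc 2 (n - 1)) := by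
    ext k
    simp only [mem_Icc, mem_insert]
    omega
  rw [etaPart_eq hn, h, pairSum, sum_insert (by simp [mem_Icc]; omega), pairSum, ← add_assoc]

/-- The root vectors of the coproduct. -/
lemma lowerEl_coprod (hY : URel Yᵘ) (hY' : DCartan Y)
    (hc : CommFam X Y) {i j : ℕ} (hi : 1 ≤ i) (hij : i < j) (hj : j ≤ n + 1) :
    lowerEl (coprod X Y)ᵘ j i = lowerEl Xᵘ j i * qPow (eDiag Yᵘ i - eDiag Yᵘ j) +
        lowerEl Yᵘ j i + qDiff • ∑ k ∈ Ioo i j, lowerEl Xᵘ j k * (lowerEl Yᵘ k i *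
          qPow (eDiag Yᵘ k - eDiag Yᵘ j)) := by
  induction j, hij using Nat.le_induction with
  | base =>
    rw [lowerEl_self, lowerEl_self, lowerEl_self, fEl_coprod, eDiag_sub_eDiag_succ hi,
      Finset.sum_eq_zero (fun k hk => ?_), smul_zero, add_zero]
    rw [mem_Ioo] at hk
    omega
  | succ j hij ih =>
    have hij' : i < j := hij
    have hjm : j ∈ Icc 1 n := mem_Icc.2 (by omega)
    have hl : ∀ k, ListComm [fEl Yᵘ j, qPow (hEl Yᵘ j), lowerEl Yᵘ k i,
          qPow (eDiag Yᵘ k - eDiag Yᵘ j)]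
        [fEl Xᵘ j, lowerEl Xᵘ j k] := fun k =>
      listComm_of_bicomm hc
        (by simp [bicomm_fEl, bicomm_qPow_h, bicomm_lowerEl, bicomm_qPow, bicomm_eDiag, sub_mem])
        (by simp [bicomm_fEl, bicomm_lowerEl])
    simp [ListComm] at hl
    have hcm := hY.commute_eDiag
    have r0 : ∀ k, qPow (eDiag Yᵘ k - eDiag Yᵘ j) * qPow (hEl Yᵘ j) =
        qPow (eDiag Yᵘ k - eDiag Yᵘ (j + 1)) := fun k => by
      rw [← eDiag_sub_eDiag_succ (by omega : 1 ≤ j), ← qPow_add, sub_add_sub_cancel]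
      exact (((hcm k j).sub_left (hcm j j)).sub_right ((hcm k _).sub_left (hcm j _)))
    have r0' : ∀ k, qPow (hEl Yᵘ j) * qPow (eDiag Yᵘ k - eDiag Yᵘ j) =
        qPow (eDiag Yᵘ k - eDiag Yᵘ (j + 1)) := fun k => by
      rw [← eDiag_sub_eDiag_succ (by omega : 1 ≤ j), ← qPow_add, add_comm, sub_add_sub_cancel]
      exact (((hcm k j).sub_left (hcm j j)).sub_right ((hcm k _).sub_left (hcm j _))).symm
    have hf := hY.fullWt_f hY' hjm
    have r1 : ∀ k, 1 ≤ k → k < j → qPow (eDiag Yᵘ k - eDiag Yᵘ j) * fEl Yᵘ j = qInt 1 • (fEl Yᵘ j *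
          qPow (eDiag Yᵘ k - eDiag Yᵘ j)) := fun k h1 h2 =>
      (hf.qc_sub (by omega) (by omega) (by grind [wt])).eq
    have h1 : qComm (-1) (fEl Xᵘ j * qPow (hEl Yᵘ j) + fEl Yᵘ j)
        (lowerEl Xᵘ j i * qPow (eDiag Yᵘ i - eDiag Yᵘ j)) = qComm (-1) (fEl Xᵘ j) (lowerEl Xᵘ j i) *
          qPow (eDiag Yᵘ i - eDiag Yᵘ (j + 1)) := by
      refine eq_of_forall_mul_right fun t => ?_
      simp only [qComm, mul_add, add_mul, sub_mul, smul_mul_assoc, mul_smul_comm,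
        mul_assoc, smul_add, hl, mul_rule (r0 i), mul_rule (r0' i), mul_rule (r1 i hi hij')]
      match_scalars <;> grind [qInt_one_mul]
    have h2 : qComm (-1) (fEl Xᵘ j * qPow (hEl Yᵘ j) + fEl Yᵘ j)
        (lowerEl Yᵘ j i) = qDiff • (fEl Xᵘ j * (lowerEl Yᵘ j i *
          qPow (eDiag Yᵘ j - eDiag Yᵘ (j + 1)))) +
        qComm (-1) (fEl Yᵘ j) (lowerEl Yᵘ j i) := by
      have r2 := ((hY.fullWt_lowerEl hY' hi hij' (by omega)).qc_h hjm (r := 1) (by grind [wt])).eq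
      refine eq_of_forall_mul_right fun t => ?_
      rw [eDiag_sub_eDiag_succ (by omega : 1 ≤ j)]
      simp only [qComm, mul_add, add_mul, sub_mul, smul_mul_assoc, mul_smul_comm,
        mul_assoc, smul_add, ← hl, mul_rule r2, qDiff]
      match_scalars <;> grind [qInt_one_mul]
    have h3 : ∀ k ∈ Ioo i j, qComm (-1) (fEl Xᵘ j * qPow (hEl Yᵘ j) + fEl Yᵘ j)
          (lowerEl Xᵘ j k * (lowerEl Yᵘ k i * qPow (eDiag Yᵘ k - eDiag Yᵘ j))) =
          lowerEl Xᵘ (j + 1) k * (lowerEl Yᵘ k i *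
            qPow (eDiag Yᵘ k - eDiag Yᵘ (j + 1))) := fun k hk => by
      rw [mem_Ioo] at hk
      have r2 := ((hY.fullWt_lowerEl hY' hi hk.1 (by omega)).qc_h hjm (r := 0) (by grind [wt])).comm
      have r3 := hY.f_lowerEl_far hk.1 (Or.inr hk.2)
      rw [lowerEl_succ hk.2]
      refine eq_of_forall_mul_right fun t => ?_
      simp only [qComm, mul_add, add_mul, sub_mul, smul_mul_assoc, mul_smul_comm,
        mul_assoc, smul_add, hl, mul_rule (r0 k), mul_rule (r0' k),
        mul_rule (r1 k (by omega) hk.2), mul_rule r2, mul_rule r3]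
      match_scalars <;> grind [qInt_one_mul]
    have h4 : ∀ u a b d : B, qComm (-1) u (a + b + qDiff • d) =
        qComm (-1) u a + qComm (-1) u b + qDiff • qComm (-1) u d := fun u a b d => by
      simp only [qComm, mul_add, add_mul, smul_add, smul_sub, mul_smul_comm, smul_mul_assoc,
        smul_comm qDiff]
      abel
    have h5 : ∀ (u : B) (T : ℕ → B), qComm (-1) u (∑ k ∈ Ioo i j, T k) =
        ∑ k ∈ Ioo i j, qComm (-1) u (T k) := fun u T => by
      simp only [qComm, mul_sum, sum_mul, smul_sum, Finset.sum_sub_distrib]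
    have h6 : Ioo i (j + 1) = insert j (Ioo i j) := by
      ext k
      simp only [mem_Ioo, mem_insert]
      omega
    rw [lowerEl_succ hij', ih (by omega), fEl_coprod, h4, h1, h2, h5, sum_congr rfl h3, h6,
      sum_insert (by simp), lowerEl_self, lowerEl_succ hij', lowerEl_succ hij', smul_add]
    abel

lemma URel.eTilde_eq_col (hY : URel Yᵘ) (hY' : DCartan Y) (hn : 1 < n) :
    eTilde Yᵘ = col Y (n + 1) 1 := by
  have h := ((hY.fullWt_lowerEl hY' le_rfl (by omega : 1 < n + 1) le_rfl).qc_add (i := 1)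
    (j := n + 1) (r := 0) (by omega) (by omega) (by grind [wt])).comm
  exact h

/-- The shift of `ξ_{δ-θ}` in the singular root vector, for the coproduct. -/
lemma col_coprod (hX : URel Xᵘ) (hX' : DCartan X) (hY : URel Yᵘ)
    (hY' : DCartan Y) (hc : CommFam X Y) (hn : 1 < n) :
    col (coprod X Y) (n + 1) 1 = qDiff • etaPart X Y + col X (n + 1) 1 +
      grp X (n + 1) * row Y 1 (n + 1) := by
  have hcm := hY.commute_eDiag
  have hK : qPow (eDiag Xᵘ 1 + eDiag Yᵘ 1 + (eDiag Xᵘ (n + 1) + eDiag Yᵘ (n + 1))) = κ[X,n + 1] *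
        κ[Y,n + 1] := by
    rw [add_add_add_comm]
    exact qPow_add (bicomm_comm hc (add_mem (bicomm_eDiag X _) (bicomm_eDiag X _))
      (add_mem (bicomm_eDiag Y _) (bicomm_eDiag Y _)))
  have hl : ∀ k, ListComm [lowerEl Yᵘ k 1, qPow (eDiag Yᵘ k - eDiag Yᵘ (n + 1))]
      [κ[X,n + 1]] := fun k =>
    listComm_of_bicomm hc (by simp [bicomm_lowerEl, bicomm_qPow, bicomm_eDiag, sub_mem])
      (by simp [bicomm_qPow, bicomm_eDiag, add_mem])
  simp [ListComm] at hl
  have r : ∀ k, qPow (eDiag Yᵘ k - eDiag Yᵘ (n + 1)) * κ[Y,n + 1] = κ[Y,k] := fun k => by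
    rw [← qPow_add]
    · congr 1
      abel
    · exact ((hcm k 1).add_right (hcm k _)).sub_left ((hcm _ 1).add_right (hcm _ _))
  have h1 : lowerEl Xᵘ (n + 1) 1 * qPow (eDiag Yᵘ 1 - eDiag Yᵘ (n + 1)) * (κ[X,n + 1] *
        κ[Y,n + 1]) =
      col X (n + 1) 1 * (qDiff • rowBot Y 1 + 1) := by
    rw [qDiff_smul_rowBot, sub_add_cancel, col, mul_assoc, (hl 1).2, r 1, ← mul_assoc]
  have h2 : lowerEl Yᵘ (n + 1) 1 * (κ[X,n + 1] * κ[Y,n + 1]) =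
      (qDiff • colTop X (n + 1) + grp X (n + 1)) * row Y 1 (n + 1) := by
    rw [hX.qDiff_smul_colTop hX', sub_add_cancel, (hl _).1, row]
  have h3 : (∑ k ∈ Ioo 1 (n + 1), lowerEl Xᵘ (n + 1) k * (lowerEl Yᵘ k 1 *
          qPow (eDiag Yᵘ k - eDiag Yᵘ (n + 1)))) *
      (κ[X,n + 1] * κ[Y,n + 1]) = pairSum X Y (n + 1) 1 (Icc 2 n) := by
    have h : Icc 2 n = Ioo 1 (n + 1) := by
      ext k
      simp only [mem_Icc, mem_Ioo]
      omega
    rw [pairSum, sum_mul, h]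
    refine sum_congr rfl fun k _ => ?_
    rw [mul_assoc, mul_assoc, (hl k).2, (hl k).1, r k, ← mul_assoc]
    rfl
  rw [col, lowerEl_coprod hY hY' hc le_rfl (by omega) le_rfl, eDiag_coprod, eDiag_coprod, hK,
    add_mul, add_mul, smul_mul_assoc, h1, h2, h3, etaPart_eq hn]
  simp only [smul_add, mul_add, add_mul, mul_smul_comm, smul_mul_assoc, mul_one]
  abel

end EtaPart

/-! ### The relations of the Drinfeldian for the coproduct -/

section CoproductRelations

variable {n : ℕ} {B : Type*} [Ring B] [Algebra BaseRing B]

/-- The cubic Serre expression of `e_{α_1}` and `ξ_{δ-θ}`. -/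
def serreFirst (y : DIdx n → B) : B := qComm 1 (eEl yᵘ 1) (qComm (-1) (eEl yᵘ 1) (y .xi))

/-- The cubic Serre expression of `e_{α_n}` and `ξ_{δ-θ}`. -/
def serreLast (y : DIdx n → B) : B := qComm 1 (qComm (-1) (y .xi) (eEl yᵘ n)) (eEl yᵘ n)

/-- The difference of the two sides of the first `η`-deformed Serre relation. -/
def etaSerreFirst (y : DIdx n → B) : B := qComm 1 (qComm (-1) (eEl yᵘ 1) (y .xi)) (y .xi) -
    eta • (qInt (-1) • (qComm (-1) (eEl yᵘ 1) (col y (n + 1) 1) * y .xi) -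
      col y (n + 1) 1 * qComm (-1) (eEl yᵘ 1) (y .xi))

/-- The difference of the two sides of the second `η`-deformed Serre relation. -/
def etaSerreLast (y : DIdx n → B) : B := qComm 1 (y .xi) (qComm (-1) (y .xi) (eEl yᵘ n)) -
    eta • (qInt 2 • (qComm (-1) (col y (n + 1) 1) (eEl yᵘ n) * y .xi) -
      qInt 1 • (col y (n + 1) 1 * qComm (-1) (y .xi) (eEl yᵘ n)))

variable [IsAdicComplete adicIdeal B] {X Y y : DIdx n → B}

lemma URel.eta_serre_first_iff (hx : URel yᵘ) (hy : DCartan y) (hn : 1 < n) :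
    etaSerreFirst y = 0 ↔ qComm 1 (qComm (-1) (eEl yᵘ 1) (y .xi)) (y .xi) = eta • (κ[y,n + 1] *
          (qInt (-2) • ((eEl yᵘ 1 * lowerEl yᵘ (n + 1) 1 -
              lowerEl yᵘ (n + 1) 1 * eEl yᵘ 1) * y .xi) -
            lowerEl yᵘ (n + 1) 1 * qComm (-1) (eEl yᵘ 1) (y .xi))) := by
  have e : col y (n + 1) 1 = κ[y,n + 1] * lowerEl yᵘ (n + 1) 1 := (hx.eTilde_eq_col hy hn).symm
  have h1 : κ[y,n + 1] * eEl yᵘ 1 = qInt 1 • (eEl yᵘ 1 * κ[y,n + 1]) :=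
    ((hx.fullWt_e hy (mem_Icc.2 (by omega))).qc_add (by omega) (by omega) (by grind [wt])).eq
  rw [etaSerreFirst, sub_eq_zero]
  refine Eq.congr_right ?_
  congr 1
  rw [e, qInt_neg_two]
  generalize qComm (-1) (eEl yᵘ 1) (y .xi) = w
  refine eq_of_forall_mul_right fun t => ?_
  simp only [qComm, mul_sub, sub_mul, smul_mul_assoc, mul_smul_comm, mul_assoc, smul_sub,
    mul_rule h1]
  match_scalars <;> grind [qInt_one_mul]

lemma URel.eta_serre_last_iff (hx : URel yᵘ) (hy : DCartan y) (hn : 1 < n) :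
    etaSerreLast y = 0 ↔ qComm 1 (y .xi) (qComm (-1) (y .xi) (eEl yᵘ n)) =
      eta • (qPow (eDiag yᵘ 1 + eDiag yᵘ (n + 1) + 1) *
          (qInt 1 • ((lowerEl yᵘ (n + 1) 1 * eEl yᵘ n - eEl yᵘ n * lowerEl yᵘ (n + 1) 1) * y .xi) -
            lowerEl yᵘ (n + 1) 1 * qComm (-1) (y .xi) (eEl yᵘ n))) := by
  have hK : qPow (eDiag yᵘ 1 + eDiag yᵘ (n + 1) + 1) = qInt 1 • κ[y,n + 1] := by
    rw [qPow_add (Commute.one_right _), ← Int.cast_one (R := B), qPow_intCast, mul_smul_comm,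
      mul_one]
  have e : col y (n + 1) 1 = κ[y,n + 1] * lowerEl yᵘ (n + 1) 1 := (hx.eTilde_eq_col hy hn).symm
  have h1 : κ[y,n + 1] * eEl yᵘ n = qInt (-1) • (eEl yᵘ n * κ[y,n + 1]) :=
    ((hx.fullWt_e hy (mem_Icc.2 (by omega))).qc_add (by omega) (by omega) (by grind [wt])).eq
  rw [etaSerreLast, sub_eq_zero]
  refine Eq.congr_right ?_
  congr 1
  rw [e, hK, qInt_two]
  generalize qComm (-1) (y .xi) (eEl yᵘ n) = w
  refine eq_of_forall_mul_right fun t => ?_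
  simp only [qComm, mul_sub, sub_mul, smul_mul_assoc, mul_smul_comm, mul_assoc, smul_sub,
    mul_rule h1]
  match_scalars <;> grind [qInt_one_mul]

lemma coprod_xi (X Y : DIdx n → B) :
    coprod X Y .xi = X .xi + grp X (n + 1) * Y .xi + eta • etaPart X Y := rfl

lemma XiRel.listComm_first (hc : CommFam X Y) :
    ListComm [eEl Yᵘ 1, rowBot Y 1, row Y 1 2, row Y 1 (n + 1), rowBot Y 2, row Y 2 (n + 1), Y .xi]
      [eEl Xᵘ 1, qPow (-hEl Xᵘ 1), col X (n + 1) 1, col X (n + 1) 2,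
        colTop X (n + 1), grp X (n + 1), X .xi] :=
  listComm_of_bicomm hc (by simp [bicomm_eEl, bicomm_row, bicomm_rowBot, bicomm_gen])
    (by simp [bicomm_eEl, bicomm_qPow_neg_h, bicomm_col, bicomm_colTop, bicomm_grp, bicomm_gen])

lemma XiRel.listComm_last (hc : CommFam X Y) :
    ListComm [eEl Yᵘ n, rowBot Y 1, row Y 1 n, row Y 1 (n + 1), Y .xi]
      [eEl Xᵘ n, qPow (-hEl Xᵘ n), col X (n + 1) 1, col X (n + 1) n,
        colTop X (n + 1), grp X (n + 1), col X n 1, colTop X n, X .xi] :=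
  listComm_of_bicomm hc (by simp [bicomm_eEl, bicomm_row, bicomm_rowBot, bicomm_gen])
    (by simp [bicomm_eEl, bicomm_qPow_neg_h, bicomm_col, bicomm_colTop, bicomm_grp, bicomm_gen])

lemma coprod_serreFirst (hX : XiRel X) (hY : XiRel Y) (hc : CommFam X Y)
    (hn : 1 < n) : serreFirst (coprod X Y) = serreFirst X + qPow (-hEl Xᵘ 1) * qPow (-hEl Xᵘ 1) *
      grp X (n + 1) * serreFirst Y := by
  have h1 := colFirst hX.1 hX.2.1 hn
  have h2 := rowFirst hY.1 hY.2.1 hn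
  have h3 := sumFirst hX.1 hX.2.1 hY.1 hY.2.1 hc hn
  have h4 := XiRel.listComm_first hc
  have h5 := xiFirst hX hY hc hn
  obtain ⟨f1, f2, f3, f4⟩ := first_relations h1 h2 h3 h4 h5 eta
  rw [serreFirst, eEl_coprod, coprod_xi, etaPart_eq_first hn, f1, f3]
  rfl

lemma coprod_serreLast (hX : XiRel X) (hY : XiRel Y) (hc : CommFam X Y)
    (hn : 1 < n) : serreLast (coprod X Y) = serreLast X + grp X (n + 1) * qPow (-hEl Xᵘ n) *
      qPow (-hEl Xᵘ n) * serreLast Y := by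
  have h1 := colLast hX.1 hX.2.1 hn
  have h2 := rowLast hY.1 hY.2.1 hn
  have h3 := sumLast hX.1 hX.2.1 hY.1 hY.2.1 hc hn
  have h4 := XiRel.listComm_last hc
  have h5 := xiLast hX hY hc hn
  obtain ⟨f1, f2, f3, f4⟩ := last_relations h1 h2 h3 h4 h5 eta
  rw [serreLast, eEl_coprod, coprod_xi, etaPart_eq_last hn, f1, f3]
  rfl

lemma coprod_etaSerreFirst (hX : XiRel X) (hY : XiRel Y) (hc : CommFam X Y)
    (hn : 1 < n) : etaSerreFirst (coprod X Y) = etaSerreFirst X +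
      qPow (-hEl Xᵘ 1) * grp X (n + 1) * grp X (n + 1) * etaSerreFirst Y := by
  have h1 := colFirst hX.1 hX.2.1 hn
  have h2 := rowFirst hY.1 hY.2.1 hn
  have h3 := sumFirst hX.1 hX.2.1 hY.1 hY.2.1 hc hn
  have h4 := XiRel.listComm_first hc
  have h5 := xiFirst hX hY hc hn
  obtain ⟨f1, f2, f3, f4⟩ := first_relations h1 h2 h3 h4 h5 eta
  have h6 : qComm (-1) (eEl Xᵘ 1) (col X (n + 1) 1) =
      -(qInt (-1) • (col X (n + 1) 2 * qPow (-hEl Xᵘ 1))) := by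
    rw [qComm, h1.E_a₁]
    abel
  have h7 : qComm (-1) (eEl Yᵘ 1) (row Y 1 (n + 1)) = -(qInt (-1) • (row Y 2 (n + 1))) := by
    rw [qComm, h2.E_β₃]
    abel
  have h8 : etaSerreFirst Y = qComm 1 (qComm (-1) (eEl Yᵘ 1) (Y .xi)) (Y .xi) -
      eta • (qInt (-1) • (qComm (-1) (eEl Yᵘ 1) (row Y 1 (n + 1)) * Y .xi) -
        row Y 1 (n + 1) * qComm (-1) (eEl Yᵘ 1) (Y .xi)) := rfl
  rw [h8, h7, etaSerreFirst, etaSerreFirst, h6, col_coprod hX.1 hX.2.1 hY.1 hY.2.1 hc hn,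
    eEl_coprod, coprod_xi, etaPart_eq_first hn, f1, f2, f4]

lemma coprod_etaSerreLast (hX : XiRel X) (hY : XiRel Y) (hc : CommFam X Y)
    (hn : 1 < n) : etaSerreLast (coprod X Y) = etaSerreLast X +
      grp X (n + 1) * grp X (n + 1) * qPow (-hEl Xᵘ n) * etaSerreLast Y := by
  have h1 := colLast hX.1 hX.2.1 hn
  have h2 := rowLast hY.1 hY.2.1 hn
  have h3 := sumLast hX.1 hX.2.1 hY.1 hY.2.1 hc hn
  have h4 := XiRel.listComm_last hc
  have h5 := xiLast hX hY hc hn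
  obtain ⟨f1, f2, f3, f4⟩ := last_relations h1 h2 h3 h4 h5 eta
  have h6 : qComm (-1) (col X (n + 1) 1) (eEl Xᵘ n) = -(qInt (-1) • col X n 1) := by
    rw [qComm, h1.E_a₁]
    match_scalars <;> grind [qInt_one_mul]
  have h7 : qComm (-1) (row Y 1 (n + 1)) (eEl Yᵘ n) = -(qInt (-1) • (row Y 1 n)) := by
    rw [qComm, h2.E_β₃]
    match_scalars <;> grind [qInt_one_mul]
  have h8 : etaSerreLast Y = qComm 1 (Y .xi) (qComm (-1) (Y .xi) (eEl Yᵘ n)) -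
      eta • (qInt 2 • (qComm (-1) (row Y 1 (n + 1)) (eEl Yᵘ n) * Y .xi) -
        qInt 1 • (row Y 1 (n + 1) * qComm (-1) (Y .xi) (eEl Yᵘ n))) := rfl
  rw [h8, h7, etaSerreLast, etaSerreLast, h6, col_coprod hX.1 hX.2.1 hY.1 hY.2.1 hc hn,
    eEl_coprod, coprod_xi, etaPart_eq_last hn, f1, f2, f4]

lemma coprod_zeta (hX : URel Xᵘ) (hX' : DCartan X) (hY : URel Yᵘ)
    (hY' : DCartan Y) (hZ : URel (coprod X Y)ᵘ) (hZ' : DCartan (coprod X Y))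
    (hc : CommFam X Y) (hn : 1 < n) :
    zetaEl (coprod X Y) (eTilde (coprod X Y)ᵘ) =
      zetaEl X (eTilde Xᵘ) + grp X (n + 1) * zetaEl Y (eTilde Yᵘ) := by
  have e : col Y (n + 1) 1 = row Y 1 (n + 1) := rfl
  rw [hZ.eTilde_eq_col hZ' hn, hX.eTilde_eq_col hX' hn, hY.eTilde_eq_col hY' hn, zetaEl, zetaEl,
    zetaEl, col_coprod hX hX' hY hY' hc hn, coprod_xi, e]
  simp only [smul_add, mul_sub, mul_smul_comm, smul_comm qDiff eta]
  abel

lemma coprod_urel (hX : URel Xᵘ) (hY : URel Yᵘ)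
    (hc : CommFam X Y) : URel (coprod X Y)ᵘ := by
  refine ⟨coprod_ucartan hX.1 hY.1 hc, fun a b h => ?_⟩
  cases h with
  | ef_same i hi =>
    rw [coprod_ef hX.1 hY.1 hc hi hi, hX.2 _ _ (.ef_same i hi), hY.2 _ _ (.ef_same i hi),
      coprod_qNum_h hc]
  | ef_ne i j hi hj hij =>
    rw [coprod_ef hX.1 hY.1 hc hi hj, hX.2 _ _ (.ef_ne i j hi hj hij),
      hY.2 _ _ (.ef_ne i j hi hj hij), zero_mul, mul_zero, add_zero]
  | ee_far i j hi hj hij =>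
    rw [← sub_eq_zero, coprod_ee hX.1 hc hi hj hij,
      sub_eq_zero.2 (hX.2 _ _ (.ee_far i j hi hj hij)),
      sub_eq_zero.2 (hY.2 _ _ (.ee_far i j hi hj hij)), mul_zero, add_zero]
  | ff_far i j hi hj hij =>
    rw [← sub_eq_zero, coprod_ff hY.1 hc hi hj hij,
      sub_eq_zero.2 (hX.2 _ _ (.ff_far i j hi hj hij)),
      sub_eq_zero.2 (hY.2 _ _ (.ff_far i j hi hj hij)), zero_mul, add_zero]
  | e_serre i j hi hj hij =>
    rw [coprod_e_serre hX.1 hc hi hj hij, hX.2 _ _ (.e_serre i j hi hj hij),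
      hY.2 _ _ (.e_serre i j hi hj hij), mul_zero, add_zero]
  | f_serre i j hi hj hij =>
    rw [coprod_f_serre hY.1 hc hi hj hij, hX.2 _ _ (.f_serre i j hi hj hij),
      hY.2 _ _ (.f_serre i j hi hj hij), zero_mul, add_zero]

/-- The relations between `ξ_{δ-θ}` and the root vectors, as vanishing of expressions. -/
lemma XiRel.drel (hy : XiRel y) (hn : 1 < n)
    (he : ∀ k, 1 < k ∧ k < n → eEl yᵘ k * y .xi - y .xi * eEl yᵘ k = 0)
    (h1 : serreFirst y = 0) (h2 : serreLast y = 0) (h3 : etaSerreFirst y = 0)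
    (h4 : etaSerreLast y = 0) : DRel y := by
  refine ⟨hy.1, hy.2.1, fun a b h => ?_⟩
  cases h with
  | xi_f i hi => exact sub_eq_zero.2 (hy.2.2 i)
  | e_xi i hi =>
    rw [mem_Icc] at hi
    exact he i (by omega)
  | serre_first => exact h1
  | serre_last => exact h2
  | eta_serre_first => exact (hy.1.eta_serre_first_iff hy.2.1 hn).1 h3
  | eta_serre_last => exact (hy.1.eta_serre_last_iff hy.2.1 hn).1 h4

lemma DRel.e_xi (hy : DRel y) {k : ℕ} (hk : 1 < k ∧ k < n) :
    eEl yᵘ k * y .xi - y .xi * eEl yᵘ k = 0 :=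
  hy.2.2 _ _ (.e_xi k (mem_Icc.2 (by omega)))

lemma DRel.serreFirst (hy : DRel y) : serreFirst y = 0 := hy.2.2 _ _ .serre_first

lemma DRel.serreLast (hy : DRel y) : serreLast y = 0 := hy.2.2 _ _ .serre_last

lemma DRel.etaSerreFirst (hy : DRel y) (hn : 1 < n) : etaSerreFirst y = 0 :=
  (hy.1.eta_serre_first_iff hy.2.1 hn).2 (hy.2.2 _ _ .eta_serre_first)

lemma DRel.etaSerreLast (hy : DRel y) (hn : 1 < n) : etaSerreLast y = 0 :=
  (hy.1.eta_serre_last_iff hy.2.1 hn).2 (hy.2.2 _ _ .eta_serre_last)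

/-- A family commutes with `f_{α_k}` for all `k` if it does for `1 ≤ k ≤ n`. -/
lemma xiRel_of_mem (hx : URel yᵘ) (hy : DCartan y)
    (h : ∀ k ∈ Icc 1 n, y .xi * fEl yᵘ k - fEl yᵘ k * y .xi = 0) : XiRel y := by
  refine ⟨hx, hy, fun k => ?_⟩
  by_cases hk : k ∈ Icc 1 n
  · exact sub_eq_zero.1 (h k hk)
  · rw [fEl_of_notMem hk, mul_zero, zero_mul]

/-- The coproduct of two commuting families satisfying the relations of the Drinfeldian satisfies
them too. -/
lemma coprod_drel (hX : DRel X) (hY : DRel Y) (hc : CommFam X Y) (hn : 1 < n) :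
    DRel (coprod X Y) := by
  have hX1 := hX.xiRel
  have hY1 := hY.xiRel
  have hZ : XiRel (coprod X Y) := by
    refine xiRel_of_mem (coprod_urel hX.1 hY.1 hc)
      (coprod_dcartan hX.1 hX1.2.1 hY.1 hY1.2.1 hc hn) fun k hk => ?_
    rw [coprod_xi_f hX.1 hX1.2.1 hY.1 hY1.2.1 hc hn hk, hX1.2.2, hY1.2.2, sub_self, sub_self,
      zero_mul, mul_zero, add_zero]
  refine hZ.drel hn (fun k hk => ?_) ?_ ?_ ?_ ?_
  · rw [coprod_e_xi hX.1 hX1.2.1 hY.1 hY1.2.1 hc hn hk, hX.e_xi hk, hY.e_xi hk, mul_zero, add_zero]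
  · rw [coprod_serreFirst hX1 hY1 hc hn, hX.serreFirst, hY.serreFirst, mul_zero, add_zero]
  · rw [coprod_serreLast hX1 hY1 hc hn, hX.serreLast, hY.serreLast, mul_zero, add_zero]
  · rw [coprod_etaSerreFirst hX1 hY1 hc hn, hX.etaSerreFirst hn, hY.etaSerreFirst hn, mul_zero,
      add_zero]
  · rw [coprod_etaSerreLast hX1 hY1 hc hn, hX.etaSerreLast hn, hY.etaSerreLast hn, mul_zero,
      add_zero]

end CoproductRelations

/-! ### Coassociativity on generators -/

section Coassociativity

variable {n : ℕ} {B : Type*} [Ring B] [Algebra BaseRing B] [IsAdicComplete adicIdeal B]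
variable {X Y V : DIdx n → B}

lemma qPow_add_of_mem (hc : CommFam X Y) {u v : B} (hu : u ∈ bicomm X)
    (hv : v ∈ bicomm Y) : qPow (u + v) = qPow u * qPow v :=
  qPow_add (bicomm_comm hc hu hv)

lemma grp_coprod (hc : CommFam X Y) (m : ℕ) :
    grp (coprod X Y) m = grp X m * grp Y m := by
  have e : (coprod X Y) .hd = X .hd + Y .hd := rfl
  have hm : ∀ x : DIdx n → B, eDiag xᵘ 1 - eDiag xᵘ m - x .hd ∈ bicomm x := fun x =>
    sub_mem (sub_mem (bicomm_eDiag x _) (bicomm_eDiag x _)) (bicomm_gen x _)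
  rw [grp, grp, grp, ← qPow_add_of_mem hc (hm X) (hm Y), eDiag_coprod, eDiag_coprod, e]
  congr 1
  abel

/-- The left tensor factors of the coproduct of `ξ_{δ-θ}`, evaluated on a coproduct. -/
lemma colEntry_coprod (hX : URel Xᵘ) (hX' : DCartan X) (hY : URel Yᵘ)
    (hY' : DCartan Y) (hc : CommFam X Y) {i : ℕ} (hi : 1 ≤ i) (hi' : i ≤ n + 1) :
    colEntry (coprod X Y) i = colEntry X i * κ[Y,i] + grp X (n + 1) * colEntry Y i +
      qDiff • ∑ k ∈ Ioc i (n + 1), colEntry X k * col Y k i := by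
  have hcm := hY.commute_eDiag
  have hd := hY.commute_half_eDiag hY'
  have hdX := hX.commute_half_eDiag hX'
  have hcX := hX.commute_eDiag
  rcases hi'.eq_or_lt with rfl | hi'
  · have m1 : ∀ x : DIdx n → B, halfHd x + eDiag xᵘ (n + 1) ∈ bicomm x := fun x =>
      add_mem (bicomm_halfHd x) (bicomm_eDiag x _)
    have m2 : ∀ x : DIdx n → B, eDiag xᵘ 1 - halfHd x ∈ bicomm x := fun x =>
      sub_mem (bicomm_eDiag x _) (bicomm_halfHd x)
    have e1 : qPow (-(halfHd X + eDiag Xᵘ (n + 1))) * qPow (eDiag Xᵘ 1 - halfHd X) =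
        grp X (n + 1) := by
      rw [← qPow_add, grp, ← halfHd_add X]
      · congr 1
        abel
      · exact (((hdX 1).sub_right (Commute.refl _)).add_left
          ((hcX _ 1).sub_right (hdX _).symm)).neg_left
    have e2 : qPow (halfHd Y + eDiag Yᵘ (n + 1)) * qPow (eDiag Yᵘ 1 - halfHd Y) = κ[Y,n + 1] := by
      rw [← qPow_add]
      · congr 1
        abel
      · exact ((hd 1).sub_right (Commute.refl _)).add_left ((hcm _ 1).sub_right (hd _).symm)
    have hl := listComm_of_bicomm hc
      (l := [qPow (halfHd Y + eDiag Yᵘ (n + 1)), qNum (halfHd Y + eDiag Yᵘ (n + 1))])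
      (l' := [qPow (eDiag Xᵘ 1 - halfHd X)])
      (by simp [bicomm_qPow (m1 Y), bicomm_qNum (m1 Y)]) (by simp [bicomm_qPow (m2 X)])
    simp [ListComm] at hl
    rw [Finset.Ioc_self, sum_empty, smul_zero, add_zero, colEntry, if_pos rfl, colEntry,
      if_pos rfl, colEntry, if_pos rfl, colTop, halfHd_coprod, eDiag_coprod, eDiag_coprod,
      add_add_add_comm, qNum_add (bicomm_comm hc (m1 X) (m1 Y)), add_sub_add_comm,
      qPow_add_of_mem hc (m2 X) (m2 Y), add_mul, mul_assoc, mul_assoc, hl.1, hl.2, e2, ← mul_assoc,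
      ← mul_assoc (qPow (-_)), e1]
    rfl
  · have hK : qPow (eDiag (coprod X Y)ᵘ 1 + eDiag (coprod X Y)ᵘ (n + 1)) =
        κ[X,n + 1] * κ[Y,n + 1] := by
      rw [eDiag_coprod, eDiag_coprod, add_add_add_comm]
      exact qPow_add_of_mem hc (add_mem (bicomm_eDiag X _) (bicomm_eDiag X _))
        (add_mem (bicomm_eDiag Y _) (bicomm_eDiag Y _))
    have hl : ∀ k, ListComm [lowerEl Yᵘ k i, qPow (eDiag Yᵘ k - eDiag Yᵘ (n + 1))]
        [κ[X,n + 1]] := fun k =>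
      listComm_of_bicomm hc (by simp [bicomm_lowerEl, bicomm_qPow, bicomm_eDiag, sub_mem])
        (by simp [bicomm_qPow, bicomm_eDiag, add_mem])
    simp [ListComm] at hl
    have r : ∀ k, qPow (eDiag Yᵘ k - eDiag Yᵘ (n + 1)) * κ[Y,n + 1] = κ[Y,k] := fun k => by
      rw [← qPow_add]
      · congr 1
        abel
      · exact ((hcm k 1).add_right (hcm k _)).sub_left ((hcm _ 1).add_right (hcm _ _))
    have h1 : lowerEl Xᵘ (n + 1) i * qPow (eDiag Yᵘ i - eDiag Yᵘ (n + 1)) * (κ[X,n + 1] *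
          κ[Y,n + 1]) =
        colEntry X i * κ[Y,i] := by
      rw [colEntry, if_neg hi'.ne, col, mul_assoc, (hl i).2, r i, ← mul_assoc]
    have h2 : lowerEl Yᵘ (n + 1) i * (κ[X,n + 1] * κ[Y,n + 1]) =
        (qDiff • colTop X (n + 1) + grp X (n + 1)) * col Y (n + 1) i := by
      rw [hX.qDiff_smul_colTop hX', sub_add_cancel, (hl _).1, col]
    have h3 : (∑ k ∈ Ioo i (n + 1), lowerEl Xᵘ (n + 1) k * (lowerEl Yᵘ k i *
            qPow (eDiag Yᵘ k - eDiag Yᵘ (n + 1)))) *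
        (κ[X,n + 1] * κ[Y,n + 1]) = ∑ k ∈ Ioo i (n + 1), colEntry X k * col Y k i := by
      rw [sum_mul]
      refine sum_congr rfl fun k hk => ?_
      rw [mem_Ioo] at hk
      rw [mul_assoc, mul_assoc, (hl k).2, (hl k).1, r k, ← mul_assoc, colEntry, if_neg hk.2.ne, col,
        col]
    have h4 : Ioc i (n + 1) = insert (n + 1) (Ioo i (n + 1)) := by
      ext k
      simp only [Finset.mem_Ioc, mem_Ioo, mem_insert]
      omega
    have h5 : colEntry Y i = col Y (n + 1) i := if_neg hi'.ne
    have h6 : colEntry X (n + 1) = colTop X (n + 1) := if_pos rfl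
    rw [h4, sum_insert (by simp), h5, h6]
    conv_lhs => rw [colEntry, if_neg hi'.ne, col, hK, lowerEl_coprod hY hY' hc hi hi' le_rfl,
      add_mul, add_mul, smul_mul_assoc, h1, h2, h3]
    simp only [smul_add, add_mul, smul_mul_assoc]
    abel

/-- The right tensor factors of the coproduct of `ξ_{δ-θ}`, evaluated on a coproduct. -/
lemma rowEntry_coprod (hY : URel Yᵘ) (hY' : DCartan Y)
    (hc : CommFam X Y) {i : ℕ} (hi : 1 ≤ i) (hi' : i ≤ n + 1) :
    rowEntry (coprod X Y) i = rowEntry X i + κ[X,i] * rowEntry Y i +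
      qDiff • ∑ k ∈ Ico 1 i, col X i k * rowEntry Y k := by
  have hcm := hY.commute_eDiag
  have r0 : κ[Y,1] = qDiff • rowBot Y 1 + 1 := by
    rw [qDiff_smul_rowBot, sub_add_cancel]
  rcases hi.eq_or_lt with rfl | hi
  · have e1 : κ[X,1] = qDiff • rowBot X 1 + 1 := by
      rw [qDiff_smul_rowBot, sub_add_cancel]
    have hl := listComm_of_bicomm hc (l := [qPow (eDiag Yᵘ 1), qNum (eDiag Yᵘ 1)])
      (l' := [qPow (eDiag Xᵘ 1)])
      (by simp [bicomm_qPow, bicomm_qNum, bicomm_eDiag]) (by simp [bicomm_qPow, bicomm_eDiag])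
    simp [ListComm] at hl
    rw [Finset.Ico_self, sum_empty, smul_zero, add_zero, rowEntry, if_pos rfl, rowEntry,
      if_pos rfl, rowEntry, if_pos rfl, rowBot, eDiag_coprod,
      qNum_add (bicomm_comm hc (bicomm_eDiag X 1) (bicomm_eDiag Y 1)),
      qPow_add_of_mem hc (bicomm_eDiag X 1) (bicomm_eDiag Y 1), add_mul, mul_assoc, mul_assoc,
      hl.1, hl.2, ← mul_assoc (qPow (-_)), qPow_neg_mul, one_mul, ← qPow_add (Commute.refl _), r0,
      e1, ← mul_assoc, ← rowBot, ← rowBot]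
    simp only [mul_add, add_mul, mul_smul_comm, smul_mul_assoc, one_mul, mul_one]
    abel
  · have hK : qPow (eDiag (coprod X Y)ᵘ 1 + eDiag (coprod X Y)ᵘ i) = κ[X,i] *
          κ[Y,i] := by
      rw [eDiag_coprod, eDiag_coprod, add_add_add_comm]
      exact qPow_add_of_mem hc (add_mem (bicomm_eDiag X _) (bicomm_eDiag X _))
        (add_mem (bicomm_eDiag Y _) (bicomm_eDiag Y _))
    have hl : ∀ k, ListComm [lowerEl Yᵘ k 1, qPow (eDiag Yᵘ k - eDiag Yᵘ i)] [κ[X,i]] := fun k =>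
      listComm_of_bicomm hc (by simp [bicomm_lowerEl, bicomm_qPow, bicomm_eDiag, sub_mem])
        (by simp [bicomm_qPow, bicomm_eDiag, add_mem])
    simp [ListComm] at hl
    have r : ∀ k, qPow (eDiag Yᵘ k - eDiag Yᵘ i) * κ[Y,i] = κ[Y,k] := fun k => by
      rw [← qPow_add]
      · congr 1
        abel
      · exact ((hcm k 1).add_right (hcm k _)).sub_left ((hcm _ 1).add_right (hcm _ _))
    have h1 : lowerEl Xᵘ i 1 * qPow (eDiag Yᵘ 1 - eDiag Yᵘ i) * (κ[X,i] * κ[Y,i]) =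
        row X 1 i * (qDiff • rowBot Y 1 + 1) := by
      rw [row, mul_assoc, (hl 1).2, r 1, ← mul_assoc, r0]
    have h2 : lowerEl Yᵘ i 1 * (κ[X,i] * κ[Y,i]) = κ[X,i] * rowEntry Y i := by
      rw [(hl _).1, rowEntry, if_neg hi.ne', row]
    have h3 : (∑ k ∈ Ioo 1 i, lowerEl Xᵘ i k * (lowerEl Yᵘ k 1 * qPow (eDiag Yᵘ k - eDiag Yᵘ i))) *
        (κ[X,i] * κ[Y,i]) = ∑ k ∈ Ioo 1 i, col X i k * rowEntry Y k := by
      rw [sum_mul]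
      refine sum_congr rfl fun k hk => ?_
      rw [mem_Ioo] at hk
      rw [mul_assoc, mul_assoc, (hl k).2, (hl k).1, r k, ← mul_assoc, rowEntry, if_neg hk.1.ne',
        row, col]
    have h4 : Ico 1 i = insert 1 (Ioo 1 i) := by
      ext k
      simp only [mem_Ico, mem_Ioo, mem_insert]
      omega
    have h5 : rowEntry X i = row X 1 i := if_neg hi.ne'
    have h6 : rowEntry Y 1 = rowBot Y 1 := if_pos rfl
    have h7 : col X i 1 = row X 1 i := rfl
    rw [h4, sum_insert (by simp), h5, h6, h7]
    conv_lhs => rw [rowEntry, if_neg hi.ne', row, hK, lowerEl_coprod hY hY' hc le_rfl hi hi',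
      add_mul, add_mul, smul_mul_assoc, h1, h2, h3]
    simp only [smul_add, mul_add, mul_one, mul_smul_comm]
    abel

lemma etaPart_coassoc (hX : URel Xᵘ) (hX' : DCartan X) (hY : URel Yᵘ)
    (hY' : DCartan Y) (hV : URel Vᵘ) (hV' : DCartan V)
    (hXY : ∀ a b, X a * Y b = Y b * X a) (hYV : ∀ a b, Y a * V b = V b * Y a) :
    etaPart X Y + etaPart (coprod X Y) V =
      grp X (n + 1) * etaPart Y V + etaPart X (coprod Y V) := by
  have h1 : etaPart (coprod X Y) V = ∑ i ∈ Icc 1 (n + 1), (colEntry X i * (κ[Y,i] * rowEntry V i) +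
        grp X (n + 1) * (colEntry Y i * rowEntry V i) +
        qDiff • ∑ k ∈ Ioc i (n + 1), colEntry X k * (col Y k i * rowEntry V i)) :=
    sum_congr rfl fun i hi => by
      rw [mem_Icc] at hi
      rw [colEntry_coprod hX hX' hY hY' hXY hi.1 hi.2]
      simp only [add_mul, mul_assoc, smul_mul_assoc, sum_mul]
  have h2 : etaPart X (coprod Y V) = ∑ i ∈ Icc 1 (n + 1), (colEntry X i * rowEntry Y i +
        colEntry X i * (κ[Y,i] * rowEntry V i) +
        qDiff • ∑ k ∈ Ico 1 i, colEntry X i * (col Y i k * rowEntry V k)) :=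
    sum_congr rfl fun i hi => by
      rw [mem_Icc] at hi
      rw [rowEntry_coprod hV hV' hYV hi.1 hi.2]
      simp only [mul_add, mul_smul_comm, mul_sum]
  have h3 : ∑ i ∈ Icc 1 (n + 1), ∑ k ∈ Ioc i (n + 1), colEntry X k * (col Y k i * rowEntry V i) =
      ∑ i ∈ Icc 1 (n + 1), ∑ k ∈ Ico 1 i, colEntry X i * (col Y i k * rowEntry V k) :=
    Finset.sum_comm' fun i k => by
      simp only [mem_Icc, Finset.mem_Ioc, mem_Ico]
      omega
  rw [h1, h2]
  simp only [sum_add_distrib, ← smul_sum, h3, ← mul_sum]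
  rw [etaPart, etaPart]
  abel

lemma coprod_coassoc (hX : URel Xᵘ) (hX' : DCartan X) (hY : URel Yᵘ)
    (hY' : DCartan Y) (hV : URel Vᵘ) (hV' : DCartan V)
    (hXY : ∀ a b, X a * Y b = Y b * X a) (hYV : ∀ a b, Y a * V b = V b * Y a) :
    coprod (coprod X Y) V = coprod X (coprod Y V) := by
  funext a
  match a with
  | .u (.h i) => exact add_assoc _ _ _
  | .u (.e i) =>
    have e : qPow (-(X (.u (.h i)) + Y (.u (.h i)))) =
        qPow (-X (.u (.h i))) * qPow (-Y (.u (.h i))) := by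
      rw [neg_add]
      exact qPow_add_of_mem hXY (neg_mem (bicomm_gen X _)) (neg_mem (bicomm_gen Y _))
    change X _ + _ * Y _ + qPow (-(X (.u (.h i)) + Y (.u (.h i)))) * V _ = X _ + _ * (Y _ + _ * V _)
    rw [e, mul_add, mul_assoc, add_assoc]
  | .u (.f i) =>
    have e : qPow (Y (.u (.h i)) + V (.u (.h i))) = qPow (Y (.u (.h i))) * qPow (V (.u (.h i))) :=
      qPow_add_of_mem hYV (bicomm_gen Y _) (bicomm_gen V _)
    change (X _ * _ + Y _) * _ + V _ = X _ * qPow (Y (.u (.h i)) + V (.u (.h i))) + (Y _ * _ + V _)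
    rw [e, add_mul, mul_assoc, add_assoc]
  | .xi =>
    have h := etaPart_coassoc hX hX' hY hY' hV hV' hXY hYV
    have h' := congrArg (eta • ·) h
    simp only [smul_add] at h'
    rw [coprod_xi, coprod_xi, coprod_xi, coprod_xi, grp_coprod hXY]
    simp only [mul_add, mul_smul_comm, mul_assoc]
    rw [add_assoc _ _ (eta • etaPart (coprod X Y) V)]
    rw [show X .xi + grp X (n + 1) * Y .xi + eta • etaPart X Y +
        (grp X (n + 1) * (grp Y (n + 1) * V .xi) + eta • etaPart (coprod X Y) V) =
        X .xi + grp X (n + 1) * Y .xi + grp X (n + 1) * (grp Y (n + 1) * V .xi) +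
        (eta • etaPart X Y + eta • etaPart (coprod X Y) V) by abel, h']
    abel
  | .hd => exact add_assoc _ _ _

end Coassociativity

/-! ### The antipode on generators -/

section Opposite

variable {A : Type*} [Ring A] [Algebra BaseRing A]

lemma HasWt.op_neg {u a : A} {r : ℤ} (h : HasWt u r a) : HasWt (op (-u)) r (op a) := by
  have h' : op (a * -u) = op (-u * a + r • a) := by
    rw [neg_mul, mul_neg, h]
    congr 1
    abel
  exact h'

lemma HasWt.of_op_neg {u a : A} {r : ℤ} (h : HasWt (op (-u)) r (op a)) : HasWt u r a := by
  have h' : a * -u = -u * a + r • a := op_injective h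
  rw [HasWt, ← sub_eq_zero]
  rw [mul_neg, neg_mul, ← sub_eq_zero] at h'
  rw [← h']
  abel

variable [IsAdicComplete adicIdeal A]

lemma op_logSum (u : ℕ → A) : op (logSum u) = logSum fun k => op (u k) := by
  refine (IsLogSum.logSum_eq fun N => ?_).symm
  have := (opLinearEquiv BaseRing (M := A)).toLinearMap.map_mem_pow_smul_top adicIdeal N
    (isLogSum_logSum u N)
  simpa using this

lemma qPow_op (u : A) : qPow (op u) = op (qPow u) := by
  simp only [qPow, op_logSum, op_smul, op_pow]

end Opposite

section AntipodeFamily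

variable {n : ℕ} {A : Type*} [Ring A] [Algebra BaseRing A]

/-- The antipode on the generators of `U_q(sl(n+1))`. -/
def antiU (x : UIdx n → A) : UIdx n → Aᵐᵒᵖ
  | .h i => op (-x (.h i))
  | .e i => op (-(qPow (x (.h i)) * x (.e i)))
  | .f i => op (-(x (.f i) * qPow (-x (.h i))))

/-- The antipode on the generators of the Drinfeldian, with `w` as the image of `ξ_{δ-θ}`. -/
def antiAux (y : DIdx n → A) (w : Aᵐᵒᵖ) : DIdx n → Aᵐᵒᵖ
  | .u a => antiU yᵘ a
  | .xi => w
  | .hd => op (-y .hd)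

/-- The image of `ξ_{δ-θ}` under the antipode, obtained by solving the antipode axiom for it. -/
def antiXi (y : DIdx n → A) : A := -(unop (grp (antiAux y 0) (n + 1)) * y .xi) -
    eta • ∑ i ∈ Icc 1 (n + 1), unop (colEntry (antiAux y 0) i) * rowEntry y i

/-- The antipode on the generators of the Drinfeldian. -/
def anti (y : DIdx n → A) : DIdx n → Aᵐᵒᵖ := antiAux y (op (antiXi y))

lemma hEl_antiU (x : UIdx n → A) (k : ℕ) : hEl (antiU x) k = op (-hEl x k) := by
  unfold hEl at1
  split_ifs
  · rfl
  · simp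

lemma eEl_antiU (x : UIdx n → A) (k : ℕ) : eEl (antiU x) k = op (-(qPow (hEl x k) * eEl x k)) := by
  unfold hEl eEl at1
  split_ifs
  · rfl
  · simp

lemma fEl_antiU (x : UIdx n → A) (k : ℕ) : fEl (antiU x) k = op (-(fEl x k * qPow (-hEl x k))) := by
  unfold hEl fEl at1
  split_ifs
  · rfl
  · simp

lemma eDiag_antiU (x : UIdx n → A) (k : ℕ) : eDiag (antiU x) k = op (-eDiag x k) := by
  simp only [eDiag, hEl_antiU, op_neg, op_sub, op_smul, Finset.op_sum, smul_neg,
    Finset.sum_neg_distrib, neg_sub_neg, neg_sub]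

variable [IsAdicComplete adicIdeal A] {x : UIdx n → A} {y : DIdx n → A}

lemma antiU_ucartan (hx : UCartan x) : UCartan (antiU x) := by
  have hq : ∀ i j, HasWt (hEl x i) 0 (qPow (hEl x j)) := fun i j =>
    hasWt_zero_iff.2 (mul_qPow_of_mul_eq (hx.hh i j))
  have hq' : ∀ i j, HasWt (hEl x i) 0 (qPow (-hEl x j)) := fun i j =>
    hasWt_zero_iff.2 (mul_qPow_of_mul_eq (by rw [mul_neg, neg_mul, hx.hh]))
  intro a b h
  cases h with
  | hh i j hi hj =>
    rw [hEl_antiU, hEl_antiU, ← op_mul, ← op_mul, neg_mul_neg, neg_mul_neg, hx.hh]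
  | he i j hi hj =>
    rw [hEl_antiU, eEl_antiU]
    exact sub_eq_iff_eq_add'.2 (((hq i j).mul (hx.hasWt_e hi hj)).neg_right.cast
      (zero_add _)).op_neg
  | hf i j hi hj =>
    rw [hEl_antiU, fEl_antiU]
    exact sub_eq_iff_eq_add'.2 (((hx.hasWt_f hi hj).mul (hq' i j)).neg_right.cast
      (add_zero _)).op_neg

end AntipodeFamily

section Pairing

variable {A : Type*} [Ring A] [Algebra BaseRing A]

/-- `s ↦ s ⊗ 1` in `Aᵐᵒᵖ ⊗̂ A`. -/
def opLeft (A : Type*) [Ring A] [Algebra BaseRing A] :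
    Aᵐᵒᵖ →ₐ[BaseRing] AdicCompl adicIdeal (Aᵐᵒᵖ ⊗[BaseRing] A) :=
  (toCompl adicIdeal (Aᵐᵒᵖ ⊗[BaseRing] A)).comp Algebra.TensorProduct.includeLeft

/-- `a ↦ 1 ⊗ a` in `Aᵐᵒᵖ ⊗̂ A`. -/
def opRight (A : Type*) [Ring A] [Algebra BaseRing A] :
    A →ₐ[BaseRing] AdicCompl adicIdeal (Aᵐᵒᵖ ⊗[BaseRing] A) :=
  (toCompl adicIdeal (Aᵐᵒᵖ ⊗[BaseRing] A)).comp Algebra.TensorProduct.includeRight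

lemma opLeft_mul_opRight (s : Aᵐᵒᵖ) (a : A) :
    opLeft A s * opRight A a = toCompl adicIdeal (Aᵐᵒᵖ ⊗[BaseRing] A) (s ⊗ₜ a) := by
  change toCompl adicIdeal (Aᵐᵒᵖ ⊗[BaseRing] A) (s ⊗ₜ 1) *
    toCompl adicIdeal (Aᵐᵒᵖ ⊗[BaseRing] A) (1 ⊗ₜ a) = _
  rw [← map_mul, Algebra.TensorProduct.tmul_mul_tmul, mul_one, one_mul]

lemma opLeft_comm (s : Aᵐᵒᵖ) (a : A) : opLeft A s * opRight A a = opRight A a * opLeft A s := by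
  rw [opLeft_mul_opRight]
  change _ = toCompl adicIdeal (Aᵐᵒᵖ ⊗[BaseRing] A) (1 ⊗ₜ a) *
    toCompl adicIdeal (Aᵐᵒᵖ ⊗[BaseRing] A) (s ⊗ₜ 1)
  rw [← map_mul, Algebra.TensorProduct.tmul_mul_tmul, mul_one, one_mul]

/-- The multiplication `op t ⊗ a ↦ t a`. -/
def opTensorMul (A : Type*) [Ring A] [Algebra BaseRing A] : Aᵐᵒᵖ ⊗[BaseRing] A →ₗ[BaseRing] A :=
  LinearMap.mul' BaseRing A ∘ₗ
    TensorProduct.map (opLinearEquiv BaseRing).symm.toLinearMap LinearMap.id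

variable [IsAdicComplete adicIdeal A]

/-- The multiplication `op t ⊗ a ↦ t a` on `Aᵐᵒᵖ ⊗̂ A`. It is not a homomorphism, but its kernel is
a right ideal. -/
def opMul (A : Type*) [Ring A] [Algebra BaseRing A] [IsAdicComplete adicIdeal A] :
    AdicCompl adicIdeal (Aᵐᵒᵖ ⊗[BaseRing] A) →ₗ[BaseRing] A :=
  complLinLift adicIdeal (opTensorMul A)

lemma opMul_toCompl (z : Aᵐᵒᵖ ⊗[BaseRing] A) :
    opMul A (toCompl adicIdeal (Aᵐᵒᵖ ⊗[BaseRing] A) z) = opTensorMul A z :=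
  complLinLift_toCompl adicIdeal _ z

lemma opMul_mul (z : AdicCompl adicIdeal (Aᵐᵒᵖ ⊗[BaseRing] A)) (s : Aᵐᵒᵖ) (a : A) :
    opMul A (z * (opLeft A s * opRight A a)) = unop s * opMul A z * a := by
  have h : opMul A ∘ₗ LinearMap.mulRight BaseRing (opLeft A s * opRight A a) =
      (LinearMap.mulLeft BaseRing (unop s) ∘ₗ LinearMap.mulRight BaseRing a) ∘ₗ opMul A := by
    refine complLinear_ext adicIdeal adicIdeal_fg fun w => ?_
    simp only [LinearMap.comp_apply, LinearMap.mulRight_apply, LinearMap.mulLeft_apply,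
      opLeft_mul_opRight, ← map_mul, opMul_toCompl]
    induction w using TensorProduct.induction_on with
    | zero => simp
    | add u v hu hv => simp only [add_mul, mul_add, map_add, hu, hv]
    | tmul t b =>
      rw [Algebra.TensorProduct.tmul_mul_tmul]
      change unop (t * s) * (b * a) = unop s * (unop t * b * a)
      rw [unop_mul]
      simp only [mul_assoc]
  have := LinearMap.congr_fun h z
  simpa [mul_assoc] using this

lemma opMul_scalar_mul {z : AdicCompl adicIdeal (Aᵐᵒᵖ ⊗[BaseRing] A)} {c : BaseRing}
    (hz : opMul A z = algebraMap BaseRing A c) (w : AdicCompl adicIdeal (Aᵐᵒᵖ ⊗[BaseRing] A)) :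
    opMul A (z * w) = c • opMul A w := by
  have h : opMul A ∘ₗ LinearMap.mulLeft BaseRing z = c • opMul A := by
    refine complLinear_ext adicIdeal adicIdeal_fg fun w => ?_
    simp only [LinearMap.comp_apply, LinearMap.mulLeft_apply, LinearMap.smul_apply]
    induction w using TensorProduct.induction_on with
    | zero => simp
    | add u v hu hv => simp only [mul_add, map_add, hu, hv, smul_add]
    | tmul t b =>
      rw [← opLeft_mul_opRight, opMul_mul, hz, opLeft_mul_opRight, opMul_toCompl,
        ← Algebra.commutes,
        mul_assoc, ← Algebra.smul_def]
      rfl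
  exact LinearMap.congr_fun h w

lemma opMul_left_right (s : Aᵐᵒᵖ) (a : A) : opMul A (opLeft A s * opRight A a) = unop s * a := by
  rw [opLeft_mul_opRight, opMul_toCompl]
  rfl

lemma opMul_right (a : A) : opMul A (opRight A a) = a := by
  simpa using opMul_left_right 1 a

lemma opMul_mul_eq_zero {z : AdicCompl adicIdeal (Aᵐᵒᵖ ⊗[BaseRing] A)} (hz : opMul A z = 0)
    (w : AdicCompl adicIdeal (Aᵐᵒᵖ ⊗[BaseRing] A)) : opMul A (z * w) = 0 := by
  rw [opMul_scalar_mul (c := 0) (by rw [hz, map_zero]), zero_smul]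

/-- A commuting pair of homomorphisms of `Aᵐᵒᵖ` and `A` to `B` with a linear map `B → A` that
extends the multiplication `op t ⊗ a ↦ t a` and whose kernel is a right ideal. -/
structure AntiPairing (A B : Type*) [Ring A] [Algebra BaseRing A] [Ring B] [Algebra BaseRing B]
  where
  left : Aᵐᵒᵖ →ₐ[BaseRing] B
  right : A →ₐ[BaseRing] B
  comm : ∀ s a, left s * right a = right a * left s
  mul : B →ₗ[BaseRing] A
  mul_left_right : ∀ s a, mul (left s * right a) = unop s * a
  mul_mul_eq_zero : ∀ {z} (_ : mul z = 0) (w : B), mul (z * w) = 0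

/-- The pairing on `Aᵐᵒᵖ ⊗̂ A`. -/
def opPairing (A : Type*) [Ring A] [Algebra BaseRing A] [IsAdicComplete adicIdeal A] :
    AntiPairing A (AdicCompl adicIdeal (Aᵐᵒᵖ ⊗[BaseRing] A)) where
  left := opLeft A
  right := opRight A
  comm := opLeft_comm
  mul := opMul A
  mul_left_right := opMul_left_right
  mul_mul_eq_zero hz w := opMul_mul_eq_zero hz w

end Pairing

section AntiPairing

variable {A B : Type*} [Ring A] [Algebra BaseRing A] [Ring B] [Algebra BaseRing B]
variable (P : AntiPairing A B)

lemma AntiPairing.mul_left (s : Aᵐᵒᵖ) : P.mul (P.left s) = unop s := by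
  simpa using P.mul_left_right s 1

lemma AntiPairing.mul_right (a : A) : P.mul (P.right a) = a := by
  simpa using P.mul_left_right 1 a

lemma AntiPairing.mul_qComm {z w : B} (hz : P.mul z = 0) (hw : P.mul w = 0) (r : ℤ) :
    P.mul (qComm r z w) = 0 := by
  rw [qComm, map_sub, map_smul, P.mul_mul_eq_zero hz, P.mul_mul_eq_zero hw, smul_zero, sub_zero]

lemma AntiPairing.mul_comm {z w : B} (hz : P.mul z = 0) (hw : P.mul w = 0) :
    P.mul (z * w - w * z) = 0 := by
  rw [map_sub, P.mul_mul_eq_zero hz, P.mul_mul_eq_zero hw, sub_zero]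

/-- If a relator `ρ` of a coproduct equals `ρ(s) ⊗ u` with `u` invertible, and lies in the kernel of
the multiplication, then `ρ(s) = 0`. -/
lemma AntiPairing.eq_zero_of_mul {s : Aᵐᵒᵖ} {u v : A} (huv : u * v = 1)
    (h : P.mul (P.left s * P.right u) = 0) : s = 0 := by
  rw [P.mul_left_right] at h
  have h2 : unop s * u * v = 0 := by rw [h, zero_mul]
  rw [mul_assoc, huv, mul_one] at h2
  exact unop_injective h2

end AntiPairing

/-! ### The left antipode axiom on relations -/

section CoproductMap

variable {n : ℕ} {B C : Type*} [Ring B] [Algebra BaseRing B] [IsAdicComplete adicIdeal B]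
variable [Ring C] [Algebra BaseRing C] [IsAdicComplete adicIdeal C]
variable (φ : B →ₐ[BaseRing] C) (X Y : DIdx n → B)

lemma map_uEl : (fun a => φ (uPart X a)) = uPart fun a => φ (X a) := rfl

lemma map_halfHd : φ (halfHd X) = halfHd fun a => φ (X a) := map_smul φ _ _

lemma map_grp (m : ℕ) : φ (grp X m) = grp (fun a => φ (X a)) m := by
  rw [grp, φ.map_qPow, map_sub, map_sub, map_eDiag, map_eDiag, map_uEl]
  rfl

lemma map_col (m i : ℕ) : φ (col X m i) = col (fun a => φ (X a)) m i := by
  rw [col, map_mul, φ.map_qPow, map_add, map_eDiag, map_eDiag, map_lowerEl, map_uEl]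
  rfl

lemma map_colTop (m : ℕ) : φ (colTop X m) = colTop (fun a => φ (X a)) m := by
  rw [colTop, map_mul, φ.map_qPow, φ.map_qNum, map_add, map_sub, map_eDiag, map_eDiag, map_halfHd,
    map_uEl]
  rfl

lemma map_row (r i : ℕ) : φ (row X r i) = row (fun a => φ (X a)) r i := by
  rw [row, map_mul, φ.map_qPow, map_add, map_eDiag, map_eDiag, map_lowerEl, map_uEl]
  rfl

lemma map_rowBot (r : ℕ) : φ (rowBot X r) = rowBot (fun a => φ (X a)) r := by
  rw [rowBot, map_mul, φ.map_qPow, φ.map_qNum, map_eDiag, map_uEl]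
  rfl

lemma map_colEntry (i : ℕ) : φ (colEntry X i) = colEntry (fun a => φ (X a)) i := by
  unfold colEntry
  split_ifs
  exacts [map_colTop φ X _, map_col φ X _ _]

lemma map_rowEntry (i : ℕ) : φ (rowEntry X i) = rowEntry (fun a => φ (X a)) i := by
  unfold rowEntry
  split_ifs
  exacts [map_rowBot φ X _, map_row φ X _ _]

lemma map_etaPart : φ (etaPart X Y) = etaPart (fun a => φ (X a)) fun a => φ (Y a) := by
  simp only [etaPart, map_sum, map_mul, map_colEntry, map_rowEntry]

lemma map_coprod (a : DIdx n) :
    φ (coprod X Y a) = coprod (fun a => φ (X a)) (fun a => φ (Y a)) a := by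
  match a with
  | .u (.h i) => exact map_add φ _ _
  | .u (.e i) =>
    change φ (X _ + qPow (-X _) * Y _) = φ (X _) + qPow (-φ (X _)) * φ (Y _)
    rw [map_add, map_mul, φ.map_qPow, map_neg]
  | .u (.f i) =>
    change φ (X _ * qPow (Y _) + Y _) = φ (X _) * qPow (φ (Y _)) + φ (Y _)
    rw [map_add, map_mul, φ.map_qPow]
  | .xi =>
    rw [coprod_xi, coprod_xi, map_add, map_add, map_mul, map_smul, map_grp, map_etaPart]
  | .hd => exact map_add φ _ _

end CoproductMap

section PairingRelations

variable {n : ℕ} {A B : Type*} [Ring A] [Algebra BaseRing A] [IsAdicComplete adicIdeal A]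
variable [Ring B] [Algebra BaseRing B] [IsAdicComplete adicIdeal B]

lemma LinearMap.map_logSum (f : B →ₗ[BaseRing] A) (u : ℕ → B) :
    f (logSum u) = logSum fun k => f (u k) := by
  refine (IsLogSum.logSum_eq fun N => ?_).symm
  simpa using f.map_mem_pow_smul_top adicIdeal N (isLogSum_logSum u N)

variable (P : AntiPairing A B)

lemma AntiPairing.mul_qNum {z : B} (hz : P.mul z = 0) : P.mul (qNum z) = 0 := by
  have h : ∀ k : ℕ, P.mul (if Even k then scal (1 / ((k + 1).factorial : ℂ)) • z ^ (k + 1) else 0) =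
      0 := fun k => by
    split_ifs
    · rw [map_smul, pow_succ', P.mul_mul_eq_zero hz, smul_zero]
    · exact map_zero _
  have h2 : P.mul (qSinh z) = 0 := by
    rw [qSinh, P.mul.map_logSum]
    simp only [h]
    exact IsLogSum.logSum_eq fun N => by simp
  rw [qNum, map_smul, h2, smul_zero]

/-- The two families of generators in `B`, and their coproduct. -/
def AntiPairing.cop (x : DIdx n → Aᵐᵒᵖ) (y : DIdx n → A) : DIdx n → B :=
  coprod (fun a => P.left (x a)) fun a => P.right (y a)

variable {P} {x : DIdx n → Aᵐᵒᵖ} {y : DIdx n → A}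

lemma AntiPairing.cop_hEl (hz : ∀ a, P.mul (P.cop x y a) = 0) (k : ℕ) :
    P.mul (hEl (P.cop x y)ᵘ k) = 0 := by
  unfold hEl at1
  split_ifs
  exacts [hz _, map_zero _]

lemma AntiPairing.cop_eEl (hz : ∀ a, P.mul (P.cop x y a) = 0) (k : ℕ) :
    P.mul (eEl (P.cop x y)ᵘ k) = 0 := by
  unfold eEl at1
  split_ifs
  exacts [hz _, map_zero _]

lemma AntiPairing.cop_fEl (hz : ∀ a, P.mul (P.cop x y a) = 0) (k : ℕ) :
    P.mul (fEl (P.cop x y)ᵘ k) = 0 := by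
  unfold fEl at1
  split_ifs
  exacts [hz _, map_zero _]

lemma AntiPairing.cop_lowerEl (hz : ∀ a, P.mul (P.cop x y a) = 0) (j i : ℕ) :
    P.mul (lowerEl (P.cop x y)ᵘ j i) = 0 := by
  rw [lowerEl]
  induction j - i - 1 with
  | zero => exact P.cop_fEl hz i
  | succ d ih => exact P.mul_qComm (P.cop_fEl hz _) ih _

lemma UCartan.map {C : Type*} [Ring C] [Algebra BaseRing C] [IsAdicComplete adicIdeal C]
    {x : UIdx n → A} (hx : UCartan x) (φ : A →ₐ[BaseRing] C) : UCartan fun a => φ (x a) := by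
  intro a b h
  obtain ⟨a', b', h', rfl, rfl⟩ := h.exists_lift φ x
  rw [hx _ _ h']

lemma DCartan.map {C : Type*} [Ring C] [Algebra BaseRing C] [IsAdicComplete adicIdeal C]
    {x : DIdx n → A} (hx : DCartan x) (φ : A →ₐ[BaseRing] C) : DCartan fun a => φ (x a) := by
  intro a b h
  obtain ⟨a', b', h', rfl, rfl⟩ := h.exists_lift φ x
  rw [hx _ _ h']

variable (P)

/-- The relations of `U_q(sl(n+1))` pass to the antipode. -/
lemma AntiPairing.urel (hx : UCartan xᵘ) (hy : URel yᵘ)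
    (hz : ∀ a, P.mul (P.cop x y a) = 0) : URel xᵘ := by
  have hX : UCartan (uPart fun a => P.left (x a)) := hx.map P.left
  have hY : URel (uPart fun a => P.right (y a)) := hy.map P.right
  have hc : ∀ a b, P.left (x a) * P.right (y b) = P.right (y b) * P.left (x a) := fun _ _ =>
    P.comm _ _
  have qr : ∀ k, qPow (hEl (uPart fun a => P.right (y a)) k) = P.right (qPow (hEl yᵘ k)) :=
    fun k => by rw [P.right.map_qPow, map_hEl]; rfl
  have le : ∀ k, eEl (uPart fun a => P.left (x a)) k = P.left (eEl xᵘ k) :=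
    fun k => (map_eEl P.left xᵘ k).symm
  have lf : ∀ k, fEl (uPart fun a => P.left (x a)) k = P.left (fEl xᵘ k) :=
    fun k => (map_fEl P.left xᵘ k).symm
  have lh : ∀ k, hEl (uPart fun a => P.left (x a)) k = P.left (hEl xᵘ k) :=
    fun k => (map_hEl P.left xᵘ k).symm
  have inv := fun k => qPow_mul_neg (hEl yᵘ k)
  have inv2 : ∀ i j, qPow (hEl yᵘ i) * qPow (hEl yᵘ j) *
      (qPow (-hEl yᵘ j) * qPow (-hEl yᵘ i)) = 1 := fun i j => by
    rw [mul_assoc, ← mul_assoc (qPow (hEl yᵘ j)), inv, one_mul, inv]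
  refine ⟨hx, fun a b h => ?_⟩
  cases h with
  | ef_same i hi =>
    have h1 := coprod_ef hX hY.1 hc hi hi
    rw [hY.2 _ _ (.ef_same i hi)] at h1
    have h2 := coprod_qNum_h (X := fun a => P.left (x a)) (Y := fun a => P.right (y a)) hc i
    have h3 := congrArg₂ (· - ·) h1 h2
    simp only [add_sub_add_right_eq_sub, ← sub_mul] at h3
    rw [← sub_eq_zero]
    refine P.eq_zero_of_mul (inv i) ?_
    rw [map_sub P.left, map_sub P.left, map_mul P.left, map_mul P.left, P.left.map_qNum, ← le, ← lf,
      ← lh, ← qr]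
    have a1 := P.mul_comm (P.cop_eEl hz i) (P.cop_fEl hz i)
    have a2 := P.mul_qNum (P.cop_hEl hz i)
    rw [← h3, map_sub]
    exact (congrArg₂ (· - ·) a1 a2).trans (sub_zero 0)
  | ef_ne i j hi hj hij =>
    have h1 := coprod_ef hX hY.1 hc hi hj
    rw [hY.2 _ _ (.ef_ne i j hi hj hij), mul_zero, add_zero] at h1
    refine P.eq_zero_of_mul (inv j) ?_
    rw [map_sub P.left, map_mul P.left, map_mul P.left, ← le, ← lf, ← qr, ← h1]
    exact P.mul_comm (P.cop_eEl hz i) (P.cop_fEl hz j)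
  | ee_far i j hi hj hij =>
    have h1 := coprod_ee (Y := fun a => P.right (y a)) hX hc hi hj hij
    rw [sub_eq_zero.2 (hY.2 _ _ (.ee_far i j hi hj hij)), mul_zero, add_zero] at h1
    rw [← sub_eq_zero]
    refine P.eq_zero_of_mul (one_mul 1) ?_
    rw [map_sub P.left, map_mul P.left, map_mul P.left, ← le, ← le, map_one P.right, mul_one, ← h1]
    exact P.mul_comm (P.cop_eEl hz i) (P.cop_eEl hz j)
  | ff_far i j hi hj hij =>
    have h1 := coprod_ff (X := fun a => P.left (x a)) hY.1 hc hi hj hij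
    rw [sub_eq_zero.2 (hY.2 _ _ (.ff_far i j hi hj hij)), add_zero] at h1
    rw [← sub_eq_zero]
    refine P.eq_zero_of_mul (inv2 i j) ?_
    rw [map_sub P.left, map_mul P.left, map_mul P.left, map_mul P.right, ← lf, ← lf, ← qr, ← qr,
      ← h1]
    exact P.mul_comm (P.cop_fEl hz i) (P.cop_fEl hz j)
  | e_serre i j hi hj hij =>
    have h1 := coprod_e_serre (Y := fun a => P.right (y a)) hX hc hi hj hij
    rw [hY.2 _ _ (.e_serre i j hi hj hij), mul_zero, add_zero] at h1
    refine P.eq_zero_of_mul (one_mul 1) ?_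
    rw [map_qComm P.left, map_qComm P.left, ← le, ← le, map_one P.right, mul_one, ← h1]
    exact P.mul_qComm (P.mul_qComm (P.cop_eEl hz i) (P.cop_eEl hz j) _) (P.cop_eEl hz j) _
  | f_serre i j hi hj hij =>
    have h1 := coprod_f_serre (X := fun a => P.left (x a)) hY.1 hc hi hj hij
    rw [hY.2 _ _ (.f_serre i j hi hj hij), add_zero] at h1
    have inv3 : qPow (hEl yᵘ i) * qPow (hEl yᵘ j) * qPow (hEl yᵘ j) *
        (qPow (-hEl yᵘ j) * (qPow (-hEl yᵘ j) * qPow (-hEl yᵘ i))) = 1 := by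
      rw [mul_assoc, ← mul_assoc (qPow (hEl yᵘ j)), inv, one_mul, inv2]
    refine P.eq_zero_of_mul inv3 ?_
    rw [map_qComm P.left, map_qComm P.left, map_mul P.right, map_mul P.right, ← lf, ← lf, ← qr,
      ← qr, ← h1]
    exact P.mul_qComm (P.mul_qComm (P.cop_fEl hz i) (P.cop_fEl hz j) _) (P.cop_fEl hz j) _

/-- The relations of the Drinfeldian pass to the antipode. -/
lemma AntiPairing.drel (hx : URel xᵘ) (hx' : DCartan x) (hy : DRel y) (hn : 1 < n)
    (hz : ∀ a, P.mul (P.cop x y a) = 0) : DRel x := by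
  have hX : URel (uPart fun a => P.left (x a)) := hx.map P.left
  have hX' : DCartan fun a => P.left (x a) := hx'.map P.left
  have hY : DRel fun a => P.right (y a) := hy.map P.right
  have hY1 := hY.xiRel
  have hc : ∀ a b, P.left (x a) * P.right (y b) = P.right (y b) * P.left (x a) := fun _ _ =>
    P.comm _ _
  have qr : ∀ k, qPow (hEl (uPart fun a => P.right (y a)) k) = P.right (qPow (hEl yᵘ k)) :=
    fun k => by rw [P.right.map_qPow, map_hEl]; rfl
  have le : ∀ k, P.left (eEl xᵘ k) = eEl (uPart fun a => P.left (x a)) k :=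
    fun k => map_eEl P.left xᵘ k
  have lf : ∀ k, P.left (fEl xᵘ k) = fEl (uPart fun a => P.left (x a)) k :=
    fun k => map_fEl P.left xᵘ k
  have of_left : ∀ {s : Aᵐᵒᵖ}, P.mul (P.left s) = 0 → s = 0 := fun h =>
    unop_injective (by rw [← P.mul_left, h, unop_zero])
  have h1 : XiRel x := xiRel_of_mem hx hx' fun k hk => by
    have h1 := coprod_xi_f hX hX' hY.1 hY1.2.1 hc hn hk
    rw [sub_eq_zero.2 (hY1.2.2 k), mul_zero, add_zero] at h1
    refine P.eq_zero_of_mul (qPow_mul_neg (hEl yᵘ k)) ?_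
    rw [map_sub P.left, map_mul P.left, map_mul P.left, lf, ← qr, ← h1]
    exact P.mul_comm (hz .xi) (P.cop_fEl hz k)
  have hX1 : XiRel fun a => P.left (x a) := ⟨hX, hX', fun k => by
    rw [← lf, ← map_mul, h1.2.2, map_mul]⟩
  have z0 := hz .xi
  have z1 := P.cop_eEl hz 1
  have zn := P.cop_eEl hz n
  have zc : P.mul (col (P.cop x y) (n + 1) 1) = 0 := P.mul_mul_eq_zero (P.cop_lowerEl hz _ _) _
  refine h1.drel hn (fun k hk => ?_) ?_ ?_ ?_ ?_
  · have h2 := coprod_e_xi hX hX' hY.1 hY1.2.1 hc hn hk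
    rw [hY.e_xi hk, mul_zero, add_zero] at h2
    refine of_left ?_
    rw [map_sub P.left, map_mul P.left, map_mul P.left, le, ← h2]
    exact P.mul_comm (P.cop_eEl hz k) z0
  · have h2 := coprod_serreFirst hX1 hY1 hc hn
    rw [hY.serreFirst, mul_zero, add_zero] at h2
    refine of_left ?_
    rw [serreFirst, map_qComm, map_qComm, le]
    refine (congrArg P.mul h2).symm.trans ?_
    exact P.mul_qComm z1 (P.mul_qComm z1 z0 _) _
  · have h2 := coprod_serreLast hX1 hY1 hc hn
    rw [hY.serreLast, mul_zero, add_zero] at h2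
    refine of_left ?_
    rw [serreLast, map_qComm, map_qComm, le]
    refine (congrArg P.mul h2).symm.trans ?_
    exact P.mul_qComm (P.mul_qComm z0 zn _) zn _
  · have h2 := coprod_etaSerreFirst hX1 hY1 hc hn
    rw [hY.etaSerreFirst hn, mul_zero, add_zero] at h2
    refine of_left ?_
    have h3 : P.left (etaSerreFirst x) = etaSerreFirst fun a => P.left (x a) := by
      simp only [etaSerreFirst, map_sub, map_smul, map_mul, map_qComm, le, map_col]
    rw [h3]
    refine (congrArg P.mul h2).symm.trans ?_
    have zz := P.mul_qComm z1 z0 (-1)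
    change P.mul (qComm 1 (qComm (-1) (eEl (P.cop x y)ᵘ 1) (P.cop x y .xi)) (P.cop x y .xi) -
      eta • (qInt (-1) • (qComm (-1) (eEl (P.cop x y)ᵘ 1) (col (P.cop x y) (n + 1) 1) *
        P.cop x y .xi) - col (P.cop x y) (n + 1) 1 *
          qComm (-1) (eEl (P.cop x y)ᵘ 1) (P.cop x y .xi))) = 0
    rw [map_sub, map_smul, map_sub, map_smul, P.mul_qComm zz z0,
      P.mul_mul_eq_zero (P.mul_qComm z1 zc _), P.mul_mul_eq_zero zc]
    simp
  · have h2 := coprod_etaSerreLast hX1 hY1 hc hn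
    rw [hY.etaSerreLast hn, mul_zero, add_zero] at h2
    refine of_left ?_
    have h3 : P.left (etaSerreLast x) = etaSerreLast fun a => P.left (x a) := by
      simp only [etaSerreLast, map_sub, map_smul, map_mul, map_qComm, le, map_col]
    rw [h3]
    refine (congrArg P.mul h2).symm.trans ?_
    have zz := P.mul_qComm z0 zn (-1)
    change P.mul (qComm 1 (P.cop x y .xi) (qComm (-1) (P.cop x y .xi) (eEl (P.cop x y)ᵘ n)) -
      eta • (qInt 2 • (qComm (-1) (col (P.cop x y) (n + 1) 1) (eEl (P.cop x y)ᵘ n) *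
        P.cop x y .xi) - qInt 1 • (col (P.cop x y) (n + 1) 1 *
          qComm (-1) (P.cop x y .xi) (eEl (P.cop x y)ᵘ n)))) = 0
    rw [map_sub, map_smul, map_sub, map_smul, map_smul, P.mul_qComm z0 zz,
      P.mul_mul_eq_zero (P.mul_qComm zc zn _), P.mul_mul_eq_zero zc]
    simp

end PairingRelations

section Antipode

variable {n : ℕ} {A : Type*} [Ring A] [Algebra BaseRing A] [IsAdicComplete adicIdeal A]
variable {y : DIdx n → A}

lemma antiXi_eq (y : DIdx n → A) : antiXi y = -(unop (grp (anti y) (n + 1)) * y .xi) -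
    eta • ∑ i ∈ Icc 1 (n + 1), unop (colEntry (anti y) i) * rowEntry y i := rfl

/-- The multiplication `S(a) ⊗ b ↦ S(a) b` annihilates the coproducts of the generators. -/
lemma AntiPairing.mul_cop_anti {B : Type*} [Ring B] [Algebra BaseRing B]
    [IsAdicComplete adicIdeal B] (P : AntiPairing A B) (y : DIdx n → A) (a : DIdx n) :
    P.mul (P.cop (anti y) y a) = 0 := by
  match a with
  | .u (.h i) =>
    change P.mul (P.left (op (-y _)) + P.right (y _)) = 0
    rw [map_add, P.mul_left, P.mul_right, unop_op, neg_add_cancel]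
  | .u (.e i) =>
    change P.mul (P.left (op (-(qPow (y (.u (.h i))) * y (.u (.e i))))) +
      qPow (-P.left (op (-y (.u (.h i))))) * P.right (y (.u (.e i)))) = 0
    rw [← map_neg, ← P.left.map_qPow, ← op_neg, neg_neg, qPow_op, map_add, P.mul_left,
      P.mul_left_right, unop_op, unop_op, neg_add_cancel]
  | .u (.f i) =>
    change P.mul (P.left (op (-(y (.u (.f i)) * qPow (-y (.u (.h i)))))) *
      qPow (P.right (y (.u (.h i)))) + P.right (y (.u (.f i)))) = 0
    rw [← P.right.map_qPow, map_add, P.mul_right, P.mul_left_right, unop_op, neg_mul, mul_assoc,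
      qPow_neg_mul, mul_one, neg_add_cancel]
  | .xi =>
    change P.mul (P.left (op (antiXi y)) + grp (fun a => P.left (anti y a)) (n + 1) *
      P.right (y .xi) + eta • etaPart (fun a => P.left (anti y a)) fun a => P.right (y a)) = 0
    simp only [etaPart, ← map_grp, ← map_colEntry, ← map_rowEntry, map_add, map_smul, map_sum,
      P.mul_left, P.mul_left_right, unop_op]
    rw [antiXi_eq]
    abel
  | .hd =>
    change P.mul (P.left (op (-y _)) + P.right (y _)) = 0
    rw [map_add, P.mul_left, P.mul_right, unop_op, neg_add_cancel]

/-- The antipode on generators satisfies the relations of `U_q(sl(n+1))`. -/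
lemma anti_urel (hy : URel yᵘ) : URel (anti y)ᵘ :=
  (opPairing A).urel (antiU_ucartan hy.1) hy ((opPairing A).mul_cop_anti y)

lemma anti_dcartan (hy : URel yᵘ) (hy' : DCartan y) (hc : ∀ a, y .hd * a = a * y .hd)
    (hn : 1 < n) : DCartan (anti y) := by
  have hu : URel (antiAux y 0)ᵘ := anti_urel hy
  have hc' : ∀ (w : Aᵐᵒᵖ) b, antiAux y w .hd * b = b * antiAux y w .hd := fun w b =>
    unop_injective (show unop b * -y .hd = -y .hd * unop b by rw [mul_neg, neg_mul, hc])
  have hd : DCartan (antiAux y 0) := .of_hasWt (fun _ => hc' 0 _) hn fun _ _ _ => .zero_right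
  have hw : ∀ {b : Aᵐᵒᵖ} {w : ℕ → ℤ}, FullWt (antiAux y 0) w b → ∀ k, 1 ≤ k → k ≤ n + 1 →
      HasWt (eDiag yᵘ k) (w k) (unop b) := fun {b w} hb k hk hk' => by
    refine .of_op_neg ?_
    rw [← eDiag_antiU]
    exact hb.eps k hk hk'
  refine .of_hasWt (fun _ => hc' _ _) hn fun k hk hk' => ?_
  have hxi := hy'.hasWt_xi hn hk hk'
  have hs : ∀ S : Finset ℕ, S ⊆ Icc 1 (n + 1) → HasWt (eDiag yᵘ k) (thetaWt n k)
      (∑ i ∈ S, unop (colEntry (antiAux y 0) i) * rowEntry y i) := fun S hS => by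
    induction S using Finset.induction_on with
    | empty => exact .zero_right
    | insert i S hi ih =>
      rw [sum_insert hi]
      have h1 := mem_Icc.1 (hS (Finset.mem_insert_self _ _))
      refine .add_right (((hw (hu.fullWt_colEntry hd h1.1 h1.2) k hk hk').mul
        ((hy.fullWt_rowEntry hy' h1.1 h1.2).eps k hk hk')).cast ?_)
        (ih ((Finset.subset_insert _ _).trans hS))
      simp only [wt, thetaWt]
      ring
  have h2 : HasWt (eDiag yᵘ k) (thetaWt n k) (antiXi y) := by
    rw [antiXi, sub_eq_add_neg]
    exact .add_right (((hw (hu.fullWt_grp hd _) k hk hk').mul hxi).cast (zero_add _)).neg_right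
      ((hs _ subset_rfl).smul_right _).neg_right
  have h3 : eDiag (anti y)ᵘ k = op (-eDiag yᵘ k) := eDiag_antiU _ _
  rw [h3]
  exact h2.op_neg

/-- The antipode on generators satisfies the relations of the Drinfeldian. -/
lemma anti_drel (hy : DRel y) (hc : ∀ a, y .hd * a = a * y .hd) (hn : 1 < n) : DRel (anti y) :=
  (opPairing A).drel (anti_urel hy.1) (anti_dcartan hy.1 hy.2.1 hc hn) hy hn
    ((opPairing A).mul_cop_anti y)

end Antipode

/-! ### The right antipode axiom -/

section RightPairing

/-- The mirror image of `AntiPairing`: a commuting pair of homomorphisms of `A` and `Aᵐᵒᵖ` to `B`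
with a linear map `B → A` that extends `a ⊗ op t ↦ a t`. If it takes a scalar value on `z`, it is
homogeneous with respect to right multiplication by `z`. -/
structure AntiCopairing (A B : Type*) [Ring A] [Algebra BaseRing A] [Ring B] [Algebra BaseRing B]
    where
  left : A →ₐ[BaseRing] B
  right : Aᵐᵒᵖ →ₐ[BaseRing] B
  comm : ∀ a s, left a * right s = right s * left a
  mul : B →ₗ[BaseRing] A
  mul_left_right : ∀ a s, mul (left a * right s) = a * unop s
  mul_mul_scalar : ∀ {z c} (_ : mul z = algebraMap BaseRing A c) (w : B), mul (w * z) = c • mul w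

section Concrete

variable {A : Type*} [Ring A] [Algebra BaseRing A]

/-- `a ↦ a ⊗ 1` in `A ⊗̂ Aᵐᵒᵖ`. -/
def copLeft (A : Type*) [Ring A] [Algebra BaseRing A] :
    A →ₐ[BaseRing] AdicCompl adicIdeal (A ⊗[BaseRing] Aᵐᵒᵖ) :=
  (toCompl adicIdeal (A ⊗[BaseRing] Aᵐᵒᵖ)).comp Algebra.TensorProduct.includeLeft

/-- `s ↦ 1 ⊗ s` in `A ⊗̂ Aᵐᵒᵖ`. -/
def copRight (A : Type*) [Ring A] [Algebra BaseRing A] :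
    Aᵐᵒᵖ →ₐ[BaseRing] AdicCompl adicIdeal (A ⊗[BaseRing] Aᵐᵒᵖ) :=
  (toCompl adicIdeal (A ⊗[BaseRing] Aᵐᵒᵖ)).comp Algebra.TensorProduct.includeRight

lemma copLeft_mul_copRight (a : A) (s : Aᵐᵒᵖ) :
    copLeft A a * copRight A s = toCompl adicIdeal (A ⊗[BaseRing] Aᵐᵒᵖ) (a ⊗ₜ s) := by
  change toCompl adicIdeal (A ⊗[BaseRing] Aᵐᵒᵖ) (a ⊗ₜ 1) *
    toCompl adicIdeal (A ⊗[BaseRing] Aᵐᵒᵖ) (1 ⊗ₜ s) = _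
  rw [← map_mul, Algebra.TensorProduct.tmul_mul_tmul, mul_one, one_mul]

lemma copLeft_comm (a : A) (s : Aᵐᵒᵖ) :
    copLeft A a * copRight A s = copRight A s * copLeft A a := by
  rw [copLeft_mul_copRight]
  change _ = toCompl adicIdeal (A ⊗[BaseRing] Aᵐᵒᵖ) (1 ⊗ₜ s) *
    toCompl adicIdeal (A ⊗[BaseRing] Aᵐᵒᵖ) (a ⊗ₜ 1)
  rw [← map_mul, Algebra.TensorProduct.tmul_mul_tmul, mul_one, one_mul]

/-- The multiplication `a ⊗ op t ↦ a t`. -/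
def tensorMulOp (A : Type*) [Ring A] [Algebra BaseRing A] : A ⊗[BaseRing] Aᵐᵒᵖ →ₗ[BaseRing] A :=
  LinearMap.mul' BaseRing A ∘ₗ
    TensorProduct.map LinearMap.id (opLinearEquiv BaseRing).symm.toLinearMap

variable [IsAdicComplete adicIdeal A]

/-- The multiplication `a ⊗ op t ↦ a t` on `A ⊗̂ Aᵐᵒᵖ`. -/
def mulOp (A : Type*) [Ring A] [Algebra BaseRing A] [IsAdicComplete adicIdeal A] :
    AdicCompl adicIdeal (A ⊗[BaseRing] Aᵐᵒᵖ) →ₗ[BaseRing] A :=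
  complLinLift adicIdeal (tensorMulOp A)

lemma mulOp_toCompl (z : A ⊗[BaseRing] Aᵐᵒᵖ) :
    mulOp A (toCompl adicIdeal (A ⊗[BaseRing] Aᵐᵒᵖ) z) = tensorMulOp A z :=
  complLinLift_toCompl adicIdeal _ z

lemma mulOp_left_right (a : A) (s : Aᵐᵒᵖ) : mulOp A (copLeft A a * copRight A s) = a * unop s := by
  rw [copLeft_mul_copRight, mulOp_toCompl]
  rfl

lemma mulOp_mul (z : AdicCompl adicIdeal (A ⊗[BaseRing] Aᵐᵒᵖ)) (a : A) (s : Aᵐᵒᵖ) :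
    mulOp A (copLeft A a * copRight A s * z) = a * mulOp A z * unop s := by
  have h : mulOp A ∘ₗ LinearMap.mulLeft BaseRing (copLeft A a * copRight A s) =
      (LinearMap.mulRight BaseRing (unop s) ∘ₗ LinearMap.mulLeft BaseRing a) ∘ₗ mulOp A := by
    refine complLinear_ext adicIdeal adicIdeal_fg fun w => ?_
    simp only [LinearMap.comp_apply, LinearMap.mulRight_apply, LinearMap.mulLeft_apply,
      copLeft_mul_copRight, ← map_mul, mulOp_toCompl]
    induction w using TensorProduct.induction_on with
    | zero => simp
    | add u v hu hv => simp only [add_mul, mul_add, map_add, hu, hv]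
    | tmul b t =>
      rw [Algebra.TensorProduct.tmul_mul_tmul]
      change a * b * unop (s * t) = a * (b * unop t) * unop s
      rw [unop_mul]
      simp only [mul_assoc]
  exact LinearMap.congr_fun h z

lemma mulOp_mul_scalar {z : AdicCompl adicIdeal (A ⊗[BaseRing] Aᵐᵒᵖ)} {c : BaseRing}
    (hz : mulOp A z = algebraMap BaseRing A c) (w : AdicCompl adicIdeal (A ⊗[BaseRing] Aᵐᵒᵖ)) :
    mulOp A (w * z) = c • mulOp A w := by
  have h : mulOp A ∘ₗ LinearMap.mulRight BaseRing z = c • mulOp A := by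
    refine complLinear_ext adicIdeal adicIdeal_fg fun w => ?_
    simp only [LinearMap.comp_apply, LinearMap.mulRight_apply, LinearMap.smul_apply]
    induction w using TensorProduct.induction_on with
    | zero => simp
    | add u v hu hv => simp only [add_mul, map_add, hu, hv, smul_add]
    | tmul b t =>
      rw [← copLeft_mul_copRight, mulOp_mul, hz, copLeft_mul_copRight, mulOp_toCompl,
        ← Algebra.commutes, mul_assoc, ← Algebra.smul_def]
      rfl
  exact LinearMap.congr_fun h w

/-- The pairing on `A ⊗̂ Aᵐᵒᵖ`. -/
def opCopairing (A : Type*) [Ring A] [Algebra BaseRing A] [IsAdicComplete adicIdeal A] :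
    AntiCopairing A (AdicCompl adicIdeal (A ⊗[BaseRing] Aᵐᵒᵖ)) where
  left := copLeft A
  right := copRight A
  comm := copLeft_comm
  mul := mulOp A
  mul_left_right := mulOp_left_right
  mul_mul_scalar hz w := mulOp_mul_scalar hz w

end Concrete

variable {n : ℕ} {A B : Type*} [Ring A] [Algebra BaseRing A] [Ring B] [Algebra BaseRing B]
variable (P : AntiCopairing A B)

lemma AntiCopairing.mul_left (a : A) : P.mul (P.left a) = a := by
  simpa using P.mul_left_right a 1

lemma AntiCopairing.mul_right (s : Aᵐᵒᵖ) : P.mul (P.right s) = unop s := by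
  simpa using P.mul_left_right 1 s

lemma AntiCopairing.mul_mul_eq_zero {z : B} (hz : P.mul z = 0) (w : B) : P.mul (w * z) = 0 := by
  rw [P.mul_mul_scalar (c := 0) (by rw [hz, map_zero]), zero_smul]

variable [IsAdicComplete adicIdeal A] [IsAdicComplete adicIdeal B]

lemma AntiCopairing.mul_mul_qPow {z : B} (hz : P.mul z = 0) (w : B) :
    P.mul (w * qPow z) = P.mul w := by
  have h : ∀ k : ℕ, P.mul (scal (1 / (k.factorial : ℂ)) • z ^ k) =
      scal (1 / (k.factorial : ℂ)) • (0 : A) ^ k := fun k => by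
    rw [map_smul]
    cases k with
    | zero => rw [pow_zero, pow_zero, ← map_one P.left, P.mul_left]
    | succ k => rw [pow_succ, P.mul_mul_eq_zero hz, pow_succ, mul_zero]
  have h2 : P.mul (qPow z) = 1 := by
    rw [qPow, P.mul.map_logSum]
    simp only [h]
    exact qPow_zero
  rw [P.mul_mul_scalar (c := 1) (by rw [h2, map_one]), one_smul]

lemma AntiCopairing.mul_qNum {z : B} (hz : P.mul z = 0) : P.mul (qNum z) = 0 := by
  have h : ∀ k : ℕ, P.mul (if Even k then scal (1 / ((k + 1).factorial : ℂ)) • z ^ (k + 1) else 0) =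
      0 := fun k => by
    split_ifs
    · rw [map_smul, pow_succ, P.mul_mul_eq_zero hz, smul_zero]
    · exact map_zero _
  have h2 : P.mul (qSinh z) = 0 := by
    rw [qSinh, P.mul.map_logSum]
    simp only [h]
    exact IsLogSum.logSum_eq fun N => by simp
  rw [qNum, map_smul, h2, smul_zero]

lemma AntiCopairing.mul_rowEntry {z : DIdx n → B} (hf : ∀ i, P.mul (fEl zᵘ i) = 0)
    (hh : ∀ i, P.mul (hEl zᵘ i) = 0) (i : ℕ) : P.mul (rowEntry z i) = 0 := by
  have hd : ∀ k, P.mul (eDiag zᵘ k) = 0 := fun k => by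
    simp [eDiag, map_sub, map_smul, map_sum, hh]
  have hl : P.mul (lowerEl zᵘ i 1) = 0 := by
    rw [lowerEl]
    induction i - 1 - 1 with
    | zero => exact hf 1
    | succ d ih =>
      rw [lowerAux, qComm, map_sub, map_smul, P.mul_mul_eq_zero ih, P.mul_mul_eq_zero (hf _),
        smul_zero, sub_zero]
  unfold rowEntry
  split_ifs
  · rw [rowBot, P.mul_mul_qPow (hd 1), P.mul_qNum (hd 1)]
  · rw [row, P.mul_mul_qPow (by rw [map_add, hd, hd, add_zero]), hl]

end RightPairing

section AntipodeXi

variable {n : ℕ} {A B : Type*} [Ring A] [Algebra BaseRing A] [IsAdicComplete adicIdeal A]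
variable [Ring B] [Algebra BaseRing B] [IsAdicComplete adicIdeal B]
variable {y : DIdx n → A}

/-- The multiplication `a ⊗ S(b) ↦ a S(b)` annihilates the coproducts of the `h_{α_i}`. -/
lemma AntiCopairing.mul_h (P : AntiCopairing A B) (y : DIdx n → A) (i : Fin n) :
    P.mul (coprod (fun a => P.left (y a)) (fun a => P.right (anti y a)) (.u (.h i))) = 0 := by
  change P.mul (P.left (y _) + P.right (op (-y _))) = 0
  rw [map_add, P.mul_left, P.mul_right, unop_op, add_neg_cancel]

lemma AntiCopairing.mul_hd (P : AntiCopairing A B) (y : DIdx n → A) :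
    P.mul (coprod (fun a => P.left (y a)) (fun a => P.right (anti y a)) .hd) = 0 := by
  change P.mul (P.left (y _) + P.right (op (-y _))) = 0
  rw [map_add, P.mul_left, P.mul_right, unop_op, add_neg_cancel]

lemma AntiCopairing.mul_e (P : AntiCopairing A B) (y : DIdx n → A) (i : Fin n) :
    P.mul (coprod (fun a => P.left (y a)) (fun a => P.right (anti y a)) (.u (.e i))) = 0 := by
  change P.mul (P.left (y (.u (.e i))) + qPow (-P.left (y (.u (.h i)))) *
    P.right (op (-(qPow (y (.u (.h i))) * y (.u (.e i)))))) = 0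
  rw [← map_neg, ← P.left.map_qPow, map_add, P.mul_left, P.mul_left_right, unop_op, mul_neg,
    ← mul_assoc, qPow_neg_mul, one_mul, add_neg_cancel]

lemma AntiCopairing.mul_f (P : AntiCopairing A B) (y : DIdx n → A) (i : Fin n) :
    P.mul (coprod (fun a => P.left (y a)) (fun a => P.right (anti y a)) (.u (.f i))) = 0 := by
  change P.mul (P.left (y (.u (.f i))) * qPow (P.right (op (-y (.u (.h i))))) +
    P.right (op (-(y (.u (.f i)) * qPow (-y (.u (.h i))))))) = 0
  rw [← P.right.map_qPow, qPow_op, map_add, P.mul_right, P.mul_left_right, unop_op, unop_op,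
    add_neg_cancel]

lemma unop_grp_anti (y : DIdx n → A) (m : ℕ) :
    unop (grp (anti y) m) = qPow (-(eDiag yᵘ 1 - eDiag yᵘ m - y .hd)) := by
  have e : ∀ k, eDiag (anti y)ᵘ k = op (-eDiag yᵘ k) := fun k => eDiag_antiU _ _
  have e' : anti y .hd = op (-y .hd) := rfl
  rw [grp, e, e, e', ← op_sub, ← op_sub, qPow_op, unop_op]
  congr 1
  abel

lemma grp_mul_unop_grp_anti (y : DIdx n → A) (m : ℕ) : grp y m * unop (grp (anti y) m) = 1 := by
  rw [unop_grp_anti, grp, qPow_mul_neg]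

/-- The antipode on the left tensor factors of the coproduct of `ξ_{δ-θ}`, from the antipode axiom
for them. -/
lemma anti_colEntry (hy : DRel y) (hc : ∀ a, y .hd * a = a * y .hd) (hn : 1 < n)
    {i : ℕ} (hi : 1 ≤ i) (hi' : i ≤ n + 1) : unop (colEntry (anti y) i) * κ[y,i] +
      unop (grp (anti y) (n + 1)) * colEntry y i +
      qDiff • ∑ k ∈ Ioc i (n + 1), unop (colEntry (anti y) k) * col y k i = 0 := by
  obtain ⟨B, _, _, _, ⟨P⟩⟩ : ∃ (B : Type _) (_ : Ring B) (_ : Algebra BaseRing B)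
      (_ : IsAdicComplete adicIdeal B), Nonempty (AntiPairing A B) :=
    ⟨_, _, _, inferInstance, ⟨opPairing A⟩⟩
  have hz := P.mul_cop_anti y
  have hs := anti_drel hy hc hn
  have hX : DRel fun a => P.left (anti y a) := hs.map P.left
  have hY : DRel fun a => P.right (y a) := hy.map P.right
  have h := colEntry_coprod hX.1 hX.2.1 hY.1 hY.2.1 (fun _ _ => P.comm _ _) hi hi'
  have h0 : P.mul (colEntry (P.cop (anti y) y) i) = 0 := by
    unfold colEntry
    split_ifs
    · refine P.mul_mul_eq_zero (P.mul_qNum ?_) _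
      have hd : P.mul (eDiag (P.cop (anti y) y)ᵘ (n + 1)) = 0 := by
        simp [eDiag, map_sub, map_smul, map_sum, P.cop_hEl hz]
      rw [map_add, hd, halfHd, map_smul, hz, smul_zero, add_zero]
    · exact P.mul_mul_eq_zero (P.cop_lowerEl hz _ _) _
  have h1 := (congrArg P.mul h).symm.trans h0
  rw [← map_colEntry, ← map_grp, ← map_colEntry] at h1
  simp only [← map_colEntry, ← map_col] at h1
  have e : ∀ k, eDiag (uPart fun a => P.right (y a)) k = P.right (eDiag yᵘ k) :=
    fun k => (map_eDiag P.right yᵘ k).symm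
  simp only [e, ← map_add P.right, ← P.right.map_qPow] at h1
  simpa only [map_add P.mul, map_smul, map_sum, P.mul_left_right] using h1

/-- The antipode on the right tensor factors of the coproduct of `ξ_{δ-θ}`, from the antipode axiom
for them. -/
lemma anti_rowEntry (hy : DRel y) (hc : ∀ a, y .hd * a = a * y .hd) (hn : 1 < n)
    {i : ℕ} (hi : 1 ≤ i) (hi' : i ≤ n + 1) : rowEntry y i + κ[y,i] * unop (rowEntry (anti y) i) +
      qDiff • ∑ k ∈ Ico 1 i, col y i k * unop (rowEntry (anti y) k) = 0 := by
  obtain ⟨B, _, _, _, ⟨P⟩⟩ : ∃ (B : Type _) (_ : Ring B) (_ : Algebra BaseRing B)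
      (_ : IsAdicComplete adicIdeal B), Nonempty (AntiCopairing A B) :=
    ⟨_, _, _, inferInstance, ⟨opCopairing A⟩⟩
  have hs := anti_drel hy hc hn
  have hY : DRel fun a => P.right (anti y a) := hs.map P.right
  have h := rowEntry_coprod (X := fun a => P.left (y a)) hY.1 hY.2.1 (fun _ _ => P.comm _ _) hi hi'
  have h0 := P.mul_rowEntry (z := coprod (fun a => P.left (y a)) fun a => P.right (anti y a))
    (fun k => by
      unfold fEl at1
      split_ifs
      exacts [P.mul_f y _, map_zero _])
    (fun k => by
      unfold hEl at1
      split_ifs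
      exacts [P.mul_h y _, map_zero _]) i
  have h1 := (congrArg P.mul h).symm.trans h0
  simp only [← map_rowEntry, ← map_col] at h1
  have e : ∀ k, eDiag (uPart fun a => P.left (y a)) k = P.left (eDiag yᵘ k) :=
    fun k => (map_eDiag P.left yᵘ k).symm
  simp only [e, ← map_add P.left, ← P.left.map_qPow] at h1
  simpa only [map_add P.mul, map_smul, map_sum, P.mul_left_right, P.mul_left] using h1

/-- Both sides are the coefficient of `η` in `S(ξ_{δ-θ})`, up to sign, obtained from the two
antipode axioms. -/
lemma anti_etaPart (hy : DRel y) (hc : ∀ a, y .hd * a = a * y .hd) (hn : 1 < n) :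
    unop (grp (anti y) (n + 1)) * ∑ i ∈ Icc 1 (n + 1), colEntry y i * unop (rowEntry (anti y) i) =
    ∑ i ∈ Icc 1 (n + 1), unop (colEntry (anti y) i) * rowEntry y i := by
  have h1 : ∑ i ∈ Icc 1 (n + 1), (unop (colEntry (anti y) i) * κ[y,i] * unop (rowEntry (anti y) i) +
      unop (grp (anti y) (n + 1)) * (colEntry y i * unop (rowEntry (anti y) i)) +
      qDiff • ∑ k ∈ Ioc i (n + 1),
        unop (colEntry (anti y) k) * col y k i * unop (rowEntry (anti y) i)) = 0 :=
    Finset.sum_eq_zero fun i hi => by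
      rw [mem_Icc] at hi
      have := congrArg (· * unop (rowEntry (anti y) i)) (anti_colEntry hy hc hn hi.1 hi.2)
      simpa only [add_mul, smul_mul_assoc, sum_mul, zero_mul, mul_assoc] using this
  have h2 : ∑ i ∈ Icc 1 (n + 1), (unop (colEntry (anti y) i) * rowEntry y i +
      unop (colEntry (anti y) i) * κ[y,i] * unop (rowEntry (anti y) i) + qDiff • ∑ k ∈ Ico 1 i,
        unop (colEntry (anti y) i) * col y i k * unop (rowEntry (anti y) k)) = 0 :=
    Finset.sum_eq_zero fun i hi => by
      rw [mem_Icc] at hi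
      have := congrArg (unop (colEntry (anti y) i) * ·) (anti_rowEntry hy hc hn hi.1 hi.2)
      simpa only [mul_add, mul_smul_comm, mul_sum, mul_zero, mul_assoc] using this
  have h3 : ∑ i ∈ Icc 1 (n + 1), ∑ k ∈ Ioc i (n + 1),
      unop (colEntry (anti y) k) * col y k i * unop (rowEntry (anti y) i) =
      ∑ i ∈ Icc 1 (n + 1), ∑ k ∈ Ico 1 i,
        unop (colEntry (anti y) i) * col y i k * unop (rowEntry (anti y) k) :=
    Finset.sum_comm' fun i k => by
      simp only [mem_Icc, Finset.mem_Ioc, mem_Ico]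
      omega
  rw [← h2] at h1
  simp only [sum_add_distrib, ← smul_sum, h3, ← mul_sum] at h1
  rw [add_left_inj, add_comm, add_left_inj] at h1
  exact h1

lemma antiXi_eq_mul (hy : DRel y) (hc : ∀ a, y .hd * a = a * y .hd) (hn : 1 < n) :
    antiXi y = -(unop (grp (anti y) (n + 1)) * (y .xi +
    eta • ∑ i ∈ Icc 1 (n + 1), colEntry y i * unop (rowEntry (anti y) i))) := by
  rw [antiXi_eq, ← anti_etaPart hy hc hn, mul_add, mul_smul_comm]
  abel

/-- The multiplication `a ⊗ S(b) ↦ a S(b)` annihilates the coproducts of the generators. -/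
lemma AntiCopairing.mul_coprod_anti (P : AntiCopairing A B) (hy : DRel y)
    (hc : ∀ a, y .hd * a = a * y .hd) (hn : 1 < n) (a : DIdx n) :
    P.mul (coprod (fun a => P.left (y a)) (fun a => P.right (anti y a)) a) = 0 := by
  match a with
  | .u (.h i) => exact P.mul_h y i
  | .u (.e i) => exact P.mul_e y i
  | .u (.f i) => exact P.mul_f y i
  | .xi =>
    change P.mul (P.left (y .xi) + grp (fun a => P.left (y a)) (n + 1) * P.right (op (antiXi y)) +
      eta • etaPart (fun a => P.left (y a)) fun a => P.right (anti y a)) = 0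
    simp only [etaPart, ← map_grp, ← map_colEntry, ← map_rowEntry, map_add, map_smul, map_sum,
      P.mul_left, P.mul_left_right, unop_op]
    rw [antiXi_eq_mul hy hc hn, mul_neg, ← mul_assoc, grp_mul_unop_grp_anti, one_mul]
    abel
  | .hd => exact P.mul_hd y

end AntipodeXi

/-! ### The antipode of `ξ_{δ-θ}` -/

section Chains

variable {n : ℕ} {B : Type*} [Ring B] [Algebra BaseRing B] (x : UIdx n → B)

/-- The sum of the products `e_{j,i_k} e_{i_k,i_{k-1}} ⋯ e_{i_1,1}` over all
`J ≥ i_k > ⋯ > i_1 ≥ 2`. -/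
def chainSum (j J k : ℕ) : B :=
  ∑ s ∈ (Icc 2 J).powersetCard k, chainProd x (j :: (s.sort (· ≥ ·) ++ [1]))

lemma chainSum_zero (j J : ℕ) : chainSum x j J 0 = lowerEl x j 1 := by
  simp [chainSum, chainProd]

lemma chainSum_succ_succ {J : ℕ} (hJ : 1 ≤ J) (j k : ℕ) : chainSum x j (J + 1) (k + 1) =
      chainSum x j J (k + 1) + lowerEl x j (J + 1) * chainSum x (J + 1) J k := by
  have h1 : Icc 2 (J + 1) = insert (J + 1) (Icc 2 J) := by
    ext m
    simp only [mem_Icc, mem_insert]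
    omega
  have h2 : J + 1 ∉ Icc 2 J := by simp
  have hs : ∀ {k : ℕ} {s : Finset ℕ}, s ∈ (Icc 2 J).powersetCard k → J + 1 ∉ s :=
    fun hs h => h2 ((Finset.mem_powersetCard.1 hs).1 h)
  rw [chainSum, h1, Finset.powersetCard_succ_insert h2, Finset.sum_union, Finset.sum_image]
  · congr 1
    rw [chainSum, mul_sum]
    refine sum_congr rfl fun s h => ?_
    rw [Finset.sort_insert]
    · rfl
    · exact fun m hm => by
        have := mem_Icc.1 ((Finset.mem_powersetCard.1 h).1 hm)
        omega
    · exact hs h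
  · intro s h t h' e
    rw [← Finset.erase_insert (hs h), ← Finset.erase_insert (hs h')]
    exact congrArg (Finset.erase · (J + 1)) e
  · rw [Finset.disjoint_left]
    intro s h h'
    obtain ⟨t, _, rfl⟩ := Finset.mem_image.1 h'
    exact hs h (Finset.mem_insert_self _ _)

lemma chainSum_eq_zero (j : ℕ) {J k : ℕ} (h : J < k + 1) (hk : 1 ≤ k) : chainSum x j J k = 0 := by
  rw [chainSum, Finset.powersetCard_eq_empty.2 (by rw [Nat.card_Icc]; omega), sum_empty]

lemma chainSum_succ (j k : ℕ) {J : ℕ} (hJ : 1 ≤ J) : chainSum x j J (k + 1) =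
    ∑ m ∈ Icc 2 J, lowerEl x j m * chainSum x m (m - 1) k := by
  induction J, hJ using Nat.le_induction with
  | base => rw [chainSum_eq_zero x j (by omega) (by omega), Finset.Icc_eq_empty (by omega),
    sum_empty]
  | succ J hJ ih =>
    rw [chainSum_succ_succ x hJ, ih, Finset.sum_Icc_succ_top (by omega)]
    rfl

/-- The alternating sum of the `chainSum`s solves the recursion of the antipode on root vectors. -/
lemma chainSum_recursion (c : BaseRing) {i : ℕ} (hi : 2 ≤ i) (hi' : i ≤ n + 1) :
    ∑ k ∈ Finset.range n, (-c) ^ k • chainSum x i (i - 1) k = lowerEl x i 1 -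
      c • ∑ m ∈ Ico 2 i, lowerEl x i m *
        ∑ k ∈ Finset.range n, (-c) ^ k • chainSum x m (m - 1) k := by
  have h1 : ∑ k ∈ Finset.range n, (-c) ^ k • chainSum x i (i - 1) k =
      ∑ k ∈ Finset.range (n + 1), (-c) ^ k • chainSum x i (i - 1) k := by
    rw [Finset.sum_range_succ, chainSum_eq_zero x i (by omega) (by omega), smul_zero, add_zero]
  have h2 : Ico 2 i = Icc 2 (i - 1) := by
    ext m
    simp only [mem_Icc, mem_Ico]
    omega
  rw [h1, Finset.sum_range_succ', pow_zero, one_smul, chainSum_zero, h2, add_comm, sub_eq_add_neg]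
  congr 1
  simp only [chainSum_succ x i _ (show 1 ≤ i - 1 by omega), mul_sum, mul_smul_comm]
  rw [Finset.sum_comm, ← neg_smul, smul_sum]
  refine sum_congr rfl fun k _ => ?_
  simp only [smul_sum, smul_smul, pow_succ']

lemma sum_lowerEl_mul_chainSum (c : BaseRing) (hn : 1 ≤ n) (j : ℕ) : ∑ m ∈ Icc 2 n, lowerEl x j m *
        ∑ k ∈ Finset.range n, (-c) ^ k • chainSum x m (m - 1) k =
      ∑ k ∈ Finset.range n, (-c) ^ k • chainSum x j n (k + 1) := by
  simp only [chainSum_succ x j _ hn, mul_sum, mul_smul_comm, smul_sum]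
  exact Finset.sum_comm

end Chains

/-! ### The closed formula for the antipode of `ξ_{δ-θ}` -/

section AntipodeFormula

variable {n : ℕ} {A : Type*} [Ring A] [Algebra BaseRing A] [IsAdicComplete adicIdeal A]
variable {y : DIdx n → A}

lemma qInt_neg_mul_neg_pow (k : ℕ) :
    qInt (-1) * (-(qInt (-1) * qDiff)) ^ k = qInt (-((k + 1 : ℕ) : ℤ)) * (-qDiff) ^ k := by
  have h : ∀ m : ℕ, qInt (-1) ^ m = qInt (-(m : ℤ)) := fun m => by
    induction m with
    | zero => rw [pow_zero, Nat.cast_zero, neg_zero, qInt_zero]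
    | succ m ih => rw [pow_succ, ih, ← qInt_add, Nat.cast_succ, neg_add]
  rw [← mul_neg, mul_pow, ← mul_assoc, ← pow_succ', h]

lemma anti_rowEntry_one (hy : DRel y) (hc : ∀ a, y .hd * a = a * y .hd) (hn : 1 < n) :
    unop (rowEntry (anti y) 1) = -(qPow (-(eDiag yᵘ 1 + eDiag yᵘ 1)) * rowEntry y 1) := by
  have h := anti_rowEntry hy hc hn le_rfl (show 1 ≤ n + 1 by omega)
  rw [Finset.Ico_self, sum_empty, smul_zero, add_zero] at h
  rw [← one_mul (unop _), ← qPow_neg_mul (eDiag yᵘ 1 + eDiag yᵘ 1), mul_assoc, ← mul_neg]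
  congr 1
  exact (neg_eq_of_add_eq_zero_right h).symm

lemma URel.lowerEl_mul_qPow (hy : URel yᵘ) {i k l : ℕ} (hk : 1 < k) (hki : k < i)
    (hi : i ≤ n + 1) (hl : l = i) : lowerEl yᵘ i k * κ[y,l] =
      qInt (-1) • (κ[y,l] * lowerEl yᵘ i k) := by
  subst hl
  have h1 := hy.hasWt_lowerEl (by omega) hki hi le_rfl (show 1 ≤ n + 1 by omega)
  have h2 := hy.hasWt_lowerEl (by omega) hki hi (show 1 ≤ l by omega) hi
  exact ((h1.add_left h2).qPow.symm.cast (by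
    rw [if_neg (by omega), if_neg (by omega), if_pos rfl, if_neg (by omega)]; rfl)).eq

lemma URel.lowerEl_one_mul_qPow (hy : URel yᵘ) {i : ℕ} (hki : 1 < i) (hi : i ≤ n + 1) :
    lowerEl yᵘ i 1 * κ[y,i] = κ[y,i] * lowerEl yᵘ i 1 := by
  have h1 := hy.hasWt_lowerEl le_rfl hki hi le_rfl (show 1 ≤ n + 1 by omega)
  have h2 := hy.hasWt_lowerEl le_rfl hki hi (show 1 ≤ i by omega) hi
  exact (((h1.add_left h2).qPow.cast (s := 0) (by
    rw [if_neg (by omega), if_pos rfl, if_pos rfl, if_neg (by omega)]; rfl)).comm).symm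

/-- The antipode of `e_{i1} q ^ (e_{11} + e_{ii})` is an alternating sum over chains. -/
lemma anti_rowEntry_eq (hy : DRel y) (hc : ∀ a, y .hd * a = a * y .hd) (hn : 1 < n) {i : ℕ}
    (hi : 2 ≤ i) (hi' : i ≤ n + 1) : unop (rowEntry (anti y) i) =
      -((∑ k ∈ Finset.range n, (-(qInt (-1) * qDiff)) ^ k • chainSum yᵘ i (i - 1) k) *
        qPow (-(eDiag yᵘ 1 + eDiag yᵘ 1))) := by
  induction i using Nat.strong_induction_on with
  | _ i ih =>
    have h := anti_rowEntry hy hc hn (show 1 ≤ i by omega) hi'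
    have e1 : Ico 1 i = insert 1 (Ico 2 i) := by
      ext m
      simp only [mem_Ico, mem_insert]
      omega
    have e2 : rowEntry y i = lowerEl yᵘ i 1 * κ[y,i] := if_neg (by omega)
    have e3 : rowEntry y 1 = rowBot y 1 := if_pos rfl
    have e4 : 1 - qPow (-(eDiag yᵘ 1 + eDiag yᵘ 1)) * qDiff • rowEntry y 1 =
        qPow (-(eDiag yᵘ 1 + eDiag yᵘ 1)) := by
      rw [e3, qDiff_smul_rowBot, mul_sub, qPow_neg_mul, mul_one, sub_sub_cancel]
    have e5 : ∑ k ∈ Ico 2 i, col y i k * unop (rowEntry (anti y) k) = -(qInt (-1) • (κ[y,i] *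
          ((∑ k ∈ Ico 2 i, lowerEl yᵘ i k * ∑ m ∈ Finset.range n,
            (-(qInt (-1) * qDiff)) ^ m • chainSum yᵘ k (k - 1) m) *
            qPow (-(eDiag yᵘ 1 + eDiag yᵘ 1))))) := by
      rw [sum_mul, mul_sum, smul_sum, ← Finset.sum_neg_distrib]
      refine sum_congr rfl fun k hk => ?_
      rw [mem_Ico] at hk
      rw [ih k hk.2 hk.1 (by omega), col, hy.1.lowerEl_mul_qPow (by omega) hk.2 hi' rfl, mul_neg,
        smul_mul_assoc, mul_assoc, mul_assoc]
    have e6 : rowEntry y i + qDiff • (col y i 1 * unop (rowEntry (anti y) 1)) =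
        κ[y,i] * (lowerEl yᵘ i 1 * qPow (-(eDiag yᵘ 1 + eDiag yᵘ 1))) := by
      rw [anti_rowEntry_one hy hc hn, e2, col, mul_neg, smul_neg, ← sub_eq_add_neg,
        ← mul_smul_comm, ← mul_smul_comm, ← mul_one (lowerEl yᵘ i 1 * _), mul_assoc _ 1,
        one_mul, ← mul_sub, e4, hy.1.lowerEl_one_mul_qPow (by omega) hi', mul_assoc]
    rw [e1, sum_insert (by simp), smul_add, add_right_comm, ← add_assoc, e6, e5, smul_neg,
      smul_smul, mul_comm qDiff, ← mul_smul_comm, ← sub_eq_add_neg, ← mul_sub, ← mul_add,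
      ← smul_mul_assoc, ← sub_mul,
      ← chainSum_recursion yᵘ _ hi hi'] at h
    have h' := congrArg (qPow (-(eDiag yᵘ 1 + eDiag yᵘ i)) * ·) h
    simp only [← mul_assoc, qPow_neg_mul, one_mul, mul_zero] at h'
    exact (neg_eq_of_add_eq_zero_right h').symm

/-- The simplification of `S(ξ_{δ-θ})` in terms of commuting `a = e_{11}`, `b = e_{n+1,n+1}`,
`h = h_δ / 2` and `e = e_{n+1,1}`. -/
lemma antiXi_formula_aux {a b h d e : A} (hab : Commute a b) (hha : Commute h a)
    (hhb : Commute h b) (hd : h + h = d) (he : e * a = (a + 1) * e) (x s : A) :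
    -(qPow (d - a + b) * (x + eta • (qPow (a + b) * e * -(qPow (-(a + a)) * (qNum a * qPow a)) +
      (qNum (h + b) * qPow (a - h) * -((e - (qInt (-1) * qDiff) • s) * qPow (-(a + a))) +
        -(qInt (-1) • (qPow (a + b) * (s * qPow (-(a + a))))))))) =
      -(qPow (d - a + b) * x) + eta • (qNum (h + a + b + 1) * qPow (h - a + b - 1) * e) +
        eta • (qInt (-1) • (s * qPow (-(a + a)))) := by
  subst hd
  have cv : Commute (h + b) (a + 1) := (hha.add_left hab.symm).add_right (Commute.one_right _)
  have g1 : qPow (h + h - a + b) * qPow (a + b) = qPow (h + b + (h + b)) := by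
    rw [← qPow_add]
    · congr 1
      abel
    · exact (((hha.add_left hha).sub_left (Commute.refl a)).add_left hab.symm).add_right
        (((hhb.add_left hhb).sub_left hab).add_left (Commute.refl b))
  have g2 : qPow (h + h - a + b) * (qNum (h + b) * qPow (a - h)) = qNum (h + b) * qPow (h + b) := by
    have c : Commute (h + h - a + b) (h + b) :=
      ((((Commute.refl h).add_left (Commute.refl h)).sub_left hha.symm).add_left hhb.symm).add_right
        (((hhb.add_left hhb).sub_left hab).add_left (Commute.refl b))
    rw [← mul_assoc, mul_qNum_of_mul_eq (qPow_comm c), mul_assoc, ← qPow_add]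
    · congr 2
      abel
    · exact (((hha.add_left hha).sub_left (Commute.refl a)).add_left hab.symm).sub_right
        ((((Commute.refl h).add_left (Commute.refl h)).sub_left hha.symm).add_left hhb.symm)
  have g3 : qDiff • (qNum (h + b) * qPow (h + b)) = qPow (h + b + (h + b)) - 1 := by
    rw [← smul_mul_assoc, qDiff_smul_qNum, sub_mul, qPow_neg_mul, qPow_add (Commute.refl _)]
  have g4 : e * qPow (-(a + a)) = qPow (-(a + 1 + (a + 1))) * e :=
    mul_qPow_of_mul_eq (by rw [mul_neg, mul_add, he, neg_mul, add_mul (a + 1)])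
  have g5 : e * (qPow (-(a + a)) * (qNum a * qPow a)) = qNum (a + 1) * qPow (-(a + 1)) * e := by
    have : qPow (-(a + a)) * (qNum a * qPow a) = qNum a * qPow (-a) := by
      rw [← mul_assoc, mul_qNum_of_mul_eq (qPow_comm
        (((Commute.refl a).add_left (Commute.refl a)).neg_left)), mul_assoc, ← qPow_add]
      · congr 2
        abel
      · exact ((Commute.refl a).add_left (Commute.refl a)).neg_left
    rw [this, ← mul_assoc, mul_qNum_of_mul_eq he, mul_assoc,
      mul_qPow_of_mul_eq (show e * -a = -(a + 1) * e by rw [mul_neg, he, neg_mul]), mul_assoc]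
  have g6 : qNum (h + a + b + 1) * qPow (h - a + b - 1) =
      qPow (h + b + (h + b)) * (qNum (a + 1) * qPow (-(a + 1))) +
        qNum (h + b) * qPow (h + b) * qPow (-(a + 1 + (a + 1))) := by
    have e1 : h + a + b + 1 = (a + 1) + (h + b) := by abel
    have e2 : h - a + b - 1 = (h + b) + -(a + 1) := by abel
    have c1 : qPow (h + b) * qNum (a + 1) = qNum (a + 1) * qPow (h + b) :=
      mul_qNum_of_mul_eq (qPow_comm cv)
    have c2 : qPow (-(a + 1)) * qNum (h + b) = qNum (h + b) * qPow (-(a + 1)) :=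
      mul_qNum_of_mul_eq (qPow_comm cv.symm.neg_left)
    have c3 : qPow (-(a + 1)) * qPow (h + b) = qPow (h + b) * qPow (-(a + 1)) :=
      mul_qPow_of_mul_eq (qPow_comm cv.symm.neg_left)
    rw [e1, e2, qNum_add cv.symm, qPow_add cv.neg_right, neg_add (a + 1),
      qPow_add (Commute.refl (h + b)), qPow_add (Commute.refl (-(a + 1))), add_mul, c2]
    simp only [mul_assoc]
    rw [← mul_assoc (qPow (-(a + 1))), c3, mul_assoc, ← mul_assoc _ (qNum (a + 1))
      (qPow (-(a + 1))),
      c1, mul_assoc, ← mul_assoc (qPow (h + b)) (qNum (a + 1)), c1]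
    simp only [mul_assoc]
  have k1 : qPow (h + h - a + b) * (qPow (a + b) * e * -(qPow (-(a + a)) * (qNum a * qPow a))) =
      -(qPow (h + b + (h + b)) * (qNum (a + 1) * qPow (-(a + 1)) * e)) := by
    rw [mul_neg, mul_neg, mul_assoc, g5, ← mul_assoc, g1]
  have k2 : qPow (h + h - a + b) * (qNum (h + b) * qPow (a - h) *
      -((e - (qInt (-1) * qDiff) • s) * qPow (-(a + a)))) =
      -(qNum (h + b) * qPow (h + b) * (qPow (-(a + 1 + (a + 1))) * e)) +
        qInt (-1) • ((qPow (h + b + (h + b)) - 1) * (s * qPow (-(a + a)))) := by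
    rw [← g3, mul_neg, mul_neg, ← mul_assoc, g2, sub_mul, g4, mul_sub, neg_sub, smul_mul_assoc,
      mul_smul_comm, smul_mul_assoc, smul_smul]
    abel
  have k3 : qPow (h + h - a + b) * -(qInt (-1) • (qPow (a + b) * (s * qPow (-(a + a))))) =
      -(qInt (-1) • (qPow (h + b + (h + b)) * (s * qPow (-(a + a))))) := by
    rw [mul_neg, mul_smul_comm, ← mul_assoc, g1]
  rw [mul_add, mul_smul_comm, mul_add, mul_add, k1, k2, k3, g6, add_mul, sub_mul, one_mul, smul_sub]
  simp only [mul_assoc, smul_add, smul_sub, smul_neg]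
  abel

/-- The value of the antipode on `ξ_{δ-θ}`. -/
lemma antiXi_formula (hy : DRel y) (hc : ∀ a, y .hd * a = a * y .hd) (hn : 1 < n) :
    antiXi y = -(qPow (y .hd - eDiag yᵘ 1 + eDiag yᵘ (n + 1)) * y .xi) +
      eta • (qNum (halfHd y + eDiag yᵘ 1 + eDiag yᵘ (n + 1) + 1) *
        qPow (halfHd y - eDiag yᵘ 1 + eDiag yᵘ (n + 1) - 1) * lowerEl yᵘ (n + 1) 1) +
      eta • ∑ k ∈ Icc 1 n, (qInt (-k) * (-qDiff) ^ (k - 1)) •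
        (chainSum yᵘ (n + 1) n k * qPow (scal (-2) • eDiag yᵘ 1)) := by
  have hcm := hy.1.commute_eDiag
  have hd := hy.1.commute_half_eDiag hy.2.1
  have hdd : halfHd y + halfHd y = y .hd := halfHd_add y
  have hsum : Icc 1 (n + 1) = insert 1 (insert (n + 1) (Icc 2 n)) := by
    ext m
    simp only [mem_Icc, mem_insert]
    omega
  have hg : unop (grp (anti y) (n + 1)) = qPow (y .hd - eDiag yᵘ 1 + eDiag yᵘ (n + 1)) := by
    rw [unop_grp_anti]
    congr 1
    abel
  have h2 : scal (-2) • eDiag yᵘ 1 = -(eDiag yᵘ 1 + eDiag yᵘ 1) := by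
    rw [← two_smul BaseRing, ← neg_smul]
    congr 1
    rw [scal, map_neg, map_ofNat]
  have hE := hy.1.hasWt_lowerEl le_rfl (show 1 < n + 1 by omega) le_rfl le_rfl
    (show 1 ≤ n + 1 by omega)
  rw [if_neg (by omega), if_pos rfl] at hE
  have hC := sum_lowerEl_mul_chainSum yᵘ (qInt (-1) * qDiff) hn.le (n + 1)
  have hN := chainSum_recursion yᵘ (qInt (-1) * qDiff) (show 2 ≤ n + 1 by omega) le_rfl
  have r1 := anti_rowEntry_one hy hc hn
  have rN := anti_rowEntry_eq hy hc hn (show 2 ≤ n + 1 by omega) le_rfl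
  have hico : Ico 2 (n + 1) = Icc 2 n := by
    ext m
    simp only [mem_Icc, mem_Ico]
    omega
  rw [hN, hico, hC] at rN
  have hmid : ∑ i ∈ Icc 2 n, colEntry y i * unop (rowEntry (anti y) i) = -(qInt (-1) • (κ[y,n + 1] *
        ((∑ k ∈ Finset.range n, (-(qInt (-1) * qDiff)) ^ k • chainSum yᵘ (n + 1) n (k + 1)) *
          qPow (-(eDiag yᵘ 1 + eDiag yᵘ 1))))) := by
    rw [← hC, sum_mul, mul_sum, smul_sum, ← Finset.sum_neg_distrib]
    refine sum_congr rfl fun k hk => ?_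
    rw [mem_Icc] at hk
    rw [anti_rowEntry_eq hy hc hn hk.1 (by omega), colEntry, if_neg (by omega), col,
      hy.1.lowerEl_mul_qPow (by omega) (by omega) le_rfl rfl, mul_neg, smul_mul_assoc, mul_assoc,
      mul_assoc]
  have hlast : ∑ k ∈ Icc 1 n, (qInt (-k) * (-qDiff) ^ (k - 1)) •
        (chainSum yᵘ (n + 1) n k * qPow (scal (-2) • eDiag yᵘ 1)) =
      qInt (-1) • ((∑ k ∈ Finset.range n,
        (-(qInt (-1) * qDiff)) ^ k • chainSum yᵘ (n + 1) n (k + 1)) *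
          qPow (-(eDiag yᵘ 1 + eDiag yᵘ 1))) := by
    rw [sum_mul, smul_sum, h2]
    refine Finset.sum_nbij' (fun k => k - 1) (fun k => k + 1) (fun k hk => ?_) (fun k hk => ?_)
      (fun k hk => ?_) (fun k _ => rfl) fun k hk => ?_
    · rw [mem_Icc] at hk
      rw [Finset.mem_range]
      omega
    · rw [Finset.mem_range] at hk
      rw [mem_Icc]
      omega
    · rw [mem_Icc] at hk
      omega
    · rw [mem_Icc] at hk
      obtain ⟨k, rfl⟩ : ∃ m, k = m + 1 := ⟨k - 1, by omega⟩
      change (qInt (-((k + 1 : ℕ) : ℤ)) * (-qDiff) ^ k) • _ = _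
      rw [← qInt_neg_mul_neg_pow, mul_smul, smul_mul_assoc]
      rfl
  have hE' : lowerEl yᵘ (n + 1) 1 * eDiag yᵘ 1 = (eDiag yᵘ 1 + 1) * lowerEl yᵘ (n + 1) 1 := by
    rw [add_mul, hE, one_mul, zero_sub, neg_smul, one_smul, neg_add_cancel_right]
  rw [hlast, antiXi_eq_mul hy hc hn, hg, hsum, sum_insert (by simp; omega),
    sum_insert (by simp), hmid, r1, rN, colEntry, if_neg (by omega), col,
    hy.1.lowerEl_one_mul_qPow (show 1 < n + 1 by omega) le_rfl, colEntry, if_pos rfl, colTop,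
    rowEntry, if_pos rfl, rowBot]
  have hv : ∀ k, Commute (halfHd y + eDiag yᵘ (n + 1)) (eDiag yᵘ k) := fun k =>
    (hd k).add_left (hcm _ k)
  generalize (∑ k ∈ Finset.range n, (-(qInt (-1) * qDiff)) ^ k • chainSum yᵘ (n + 1) n (k + 1)) = S
  have hh : ∀ k, Commute (eDiag yᵘ k) (halfHd y) := fun k => (hd k).symm
  exact antiXi_formula_aux (hcm 1 (n + 1)) (hd 1) (hd (n + 1)) hdd hE' (y .xi) S

end AntipodeFormula

/-! ### The topological Hopf algebra -/

section Universal

variable {n : ℕ} {A : Type} [Ring A] [Algebra BaseRing A] [IsAdicComplete adicIdeal A]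

/-- The universal property of the Drinfeldian: the family `y` satisfies the relations, every
solution of the relations in a complete algebra is an image of `y`, and `y` generates `A`
topologically. -/
structure IsUniversal (y : DIdx n → A) : Prop where
  rel : DRel y
  lift : ∀ {B : Type} [Ring B] [Algebra BaseRing B] [IsAdicComplete adicIdeal B] {x : DIdx n → B},
    DRel x → ∃ φ : A →ₐ[BaseRing] B, ∀ a, φ (y a) = x a
  dense : ∀ {M : Type} [AddCommGroup M] [Module BaseRing M] [IsHausdorff adicIdeal M]
    {f g : A →ₗ[BaseRing] M}, (∀ a ∈ Algebra.adjoin BaseRing (Set.range y), f a = g a) → f = g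

variable {y : DIdx n → A}

lemma IsUniversal.hom_ext (hy : IsUniversal y) {B : Type} [Ring B] [Algebra BaseRing B]
    [IsHausdorff adicIdeal B] {f g : A →ₐ[BaseRing] B} (h : ∀ a, f (y a) = g (y a)) : f = g := by
  have h1 : Algebra.adjoin BaseRing (Set.range y) ≤ AlgHom.equalizer f g :=
    Algebra.adjoin_le (by rintro _ ⟨a, rfl⟩; exact h a)
  exact AlgHom.toLinearMap_injective (hy.dense fun a ha => h1 ha)

lemma IsUniversal.hd_central (hy : IsUniversal y) (a : A) : y .hd * a = a * y .hd := by
  have h1 : Algebra.adjoin BaseRing (Set.range y) ≤ Subalgebra.centralizer BaseRing {y .hd} :=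
    Algebra.adjoin_le (by
      rintro _ ⟨a, rfl⟩
      rw [SetLike.mem_coe, Subalgebra.mem_centralizer_iff]
      rintro _ rfl
      exact DCartan.hd_comm hy.rel.2.1 a)
  have h2 : LinearMap.mulLeft BaseRing (y .hd) = LinearMap.mulRight BaseRing (y .hd) :=
    hy.dense fun a ha => (Subalgebra.mem_centralizer_iff BaseRing).1 (h1 ha) _ rfl
  exact LinearMap.congr_fun h2 a

lemma drin_universal (n : ℕ) : IsUniversal (dGen n) where
  rel := dGen_rel n
  lift hx := ⟨drinLift _ hx, drinLift_dGen _ hx⟩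
  dense {M} _ _ _ f g h := by
    have h1 : f ∘ₗ (presProj (drinRel n)).toLinearMap =
        g ∘ₗ (presProj (drinRel n)).toLinearMap := by
      refine complLinear_ext adicIdeal adicIdeal_fg fun a => h _ ?_
      change presProj (drinRel n) (toCompl adicIdeal (FreeAlgebra BaseRing (DIdx n)) a) ∈ _
      induction a using FreeAlgebra.induction with
      | grade0 c =>
        rw [AlgHom.commutes, AlgHom.commutes]
        exact Subalgebra.algebraMap_mem _ c
      | grade1 a => exact Algebra.subset_adjoin ⟨a, rfl⟩
      | mul a b ha hb =>
        rw [map_mul, map_mul]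
        exact mul_mem ha hb
      | add a b ha hb =>
        rw [map_add, map_add]
        exact add_mem ha hb
    refine LinearMap.ext fun x => ?_
    obtain ⟨w, rfl⟩ := presProj_surjective (drinRel n) x
    exact LinearMap.congr_fun h1 w

end Universal

section TensorSquare

variable {A C : Type} [Ring A] [Algebra BaseRing A] [Ring C] [Algebra BaseRing C]

/-- `a ↦ a ⊗ 1` in `A ⊗̂ C`. -/
def tensorLeft (A C : Type) [Ring A] [Algebra BaseRing A] [Ring C] [Algebra BaseRing C] :
    A →ₐ[BaseRing] AdicCompl adicIdeal (A ⊗[BaseRing] C) :=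
  (toCompl adicIdeal (A ⊗[BaseRing] C)).comp Algebra.TensorProduct.includeLeft

/-- `c ↦ 1 ⊗ c` in `A ⊗̂ C`. -/
def tensorRight (A C : Type) [Ring A] [Algebra BaseRing A] [Ring C] [Algebra BaseRing C] :
    C →ₐ[BaseRing] AdicCompl adicIdeal (A ⊗[BaseRing] C) :=
  (toCompl adicIdeal (A ⊗[BaseRing] C)).comp Algebra.TensorProduct.includeRight

lemma tensorLeft_mul_tensorRight (a : A) (c : C) :
    tensorLeft A C a * tensorRight A C c = toCompl adicIdeal (A ⊗[BaseRing] C) (a ⊗ₜ c) := by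
  change toCompl adicIdeal (A ⊗[BaseRing] C) (a ⊗ₜ 1) *
    toCompl adicIdeal (A ⊗[BaseRing] C) (1 ⊗ₜ c) = _
  rw [← map_mul, Algebra.TensorProduct.tmul_mul_tmul, mul_one, one_mul]

lemma tensorLeft_comm (a : A) (c : C) :
    tensorLeft A C a * tensorRight A C c = tensorRight A C c * tensorLeft A C a := by
  rw [tensorLeft_mul_tensorRight]
  change _ = toCompl adicIdeal (A ⊗[BaseRing] C) (1 ⊗ₜ c) *
    toCompl adicIdeal (A ⊗[BaseRing] C) (a ⊗ₜ 1)
  rw [← map_mul, Algebra.TensorProduct.tmul_mul_tmul, mul_one, one_mul]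

/-- A homomorphism out of `A ⊗̂ C` commutes with an element that commutes with the images of `A` and
of `C`. -/
lemma commute_of_tensor {B : Type} [Ring B] [Algebra BaseRing B] [IsAdicComplete adicIdeal B]
    (φ : AdicCompl adicIdeal (A ⊗[BaseRing] C) →ₐ[BaseRing] B) {b : B}
    (h1 : ∀ a, Commute (φ (tensorLeft A C a)) b) (h2 : ∀ c, Commute (φ (tensorRight A C c)) b)
    (w : AdicCompl adicIdeal (A ⊗[BaseRing] C)) : Commute (φ w) b := by
  have h : LinearMap.mulRight BaseRing b ∘ₗ φ.toLinearMap =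
      LinearMap.mulLeft BaseRing b ∘ₗ φ.toLinearMap := by
    refine complLinear_ext adicIdeal adicIdeal_fg fun w => ?_
    change φ (toCompl adicIdeal (A ⊗[BaseRing] C) w) * b =
      b * φ (toCompl adicIdeal (A ⊗[BaseRing] C) w)
    induction w using TensorProduct.induction_on with
    | zero => rw [map_zero, map_zero, zero_mul, mul_zero]
    | add u v hu hv => rw [map_add, map_add, add_mul, mul_add, hu, hv]
    | tmul a c =>
      rw [← tensorLeft_mul_tensorRight, map_mul]
      exact (h1 a).mul_left (h2 c)
  exact LinearMap.congr_fun h w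

/-- The homomorphism out of `A ⊗ C` given by commuting homomorphisms of `A` and `C`, completed. -/
def tensorLift {E : Type} [Ring E] [Algebra BaseRing E] (f : A →ₐ[BaseRing] AdicCompl adicIdeal E)
    (g : C →ₐ[BaseRing] AdicCompl adicIdeal E) (h : ∀ a c, Commute (f a) (g c)) :
    AdicCompl adicIdeal (A ⊗[BaseRing] C) →ₐ[BaseRing] AdicCompl adicIdeal E :=
  complExtendAlg adicIdeal adicIdeal_fg (Algebra.TensorProduct.lift f g h)

lemma tensorLift_left {E : Type} [Ring E] [Algebra BaseRing E]
    (f : A →ₐ[BaseRing] AdicCompl adicIdeal E) (g : C →ₐ[BaseRing] AdicCompl adicIdeal E)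
    (h : ∀ a c, Commute (f a) (g c)) (a : A) : tensorLift f g h (tensorLeft A C a) = f a := by
  change complExtend adicIdeal _ (toCompl adicIdeal (A ⊗[BaseRing] C) (a ⊗ₜ 1)) = _
  rw [complExtend_toCompl]
  change Algebra.TensorProduct.lift f g h (a ⊗ₜ 1) = _
  rw [Algebra.TensorProduct.lift_tmul, map_one, mul_one]

lemma tensorLift_right {E : Type} [Ring E] [Algebra BaseRing E]
    (f : A →ₐ[BaseRing] AdicCompl adicIdeal E) (g : C →ₐ[BaseRing] AdicCompl adicIdeal E)
    (h : ∀ a c, Commute (f a) (g c)) (c : C) : tensorLift f g h (tensorRight A C c) = g c := by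
  change complExtend adicIdeal _ (toCompl adicIdeal (A ⊗[BaseRing] C) (1 ⊗ₜ c)) = _
  rw [complExtend_toCompl]
  change Algebra.TensorProduct.lift f g h (1 ⊗ₜ c) = _
  rw [Algebra.TensorProduct.lift_tmul, map_one, one_mul]

/-- A linear map that is multiplicative on pure tensors in this sense extends as `tensorLift`. -/
lemma complExtend_eq_tensorLift {E : Type} [Ring E] [Algebra BaseRing E]
    (f : A →ₐ[BaseRing] AdicCompl adicIdeal E) (g : C →ₐ[BaseRing] AdicCompl adicIdeal E)
    (h : ∀ a c, Commute (f a) (g c)) {F : A ⊗[BaseRing] C →ₗ[BaseRing] AdicCompl adicIdeal E}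
    (hF : ∀ a c, F (a ⊗ₜ c) = f a * g c) (w : AdicCompl adicIdeal (A ⊗[BaseRing] C)) :
    complExtend adicIdeal F w = tensorLift f g h w := by
  have : F = (Algebra.TensorProduct.lift f g h).toLinearMap := by
    refine TensorProduct.ext' fun a c => ?_
    rw [hF]
    exact (Algebra.TensorProduct.lift_tmul f g h a c).symm
  rw [this]
  rfl

end TensorSquare

section CoproductZero

variable {n : ℕ} {B : Type*} [Ring B] [Algebra BaseRing B] [IsAdicComplete adicIdeal B]

lemma hEl_zero (k : ℕ) : hEl (uPart fun _ : DIdx n => (0 : B)) k = 0 := by simp [hEl, at1, uPart]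

lemma fEl_zero (k : ℕ) : fEl (uPart fun _ : DIdx n => (0 : B)) k = 0 := by simp [fEl, at1, uPart]

lemma eEl_zero (k : ℕ) : eEl (uPart fun _ : DIdx n => (0 : B)) k = 0 := by simp [eEl, at1, uPart]

lemma eDiag_zero (k : ℕ) : eDiag (uPart fun _ : DIdx n => (0 : B)) k = 0 := by
  simp [eDiag, hEl_zero]

lemma lowerEl_zero (j i : ℕ) : lowerEl (uPart fun _ : DIdx n => (0 : B)) j i = 0 := by
  rw [lowerEl]
  induction j - i - 1 with
  | zero => exact fEl_zero i
  | succ d ih => rw [lowerAux, ih, fEl_zero, qComm, mul_zero, smul_zero, sub_zero]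

lemma colEntry_zero (i : ℕ) : colEntry (fun _ : DIdx n => (0 : B)) i = 0 := by
  unfold colEntry
  split_ifs
  · rw [colTop, halfHd, smul_zero, zero_add, eDiag_zero, qNum_zero, zero_mul]
  · rw [col, lowerEl_zero, zero_mul]

lemma rowEntry_zero (i : ℕ) : rowEntry (fun _ : DIdx n => (0 : B)) i = 0 := by
  unfold rowEntry
  split_ifs
  · rw [rowBot, eDiag_zero, qNum_zero, zero_mul]
  · rw [row, lowerEl_zero, zero_mul]

lemma coprod_zero_left (Y : DIdx n → B) : coprod (fun _ => 0) Y = Y := by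
  funext a
  match a with
  | .u (.h i) => exact zero_add _
  | .u (.e i) =>
    change 0 + qPow (-0) * Y _ = Y _
    rw [neg_zero, qPow_zero, one_mul, zero_add]
  | .u (.f i) =>
    change 0 * _ + Y _ = Y _
    rw [zero_mul, zero_add]
  | .xi =>
    rw [coprod_xi, grp, eDiag_zero, eDiag_zero, sub_zero, sub_zero, qPow_zero, one_mul, zero_add,
      etaPart, Finset.sum_eq_zero fun i _ => by rw [colEntry_zero, zero_mul], smul_zero, add_zero]
  | .hd => exact zero_add _

lemma coprod_zero_right (X : DIdx n → B) : coprod X (fun _ => 0) = X := by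
  funext a
  match a with
  | .u (.h i) => exact add_zero _
  | .u (.e i) =>
    change X _ + _ * 0 = X _
    rw [mul_zero, add_zero]
  | .u (.f i) =>
    change X _ * qPow 0 + 0 = X _
    rw [qPow_zero, mul_one, add_zero]
  | .xi =>
    rw [coprod_xi, mul_zero, add_zero, etaPart,
      Finset.sum_eq_zero fun i _ => by rw [rowEntry_zero, mul_zero], smul_zero, add_zero]
  | .hd => exact add_zero _

lemma zero_drel : DRel fun _ : DIdx n => (0 : B) := by
  refine ⟨⟨fun a b h => ?_, fun a b h => ?_⟩, fun a b h => ?_, fun a b h => ?_⟩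
  · cases h <;> simp only [hEl_zero, eEl_zero, fEl_zero, mul_zero, sub_zero, smul_zero]
  · cases h <;> simp only [hEl_zero, eEl_zero, fEl_zero, mul_zero, sub_zero, smul_zero, qNum_zero,
      qComm]
  · cases h <;> simp only [mul_zero, zero_mul, sub_zero, neg_zero]
  · cases h <;> simp only [eEl_zero, fEl_zero, lowerEl_zero, mul_zero, sub_zero, smul_zero, qComm]

end CoproductZero

/-! ### Coassociativity, counit and antipode on the Drinfeldian -/

section HopfStructure

variable {n : ℕ} {A : Type} [Ring A] [Algebra BaseRing A] [IsAdicComplete adicIdeal A]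
variable {y : DIdx n → A}

/-- The generators in `A ⊗̂ A`, and their coproduct. -/
def comulGen (y : DIdx n → A) : DIdx n → AdicCompl adicIdeal (A ⊗[BaseRing] A) :=
  coprod (fun a => tensorLeft A A (y a)) fun a => tensorRight A A (y a)

lemma comulGen_drel (hy : DRel y) (hn : 1 < n) : DRel (comulGen y) :=
  coprod_drel (hy.map _) (hy.map _) (fun _ _ => tensorLeft_comm _ _) hn

lemma map_comulGen {E : Type} [Ring E] [Algebra BaseRing E]
    (φ : AdicCompl adicIdeal (A ⊗[BaseRing] A) →ₐ[BaseRing] AdicCompl adicIdeal E)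
    (y : DIdx n → A) (a : DIdx n) : φ (comulGen y a) =
      coprod (fun a => φ (tensorLeft A A (y a))) (fun a => φ (tensorRight A A (y a))) a :=
  map_coprod (B := AdicCompl adicIdeal (A ⊗[BaseRing] A)) (C := AdicCompl adicIdeal E) φ _ _ a

section Coassoc

variable (Δ : A →ₐ[BaseRing] AdicCompl adicIdeal (A ⊗[BaseRing] A))

/-- `a ⊗ b ↦ a ⊗ b ⊗ 1`, completed. -/
def firstTwo (A : Type) [Ring A] [Algebra BaseRing A] :
    AdicCompl adicIdeal (A ⊗[BaseRing] A) →ₐ[BaseRing]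
    AdicCompl adicIdeal (A ⊗[BaseRing] (A ⊗[BaseRing] A)) :=
  complExtendAlg adicIdeal adicIdeal_fg ((toCompl adicIdeal (A ⊗[BaseRing] (A ⊗[BaseRing] A))).comp
    (Algebra.TensorProduct.map (AlgHom.id BaseRing A) Algebra.TensorProduct.includeLeft))

/-- `a ⊗ b ↦ 1 ⊗ a ⊗ b`, completed. -/
def lastTwo (A : Type) [Ring A] [Algebra BaseRing A] :
    AdicCompl adicIdeal (A ⊗[BaseRing] A) →ₐ[BaseRing]
    AdicCompl adicIdeal (A ⊗[BaseRing] (A ⊗[BaseRing] A)) :=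
  complExtendAlg adicIdeal adicIdeal_fg ((toCompl adicIdeal (A ⊗[BaseRing] (A ⊗[BaseRing] A))).comp
    Algebra.TensorProduct.includeRight)

/-- `a ⊗ 1 ⊗ 1`. -/
def tri1 (a : A) : AdicCompl adicIdeal (A ⊗[BaseRing] (A ⊗[BaseRing] A)) :=
  toCompl adicIdeal _ (a ⊗ₜ (1 ⊗ₜ 1))

/-- `1 ⊗ a ⊗ 1`. -/
def tri2 (a : A) : AdicCompl adicIdeal (A ⊗[BaseRing] (A ⊗[BaseRing] A)) :=
  toCompl adicIdeal _ (1 ⊗ₜ (a ⊗ₜ 1))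

/-- `1 ⊗ 1 ⊗ a`. -/
def tri3 (a : A) : AdicCompl adicIdeal (A ⊗[BaseRing] (A ⊗[BaseRing] A)) :=
  toCompl adicIdeal _ (1 ⊗ₜ (1 ⊗ₜ a))

lemma firstTwo_left (a : A) : firstTwo A (tensorLeft A A a) = tri1 a := by
  change complExtend adicIdeal _ (toCompl adicIdeal (A ⊗[BaseRing] A) (a ⊗ₜ 1)) = _
  rw [complExtend_toCompl]
  rfl

lemma firstTwo_right (a : A) : firstTwo A (tensorRight A A a) = tri2 a := by
  change complExtend adicIdeal _ (toCompl adicIdeal (A ⊗[BaseRing] A) (1 ⊗ₜ a)) = _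
  rw [complExtend_toCompl]
  rfl

lemma lastTwo_left (a : A) : lastTwo A (tensorLeft A A a) = tri2 a := by
  change complExtend adicIdeal _ (toCompl adicIdeal (A ⊗[BaseRing] A) (a ⊗ₜ 1)) = _
  rw [complExtend_toCompl]
  rfl

lemma lastTwo_right (a : A) : lastTwo A (tensorRight A A a) = tri3 a := by
  change complExtend adicIdeal _ (toCompl adicIdeal (A ⊗[BaseRing] A) (1 ⊗ₜ a)) = _
  rw [complExtend_toCompl]
  rfl

lemma toCompl_commute {E : Type} [Ring E] [Algebra BaseRing E] {u v : E} (h : u * v = v * u) :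
    Commute (toCompl adicIdeal E u) (toCompl adicIdeal E v) := by
  change _ * _ = _ * _
  rw [← map_mul, h, map_mul]

lemma tri_comm (a b : A) : Commute (tri1 a) (tri2 b) ∧ Commute (tri1 a) (tri3 b) ∧
    Commute (tri2 a) (tri3 b) :=
  ⟨toCompl_commute (by simp), toCompl_commute (by simp), toCompl_commute (by simp)⟩

/-- `a ↦ 1 ⊗ 1 ⊗ a`. -/
def triRight (A : Type) [Ring A] [Algebra BaseRing A] :
    A →ₐ[BaseRing] AdicCompl adicIdeal (A ⊗[BaseRing] (A ⊗[BaseRing] A)) :=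
  (toCompl adicIdeal (A ⊗[BaseRing] (A ⊗[BaseRing] A))).comp
    (Algebra.TensorProduct.includeRight.comp Algebra.TensorProduct.includeRight)

/-- `a ↦ a ⊗ 1 ⊗ 1`. -/
def triLeft (A : Type) [Ring A] [Algebra BaseRing A] :
    A →ₐ[BaseRing] AdicCompl adicIdeal (A ⊗[BaseRing] (A ⊗[BaseRing] A)) :=
  (toCompl adicIdeal (A ⊗[BaseRing] (A ⊗[BaseRing] A))).comp Algebra.TensorProduct.includeLeft

/-- `a ↦ 1 ⊗ a ⊗ 1`. -/
def triMid (A : Type) [Ring A] [Algebra BaseRing A] :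
    A →ₐ[BaseRing] AdicCompl adicIdeal (A ⊗[BaseRing] (A ⊗[BaseRing] A)) :=
  (toCompl adicIdeal (A ⊗[BaseRing] (A ⊗[BaseRing] A))).comp
    (Algebra.TensorProduct.includeRight.comp Algebra.TensorProduct.includeLeft)

lemma comul_coassoc (hy : IsUniversal y) (hΔ : ∀ a, Δ (y a) = comulGen y a) (a : A) :
    complExtend adicIdeal (coassocLeft adicIdeal Δ) (Δ a) =
      complExtend adicIdeal (coassocRight adicIdeal Δ) (Δ a) := by
  have c1 : ∀ a b, Commute ((firstTwo A).comp Δ a) (triRight A b) := fun a b =>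
    commute_of_tensor (B := AdicCompl adicIdeal (A ⊗[BaseRing] (A ⊗[BaseRing] A)))
      (firstTwo A) (b := triRight A b) (fun c => by
      rw [firstTwo_left]
      exact (tri_comm c b).2.1) (fun c => by
      rw [firstTwo_right]
      exact (tri_comm c b).2.2) (Δ a)
  have c2 : ∀ a b, Commute (triLeft A a) ((lastTwo A).comp Δ b) := fun a b =>
    (commute_of_tensor (B := AdicCompl adicIdeal (A ⊗[BaseRing] (A ⊗[BaseRing] A)))
      (lastTwo A) (b := triLeft A a) (fun c => by
      rw [lastTwo_left]
      exact (tri_comm a c).1.symm) (fun c => by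
      rw [lastTwo_right]
      exact (tri_comm a c).2.1.symm) (Δ b)).symm
  have e1 : ∀ w, complExtend adicIdeal (coassocLeft adicIdeal Δ) w =
      tensorLift ((firstTwo A).comp Δ) (triRight A) c1 w :=
    complExtend_eq_tensorLift _ _ _ fun _ _ => rfl
  have e2 : ∀ w, complExtend adicIdeal (coassocRight adicIdeal Δ) w =
      tensorLift (triLeft A) ((lastTwo A).comp Δ) c2 w :=
    complExtend_eq_tensorLift _ _ _ fun _ _ => rfl
  rw [e1, e2]
  have h : (tensorLift ((firstTwo A).comp Δ) (triRight A) c1).comp Δ =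
      (tensorLift (triLeft A) ((lastTwo A).comp Δ) c2).comp Δ := by
    refine hy.hom_ext (B := AdicCompl adicIdeal (A ⊗[BaseRing] (A ⊗[BaseRing] A))) fun a => ?_
    have t1 : DRel fun a => tri1 (y a) :=
      DRel.map (C := AdicCompl adicIdeal (A ⊗[BaseRing] (A ⊗[BaseRing] A))) (triLeft A) y hy.rel
    have t3 : DRel fun a => tri3 (y a) :=
      DRel.map (C := AdicCompl adicIdeal (A ⊗[BaseRing] (A ⊗[BaseRing] A))) (triRight A) y hy.rel
    have t2 : DRel fun a => tri2 (y a) :=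
      DRel.map (C := AdicCompl adicIdeal (A ⊗[BaseRing] (A ⊗[BaseRing] A))) (triMid A) y hy.rel
    have l1 : ∀ b, tensorLift ((firstTwo A).comp Δ) (triRight A) c1 (tensorLeft A A (y b)) =
        coprod (fun a => tri1 (y a)) (fun a => tri2 (y a)) b := fun b => by
      rw [tensorLift_left, AlgHom.comp_apply, hΔ, map_comulGen]
      simp only [firstTwo_left, firstTwo_right]
    have l2 : ∀ b, tensorLift ((firstTwo A).comp Δ) (triRight A) c1 (tensorRight A A (y b)) =
        tri3 (y b) := fun b => tensorLift_right _ _ _ _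
    have r1 : ∀ b, tensorLift (triLeft A) ((lastTwo A).comp Δ) c2 (tensorLeft A A (y b)) =
        tri1 (y b) := fun b => tensorLift_left _ _ _ _
    have r2 : ∀ b, tensorLift (triLeft A) ((lastTwo A).comp Δ) c2 (tensorRight A A (y b)) =
        coprod (fun a => tri2 (y a)) (fun a => tri3 (y a)) b := fun b => by
      rw [tensorLift_right, AlgHom.comp_apply, hΔ, map_comulGen]
      simp only [lastTwo_left, lastTwo_right]
    rw [AlgHom.comp_apply, AlgHom.comp_apply, hΔ, map_comulGen, map_comulGen]
    simp only [l1, l2, r1, r2]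
    exact congrFun (coprod_coassoc t1.1 t1.2.1 t2.1 t2.2.1 t3.1 t3.2.1
      (fun a b => (tri_comm (y a) (y b)).1) fun a b => (tri_comm (y a) (y b)).2.2) a
  exact AlgHom.congr_fun h a

end Coassoc

section Counit

variable (Δ : A →ₐ[BaseRing] AdicCompl adicIdeal (A ⊗[BaseRing] A)) (ε : A →ₐ[BaseRing] BaseRing)

lemma comul_counit_left (hy : IsUniversal y) (hΔ : ∀ a, Δ (y a) = comulGen y a)
    (hε : ∀ a, ε (y a) = 0) (a : A) :
    complMap adicIdeal ((TensorProduct.lid BaseRing A).toLinearMap ∘ₗ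
      TensorProduct.map ε.toLinearMap LinearMap.id) (Δ a) = toCompl adicIdeal A a := by
  have c : ∀ a b, Commute (((toCompl adicIdeal A).comp (Algebra.ofId BaseRing A)).comp ε a)
      (toCompl adicIdeal A b) := fun a b => toCompl_commute (Algebra.commutes _ _)
  have e : ∀ w, complMap adicIdeal ((TensorProduct.lid BaseRing A).toLinearMap ∘ₗ
      TensorProduct.map ε.toLinearMap LinearMap.id) w = tensorLift _ _ c w :=
    complExtend_eq_tensorLift _ _ _ fun a b => by
      change toCompl adicIdeal A (ε a • b) = toCompl adicIdeal A (algebraMap BaseRing A (ε a)) * _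
      rw [← map_mul, Algebra.smul_def]
  rw [e]
  have h : (tensorLift _ _ c).comp Δ = toCompl adicIdeal A := by
    refine hy.hom_ext (B := AdicCompl adicIdeal A) fun a => ?_
    rw [AlgHom.comp_apply, hΔ, map_comulGen]
    simp only [tensorLift_left, tensorLift_right, AlgHom.comp_apply, hε, map_zero]
    rw [coprod_zero_left]
  exact AlgHom.congr_fun h a

lemma comul_counit_right (hy : IsUniversal y) (hΔ : ∀ a, Δ (y a) = comulGen y a)
    (hε : ∀ a, ε (y a) = 0) (a : A) :
    complMap adicIdeal ((TensorProduct.rid BaseRing A).toLinearMap ∘ₗ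
      TensorProduct.map LinearMap.id ε.toLinearMap) (Δ a) = toCompl adicIdeal A a := by
  have c : ∀ a b, Commute (toCompl adicIdeal A a)
      (((toCompl adicIdeal A).comp (Algebra.ofId BaseRing A)).comp ε b) :=
    fun a b => toCompl_commute (Algebra.commutes _ _).symm
  have e : ∀ w, complMap adicIdeal ((TensorProduct.rid BaseRing A).toLinearMap ∘ₗ
      TensorProduct.map LinearMap.id ε.toLinearMap) w = tensorLift _ _ c w :=
    complExtend_eq_tensorLift _ _ _ fun a b => by
      change toCompl adicIdeal A (ε b • a) =
        toCompl adicIdeal A a * toCompl adicIdeal A (algebraMap BaseRing A (ε b))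
      rw [← map_mul, ← Algebra.commutes, Algebra.smul_def]
  rw [e]
  have h : (tensorLift _ _ c).comp Δ = toCompl adicIdeal A := by
    refine hy.hom_ext (B := AdicCompl adicIdeal A) fun a => ?_
    rw [AlgHom.comp_apply, hΔ, map_comulGen]
    simp only [tensorLift_left, tensorLift_right, AlgHom.comp_apply, hε, map_zero]
    rw [coprod_zero_right]
  exact AlgHom.congr_fun h a

end Counit

section AntipodeAxiom

variable (Δ : A →ₐ[BaseRing] AdicCompl adicIdeal (A ⊗[BaseRing] A)) (ε : A →ₐ[BaseRing] BaseRing)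
  (S : A →ₐ[BaseRing] Aᵐᵒᵖ)

lemma comul_antipode_left (hy : IsUniversal y) (hΔ : ∀ a, Δ (y a) = comulGen y a)
    (hε : ∀ a, ε (y a) = 0) (hS : ∀ a, S (y a) = anti y a) (a : A) :
    complMap adicIdeal (LinearMap.mul' BaseRing A ∘ₗ
      TensorProduct.map ((opLinearEquiv BaseRing).symm.toLinearMap ∘ₗ S.toLinearMap)
        LinearMap.id) (Δ a) = toCompl adicIdeal A (algebraMap BaseRing A (ε a)) := by
  have c : ∀ a b, Commute ((opLeft A).comp S a) (opRight A b) := fun a b => opLeft_comm _ _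
  have e : ∀ w, complMap adicIdeal (LinearMap.mul' BaseRing A ∘ₗ
      TensorProduct.map ((opLinearEquiv BaseRing).symm.toLinearMap ∘ₗ S.toLinearMap)
        LinearMap.id) w = toCompl adicIdeal A (opMul A (tensorLift _ _ c w)) := fun w => by
    rw [complMap_eq]
    congr 1
    refine LinearMap.congr_fun (f := complLinLift adicIdeal _)
      (g := opMul A ∘ₗ (tensorLift _ _ c).toLinearMap) ?_ w
    refine complLinear_ext adicIdeal adicIdeal_fg fun z => ?_
    rw [complLinLift_toCompl]
    change _ = opMul A (tensorLift _ _ c (toCompl adicIdeal (A ⊗[BaseRing] A) z))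
    induction z using TensorProduct.induction_on with
    | zero => simp only [map_zero]
    | add u v hu hv => simp only [map_add, hu, hv]
    | tmul a b =>
      rw [← tensorLeft_mul_tensorRight, map_mul, tensorLift_left, tensorLift_right,
        AlgHom.comp_apply, opMul_left_right]
      rfl
  rw [e]
  congr 1
  refine LinearMap.congr_fun (f := opMul A ∘ₗ (tensorLift _ _ c).toLinearMap ∘ₗ Δ.toLinearMap)
    (g := Algebra.linearMap BaseRing A ∘ₗ ε.toLinearMap) (hy.dense fun a ha => ?_) a
  change opMul A (tensorLift _ _ c (Δ a)) = algebraMap BaseRing A (ε a)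
  induction ha using Algebra.adjoin_induction with
  | mem a ha =>
    obtain ⟨a, rfl⟩ := ha
    rw [hε, map_zero, hΔ, map_comulGen]
    simp only [tensorLift_left, tensorLift_right, AlgHom.comp_apply, hS]
    exact (opPairing A).mul_cop_anti y a
  | algebraMap r =>
    rw [AlgHom.commutes, AlgHom.commutes, AlgHom.commutes, ← AlgHom.commutes (opRight A),
      opMul_right]
    rfl
  | add a b _ _ ha hb => rw [map_add, map_add, map_add, ha, hb, map_add, map_add]
  | mul a b _ _ ha hb =>
    rw [map_mul, map_mul, opMul_scalar_mul ha, hb, map_mul, map_mul, Algebra.smul_def]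

lemma comul_antipode_right (hy : IsUniversal y) (hn : 1 < n) (hΔ : ∀ a, Δ (y a) = comulGen y a)
    (hε : ∀ a, ε (y a) = 0) (hS : ∀ a, S (y a) = anti y a) (a : A) :
    complMap adicIdeal (LinearMap.mul' BaseRing A ∘ₗ TensorProduct.map LinearMap.id
      ((opLinearEquiv BaseRing).symm.toLinearMap ∘ₗ S.toLinearMap)) (Δ a) =
        toCompl adicIdeal A (algebraMap BaseRing A (ε a)) := by
  have c : ∀ a b, Commute (copLeft A a) ((copRight A).comp S b) := fun a b => copLeft_comm _ _
  have e : ∀ w, complMap adicIdeal (LinearMap.mul' BaseRing A ∘ₗ TensorProduct.map LinearMap.id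
      ((opLinearEquiv BaseRing).symm.toLinearMap ∘ₗ S.toLinearMap)) w =
        toCompl adicIdeal A (mulOp A (tensorLift _ _ c w)) := fun w => by
    rw [complMap_eq]
    congr 1
    refine LinearMap.congr_fun (f := complLinLift adicIdeal _)
      (g := mulOp A ∘ₗ (tensorLift _ _ c).toLinearMap) ?_ w
    refine complLinear_ext adicIdeal adicIdeal_fg fun z => ?_
    rw [complLinLift_toCompl]
    change _ = mulOp A (tensorLift _ _ c (toCompl adicIdeal (A ⊗[BaseRing] A) z))
    induction z using TensorProduct.induction_on with
    | zero => simp only [map_zero]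
    | add u v hu hv => simp only [map_add, hu, hv]
    | tmul a b =>
      rw [← tensorLeft_mul_tensorRight, map_mul, tensorLift_left, tensorLift_right,
        AlgHom.comp_apply, mulOp_left_right]
      rfl
  rw [e]
  congr 1
  refine LinearMap.congr_fun (f := mulOp A ∘ₗ (tensorLift _ _ c).toLinearMap ∘ₗ Δ.toLinearMap)
    (g := Algebra.linearMap BaseRing A ∘ₗ ε.toLinearMap) (hy.dense fun a ha => ?_) a
  change mulOp A (tensorLift _ _ c (Δ a)) = algebraMap BaseRing A (ε a)
  induction ha using Algebra.adjoin_induction with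
  | mem a ha =>
    obtain ⟨a, rfl⟩ := ha
    rw [hε, map_zero, hΔ, map_comulGen]
    simp only [tensorLift_left, tensorLift_right, AlgHom.comp_apply, hS]
    exact (opCopairing A).mul_coprod_anti hy.rel hy.hd_central hn a
  | algebraMap r =>
    rw [AlgHom.commutes, AlgHom.commutes, AlgHom.commutes, ← AlgHom.commutes (copLeft A)]
    exact (opCopairing A).mul_left _
  | add a b _ _ ha hb => rw [map_add, map_add, map_add, ha, hb, map_add, map_add]
  | mul a b _ _ ha hb =>
    rw [map_mul, map_mul, mulOp_mul_scalar hb, ha, map_mul, map_mul, ← Algebra.commutes,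
      Algebra.smul_def]

end AntipodeAxiom

/-- The Hopf structure of a universal solution of the relations. -/
lemma IsUniversal.exists_topHopf (hy : IsUniversal y) (hn : 1 < n) :
    ∃ H : TopHopf adicIdeal A, (∀ a, H.comul (y a) = comulGen y a) ∧ (∀ a, H.counit (y a) = 0) ∧
      ∀ a, H.antipode (y a) = anti y a := by
  obtain ⟨Δ, hΔ⟩ := hy.lift (comulGen_drel hy.rel hn)
  obtain ⟨ε, hε⟩ := hy.lift (zero_drel (n := n) (B := BaseRing))
  obtain ⟨S, hS⟩ := hy.lift (anti_drel hy.rel hy.hd_central hn)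
  exact ⟨⟨Δ, ε, S, comul_coassoc Δ hy hΔ, comul_counit_left Δ ε hy hΔ hε,
    comul_counit_right Δ ε hy hΔ hε, comul_antipode_left Δ ε S hy hΔ hε hS,
    comul_antipode_right Δ ε S hy hn hΔ hε hS⟩, hΔ, hε, hS⟩

lemma IsUniversal.topHopf_ext (hy : IsUniversal y) {H H' : TopHopf adicIdeal A}
    (h1 : ∀ a, H.comul (y a) = H'.comul (y a)) (h2 : ∀ a, H.counit (y a) = H'.counit (y a))
    (h3 : ∀ a, H.antipode (y a) = H'.antipode (y a)) : H = H' := by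
  have e1 := hy.hom_ext (B := AdicCompl adicIdeal (A ⊗[BaseRing] A)) (f := H.comul)
    (g := H'.comul) h1
  have e2 := hy.hom_ext h2
  have e3 := hy.hom_ext h3
  cases H
  cases H'
  subst e1 e2 e3
  rfl

end HopfStructure

/-! ### Values of the Hopf structure -/

section ComulValues

variable {n : ℕ} {A B : Type*} [Ring A] [Algebra BaseRing A] [IsAdicComplete adicIdeal A]
variable [Ring B] [Algebra BaseRing B] [IsAdicComplete adicIdeal B]

/-- A coproduct `Δ : A → B` on the algebra with the generators `y`, where `B` is a completed tensor
square of `A` with pure tensors `T a b`, or any algebra with two commuting copies of `A`. -/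
structure IsComul (y : DIdx n → A) (T : A → A → B) (L R Δ : A →ₐ[BaseRing] B) : Prop where
  comm : ∀ a b, L a * R b = R b * L a
  tensor : ∀ a b, T a b = L a * R b
  gen : ∀ a, Δ (y a) = coprod (fun a => L (y a)) (fun a => R (y a)) a

variable {y : DIdx n → A} {T : A → A → B} {L R Δ : A →ₐ[BaseRing] B}

lemma IsComul.left (h : IsComul y T L R Δ) (a : A) : T a 1 = L a := by
  rw [h.tensor, map_one, mul_one]

lemma IsComul.right (h : IsComul y T L R Δ) (a : A) : T 1 a = R a := by
  rw [h.tensor, map_one, one_mul]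

lemma IsComul.tensor_mul (h : IsComul y T L R Δ) (a b c d : A) :
    T a b * T c d = T (a * c) (b * d) := by
  rw [h.tensor, h.tensor, h.tensor, map_mul, map_mul, mul_assoc, ← mul_assoc (R b), ← h.comm,
    mul_assoc, mul_assoc]

lemma IsComul.fun_eq (h : IsComul y T L R Δ) :
    (fun a => Δ (y a)) = coprod (fun a => L (y a)) fun a => R (y a) :=
  funext h.gen

lemma IsComul.comul_h (h : IsComul y T L R Δ) (i : ℕ) :
    Δ (hEl yᵘ i) = T (hEl yᵘ i) 1 + T 1 (hEl yᵘ i) := by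
  rw [h.left, h.right, map_hEl, map_hEl, map_hEl, map_uEl, map_uEl, map_uEl, h.fun_eq, hEl_coprod]

/-- The exponential of a primitive element is group-like. -/
lemma IsComul.comul_qPow (h : IsComul y T L R Δ) {u : A} (hu : Δ u = T u 1 + T 1 u) :
    Δ (qPow u) = T (qPow u) (qPow u) ∧ Δ (qPow (-u)) = T (qPow (-u)) (qPow (-u)) := by
  have key : ∀ u : A, Δ u = L u + R u → Δ (qPow u) = T (qPow u) (qPow u) := fun u hu => by
      rw [Δ.map_qPow, hu, qPow_add (h.comm u u), h.tensor, L.map_qPow, R.map_qPow]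
  rw [h.left, h.right] at hu
  refine ⟨key u hu, key (-u) ?_⟩
  rw [map_neg, map_neg, map_neg, hu, neg_add]

lemma IsComul.comul_e (h : IsComul y T L R Δ) (i : ℕ) : Δ (eEl yᵘ i) =
    T (eEl yᵘ i) 1 + T (qPow (-hEl yᵘ i)) (eEl yᵘ i) := by
  rw [h.left, h.tensor, map_eEl, map_eEl, map_eEl, L.map_qPow, map_neg, map_hEl, map_uEl, map_uEl,
    map_uEl, h.fun_eq, eEl_coprod]

lemma IsComul.comul_f (h : IsComul y T L R Δ) (i : ℕ) : Δ (fEl yᵘ i) =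
    T (fEl yᵘ i) (qPow (hEl yᵘ i)) + T 1 (fEl yᵘ i) := by
  rw [h.right, h.tensor, map_fEl, map_fEl, map_fEl, R.map_qPow, map_hEl, map_uEl, map_uEl,
    map_uEl, h.fun_eq, fEl_coprod]

lemma IsComul.comul_hd (h : IsComul y T L R Δ) : Δ (y .hd) = T (y .hd) 1 + T 1 (y .hd) := by
  rw [h.left, h.right]
  exact h.gen .hd

lemma IsComul.comul_xi (h : IsComul y T L R Δ) (hy : DRel y) (hn : 1 < n) : Δ (y .xi) =
    T (y .xi) 1 + T (qPow (eDiag yᵘ 1 - eDiag yᵘ (n + 1) - y .hd)) (y .xi) +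
      eta • ((T (lowerEl yᵘ (n + 1) 1 * qPow (eDiag yᵘ (n + 1))) (qNum (eDiag yᵘ 1)) +
        T (qNum (halfHd y + eDiag yᵘ (n + 1)) * qPow (-halfHd y))
          (lowerEl yᵘ (n + 1) 1 * qPow (eDiag yᵘ (n + 1))) +
        ∑ i ∈ Icc 2 n, T (lowerEl yᵘ (n + 1) i * qPow (eDiag yᵘ (n + 1)))
          (lowerEl yᵘ i 1 * qPow (eDiag yᵘ i))) *
      T (qPow (eDiag yᵘ 1)) (qPow (eDiag yᵘ 1))) := by
  have hcm := hy.1.commute_eDiag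
  have q1 : ∀ k, qPow (eDiag yᵘ k) * qPow (eDiag yᵘ 1) = κ[y,k] := fun k => by
    rw [add_comm, qPow_add (hcm k 1)]
  have q2 : qPow (-halfHd y) * qPow (eDiag yᵘ 1) = qPow (eDiag yᵘ 1 - halfHd y) := by
    rw [← qPow_add (hy.1.commute_half_eDiag hy.2.1 1).neg_left, neg_add_eq_sub]
  rw [h.gen, coprod_xi, etaPart_eq hn, h.left, h.tensor, add_mul, add_mul, sum_mul]
  simp only [h.tensor_mul, mul_assoc, q1, q2, pairSum, ← map_grp, ← map_col, ← map_colTop,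
    ← map_row,
    ← map_rowBot]
  simp only [h.tensor, grp, col, colTop, row, rowBot]
  rw [add_right_comm (L _ * R _)]

lemma IsComul.comul_zeta (h : IsComul y T L R Δ) (hy : DRel y) (hn : 1 < n) :
    Δ (zetaEl y (eTilde yᵘ)) = T (zetaEl y (eTilde yᵘ)) 1 +
      T (qPow (-(y .hd - ∑ i ∈ Icc 1 n, hEl yᵘ i))) (zetaEl y (eTilde yᵘ)) := by
  have hX : DRel fun a => L (y a) := hy.map L
  have hY : DRel fun a => R (y a) := hy.map R
  have hZ := coprod_drel hX hY (fun _ _ => h.comm _ _) hn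
  have hz := coprod_zeta hX.1 hX.2.1 hY.1 hY.2.1 hZ.1 hZ.2.1 (fun _ _ => h.comm _ _) hn
  have hm : ∀ φ : A →ₐ[BaseRing] B, φ (zetaEl y (eTilde yᵘ)) =
      zetaEl (fun a => φ (y a)) (eTilde (uPart fun a => φ (y a))) := fun φ => by
    rw [zetaEl, map_sub, map_smul, map_smul, map_eTilde]
    rfl
  have hg : qPow (-(y .hd - ∑ i ∈ Icc 1 n, hEl yᵘ i)) = grp y (n + 1) := by
    have e : Ico 1 (n + 1) = Icc 1 n := by
      ext k
      simp only [mem_Ico, mem_Icc]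
      omega
    rw [grp, eDiag, eDiag, e, Finset.Ico_self, sum_empty]
    congr 1
    abel
  rw [hg, h.left, h.tensor, map_grp, hm, hm, hm, h.fun_eq, hz]

end ComulValues

section AntipodeValues

variable {n : ℕ} {A : Type*} [Ring A] [Algebra BaseRing A] [IsAdicComplete adicIdeal A]
variable {y : DIdx n → A} {S : A →ₐ[BaseRing] Aᵐᵒᵖ}

lemma antipode_hEl (hS : ∀ a, S (y a) = anti y a) (i : ℕ) : unop (S (hEl yᵘ i)) = -hEl yᵘ i := by
  have e : (fun a => S (uPart y a)) = antiU yᵘ := funext fun a => hS (.u a)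
  rw [map_hEl, e, hEl_antiU, unop_op]

lemma antipode_eEl (hS : ∀ a, S (y a) = anti y a) (i : ℕ) :
    unop (S (eEl yᵘ i)) = -(qPow (hEl yᵘ i) * eEl yᵘ i) := by
  have e : (fun a => S (uPart y a)) = antiU yᵘ := funext fun a => hS (.u a)
  rw [map_eEl, e, eEl_antiU, unop_op]

lemma antipode_fEl (hS : ∀ a, S (y a) = anti y a) (i : ℕ) :
    unop (S (fEl yᵘ i)) = -(fEl yᵘ i * qPow (-hEl yᵘ i)) := by
  have e : (fun a => S (uPart y a)) = antiU yᵘ := funext fun a => hS (.u a)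
  rw [map_fEl, e, fEl_antiU, unop_op]

lemma antipode_qPow {u : A} (hu : unop (S u) = -u) :
    unop (S (qPow u)) = qPow (-u) ∧ unop (S (qPow (-u))) = qPow u := by
  have e : S u = op (-u) := unop_injective hu
  constructor
  · rw [S.map_qPow, e, qPow_op, unop_op]
  · rw [S.map_qPow, map_neg, e, ← op_neg, neg_neg, qPow_op, unop_op]

lemma antipode_zeta (hy : DRel y) (hc : ∀ a, y .hd * a = a * y .hd) (hn : 1 < n)
    (hS : ∀ a, S (y a) = anti y a) : unop (S (zetaEl y (eTilde yᵘ))) =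
      -(qPow (y .hd - ∑ i ∈ Icc 1 n, hEl yᵘ i) * zetaEl y (eTilde yᵘ)) := by
  obtain ⟨B, _, _, _, ⟨P⟩⟩ : ∃ (B : Type _) (_ : Ring B) (_ : Algebra BaseRing B)
      (_ : IsAdicComplete adicIdeal B), Nonempty (AntiPairing A B) :=
    ⟨_, _, _, inferInstance, ⟨opPairing A⟩⟩
  have hs := anti_drel hy hc hn
  have hX : DRel fun a => P.left (anti y a) := hs.map P.left
  have hY : DRel fun a => P.right (y a) := hy.map P.right
  have hZ := coprod_drel hX hY (fun _ _ => P.comm _ _) hn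
  have hz := coprod_zeta hX.1 hX.2.1 hY.1 hY.2.1 hZ.1 hZ.2.1 (fun _ _ => P.comm _ _) hn
  have h0 : P.mul (zetaEl (P.cop (anti y) y) (eTilde (P.cop (anti y) y)ᵘ)) = 0 := by
    have e := hZ.1.eTilde_eq_col hZ.2.1 hn
    have e' := P.mul_mul_eq_zero (P.cop_lowerEl (P.mul_cop_anti y) (n + 1) 1)
      (qPow (eDiag (P.cop (anti y) y)ᵘ 1 + eDiag (P.cop (anti y) y)ᵘ (n + 1)))
    have e'' := P.mul_cop_anti y .xi
    unfold AntiPairing.cop at e' e'' ⊢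
    rw [zetaEl, e, map_sub, map_smul, map_smul, e'', col, e', smul_zero, smul_zero, sub_zero]
  have hl : P.left (zetaEl (anti y) (eTilde (anti y)ᵘ)) =
      zetaEl (fun a => P.left (anti y a)) (eTilde (uPart fun a => P.left (anti y a))) := by
    rw [zetaEl, map_sub, map_smul, map_smul, map_eTilde]
    rfl
  have hr : P.right (zetaEl y (eTilde yᵘ)) =
      zetaEl (fun a => P.right (y a)) (eTilde (uPart fun a => P.right (y a))) := by
    rw [zetaEl, map_sub, map_smul, map_smul, map_eTilde]
    rfl
  have h1 := (congrArg P.mul hz).symm.trans h0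
  rw [← hl, ← hr, ← map_grp, map_add, P.mul_left, P.mul_left_right] at h1
  have hm : S (zetaEl y (eTilde yᵘ)) = zetaEl (anti y) (eTilde (anti y)ᵘ) := by
    have e : (fun a => S (uPart y a)) = uPart (anti y) := funext fun a => hS (.u a)
    rw [zetaEl, map_sub, map_smul, map_smul, map_eTilde, e, hS]
    rfl
  have hg : qPow (y .hd - ∑ i ∈ Icc 1 n, hEl yᵘ i) = unop (grp (anti y) (n + 1)) := by
    have e : Ico 1 (n + 1) = Icc 1 n := by
      ext k
      simp only [mem_Ico, mem_Icc]
      omega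
    rw [unop_grp_anti, eDiag, eDiag, e, Finset.Ico_self, sum_empty]
    congr 1
    abel
  rw [hm, hg]
  exact eq_neg_of_add_eq_zero_left h1

end AntipodeValues

/-! ### The Hopf structure of the Drinfeldian -/

section Drinfeldian

variable {n : ℕ}

lemma isComul_dGen {H : TopHopf adicIdeal (Drin n)}
    (h1 : ∀ a, H.comul (dGen n a) = comulGen (dGen n) a) :
    IsComul (B := DrinSq n) (dGen n) (dT n) (tensorLeft (Drin n) (Drin n))
      (tensorRight (Drin n) (Drin n)) H.comul where
  comm a b := tensorLeft_comm (A := Drin n) (C := Drin n) a b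
  tensor a b := (tensorLeft_mul_tensorRight (A := Drin n) (C := Drin n) a b).symm
  gen := h1

/-- The Hopf structure with the given values on the generators satisfies all the stated formulas. -/
lemma hopf_of_generators (hn : 1 < n) {H : TopHopf adicIdeal (Drin n)}
    (h1 : ∀ a, H.comul (dGen n a) = comulGen (dGen n) a) (h2 : ∀ a, H.counit (dGen n a) = 0)
    (h3 : ∀ a, H.antipode (dGen n a) = anti (dGen n) a) :
    HopfOnU n H ∧ HopfOnAffine n H ∧ HopfGeneral n H := by
  have hy := dGen_rel n
  have hc := (drin_universal n).hd_central
  have hΔ := isComul_dGen h1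
  have e0 : (fun a => H.counit (uPart (dGen n) a)) = uPart fun _ : DIdx n => (0 : BaseRing) :=
    funext fun a => h2 (.u a)
  have hε : ∀ i, H.counit (dh n i) = 0 := fun i => by
    rw [dh, map_hEl, e0, hEl_zero]
  have hq : ∀ u, H.counit u = 0 → H.counit (qPow u) = 1 ∧ H.counit (qPow (-u)) = 1 := fun u hu => by
      rw [AlgHom.map_qPow, AlgHom.map_qPow, map_neg, hu, neg_zero, qPow_zero]
      exact ⟨rfl, rfl⟩
  have hS : unop (H.antipode (dHd n)) = -dHd n := congrArg unop (h3 .hd)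
  have hxi : H.comul (dXi n) = comulXi n := by
    have := hΔ.comul_xi hy hn
    unfold comulXi
    exact this
  have hSxi : unop (H.antipode (dXi n)) = antipodeXi n := by
    refine (congrArg unop (h3 .xi)).trans ((antiXi_formula hy hc hn).trans ?_)
    unfold antipodeXi
    simp only [chainSum, sum_mul]
    rfl
  refine ⟨⟨fun i _ => hΔ.comul_h i, fun i _ => hΔ.comul_qPow (u := dh n i) (hΔ.comul_h i),
    fun i _ => hΔ.comul_e i, fun i _ => hΔ.comul_f i, fun i _ => antipode_hEl h3 i,
    fun i _ => antipode_qPow (u := dh n i) (antipode_hEl h3 i), fun i _ => antipode_eEl h3 i,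
    fun i _ => antipode_fEl h3 i, fun i _ => hε i, fun i _ => hq _ (hε i), fun i _ => ?_,
    fun i _ => ?_⟩, ⟨hΔ.comul_hd, hΔ.comul_qPow (u := dHd n) hΔ.comul_hd, hS,
    antipode_qPow (u := dHd n) hS, h2 .hd, h2 .xi, hxi, hSxi⟩,
    ⟨hΔ.comul_zeta hy hn, antipode_zeta hy hc hn h3⟩⟩
  · rw [de, map_eEl, e0, eEl_zero]
  · rw [df, map_fEl, e0, fEl_zero]

/-- A Hopf structure is determined by its values on the generators. -/
lemma HopfOnU.ext {H H' : TopHopf adicIdeal (Drin n)} (h : HopfOnU n H) (h' : HopfOnU n H')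
    (ha : HopfOnAffine n H) (ha' : HopfOnAffine n H') : H = H' := by
  have hi : ∀ i : Fin n, (i : ℕ) + 1 ∈ Icc 1 n := fun i =>
    mem_Icc.2 ⟨by omega, i.2⟩
  have eh : ∀ i : Fin n, dGen n (.u (.h i)) = dh n (i + 1) := fun i => by
    unfold dh hEl; rw [at1, dif_pos (mem_Icc.1 (hi i))]; rfl
  have ee : ∀ i : Fin n, dGen n (.u (.e i)) = de n (i + 1) := fun i => by
    unfold de eEl; rw [at1, dif_pos (mem_Icc.1 (hi i))]; rfl
  have ef : ∀ i : Fin n, dGen n (.u (.f i)) = df n (i + 1) := fun i => by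
    unfold df fEl; rw [at1, dif_pos (mem_Icc.1 (hi i))]; rfl
  have hu : ∀ {u v : (Drin n)ᵐᵒᵖ} {c : Drin n}, u.unop = c → v.unop = c → u = v :=
    fun h h' => MulOpposite.unop_injective (h.trans h'.symm)
  refine (drin_universal n).topHopf_ext ?_ ?_ ?_
  · rintro ((i | i | i) | _ | _)
    · rw [eh]; exact (h.comul_h _ (hi i)).trans (h'.comul_h _ (hi i)).symm
    · rw [ee]; exact (h.comul_e _ (hi i)).trans (h'.comul_e _ (hi i)).symm
    · rw [ef]; exact (h.comul_f _ (hi i)).trans (h'.comul_f _ (hi i)).symm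
    · exact ha.comul_xi.trans ha'.comul_xi.symm
    · exact ha.comul_hd.trans ha'.comul_hd.symm
  · rintro ((i | i | i) | _ | _)
    · rw [eh, h.counit_h _ (hi i), h'.counit_h _ (hi i)]
    · rw [ee, h.counit_e _ (hi i), h'.counit_e _ (hi i)]
    · rw [ef, h.counit_f _ (hi i), h'.counit_f _ (hi i)]
    · exact ha.counit_xi.trans ha'.counit_xi.symm
    · exact ha.counit_hd.trans ha'.counit_hd.symm
  · rintro ((i | i | i) | _ | _)
    · rw [eh]; exact hu (h.antipode_h _ (hi i)) (h'.antipode_h _ (hi i))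
    · rw [ee]; exact hu (h.antipode_e _ (hi i)) (h'.antipode_e _ (hi i))
    · rw [ef]; exact hu (h.antipode_f _ (hi i)) (h'.antipode_f _ (hi i))
    · exact hu ha.antipode_xi ha'.antipode_xi
    · exact hu ha.antipode_hd ha'.antipode_hd

end Drinfeldian

end

theorem proposition2 (n : ℕ) (hn : 1 < n) :
    -- `D'` is complete, and its generators satisfy the relations in exponential form and the
    -- general relations attached to `ẽ_{-θ}`
    (IsAdicComplete adicIdeal (Drin n) ∧ ExplicitRelations (dGen n) ∧
      GeneralRelations (eTilde (uPart (dGen n))) (dGen n) ∧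
      ∀ y : Drin n, qPow (dHd n) * y = y * qPow (dHd n) ∧ qPow (-dHd n) * y = y * qPow (-dHd n)) ∧
    -- `U_q(sl(n+1))` is a subalgebra of `D'`
    (∃! j : Uq n →ₐ[BaseRing] Drin n, (∀ a, j (uGen n a) = dGen n (.u a)) ∧
      Function.Injective j) ∧
    -- among complete algebras without `(q - q⁻¹)`-torsion, `D'` represents the families that satisfy
    -- the explicit relations, and these are the general relations attached to `ẽ_{-θ}`
    (∀ (B : Type*) [Ring B] [Algebra BaseRing B] [IsAdicComplete adicIdeal B],
      (∀ b : B, qDiff • b = 0 → b = 0) → ∀ x : DIdx n → B,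
        (GeneralRelations (eTilde (uPart x)) x ↔ ExplicitRelations x) ∧
        (ExplicitRelations x ↔
          ∃! φ : Drin n →ₐ[BaseRing] B, ∀ a, φ (dGen n a) = x a)) ∧
    -- the Hopf structure
    (∃! H : TopHopf adicIdeal (Drin n), HopfOnU n H ∧ HopfOnAffine n H ∧ HopfGeneral n H) := by
  have hy := dGen_rel n
  refine ⟨⟨inferInstance, hy.explicit hn, hy.general hn, dHd_qPow_central n⟩,
    existsUnique_inclusion n, fun B _ _ _ hB x => ⟨⟨fun h => ?_, fun h => ?_⟩,
      explicit_iff_existsUnique hB hn⟩, ?_⟩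
  · exact (DRel.of_general hB hn h).explicit hn
  · exact (DRel.of_explicit hB hn h).general hn
  · obtain ⟨H, h1, h2, h3⟩ := (drin_universal n).exists_topHopf hn
    have h := hopf_of_generators hn h1 h2 h3
    exact ⟨H, h, fun H' h' => HopfOnU.ext h'.1 h.1 h'.2.1 h.2.1⟩
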